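/- **Conventions.** A $d$-dimensional irreducible projective variety $X\subset\mathbb P^n_{\mathbb C}$ has rational $d$-forms $\omega\in\bigwedge^d\Omega_{\mathbb C(X)/\mathbb C}$. For a closed subset $Y\subset X$, $\omega$ is *logarithmic with poles along $Y$* if there is a resolution $\rho:\tilde X\to X$ (proper, birational, $\tilde X$ smooth) such that $\rho^{-1}(Y)$ is a simple normal crossings divisor, locally $\{f_1\cdots f_r=0\}$, and locally on $\tilde X$ one has $\rho^*\omega=\eta\wedge\frac{df_1}{f_1}\wedge\dots\wedge\frac{df_r}{f_r}$ with $\eta$ regular (so $\rho^*\omega$ is regular off $\rho^{-1}(Y)$). For a prime divisor $D$ with local equation $f$ along which $X$ is normal, $\operatorname{Res}_D\omega=\eta|_D$ if $\omega=\frac{df}{f}\wedge\eta+\eta'$ with $\eta,\eta'$ regular at the generic point of $D$; in general the residues along the divisors over $D$ in the normalization are pushed forward to $D$ and summed. The pushforward $f_*$ of a form along a generically finite dominant map is its trace. A *positive geometry* of dimension $d$ is a pair $(X,X_{\ge0})$, where $X$ is a $d$-dimensional irreducible complex projective variety defined over $\mathbb R$ and $X_{\ge 0}\subset X(\mathbb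 R)$ is nonempty, closed, semialgebraic and full-dimensional (Zariski dense in $X$). If $d=0$, a point is a positive geometry, with canonical forms $\pm1$. If $d\ge1$, let $\partial$ be the Zariski closure of the topological boundary of $X_{\ge0}$ in $X(\mathbb R)$. A *canonical form* of $(X,X_{\ge0})$ is a rational $d$-form $\omega$ on $X$ that is logarithmic with poles along $\partial$, has a pole along every irreducible component $D$ of $\partial$, and for every such $D$ has residue $\operatorname{Res}_D\omega$ a canonical form of $(D,D(\mathbb R)\cap X_{\ge0})$. One requires that every $(D,D(\mathbb R)\cap X_{\ge0})$ is a positive geometry of dimension $d-1$, and that a canonical form of $(X,X_{\ge 0})$ exists and is unique up to sign. **Lemma.** Let $A=\{(x,y)\in\mathbb R^2 : x\le 1,\ y^2\le x^3\}\subset\mathbb P^2(\mathbb R)$, where $(x,y)=(x:y:1)$, and let $C\subset\mathbb P^2$ be the cuspidal cubic, the closure of $\{y^2=x^3\}$ (the irreducible curve with ideal $(y^2z-x^3)$ in homogeneous coordinates $(x:y:z)$). The ideal of the Zariski closure of the topological boundary of $A$ is generated by $(x-z)(y^2z-x^3)$, and $(\mathbb P^2,A)$ is a positive geometry. (a) The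 form $$\omega_A=\frac{-2x}{(x-1)(y^2-x^3)}\,dx\wedge dy$$ is a canonical form of $(\mathbb P^2,A)$ (hence, up to sign, the only one). (b) $\omega_A$ is logarithmic with poles along the union of the line $x=1$ and $C$. The pair $(\mathbb P^1,[-1,1])$ is a positive geometry with canonical form $\omega_{[-1,1]}=\frac{2}{(t-1)(t+1)}\,dt$. The map $\gamma:\mathbb P^1\to C$, $(t:s)\mapsto(t^2s:t^3:s^3)$, that is $(t:1)\mapsto(t^2:t^3:1)$, is birational, and the residue of $\omega_A$ along $C$ is well defined and equals the pushforward: $$\operatorname{Res}_C(\omega_A)=\gamma_*\bigl(\omega_{[-1,1]}\bigr).$$ -/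

import Mathlib

open MvPolynomial KaehlerDifferential

noncomputable section

namespace PosGeom

attribute [local instance] MvPolynomial.gradedAlgebra

/-! ### Projective space, its closed subvarieties, and their function fields -/

/-- The homogeneous coordinate ring of complex projective `n`-space. -/
abbrev CoordRing (n : ℕ) : Type := MvPolynomial (Fin (n + 1)) ℂ

/-- An irreducible closed subvariety of complex projective `n`-space, given by its relevant
homogeneous prime ideal. -/
abbrev Variety (n : ℕ) : Type :=
  ProjectiveSpectrum (MvPolynomial.homogeneousSubmodule (Fin (n + 1)) ℂ)

/-- The homogeneous prime ideal of a variety. -/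
abbrev Variety.ideal {n : ℕ} (X : Variety n) : Ideal (CoordRing n) :=
  X.asHomogeneousIdeal.toIdeal

theorem irrelevant_not_le_bot (n : ℕ) :
    ¬ HomogeneousIdeal.irrelevant (MvPolynomial.homogeneousSubmodule (Fin (n + 1)) ℂ) ≤ ⊥ := by
  intro h
  have hX : (X 0 : CoordRing n) ∈
      HomogeneousIdeal.irrelevant (MvPolynomial.homogeneousSubmodule (Fin (n + 1)) ℂ) := by
    rw [HomogeneousIdeal.mem_irrelevant_iff, GradedRing.proj_apply,
      DirectSum.decompose_of_mem_ne _
        ((mem_homogeneousSubmodule 1 _).2 (isHomogeneous_X ℂ 0)) one_ne_zero]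
  have h0 : (X 0 : CoordRing n) ∈ (⊥ : Ideal (CoordRing n)) := h hX
  exact X_ne_zero (R := ℂ) (0 : Fin (n + 1)) ((Ideal.mem_bot).1 h0)

/-- Projective space itself, as a variety. -/
def projSpace (n : ℕ) : Variety n where
  asHomogeneousIdeal := ⊥
  isPrime := by
    rw [HomogeneousIdeal.toIdeal_bot]
    exact Ideal.isPrime_bot
  not_irrelevant_le := irrelevant_not_le_bot n

/-- The fraction field of the homogeneous coordinate ring of `X`. -/
abbrev ConeField {n : ℕ} (X : Variety n) : Type := FractionRing (CoordRing n ⧸ X.ideal)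

/-- The fraction `a / b` in the fraction field of the homogeneous coordinate ring of `X`
(used only when `b` does not vanish identically on `X`). -/
def ratio {n : ℕ} (X : Variety n) (a b : CoordRing n) : ConeField X :=
  algebraMap _ (ConeField X) (Ideal.Quotient.mk X.ideal a) /
    algebraMap _ (ConeField X) (Ideal.Quotient.mk X.ideal b)

theorem coneMap_ne_zero {n : ℕ} (X : Variety n) {b : CoordRing n} (hb : b ∉ X.ideal) :
    algebraMap _ (ConeField X) (Ideal.Quotient.mk X.ideal b) ≠ 0 := by
  intro h
  apply hb
  rw [← Ideal.Quotient.eq_zero_iff_mem]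
  exact (IsFractionRing.injective (CoordRing n ⧸ X.ideal) (ConeField X)) (by rw [h, map_zero])

/-- The function field `ℂ(X)`: quotients `a / b` of homogeneous polynomials of the same degree,
with `b` not vanishing identically on `X`. -/
def FunctionField {n : ℕ} (X : Variety n) : IntermediateField ℂ (ConeField X) where
  carrier := {x | ∃ (e : ℕ) (a b : CoordRing n), a.IsHomogeneous e ∧ b.IsHomogeneous e ∧
    b ∉ X.ideal ∧ x = ratio X a b}
  mul_mem' := by
    rintro _ _ ⟨e, a, b, ha, hb, hbX, rfl⟩ ⟨e', a', b', ha', hb', hbX', rfl⟩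
    refine ⟨e + e', a * a', b * b', ha.mul ha', hb.mul hb', fun h => ?_, ?_⟩
    · exact (X.isPrime.mem_or_mem h).elim hbX hbX'
    · simp only [ratio, map_mul]
      exact div_mul_div_comm _ _ _ _
  add_mem' := by
    rintro _ _ ⟨e, a, b, ha, hb, hbX, rfl⟩ ⟨e', a', b', ha', hb', hbX', rfl⟩
    refine ⟨e + e', a * b' + b * a', b * b', (ha.mul hb').add (hb.mul ha'), hb.mul hb',
      fun h => ?_, ?_⟩
    · exact (X.isPrime.mem_or_mem h).elim hbX hbX'
    · simp only [ratio, map_mul, map_add]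
      exact div_add_div _ _ (coneMap_ne_zero X hbX) (coneMap_ne_zero X hbX')
  algebraMap_mem' := by
    intro c
    refine ⟨0, C c, 1, isHomogeneous_C _ _, isHomogeneous_one _ _, fun h => ?_, ?_⟩
    · exact X.isPrime.ne_top ((Ideal.eq_top_iff_one _).2 h)
    · simp only [ratio, map_one, div_one]
      rfl
  inv_mem' := by
    rintro _ ⟨e, a, b, ha, hb, hbX, rfl⟩
    by_cases haX : a ∈ X.ideal
    · refine ⟨0, 0, 1, isHomogeneous_zero _ _ _, isHomogeneous_one _ _, fun h => ?_, ?_⟩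
      · exact X.isPrime.ne_top ((Ideal.eq_top_iff_one _).2 h)
      · simp [ratio, Ideal.Quotient.eq_zero_iff_mem.2 haX]
    · exact ⟨e, b, a, hb, ha, haX, by simp [ratio]⟩

/-- The affine coordinate function `X_i / X_j` on `X`. -/
def coordFn {n : ℕ} (X : Variety n) (i j : Fin (n + 1)) : FunctionField X :=
  ⟨ratio X (MvPolynomial.X i) (MvPolynomial.X j), by
    by_cases h : (MvPolynomial.X j : CoordRing n) ∈ X.ideal
    · have h0 : ratio X (MvPolynomial.X i) (MvPolynomial.X j) = 0 := by
        simp [ratio, Ideal.Quotient.eq_zero_iff_mem.2 h]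
      rw [h0]
      exact zero_mem _
    · exact ⟨1, _, _, isHomogeneous_X _ _, isHomogeneous_X _ _, h, rfl⟩⟩

/-- The underlying set of the local ring of `X` at (the generic point of) its subvariety `D`. -/
def localRing {n : ℕ} (X D : Variety n) : Set (FunctionField X) :=
  {x | ∃ (e : ℕ) (a b : CoordRing n), a.IsHomogeneous e ∧ b.IsHomogeneous e ∧
    b ∉ D.ideal ∧ (x : ConeField X) = ratio X a b}

/-! ### Local rings in a function field, models -/

section Models

variable {K : Type} [Field K] [Algebra ℂ K]

/-- `O` dominates the local ring `T`: `T ⊆ O`, and every element of `T` that is a unit of `O` is a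
unit of `T`. -/
def Dominates (O : Subalgebra ℂ K) (T : Set K) : Prop :=
  T ⊆ O ∧ ∀ x ∈ T, x⁻¹ ∈ O → x⁻¹ ∈ T

/-- `V` is a valuation ring of `K` over `ℂ`. -/
def IsValuationRingOf (V : Subalgebra ℂ K) : Prop := ∀ x : K, x ∈ V ∨ x⁻¹ ∈ V

theorem IsValuationRingOf.isLocalRing {V : Subalgebra ℂ K} (hV : IsValuationRingOf V) :
    IsLocalRing V :=
  inferInstanceAs (IsLocalRing (ValuationSubring.mk V.toSubring hV))

/-- A complete model of the function field `K`: the set of local rings of an integral proper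
variety over `ℂ` with function field `K`. It is the union of the sets of local rings of finitely
many affine varieties with function field `K`, and every valuation ring of `K` over `ℂ` dominates
exactly one of its members (existence is completeness, uniqueness is separatedness). -/
structure IsCompleteModel (M : Set (Subalgebra ℂ K)) : Prop where
  affine_cover : ∃ 𝒜 : Finset (Subalgebra ℂ K),
    (∀ A ∈ 𝒜, A.FG ∧ IsFractionRing A K) ∧
    ∀ O : Subalgebra ℂ K, O ∈ M ↔ ∃ A ∈ 𝒜, ∃ P : Ideal A, P.IsPrime ∧
      (O : Set K) = {x | ∃ a b : A, b ∉ P ∧ x = (a : K) / (b : K)}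
  valuative : ∀ V : Subalgebra ℂ K, IsValuationRingOf V → ∃! O, O ∈ M ∧ Dominates V (O : Set K)

end Models

/-! ### Differential forms -/

/-- The algebra of (Kähler) differential forms of `A` over `ℂ`. -/
abbrev Forms (A : Type) [CommRing A] [Algebra ℂ A] : Type := ExteriorAlgebra A (Ω[A⁄ℂ])

section Forms

variable {A B : Type} [CommRing A] [CommRing B] [Algebra ℂ A] [Algebra ℂ B]

/-- The exact one-form `df`. -/
def dForm (f : A) : Forms A := ExteriorAlgebra.ι A (KaehlerDifferential.D ℂ A f)

/-- The map on differential forms over an algebra `B` over `A`. -/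
def formMapAux (A B : Type) [CommRing A] [CommRing B] [Algebra ℂ A] [Algebra ℂ B] [Algebra A B]
    [IsScalarTower ℂ A B] : Forms A →ₐ[A] Forms B :=
  ExteriorAlgebra.lift A
    ⟨((ExteriorAlgebra.ι B).restrictScalars A).comp (KaehlerDifferential.map ℂ ℂ A B),
      fun m => by
        rw [LinearMap.comp_apply]
        exact ExteriorAlgebra.ι_sq_zero (R := B) (KaehlerDifferential.map ℂ ℂ A B m)⟩

theorem formMapAux_dForm [Algebra A B] [IsScalarTower ℂ A B] (f : A) :
    formMapAux A B (dForm f) = dForm (algebraMap A B f) := by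
  refine (ExteriorAlgebra.lift_ι_apply A _ _ _).trans ?_
  exact congrArg (ExteriorAlgebra.ι B) (KaehlerDifferential.map_D ℂ ℂ A B f)

/-- The map on differential forms induced by a homomorphism of algebras:
`g df₁ ∧ … ∧ df_k ↦ φ(g) dφ(f₁) ∧ … ∧ dφ(f_k)`. -/
def formMap (φ : A →ₐ[ℂ] B) : Forms A →+* Forms B :=
  letI : Algebra A B := φ.toRingHom.toAlgebra
  haveI : IsScalarTower ℂ A B := IsScalarTower.of_algebraMap_eq fun c => (φ.commutes c).symm
  (formMapAux A B).toRingHom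

theorem formMap_dForm (φ : A →ₐ[ℂ] B) (f : A) : formMap φ (dForm f) = dForm (φ f) := by
  let _ : Algebra A B := φ.toRingHom.toAlgebra
  have : IsScalarTower ℂ A B := IsScalarTower.of_algebraMap_eq fun c => (φ.commutes c).symm
  exact formMapAux_dForm f

theorem formMap_smul (φ : A →ₐ[ℂ] B) (a : A) (ω : Forms A) :
    formMap φ (a • ω) = φ a • formMap φ ω := by
  let _ : Algebra A B := φ.toRingHom.toAlgebra
  have : IsScalarTower ℂ A B := IsScalarTower.of_algebraMap_eq fun c => (φ.commutes c).symm
  exact (map_smul (formMapAux A B) a ω).trans (algebraMap_smul B a _).symm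

/-- The logarithmic differential `df / f`. -/
def dlog {K : Type} [Field K] [Algebra ℂ K] (f : K) : Forms K := f⁻¹ • dForm f

/-- `θ` is the pushforward (trace) of the form `ψ` along the finite extension of function fields
`j : K → L`: writing `ψ = ∑ aᵢ j(θᵢ)` with `aᵢ ∈ L` and `θᵢ` forms of `K`, one has
`θ = ∑ Tr(aᵢ) θᵢ`, which is the sum of the pullbacks of `ψ` along the local inverses. -/
def IsPushforward {K L : Type} [Field K] [Field L] [Algebra ℂ K] [Algebra ℂ L]
    (j : K →ₐ[ℂ] L) (ψ : Forms L) (θ : Forms K) : Prop :=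
  letI : Algebra K L := j.toRingHom.toAlgebra
  FiniteDimensional K L ∧ ∃ (m : ℕ) (a : Fin m → L) (τ : Fin m → Forms K),
    ψ = ∑ i, a i • formMap j (τ i) ∧ θ = ∑ i, Algebra.trace K L (a i) • τ i

end Forms

/-! ### Logarithmic forms -/

section Log

variable {K : Type} [Field K] [Algebra ℂ K]

/-- At the point with local ring `O`, the scheme is regular, the closed subset with ideal `I` is a
simple normal crossings divisor `f₁ ⋯ f_r = 0` (with `f₁, …, f_r` part of a regular system of
parameters `t₁, …, t_e`), and `ω = η ∧ df₁/f₁ ∧ … ∧ df_r/f_r` with `η` a regular form; here `ω` has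
degree `d`. -/
def IsLogAt (d : ℕ) (O : Subalgebra ℂ K) (I : Ideal O) (ω : Forms K) : Prop :=
  ∃ (_ : IsLocalRing O) (e r s : ℕ) (hre : r ≤ e) (t : Fin e → O) (η : Forms O),
    ringKrullDim O = e ∧
    Ideal.span (Set.range t) = IsLocalRing.maximalIdeal O ∧
    I.radical = Ideal.span {∏ i : Fin r, t (Fin.castLE hre i)} ∧
    s + r = d ∧ η ∈ ⋀[O]^s (Ω[O⁄ℂ]) ∧
    ω = formMap O.val η * (List.ofFn fun i : Fin r => dlog (t (Fin.castLE hre i) : K)).prod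

end Log

/-- The ideal generated in `O` by the equations of the closed set `V(I)`, where `O` contains the
local ring of `X` at its subvariety `Q`. -/
def pullbackIdeal {n : ℕ} (X Q : Variety n) (I : Ideal (CoordRing n))
    (O : Subalgebra ℂ (FunctionField X)) : Ideal O :=
  Ideal.span {x | ∃ (e : ℕ) (a b : CoordRing n), a.IsHomogeneous e ∧ b.IsHomogeneous e ∧
    a ∈ I ∧ b ∉ Q.ideal ∧ ((x : FunctionField X) : ConeField X) = ratio X a b}

/-- The rational `d`-form `ω` on the `d`-dimensional variety `X` is logarithmic with poles along the
closed subset `Y = V(I)`: for some resolution `ρ : X' → X` (a complete nonsingular model of `ℂ(X)`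
dominating `X`) such that `ρ⁻¹(Y)` is a simple normal crossings divisor, the pullback of `ω`, which
is `ω` viewed as a form of the common function field, is logarithmic along `ρ⁻¹(Y)`. -/
def IsLogarithmic {n : ℕ} (d : ℕ) (X : Variety n) (I : Ideal (CoordRing n))
    (ω : Forms (FunctionField X)) : Prop :=
  ω ∈ ⋀[FunctionField X]^d (Ω[FunctionField X⁄ℂ]) ∧
  ∃ M : Set (Subalgebra ℂ (FunctionField X)), IsCompleteModel M ∧
    ∀ O ∈ M, ∃ Q : Variety n, X.ideal ≤ Q.ideal ∧ Dominates O (localRing X Q) ∧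
      IsLogAt d O (pullbackIdeal X Q I O) ω

/-! ### Residues -/

/-- The valuation rings dominating the local ring of `X` at `D`. When `D` is a prime divisor these
are the local rings of the normalization of `X`, or of any resolution, at the prime divisors
lying over `D`; if `X` is normal at `D` there is only one, the local ring itself. -/
def Place {n : ℕ} (X D : Variety n) : Type :=
  {V : Subalgebra ℂ (FunctionField X) // IsValuationRingOf V ∧ Dominates V (localRing X D)}

instance {n : ℕ} {X D : Variety n} (V : Place X D) : IsLocalRing V.1 := V.2.1.isLocalRing

/-- The restriction of regular functions to a divisor: the map onto the residue field. -/
def residueMap {K : Type} [Field K] [Algebra ℂ K] (V : Subalgebra ℂ K) [IsLocalRing V] :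
    V →ₐ[ℂ] IsLocalRing.ResidueField V :=
  IsScalarTower.toAlgHom ℂ V (IsLocalRing.ResidueField V)

/-- The `d`-form `ω` is regular at the point with local ring `V`. -/
def IsRegularForm {K : Type} [Field K] [Algebra ℂ K] (d : ℕ) (V : Subalgebra ℂ K)
    (ω : Forms K) : Prop :=
  ∃ η ∈ ⋀[V]^d (Ω[V⁄ℂ]), formMap V.val η = ω

/-- The Poincaré residue of the `(d+1)`-form `ω` along the prime divisor with local ring `V`:
`ω = df/f ∧ η + η'` with `f` a local equation and `η`, `η'` regular, and `ψ = η` restricted to the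
divisor. -/
def IsResidueAt {K : Type} [Field K] [Algebra ℂ K] (d : ℕ) (V : Subalgebra ℂ K) [IsLocalRing V]
    (ω : Forms K) (ψ : Forms (IsLocalRing.ResidueField V)) : Prop :=
  ∃ (f : V) (η η' : Forms V), f ≠ 0 ∧ IsLocalRing.maximalIdeal V = Ideal.span {f} ∧
    η ∈ ⋀[V]^d (Ω[V⁄ℂ]) ∧ η' ∈ ⋀[V]^(d + 1) (Ω[V⁄ℂ]) ∧
    ω = dlog (f : K) * formMap V.val η + formMap V.val η' ∧
    ψ = formMap (residueMap V) η

/-- `j` is the inclusion of the function field of `D` in the residue field of a place over `D`. -/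
def IsRestriction {n : ℕ} {X D : Variety n} (V : Place X D)
    (j : FunctionField D →ₐ[ℂ] IsLocalRing.ResidueField V.1) : Prop :=
  ∀ (e : ℕ) (a b : CoordRing n), a.IsHomogeneous e → b.IsHomogeneous e → b ∉ D.ideal →
    ∀ (x : V.1) (y : FunctionField D), ((x : FunctionField X) : ConeField X) = ratio X a b →
      (y : ConeField D) = ratio D a b → j y = residueMap V.1 x

/-- `θ` is the residue along the prime divisor `D` of the `(d+1)`-form `ω` on `X`: the sum of the
pushforwards to `D` of the residues along the divisors lying over `D`. -/
def IsResidue {n : ℕ} (d : ℕ) (X D : Variety n) (ω : Forms (FunctionField X))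
    (θ : Forms (FunctionField D)) : Prop :=
  ∃ res : Place X D → Forms (FunctionField D),
    (∀ V : Place X D, ∃ (j : FunctionField D →ₐ[ℂ] IsLocalRing.ResidueField V.1)
      (ψ : Forms (IsLocalRing.ResidueField V.1)),
      IsRestriction V j ∧ IsResidueAt d V.1 ω ψ ∧ IsPushforward j ψ (res V)) ∧
    θ = ∑ᶠ V, res V

/-- The `d`-form `ω` on `X` has a pole along `D`. -/
def HasPole {n : ℕ} (d : ℕ) (X D : Variety n) (ω : Forms (FunctionField X)) : Prop :=
  ∃ V : Place X D, ¬ IsRegularForm d V.1 ω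

/-! ### Real points and semialgebraic sets -/

/-- Real projective space. -/
abbrev RealProj (n : ℕ) : Type := Projectivization ℝ (Fin (n + 1) → ℝ)

/-- The quotient topology of real projective space. -/
instance realProjTopology (n : ℕ) : TopologicalSpace (RealProj n) :=
  TopologicalSpace.coinduced
    (fun v : {v : Fin (n + 1) → ℝ // v ≠ 0} => Projectivization.mk ℝ v.1 v.2) inferInstance

/-- The affine chart `(x₁, …, x_n) ↦ (x₁ : … : x_n : 1)`. -/
def chart (n : ℕ) (v : Fin n → ℝ) : RealProj n :=
  Projectivization.mk ℝ (Fin.snoc (α := fun _ => ℝ) v 1) fun h => by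
    have := congrFun h (Fin.last n)
    simp at this

/-- The ideal of complex polynomials vanishing on (all representatives of points of) `S`; its zero
set is the Zariski closure of `S`. -/
def vanishingIdeal {n : ℕ} (S : Set (RealProj n)) : Ideal (CoordRing n) where
  carrier := {f | ∀ (v : Fin (n + 1) → ℝ) (hv : v ≠ 0), Projectivization.mk ℝ v hv ∈ S →
    MvPolynomial.eval (fun i => (v i : ℂ)) f = 0}
  add_mem' := by
    intro f g hf hg v hv hS
    rw [map_add, hf v hv hS, hg v hv hS, add_zero]
  zero_mem' := by
    intro v hv _
    exact map_zero _
  smul_mem' := by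
    intro c f hf v hv hS
    rw [smul_eq_mul, map_mul, hf v hv hS, mul_zero]

/-- The real points of `X`. -/
def realPoints {n : ℕ} (X : Variety n) : Set (RealProj n) :=
  {p | ∀ f ∈ X.ideal, MvPolynomial.eval (fun i => (p.rep i : ℂ)) f = 0}

/-- Semialgebraic subsets of affine space: the Boolean algebra generated by the sets `p > 0`. -/
inductive IsSemialgebraic {m : ℕ} : Set (Fin m → ℝ) → Prop
  | pos (p : MvPolynomial (Fin m) ℝ) : IsSemialgebraic {v | 0 < MvPolynomial.eval v p}
  | compl (S : Set (Fin m → ℝ)) : IsSemialgebraic S → IsSemialgebraic Sᶜ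
  | inter (S T : Set (Fin m → ℝ)) : IsSemialgebraic S → IsSemialgebraic T →
      IsSemialgebraic (S ∩ T)

/-- The cone over a subset of real projective space, without the origin. -/
def cone {n : ℕ} (S : Set (RealProj n)) : Set (Fin (n + 1) → ℝ) :=
  {v | ∃ hv : v ≠ 0, Projectivization.mk ℝ v hv ∈ S}

/-- The topological boundary of `S` inside the real points of `X`. -/
def boundary {n : ℕ} (X : Variety n) (S : Set (RealProj n)) : Set (RealProj n) :=
  Subtype.val '' frontier (Subtype.val ⁻¹' S : Set (realPoints X))

/-- The ideal of the Zariski closure of the boundary of `S`. -/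
def boundaryIdeal {n : ℕ} (X : Variety n) (S : Set (RealProj n)) : Ideal (CoordRing n) :=
  vanishingIdeal (boundary X S)

/-- `D` is an irreducible component of the Zariski closure of the boundary of `S`. -/
def IsBoundaryComponent {n : ℕ} (X : Variety n) (S : Set (RealProj n)) (D : Variety n) : Prop :=
  D.ideal ∈ (boundaryIdeal X S).minimalPrimes

/-! ### Positive geometries -/

/-- The data underlying a positive geometry: `X` is a `d`-dimensional variety defined over `ℝ`, and
`S` is a nonempty, closed, semialgebraic subset of its real points. It is full-dimensional:
the dimension of a semialgebraic set is that of its Zariski closure, which has to be all of `X`. -/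
structure IsAdmissible {n : ℕ} (d : ℕ) (X : Variety n) (S : Set (RealProj n)) : Prop where
  dim : Algebra.trdeg ℂ (FunctionField X) = d
  real : ∃ J : Ideal (MvPolynomial (Fin (n + 1)) ℝ),
    J.map (MvPolynomial.map (algebraMap ℝ ℂ)) = X.ideal
  subset : S ⊆ realPoints X
  nonempty : S.Nonempty
  closed : IsClosed S
  semialgebraic : IsSemialgebraic (cone S)
  full : vanishingIdeal S = X.ideal

/-- `ω` is a canonical form of `(X, S)`, `X` of dimension `d`. A point has the canonical forms `±1`.
In positive dimension, `ω` is logarithmic with poles precisely along the Zariski closure of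
the boundary of `S`, and its residue along each boundary component `D` is a canonical form of
`(D, D ∩ S)`. -/
def IsCanonicalForm {n : ℕ} : (d : ℕ) → (X : Variety n) → (S : Set (RealProj n)) →
    Forms (FunctionField X) → Prop
  | 0, _, _, ω => ω = 1 ∨ ω = -1
  | d + 1, X, S, ω =>
      IsLogarithmic (d + 1) X (boundaryIdeal X S) ω ∧
      ∀ D : Variety n, IsBoundaryComponent X S D →
        HasPole (d + 1) X D ω ∧
        ∃ θ : Forms (FunctionField D),
          IsResidue d X D ω θ ∧ IsCanonicalForm d D (realPoints D ∩ S) θ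

/-- `(X, S)` is a positive geometry of dimension `d`: the boundary components are positive
geometries, and there is a canonical form, unique up to sign. -/
def IsPositiveGeometry {n : ℕ} : (d : ℕ) → (X : Variety n) → (S : Set (RealProj n)) → Prop
  | 0, X, S => IsAdmissible 0 X S
  | d + 1, X, S =>
      IsAdmissible (d + 1) X S ∧
      (∀ D : Variety n, IsBoundaryComponent X S D → IsPositiveGeometry d D (realPoints D ∩ S)) ∧
      ∃ ω : Forms (FunctionField X), IsCanonicalForm (d + 1) X S ω ∧
        ∀ ω' : Forms (FunctionField X), IsCanonicalForm (d + 1) X S ω' → ω' = ω ∨ ω' = -ω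

/-! ### The objects of the statement -/

/-- The region `x ≤ 1`, `y² ≤ x³` in the affine chart `(x : y : 1)`. -/
def regionA : Set (RealProj 2) := chart 2 '' {v | v 0 ≤ 1 ∧ v 1 ^ 2 ≤ v 0 ^ 3}

/-- The interval `[-1, 1]` in the affine chart `(t : 1)`. -/
def interval : Set (RealProj 1) := chart 1 '' {v | -1 ≤ v 0 ∧ v 0 ≤ 1}

/-- The form `-2x / ((x - 1)(y² - x³)) dx ∧ dy` on the projective plane. -/
def omegaA : Forms (FunctionField (projSpace 2)) :=
  let x := coordFn (projSpace 2) 0 2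
  let y := coordFn (projSpace 2) 1 2
  (-2 * x / ((x - 1) * (y ^ 2 - x ^ 3))) • (dForm x * dForm y)

/-- The form `2 / ((t - 1)(t + 1)) dt` on the projective line. -/
def omegaInterval : Forms (FunctionField (projSpace 1)) :=
  let t := coordFn (projSpace 1) 0 1
  (2 / ((t - 1) * (t + 1))) • dForm t

/-- `φ` is the pullback of rational functions along the dominant morphism `Z → X` given by the
homogeneous polynomials `F`. -/
def IsPullbackAlong {n m : ℕ} (Z : Variety m) (X : Variety n) (F : Fin (n + 1) → CoordRing m)
    (φ : FunctionField X →ₐ[ℂ] FunctionField Z) : Prop :=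
  ∀ (e : ℕ) (a b : CoordRing n), a.IsHomogeneous e → b.IsHomogeneous e → b ∉ X.ideal →
    ∀ x : FunctionField X, (x : ConeField X) = ratio X a b →
      (φ x : ConeField Z) = ratio Z (MvPolynomial.aeval F a) (MvPolynomial.aeval F b)

/-- The map `(t : s) ↦ (t² s : t³ : s³)`, that is, `(t : 1) ↦ (t² : t³ : 1)`. -/
def gammaPoly : Fin 3 → CoordRing 1 := ![X 0 ^ 2 * X 1, X 0 ^ 3, X 1 ^ 3]

end PosGeom

end

open MvPolynomial KaehlerDifferential

noncomputable section

namespace PosGeom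

attribute [local instance] MvPolynomial.gradedAlgebra

/-! ### Centers of valuation rings and models glued from affine charts -/

section Models

variable {K : Type} [Field K] [Algebra ℂ K]

/-! The line L : x = z and the cubic C are rational, with parametrizations τ ↦ (1 : τ : 1) and τ ↦
(τ² : τ³ : 1), and the region meets each of them in the arc -1 ≤ τ ≤ 1. Every boundary point lies on
L or C, and the halves 0 ≤ τ ≤ 1 of both arcs consist of boundary points. Since these halves are
Zariski dense, the boundary ideal is that of L ∪ C.

In dimension one, the arcs on L and C and the interval on the projective line are treated together
as monomial curves. A logarithmic form with poles only at τ = ±1 has the shape c dt/(t² - 1), with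
residues c/2 at 1 and -c/2 at -1, so the canonical forms are those with c = ±2
(`IsMonomialCurve.exists_isCanonicalForm_iff`). The cusp τ = 0 does no harm, because being
logarithmic is tested on a resolution, where t is a coordinate.

In the plane, three blow-ups turn L ∪ C into a normal crossings divisor: at the cusp, at the point
where the strict transform of C touches the first exceptional curve E₁, and at the triple point of
E₁, E₂ and the strict transform. Along E₁, E₂, E₃ the cubic equation vanishes to order 2, 3, 6, the
form dx∧dy to order 1, 2, 4, and the numerator x to order 1, 1, 2. These orders cancel, so the form
has no pole on the exceptional curves and only simple poles on the strict transforms of L and C. The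
resolution is recorded as the set of local rings of six affine charts inside the function field
(`isAtlas_cusp`, `IsAtlas.isCompleteModel`), and the local checks are assembled in
`isLogarithmic_cusp`.

The residues follow from d(x - 1)∧dy = dx∧dy and d(y² - x³)∧dx = -2y dx∧dy. On L the residue is
-2/(y² - 1) dy. On C it is x/((x - 1)y) dx, and x = t², y = t³ make it 2/(t² - 1) dt
(`isResidue_cuspForm_line`, `isResidue_cuspForm_cubic`). The parametrization γ induces an
isomorphism of function fields, so the pushforward of the form of the interval is the same
expression.

For uniqueness, let ω be a canonical form. Its residues on L and C are those of the given form times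
signs s and s'. Subtracting s times the given form removes the pole along L. What remains is κ/(y² -
x³) dx∧dy with κ a polynomial, so its residue on C cannot have a pole at τ = 1, where C meets L;
this forces s' = s. The difference is then regular at every prime divisor, including the line at
infinity, and the plane has no nonzero regular two-forms (`eq_smul_of_restricts`,
`IsChart.eq_zero_of_isRegular`). The logarithmic hypothesis enters here only through regularity off
the boundary (`IsLogarithmic.isRegularForm`), since the existence of residues bounds the poles along
L and C. -/

theorem isUnit_subalgebra_iff {O : Subalgebra ℂ K} (x : O) :
    IsUnit x ↔ (x : K) ≠ 0 ∧ (x : K)⁻¹ ∈ O := by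
  constructor
  · rintro ⟨u, rfl⟩
    have h : ((u : O) : K) * ((u⁻¹ : Oˣ) : O) = 1 := by
      exact congrArg (Subtype.val : O → K) u.mul_inv
    refine ⟨left_ne_zero_of_mul_eq_one h, ?_⟩
    rw [inv_eq_of_mul_eq_one_right h]
    exact ((u⁻¹ : Oˣ) : O).2
  · rintro ⟨h0, h⟩
    exact IsUnit.of_mul_eq_one ⟨_, h⟩ (Subtype.ext (mul_inv_cancel₀ h0))

theorem mem_maximalIdeal_iff {O : Subalgebra ℂ K} [IsLocalRing O] (x : O) :
    x ∈ IsLocalRing.maximalIdeal O ↔ (x : K) = 0 ∨ (x : K)⁻¹ ∉ O := by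
  rw [IsLocalRing.mem_maximalIdeal, mem_nonunits_iff, isUnit_subalgebra_iff]
  tauto

/-- The local ring, on the affine variety with coordinate ring `A`, of the center of `V`. -/
def centerRing (A V : Subalgebra ℂ K) : Subalgebra ℂ K where
  carrier := {x | ∃ a ∈ A, ∃ b ∈ A, b ≠ 0 ∧ b⁻¹ ∈ V ∧ x = a / b}
  mul_mem' := by
    rintro _ _ ⟨a, ha, b, hb, hb0, hbV, rfl⟩ ⟨a', ha', b', hb', hb0', hbV', rfl⟩
    refine ⟨a * a', mul_mem ha ha', b * b', mul_mem hb hb', mul_ne_zero hb0 hb0', ?_,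
      div_mul_div_comm _ _ _ _⟩
    rw [mul_inv]
    exact mul_mem hbV hbV'
  add_mem' := by
    rintro _ _ ⟨a, ha, b, hb, hb0, hbV, rfl⟩ ⟨a', ha', b', hb', hb0', hbV', rfl⟩
    refine ⟨a * b' + b * a', add_mem (mul_mem ha hb') (mul_mem hb ha'), b * b', mul_mem hb hb',
      mul_ne_zero hb0 hb0', ?_, div_add_div _ _ hb0 hb0'⟩
    rw [mul_inv]
    exact mul_mem hbV hbV'
  algebraMap_mem' c :=
    ⟨_, A.algebraMap_mem c, 1, A.one_mem, one_ne_zero, by rw [inv_one]; exact V.one_mem, by simp⟩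

theorem mem_centerRing {A V : Subalgebra ℂ K} {x : K} :
    x ∈ centerRing A V ↔ ∃ a ∈ A, ∃ b ∈ A, b ≠ 0 ∧ b⁻¹ ∈ V ∧ x = a / b := Iff.rfl

theorem le_centerRing (A V : Subalgebra ℂ K) : A ≤ centerRing A V := fun a ha =>
  ⟨a, ha, 1, A.one_mem, one_ne_zero, by rw [inv_one]; exact V.one_mem, by simp⟩

theorem centerRing_le {A V : Subalgebra ℂ K} (h : A ≤ V) : centerRing A V ≤ V := by
  rintro _ ⟨a, ha, b, _, _, hbV, rfl⟩
  rw [div_eq_mul_inv]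
  exact mul_mem (h ha) hbV

/-- If x = a/b is a unit of V, then so is a = x·b, and a becomes an admissible denominator. -/
theorem inv_mem_centerRing {A V : Subalgebra ℂ K} {x : K} (hx : x ∈ centerRing A V)
    (hxV : x⁻¹ ∈ V) : x⁻¹ ∈ centerRing A V := by
  obtain ⟨a, ha, b, hb, hb0, hbV, rfl⟩ := hx
  by_cases ha0 : a = 0
  · simp only [ha0, zero_div, inv_zero]
    exact zero_mem _
  · refine ⟨b, hb, a, ha, ha0, ?_, inv_div _ _⟩
    have : a⁻¹ = (a / b)⁻¹ * b⁻¹ := by field_simp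
    rw [this]
    exact mul_mem hxV hbV

theorem dominates_centerRing {A V : Subalgebra ℂ K} (h : A ≤ V) :
    Dominates V (centerRing A V : Set K) :=
  ⟨centerRing_le h, fun _ hx hxV => inv_mem_centerRing hx hxV⟩

theorem centerRing_le_of_le {A B V : Subalgebra ℂ K} (h : A ≤ centerRing B V) :
    centerRing A V ≤ centerRing B V := by
  rintro _ ⟨a, ha, b, hb, hb0, hbV, rfl⟩
  rw [div_eq_mul_inv]
  exact mul_mem (h ha) (inv_mem_centerRing (h hb) hbV)

/-- An atlas of affine charts: every valuation ring is centered on some chart, and two charts have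
the same local ring at a common center. -/
structure IsAtlas (𝒜 : Set (Subalgebra ℂ K)) : Prop where
  cover : ∀ V : Subalgebra ℂ K, IsValuationRingOf V → ∃ A ∈ 𝒜, A ≤ V
  glue : ∀ A ∈ 𝒜, ∀ B ∈ 𝒜, ∀ V : Subalgebra ℂ K, IsValuationRingOf V → A ≤ V → B ≤ V →
    B ≤ centerRing A V

theorem IsAtlas.centerRing_eq {𝒜 : Set (Subalgebra ℂ K)} (h : IsAtlas 𝒜) {A B V : Subalgebra ℂ K}
    (hA : A ∈ 𝒜) (hB : B ∈ 𝒜) (hV : IsValuationRingOf V) (hAV : A ≤ V) (hBV : B ≤ V) :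
    centerRing A V = centerRing B V :=
  le_antisymm (centerRing_le_of_le (h.glue B hB A hA V hV hBV hAV))
    (centerRing_le_of_le (h.glue A hA B hB V hV hAV hBV))

/-- The local rings of the scheme glued from an atlas. -/
def atlasModel (𝒜 : Set (Subalgebra ℂ K)) : Set (Subalgebra ℂ K) :=
  {O | ∃ V : Subalgebra ℂ K, IsValuationRingOf V ∧ ∃ A ∈ 𝒜, A ≤ V ∧ O = centerRing A V}

/-- A prime ideal of a subring of a field is the center of a valuation ring. -/
theorem exists_valuationRing_center (A : Subalgebra ℂ K) (P : Ideal A) (hP : P.IsPrime) :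
    ∃ V : Subalgebra ℂ K, IsValuationRingOf V ∧ A ≤ V ∧
      ∀ a : A, a ∉ P ↔ ((a : K) ≠ 0 ∧ (a : K)⁻¹ ∈ V) := by
  let P' : Ideal A.toSubring := P
  have hP' : P'.IsPrime := hP
  -- Every local subring of a field is dominated by a valuation subring; here the local subring is
  -- the localization of A at P.
  obtain ⟨B, hB⟩ := (LocalSubring.ofPrime A.toSubring P').exists_le_valuationSubring
  have hAB : A.toSubring ≤ B.toSubring := (LocalSubring.le_ofPrime A.toSubring P').trans hB.1
  let V : Subalgebra ℂ K := { B.toSubring with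
    algebraMap_mem' := fun c => hAB (A.algebraMap_mem c) }
  refine ⟨V, fun x => B.mem_or_inv_mem x, fun x hx => hAB hx, fun a => ?_⟩
  let a' : (LocalSubring.ofPrime A.toSubring P').toSubring :=
    ⟨a, LocalSubring.le_ofPrime A.toSubring P' a.2⟩
  have h1 : IsUnit a' ↔ a ∉ P := by
    exact IsLocalization.AtPrime.isUnit_to_map_iff (R := A.toSubring)
      (LocalSubring.ofPrime A.toSubring P').toSubring P' a
  -- Domination says that the inclusion of the localization is a local homomorphism, so it reflects
  -- units.
  have h2 : IsUnit a' ↔ IsUnit (Subring.inclusion hB.1 a') :=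
    ⟨fun h => h.map _, fun h => hB.2.1 _ h⟩
  have h3 : IsUnit (Subring.inclusion hB.1 a') ↔ ((a : K) ≠ 0 ∧ (a : K)⁻¹ ∈ V) :=
    isUnit_subalgebra_iff (O := V) ⟨a, hAB a.2⟩
  rw [← h1, h2, h3]

/-- One valuation ring serves for all charts, so a later case distinction may compute O on whichever
chart is most convenient. -/
theorem IsAtlas.exists_eq_centerRing {𝒜 : Set (Subalgebra ℂ K)} (h : IsAtlas 𝒜)
    {O : Subalgebra ℂ K} (hO : O ∈ atlasModel 𝒜) :
    ∃ V : Subalgebra ℂ K, IsValuationRingOf V ∧ ∀ A ∈ 𝒜, A ≤ V → O = centerRing A V := by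
  obtain ⟨V, hV, A, hA, hAV, rfl⟩ := hO
  exact ⟨V, hV, fun B hB hBV => h.centerRing_eq hA hB hV hAV hBV⟩

/-- Primes of a chart and centers of valuation rings on it are the same thing, so the center rings
are the localizations of the charts. Existence in the valuative criterion is the covering property
and uniqueness is the gluing property. -/
theorem IsAtlas.isCompleteModel {𝒜 : Finset (Subalgebra ℂ K)}
    (h : IsAtlas (𝒜 : Set (Subalgebra ℂ K))) (hfg : ∀ A ∈ 𝒜, A.FG ∧ IsFractionRing A K) :
    IsCompleteModel (atlasModel (𝒜 : Set (Subalgebra ℂ K))) where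
  affine_cover := by
    refine ⟨𝒜, hfg, fun O => ⟨?_, ?_⟩⟩
    · rintro ⟨V, hV, A, hA, hAV, rfl⟩
      have := hV.isLocalRing
      refine ⟨A, hA, (IsLocalRing.maximalIdeal V).comap (Subalgebra.inclusion hAV),
        Ideal.comap_isPrime _ _, ?_⟩
      ext x
      constructor
      · rintro ⟨a, ha, b, hb, hb0, hbV, rfl⟩
        refine ⟨⟨a, ha⟩, ⟨b, hb⟩, ?_, rfl⟩
        rw [Ideal.mem_comap, mem_maximalIdeal_iff]
        simp [hb0, hbV]
      · rintro ⟨a, b, hb, rfl⟩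
        rw [Ideal.mem_comap, mem_maximalIdeal_iff] at hb
        simp only [Subalgebra.coe_inclusion, not_or, not_not] at hb
        exact ⟨a, a.2, b, b.2, hb.1, hb.2, rfl⟩
    · rintro ⟨A, hA, P, hP, hO⟩
      obtain ⟨V, hV, hAV, hPV⟩ := exists_valuationRing_center A P hP
      refine ⟨V, hV, A, hA, hAV, SetLike.coe_injective ?_⟩
      rw [hO]
      ext x
      constructor
      · rintro ⟨a, b, hb, rfl⟩
        exact ⟨a, a.2, b, b.2, ((hPV b).1 hb).1, ((hPV b).1 hb).2, rfl⟩
      · rintro ⟨a, ha, b, hb, hb0, hbV, rfl⟩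
        exact ⟨⟨a, ha⟩, ⟨b, hb⟩, (hPV _).2 ⟨hb0, hbV⟩, rfl⟩
  valuative := by
    intro V hV
    obtain ⟨A, hA, hAV⟩ := h.cover V hV
    refine ⟨centerRing A V, ⟨⟨V, hV, A, hA, hAV, rfl⟩, dominates_centerRing hAV⟩, ?_⟩
    rintro _ ⟨⟨W, hW, B, hB, hBW, rfl⟩, hdom⟩
    have hBV : B ≤ V := (le_centerRing B W).trans hdom.1
    -- V dominates the center ring of W on B, so an element of B is a unit of V exactly when it is a
    -- unit of W.
    have : centerRing B W = centerRing B V := by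
      ext x
      constructor
      · rintro ⟨a, ha, b, hb, hb0, hbW, rfl⟩
        exact ⟨a, ha, b, hb, hb0,
          hdom.1 (inv_mem_centerRing (le_centerRing B W hb) hbW), rfl⟩
      · rintro ⟨a, ha, b, hb, hb0, hbV, rfl⟩
        exact ⟨a, ha, b, hb, hb0,
          centerRing_le hBW (hdom.2 b (le_centerRing B W hb) hbV), rfl⟩
    rw [this]
    exact h.centerRing_eq hB hA hV hBV hAV

/-! ### Standard charts and blow-ups -/

theorem IsValuationRingOf.div_mem_or {V : Subalgebra ℂ K} (hV : IsValuationRingOf V) (x y : K) :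
    x / y ∈ V ∨ y / x ∈ V := by
  rw [← inv_div x y]
  exact hV _

/-- The charts `{w_j ≠ 0}` of the projective scheme with homogeneous coordinates `w`. -/
theorem isAtlas_standard {ι : Type} [Finite ι] [Nonempty ι] (w : ι → K) (hw : ∀ i, w i ≠ 0) :
    IsAtlas (Set.range fun j => Algebra.adjoin ℂ (Set.range fun i => w i / w j)) where
  cover V hV := by
    -- The index j is one of least valuation: in a valuation ring any two coordinates are comparable
    -- under divisibility, so a finite family has a member dividing all others.
    have key : ∀ s : Finset ι, s.Nonempty → ∃ j ∈ s, ∀ i ∈ s, w i / w j ∈ V := by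
      intro s hs
      induction hs using Finset.Nonempty.cons_induction with
      | singleton a => exact ⟨a, by simp, by simp [div_self (hw a), V.one_mem]⟩
      | cons a s ha hs ih =>
        obtain ⟨j, hj, h⟩ := ih
        rcases hV.div_mem_or (w a) (w j) with h1 | h1
        · refine ⟨j, by simp [hj], fun i hi => ?_⟩
          rcases Finset.mem_cons.1 hi with rfl | hi
          exacts [h1, h i hi]
        · refine ⟨a, by simp, fun i hi => ?_⟩
          rcases Finset.mem_cons.1 hi with rfl | hi
          · rw [div_self (hw i)]; exact V.one_mem
          · have : w i / w a = w i / w j * (w j / w a) := by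
              rw [div_mul_div_cancel₀ (hw j)]
            rw [this]
            exact mul_mem (h i hi) h1
    have := Fintype.ofFinite ι
    obtain ⟨j, -, hj⟩ := key Finset.univ Finset.univ_nonempty
    refine ⟨_, ⟨j, rfl⟩, Algebra.adjoin_le ?_⟩
    rintro _ ⟨i, rfl⟩
    exact hj i (Finset.mem_univ i)
  glue := by
    rintro _ ⟨j, rfl⟩ _ ⟨k, rfl⟩ V hV hj hk
    refine Algebra.adjoin_le ?_
    rintro _ ⟨i, rfl⟩
    refine ⟨w i / w j, Algebra.subset_adjoin ⟨i, rfl⟩, w k / w j, Algebra.subset_adjoin ⟨k, rfl⟩,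
      div_ne_zero (hw k) (hw j), ?_, ?_⟩
    · rw [inv_div]
      exact hk (Algebra.subset_adjoin ⟨j, rfl⟩)
    · rw [div_div_div_cancel_right₀ (hw j)]

/-- The origin of the chart with coordinates `u`, `v` lies on no chart in `ℛ`. -/
def IsIsolatedOrigin (ℛ : Set (Subalgebra ℂ K)) (u v : K) : Prop :=
  ∀ B ∈ ℛ, ∀ V : Subalgebra ℂ K, IsValuationRingOf V → B ≤ V → u ∈ V → v ∈ V →
    u⁻¹ ∈ V ∨ v⁻¹ ∈ V

theorem adjoin_pair_le {V : Subalgebra ℂ K} {u v : K} :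
    Algebra.adjoin ℂ {u, v} ≤ V ↔ u ∈ V ∧ v ∈ V := by
  rw [Algebra.adjoin_le_iff]
  simp [Set.insert_subset_iff]

theorem left_mem_adjoin_pair (u v : K) : u ∈ Algebra.adjoin ℂ ({u, v} : Set K) :=
  Algebra.subset_adjoin (by simp)

theorem right_mem_adjoin_pair (u v : K) : v ∈ Algebra.adjoin ℂ ({u, v} : Set K) :=
  Algebra.subset_adjoin (by simp)

theorem IsIsolatedOrigin.symm {ℛ : Set (Subalgebra ℂ K)} {u v : K} (h : IsIsolatedOrigin ℛ u v) :
    IsIsolatedOrigin ℛ v u := fun B hB V hV hBV hv hu => (h B hB V hV hBV hu hv).symm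

/-- After blowing up the origin of a chart, the new chart with coordinates `u`, `v / u` has its
origin on no other chart. -/
theorem IsIsolatedOrigin.blowup {ℛ : Set (Subalgebra ℂ K)} {u v : K} (hu : u ≠ 0) (hv : v ≠ 0)
    (h : IsIsolatedOrigin ℛ u v) :
    IsIsolatedOrigin (insert (Algebra.adjoin ℂ {v, u / v}) ℛ) u (v / u) := by
  rintro B (rfl | hB) V hV hBV h1 h2
  · right
    rw [inv_div]
    exact hBV (right_mem_adjoin_pair _ _)
  · left
    have hvV : v ∈ V := by
      have : v = u * (v / u) := by field_simp
      rw [this]; exact mul_mem h1 h2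
    rcases h B hB V hV hBV h1 hvV with h3 | h3
    · exact h3
    · have : u⁻¹ = v / u * v⁻¹ := by field_simp
      rw [this]; exact mul_mem h2 h3

/-- On the overlap with the twin chart v, u/v the function v/u is a unit. On the overlap with an old
chart the center is not the blown-up origin, so u is invertible and v/u is a quotient of functions
known on the old charts. -/
theorem blowup_glue_aux {ℛ : Set (Subalgebra ℂ K)} {u v : K} (hu : u ≠ 0) (hv : v ≠ 0)
    (h : IsAtlas (insert (Algebra.adjoin ℂ {u, v}) ℛ)) (hi : IsIsolatedOrigin ℛ u v)
    {B V : Subalgebra ℂ K} (hB : B ∈ insert (Algebra.adjoin ℂ {v, u / v}) ℛ)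
    (hV : IsValuationRingOf V) (hAV : Algebra.adjoin ℂ {u, v / u} ≤ V) (hBV : B ≤ V) :
    B ≤ centerRing (Algebra.adjoin ℂ {u, v / u}) V ∧
      Algebra.adjoin ℂ {u, v / u} ≤ centerRing B V := by
  obtain ⟨h1, h2⟩ := adjoin_pair_le.1 hAV
  have hvu : v = u * (v / u) := by field_simp
  have hvV : v ∈ V := by rw [hvu]; exact mul_mem h1 h2
  have hvA : v ∈ Algebra.adjoin ℂ ({u, v / u} : Set K) := by
    have := mul_mem (left_mem_adjoin_pair u (v / u)) (right_mem_adjoin_pair u (v / u))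
    rwa [← hvu] at this
  rcases hB with rfl | hB
  · obtain ⟨h3, h4⟩ := adjoin_pair_le.1 hBV
    have huB : u ∈ Algebra.adjoin ℂ ({v, u / v} : Set K) := by
      have h5 : u = v * (u / v) := by field_simp
      have := mul_mem (left_mem_adjoin_pair v (u / v)) (right_mem_adjoin_pair v (u / v))
      rwa [← h5] at this
    refine ⟨adjoin_pair_le.2 ⟨le_centerRing _ _ hvA, ?_⟩,
      adjoin_pair_le.2 ⟨le_centerRing _ _ huB, ?_⟩⟩
    · rw [← inv_div v u]
      exact inv_mem_centerRing (le_centerRing _ _ (right_mem_adjoin_pair _ _))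
        (by rwa [inv_div])
    · rw [← inv_div u v]
      exact inv_mem_centerRing (le_centerRing _ _ (right_mem_adjoin_pair _ _))
        (by rwa [inv_div])
  · have h0 : Algebra.adjoin ℂ {u, v} ≤ V := adjoin_pair_le.2 ⟨h1, hvV⟩
    have h01 : Algebra.adjoin ℂ {u, v} ≤ centerRing (Algebra.adjoin ℂ {u, v / u}) V :=
      adjoin_pair_le.2 ⟨le_centerRing _ _ (left_mem_adjoin_pair _ _), le_centerRing _ _ hvA⟩
    have hB0 := h.glue _ (Set.mem_insert _ _) B (Set.mem_insert_of_mem _ hB) V hV h0 hBV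
    have h0B := h.glue B (Set.mem_insert_of_mem _ hB) _ (Set.mem_insert _ _) V hV hBV h0
    have huB : u ∈ centerRing B V := h0B (left_mem_adjoin_pair u v)
    refine ⟨hB0.trans (centerRing_le_of_le h01), adjoin_pair_le.2 ⟨huB, ?_⟩⟩
    have huV : u⁻¹ ∈ V := by
      rcases hi B hB V hV hBV h1 hvV with h3 | h3
      · exact h3
      · have : u⁻¹ = v / u * v⁻¹ := by field_simp
        rw [this]; exact mul_mem h2 h3
    rw [div_eq_mul_inv]
    exact mul_mem (h0B (right_mem_adjoin_pair u v)) (inv_mem_centerRing huB huV)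

/-- The atlas of the blow-up of the origin of a chart which lies on no other chart. -/
theorem IsAtlas.blowup {ℛ : Set (Subalgebra ℂ K)} {u v : K} (hu : u ≠ 0) (hv : v ≠ 0)
    (h : IsAtlas (insert (Algebra.adjoin ℂ {u, v}) ℛ)) (hi : IsIsolatedOrigin ℛ u v) :
    IsAtlas (insert (Algebra.adjoin ℂ {u, v / u}) (insert (Algebra.adjoin ℂ {v, u / v}) ℛ)) where
  cover V hV := by
    obtain ⟨A, hA, hAV⟩ := h.cover V hV
    rcases hA with rfl | hA
    · obtain ⟨h1, h2⟩ := adjoin_pair_le.1 hAV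
      rcases hV.div_mem_or v u with h3 | h3
      · exact ⟨_, Set.mem_insert _ _, adjoin_pair_le.2 ⟨h1, h3⟩⟩
      · exact ⟨_, Set.mem_insert_of_mem _ (Set.mem_insert _ _), adjoin_pair_le.2 ⟨h2, h3⟩⟩
    · exact ⟨A, Set.mem_insert_of_mem _ (Set.mem_insert_of_mem _ hA), hAV⟩
  glue := by
    -- Exchanging u and v exchanges the two new charts, so the remaining overlaps are covered by the
    -- same lemma.
    have h' : IsAtlas (insert (Algebra.adjoin ℂ {v, u}) ℛ) := by rwa [Set.pair_comm v u]
    rintro A (rfl | hA) B (rfl | hB) V hV hAV hBV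
    · exact le_centerRing _ _
    · exact (blowup_glue_aux hu hv h hi hB hV hAV hBV).1
    · exact (blowup_glue_aux hu hv h hi hA hV hBV hAV).2
    rcases hA with rfl | hA
    · rcases hB with rfl | hB
      · exact le_centerRing _ _
      · exact (blowup_glue_aux hv hu h' hi.symm (Set.mem_insert_of_mem _ hB) hV hAV hBV).1
    · rcases hB with rfl | hB
      · exact (blowup_glue_aux hv hu h' hi.symm (Set.mem_insert_of_mem _ hA) hV hBV hAV).2
      · exact h.glue A (Set.mem_insert_of_mem _ hA) B (Set.mem_insert_of_mem _ hB) V hV hAV hBV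

end Models

/-! ### Calculus of differential forms -/

section Forms

variable {A B : Type} [CommRing A] [CommRing B] [Algebra ℂ A] [Algebra ℂ B]

theorem dForm_sub (f g : A) : dForm (f - g) = dForm f - dForm g := by simp [dForm]

theorem dForm_algebraMap (c : ℂ) : dForm (algebraMap ℂ A c) = 0 := by
  simp only [dForm, Derivation.map_algebraMap, map_zero]

theorem dForm_mul (f g : A) : dForm (f * g) = f • dForm g + g • dForm f := by simp [dForm]

theorem dForm_mul_self (f : A) : dForm f * dForm f = 0 := ExteriorAlgebra.ι_sq_zero _

theorem dForm_mul_comm (f g : A) : dForm f * dForm g = -(dForm g * dForm f) :=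
  eq_neg_of_add_eq_zero_left (ExteriorAlgebra.ι_add_mul_swap _ _)

theorem mem_exteriorPower_zero {ω : Forms A} :
    ω ∈ ⋀[A]^0 (Ω[A⁄ℂ]) ↔ ∃ c : A, ω = c • 1 := by
  rw [ExteriorAlgebra.exteriorPower, pow_zero, Submodule.mem_one]
  simp [Algebra.algebraMap_eq_smul_one, eq_comm]

theorem dForm_mem_exteriorPower_one (f : A) : dForm f ∈ ⋀[A]^1 (Ω[A⁄ℂ]) := by
  rw [ExteriorAlgebra.exteriorPower, pow_one]
  exact ⟨_, rfl⟩

theorem dForm_mul_mem_exteriorPower_two (f g : A) : dForm f * dForm g ∈ ⋀[A]^2 (Ω[A⁄ℂ]) := by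
  rw [ExteriorAlgebra.exteriorPower, pow_two]
  exact Submodule.mul_mem_mul ⟨_, rfl⟩ ⟨_, rfl⟩

theorem mem_exteriorPower_one_pair {f s : A}
    (h : Submodule.span A {KaehlerDifferential.D ℂ A f, KaehlerDifferential.D ℂ A s} = ⊤)
    {ω : Forms A} (hω : ω ∈ ⋀[A]^1 (Ω[A⁄ℂ])) : ∃ a b : A, ω = a • dForm f + b • dForm s := by
  rw [ExteriorAlgebra.exteriorPower, pow_one] at hω
  obtain ⟨x, rfl⟩ := hω
  have hx : x ∈ Submodule.span A {KaehlerDifferential.D ℂ A f, KaehlerDifferential.D ℂ A s} := by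
    rw [h]; trivial
  obtain ⟨a, b, rfl⟩ := Submodule.mem_span_pair.1 hx
  exact ⟨a, b, by simp [dForm]⟩

theorem mem_exteriorPower_two_pair {f s : A}
    (h : Submodule.span A {KaehlerDifferential.D ℂ A f, KaehlerDifferential.D ℂ A s} = ⊤)
    {ω : Forms A} (hω : ω ∈ ⋀[A]^2 (Ω[A⁄ℂ])) : ∃ c : A, ω = c • (dForm f * dForm s) := by
  rw [ExteriorAlgebra.exteriorPower, pow_two] at hω
  induction hω using Submodule.mul_induction_on' with
  | mem_mul_mem x hx y hy =>
    obtain ⟨a, b, rfl⟩ := mem_exteriorPower_one_pair h (by rwa [ExteriorAlgebra.exteriorPower, pow_one] : x ∈ ⋀[A]^1 (Ω[A⁄ℂ]))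
    obtain ⟨c, d, rfl⟩ := mem_exteriorPower_one_pair h (by rwa [ExteriorAlgebra.exteriorPower, pow_one] : y ∈ ⋀[A]^1 (Ω[A⁄ℂ]))
    refine ⟨a * d - b * c, ?_⟩
    simp only [add_mul, mul_add, smul_mul_assoc, mul_smul_comm, dForm_mul_self,
      dForm_mul_comm s f]
    module
  | add x _ y _ hx hy =>
    obtain ⟨c, rfl⟩ := hx
    obtain ⟨d, rfl⟩ := hy
    exact ⟨c + d, by module⟩

theorem mem_exteriorPower_one_single {f : A}
    (h : Submodule.span A {KaehlerDifferential.D ℂ A f} = ⊤)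
    {ω : Forms A} (hω : ω ∈ ⋀[A]^1 (Ω[A⁄ℂ])) : ∃ a : A, ω = a • dForm f := by
  obtain ⟨a, b, hab⟩ := mem_exteriorPower_one_pair (f := f) (s := f) (by simpa using h) hω
  exact ⟨a + b, by rw [hab]; module⟩

theorem formMap_one (φ : A →ₐ[ℂ] B) : formMap φ 1 = 1 := map_one _

theorem formMap_smul_dForm_mul (φ : A →ₐ[ℂ] B) (a f g : A) :
    formMap φ (a • (dForm f * dForm g)) = φ a • (dForm (φ f) * dForm (φ g)) := by
  rw [formMap_smul, map_mul, formMap_dForm, formMap_dForm]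

/-- The algebra of forms is generated by scalars and exact one-forms; identities between ring maps
on forms need only be checked on these. -/
theorem forms_induction {C : Forms A → Prop} (h1 : ∀ a : A, C (a • 1)) (hd : ∀ f : A, C (dForm f))
    (hmul : ∀ x y, C x → C y → C (x * y)) (hadd : ∀ x y, C x → C y → C (x + y)) (ω : Forms A) :
    C ω := by
  refine ExteriorAlgebra.induction (C := C) ?_ ?_ hmul hadd ω
  · intro r
    rw [Algebra.algebraMap_eq_smul_one]
    exact h1 r
  · intro x
    have hx : x ∈ Submodule.span A (Set.range (KaehlerDifferential.D ℂ A)) := by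
      rw [KaehlerDifferential.span_range_derivation]; trivial
    induction hx using Submodule.span_induction with
    | mem x h => obtain ⟨f, rfl⟩ := h; exact hd f
    | zero => rw [map_zero]; simpa using h1 0
    | add x y _ _ hx hy => rw [map_add]; exact hadd _ _ hx hy
    | smul a x _ hx =>
      have : ExteriorAlgebra.ι A (a • x) = (a • 1) * ExteriorAlgebra.ι A x := by
        rw [map_smul, smul_mul_assoc, one_mul]
      rw [this]
      exact hmul _ _ (h1 a) hx

theorem formMap_comp {C : Type} [CommRing C] [Algebra ℂ C] (φ : A →ₐ[ℂ] B) (ψ : B →ₐ[ℂ] C)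
    (ω : Forms A) : formMap ψ (formMap φ ω) = formMap (ψ.comp φ) ω := by
  induction ω using forms_induction with
  | h1 a => simp [formMap_smul]
  | hd f => simp [formMap_dForm]
  | hmul x y hx hy => simp [hx, hy]
  | hadd x y hx hy => simp [hx, hy]

theorem formMap_id (ω : Forms A) : formMap (AlgHom.id ℂ A) ω = ω := by
  induction ω using forms_induction with
  | h1 a => simp [formMap_smul]
  | hd f => simp [formMap_dForm]
  | hmul x y hx hy => simp [hx, hy]
  | hadd x y hx hy => simp [hx, hy]

theorem formMap_bijective (φ : A →ₐ[ℂ] B) (hφ : Function.Bijective φ) :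
    Function.Bijective (formMap φ) := by
  let e := AlgEquiv.ofBijective φ hφ
  refine Function.bijective_iff_has_inverse.2 ⟨formMap (e.symm : B →ₐ[ℂ] A), fun ω => ?_,
    fun ω => ?_⟩
  · rw [formMap_comp]
    have : (e.symm : B →ₐ[ℂ] A).comp φ = AlgHom.id ℂ A := by
      ext x; exact e.symm_apply_apply x
    rw [this, formMap_id]
  · rw [formMap_comp]
    have : φ.comp (e.symm : B →ₐ[ℂ] A) = AlgHom.id ℂ B := by
      ext x; exact e.apply_symm_apply x
    rw [this, formMap_id]

/-- Along an isomorphism, the pushforward is the inverse of the pullback. -/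
theorem isPushforward_iff {K L : Type} [Field K] [Field L] [Algebra ℂ K] [Algebra ℂ L]
    (j : K →ₐ[ℂ] L) (hj : Function.Surjective j) (ψ : Forms L) (θ : Forms K) :
    IsPushforward j ψ θ ↔ formMap j θ = ψ := by
  let _ : Algebra K L := j.toRingHom.toAlgebra
  have hjm : ∀ x, algebraMap K L x = j x := fun _ => rfl
  let e : K ≃ₗ[K] L := LinearEquiv.ofBijective (Algebra.linearMap K L)
    ⟨(algebraMap K L).injective, hj⟩
  have hfin : FiniteDimensional K L := Module.Finite.equiv e
  -- The extension has degree one, so the trace is the inverse of j.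
  have htr : ∀ b : K, Algebra.trace K L (j b) = b := by
    intro b
    rw [← hjm, Algebra.trace_algebraMap, ← e.finrank_eq, Module.finrank_self, one_smul]
  constructor
  · rintro ⟨-, m, a, τ, rfl, rfl⟩
    rw [map_sum]
    refine Finset.sum_congr rfl fun i _ => ?_
    obtain ⟨b, hb⟩ := hj (a i)
    rw [← hb]
    change formMap j (Algebra.trace K L (j b) • τ i) = _
    rw [htr, formMap_smul]
  · rintro rfl
    refine ⟨hfin, 1, fun _ => 1, fun _ => θ, by simp, ?_⟩
    have := htr 1
    rw [map_one] at this
    change θ = ∑ i : Fin 1, Algebra.trace K L 1 • θ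
    simp [this]

end Forms

/-! ### Charts of a function field -/

section Charts

variable {K : Type} [Field K] [Algebra ℂ K] {m : ℕ}

/-- Coordinates on an affine space birational to the variety with function field `K`. -/
structure IsChart (u : Fin m → K) : Prop where
  indep : AlgebraicIndependent ℂ u
  gen : IntermediateField.adjoin ℂ (Set.range u) = ⊤

theorem IsChart.injective {u : Fin m → K} (h : IsChart u) :
    Function.Injective (aeval u : MvPolynomial (Fin m) ℂ →ₐ[ℂ] K) := h.indep

theorem IsChart.aeval_ne_zero {u : Fin m → K} (h : IsChart u) {p : MvPolynomial (Fin m) ℂ}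
    (hp : p ≠ 0) : aeval u p ≠ 0 := fun h0 => hp (h.injective (by rw [h0, map_zero]))

theorem exists_eq_div_of_gen {u : Fin m → K}
    (h : IntermediateField.adjoin ℂ (Set.range u) = ⊤) (x : K) :
    ∃ p q : MvPolynomial (Fin m) ℂ, aeval u q ≠ 0 ∧ x = aeval u p / aeval u q := by
  have hx : x ∈ IntermediateField.adjoin ℂ (Set.range u) := by rw [h]; trivial
  obtain ⟨p, q, rfl⟩ := (IntermediateField.mem_adjoin_range_iff ℂ u x).1 hx
  by_cases hq : aeval u q = 0
  · exact ⟨0, 1, by simp, by simp [hq]⟩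
  · exact ⟨p, q, hq, rfl⟩

-- A generating family with as many members as the transcendence degree is algebraically
-- independent. New charts obtained by a change of coordinates therefore only need to generate the
-- field.
open IntermediateField.algebraAdjoinAdjoin in
theorem isChart_of_trdeg {u : Fin m → K} (hgen : IntermediateField.adjoin ℂ (Set.range u) = ⊤)
    (htr : Algebra.trdeg ℂ K = m) : IsChart u := by
  have : IsFractionRing (Algebra.adjoin ℂ (Set.range u)) K := by
    refine IsFractionRing.of_field _ _ fun x => ?_
    obtain ⟨p, q, -, rfl⟩ := exists_eq_div_of_gen hgen x
    have hmem : ∀ p : MvPolynomial (Fin m) ℂ, aeval u p ∈ Algebra.adjoin ℂ (Set.range u) := by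
      intro p
      rw [Algebra.adjoin_range_eq_range_aeval]
      exact ⟨p, rfl⟩
    exact ⟨⟨_, hmem p⟩, ⟨_, hmem q⟩, rfl⟩
  have : Algebra.IsAlgebraic (Algebra.adjoin ℂ (Set.range u)) K :=
    IsLocalization.isAlgebraic _ (nonZeroDivisors _)
  exact ⟨(Algebra.IsAlgebraic.isTranscendenceBasis_of_le_trdeg_of_finite ℂ u (by simp [htr])).1, hgen⟩

theorem IsChart.isFractionRing_adjoin {u : Fin m → K} (h : IsChart u) :
    IsFractionRing (Algebra.adjoin ℂ (Set.range u)) K := by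
  refine IsFractionRing.of_field _ _ fun x => ?_
  obtain ⟨p, q, -, rfl⟩ := exists_eq_div_of_gen h.gen x
  have hmem : ∀ p : MvPolynomial (Fin m) ℂ, aeval u p ∈ Algebra.adjoin ℂ (Set.range u) := by
    intro p
    rw [Algebra.adjoin_range_eq_range_aeval]
    exact ⟨p, rfl⟩
  exact ⟨⟨_, hmem p⟩, ⟨_, hmem q⟩, rfl⟩

theorem IsChart.trdeg {u : Fin m → K} (h : IsChart u) : Algebra.trdeg ℂ K = m := by
  have := h.isFractionRing_adjoin
  have : Algebra.IsAlgebraic (Algebra.adjoin ℂ (Set.range u)) K :=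
    IsLocalization.isAlgebraic _ (nonZeroDivisors _)
  have hb := h.indep.isTranscendenceBasis_iff_isAlgebraic.2 this
  simpa using hb.cardinalMk_eq_trdeg.symm

theorem IsChart.isFractionRing {u : Fin m → K} (h : IsChart u) :
    let _ := (aeval u : MvPolynomial (Fin m) ℂ →ₐ[ℂ] K).toRingHom.toAlgebra
    IsFractionRing (MvPolynomial (Fin m) ℂ) K := by
  let _ := (aeval u : MvPolynomial (Fin m) ℂ →ₐ[ℂ] K).toRingHom.toAlgebra
  have : FaithfulSMul (MvPolynomial (Fin m) ℂ) K :=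
    (faithfulSMul_iff_algebraMap_injective _ _).2 h.injective
  refine IsFractionRing.of_field _ _ fun x => ?_
  obtain ⟨p, q, -, rfl⟩ := exists_eq_div_of_gen h.gen x
  exact ⟨p, q, rfl⟩

/-- Kähler differentials commute with localization, and K is the fraction field of the polynomial
ring in the chart coordinates, so the basis of the dXᵢ survives. -/
theorem IsChart.exists_basis {u : Fin m → K} (h : IsChart u) :
    ∃ b : Module.Basis (Fin m) K (Ω[K⁄ℂ]), ∀ i, b i = KaehlerDifferential.D ℂ K (u i) := by
  let _ := (aeval u : MvPolynomial (Fin m) ℂ →ₐ[ℂ] K).toRingHom.toAlgebra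
  have hta : IsScalarTower ℂ (MvPolynomial (Fin m) ℂ) K :=
    IsScalarTower.of_algebraMap_eq fun c =>
      ((aeval u : MvPolynomial (Fin m) ℂ →ₐ[ℂ] K).commutes c).symm
  have := h.isFractionRing
  refine ⟨(mvPolynomialBasis ℂ (Fin m)).ofIsLocalizedModule K
    (nonZeroDivisors (MvPolynomial (Fin m) ℂ))
    (KaehlerDifferential.map ℂ ℂ (MvPolynomial (Fin m) ℂ) K), fun i => ?_⟩
  rw [Module.Basis.ofIsLocalizedModule_apply, mvPolynomialBasis_apply, KaehlerDifferential.map_D]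
  congr 1
  exact aeval_X u i

/-- The partial derivatives with respect to the coordinates of a chart. -/
def IsChart.pd {u : Fin m → K} (h : IsChart u) (i : Fin m) : Derivation ℂ K K :=
  (h.exists_basis.choose.coord i).compDer (KaehlerDifferential.D ℂ K)

theorem IsChart.pd_coord {u : Fin m → K} (h : IsChart u) (i j : Fin m) :
    h.pd i (u j) = if j = i then 1 else 0 := by
  have := h.exists_basis.choose_spec j
  change h.exists_basis.choose.coord i (KaehlerDifferential.D ℂ K (u j)) = _
  rw [← this, Module.Basis.coord_apply, Module.Basis.repr_self, Finsupp.single_apply]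

theorem IsChart.D_eq {u : Fin m → K} (h : IsChart u) (p : K) :
    KaehlerDifferential.D ℂ K p = ∑ i, h.pd i p • KaehlerDifferential.D ℂ K (u i) := by
  conv_lhs => rw [← h.exists_basis.choose.sum_repr (KaehlerDifferential.D ℂ K p)]
  refine Finset.sum_congr rfl fun i _ => ?_
  rw [h.exists_basis.choose_spec i]
  rfl

theorem IsChart.dForm_eq {u : Fin m → K} (h : IsChart u) (p : K) :
    dForm p = ∑ i, h.pd i p • dForm (u i) := by
  simp only [dForm]
  rw [h.D_eq p, map_sum]
  simp

theorem IsChart.span_D {u : Fin m → K} (h : IsChart u) :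
    Submodule.span K (Set.range fun i => KaehlerDifferential.D ℂ K (u i)) = ⊤ := by
  have : (fun i => KaehlerDifferential.D ℂ K (u i)) = h.exists_basis.choose :=
    funext fun i => (h.exists_basis.choose_spec i).symm
  rw [this, Module.Basis.span_eq]

/-- The Jacobian determinant of two functions on a surface. -/
def IsChart.jac {u : Fin 2 → K} (h : IsChart u) (p q : K) : K :=
  h.pd 0 p * h.pd 1 q - h.pd 1 p * h.pd 0 q

theorem IsChart.dForm_mul_dForm {u : Fin 2 → K} (h : IsChart u) (p q : K) :
    dForm p * dForm q = h.jac p q • (dForm (u 0) * dForm (u 1)) := by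
  rw [h.dForm_eq p, h.dForm_eq q, Fin.sum_univ_two, Fin.sum_univ_two, IsChart.jac]
  simp only [add_mul, mul_add, smul_mul_assoc, mul_smul_comm, dForm_mul_self,
    dForm_mul_comm (u 1) (u 0)]
  module

theorem IsChart.smul_dForm_mul_injective {u : Fin 2 → K} (h : IsChart u) {c d : K}
    (hcd : c • (dForm (u 0) * dForm (u 1)) = d • (dForm (u 0) * dForm (u 1))) : c = d := by
  let b := h.exists_basis.choose
  -- A linear functional on the whole exterior algebra: the determinant in degree two and zero in
  -- all other degrees. It takes du₀∧du₁ to 1.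
  let f : ∀ i, (Ω[K⁄ℂ]) [⋀^Fin i]→ₗ[K] K := fun i =>
    if hi : i = 2 then hi ▸ b.det else 0
  have hF : ExteriorAlgebra.liftAlternating f (dForm (u 0) * dForm (u 1)) = 1 := by
    have h1 : dForm (u 0) * dForm (u 1) = ExteriorAlgebra.ιMulti K 2 b := by
      rw [ExteriorAlgebra.ιMulti_apply]
      simp only [dForm, ← h.exists_basis.choose_spec 0, ← h.exists_basis.choose_spec 1]
      simp [b]
    rw [h1, ExteriorAlgebra.liftAlternating_apply_ιMulti]
    simp [f, b.det_self]
  have := congrArg (ExteriorAlgebra.liftAlternating f) hcd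
  rwa [map_smul, map_smul, hF, smul_eq_mul, smul_eq_mul, mul_one, mul_one] at this

theorem IsChart.smul_dForm_injective {u : Fin 1 → K} (h : IsChart u) {c d : K}
    (hcd : c • dForm (u 0) = d • dForm (u 0)) : c = d := by
  simp only [dForm, ← map_smul] at hcd
  rw [ExteriorAlgebra.ι_inj, ← h.exists_basis.choose_spec] at hcd
  have := congrArg (h.exists_basis.choose.coord 0) hcd
  simpa using this

end Charts

/-! ### Local rings of a chart -/

section LocalRings

variable {K : Type} [Field K] [Algebra ℂ K] {m : ℕ}

/-- The localization of the coordinate ring of a chart at a prime ideal. -/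
def locRing (u : Fin m → K) (P : Ideal (MvPolynomial (Fin m) ℂ)) [hP : P.IsPrime] :
    Subalgebra ℂ K where
  carrier := {x | ∃ p q, q ∉ P ∧ aeval u q ≠ 0 ∧ x = aeval u p / aeval u q}
  mul_mem' := by
    rintro _ _ ⟨p, q, hq, hq0, rfl⟩ ⟨p', q', hq', hq0', rfl⟩
    refine ⟨p * p', q * q', fun h => (hP.mem_or_mem h).elim hq hq', ?_, ?_⟩
    · rw [map_mul]; exact mul_ne_zero hq0 hq0'
    · rw [map_mul, map_mul, div_mul_div_comm]
  add_mem' := by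
    rintro _ _ ⟨p, q, hq, hq0, rfl⟩ ⟨p', q', hq', hq0', rfl⟩
    refine ⟨p * q' + q * p', q * q', fun h => (hP.mem_or_mem h).elim hq hq', ?_, ?_⟩
    · rw [map_mul]; exact mul_ne_zero hq0 hq0'
    · rw [map_add, map_mul, map_mul, map_mul, div_add_div _ _ hq0 hq0']
  algebraMap_mem' c :=
    ⟨C c, 1, fun h => hP.ne_top ((Ideal.eq_top_iff_one _).2 h), by simp, by simp⟩

variable {u : Fin m → K} {P : Ideal (MvPolynomial (Fin m) ℂ)} [hP : P.IsPrime]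

theorem aeval_mem_locRing (p : MvPolynomial (Fin m) ℂ) : aeval u p ∈ locRing u P :=
  ⟨p, 1, fun h => hP.ne_top ((Ideal.eq_top_iff_one _).2 h), by simp, by simp⟩

theorem coord_mem_locRing (i : Fin m) : u i ∈ locRing u P := by
  simpa using aeval_mem_locRing (u := u) (P := P) (X i)

theorem IsChart.aeval_ne_zero_of_notMem {u : Fin m → K} {P : Ideal (MvPolynomial (Fin m) ℂ)}
    (h : IsChart u) {q : MvPolynomial (Fin m) ℂ} (hq : q ∉ P) : aeval u q ≠ 0 :=
  h.aeval_ne_zero fun h0 => hq (h0 ▸ P.zero_mem)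

/-- The map `aeval u` is injective, so 1/p = p'/q' becomes the polynomial identity q' = p·p', and p
∈ P would put the denominator q' into P. Statements about units of the local ring thus become ideal
membership of polynomials. -/
theorem IsChart.inv_aeval_mem_locRing_iff (h : IsChart u) {p : MvPolynomial (Fin m) ℂ} :
    (aeval u p = 0 ∨ (aeval u p)⁻¹ ∉ locRing u P) ↔ p ∈ P := by
  constructor
  · intro h1
    by_contra hp
    rcases h1 with h1 | h1
    · exact h.aeval_ne_zero_of_notMem hp h1
    · exact h1 ⟨1, p, hp, h.aeval_ne_zero_of_notMem hp, by simp⟩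
  · intro hp
    by_contra! hcon
    obtain ⟨h0, p', q', hq', hq0', he⟩ := hcon
    apply hq'
    have : aeval u q' = aeval u (p * p') := by
      rw [map_mul]
      field_simp at he
      rw [he]
    rw [h.injective this]
    exact P.mul_mem_right _ hp

theorem IsChart.isLocalRing_locRing (h : IsChart u) : IsLocalRing (locRing u P) := by
  refine IsLocalRing.of_nonunits_add fun x y hx hy => ?_
  obtain ⟨_, p, q, hq, hq0, rfl⟩ := x
  obtain ⟨_, p', q', hq', hq0', rfl⟩ := y
  have key : ∀ {p q : MvPolynomial (Fin m) ℂ} (_ : q ∉ P) (hx : aeval u p / aeval u q ∈ locRing u P),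
      (⟨aeval u p / aeval u q, hx⟩ : locRing u P) ∈ nonunits (locRing u P) ↔ p ∈ P := by
    intro p q hq hx
    rw [← h.inv_aeval_mem_locRing_iff, mem_nonunits_iff, isUnit_subalgebra_iff]
    have hq0 := h.aeval_ne_zero_of_notMem hq
    have hqi : (aeval u q)⁻¹ ∈ locRing u P := by
      by_contra hcon
      exact hq (h.inv_aeval_mem_locRing_iff.1 (Or.inr hcon))
    have h1 : (aeval u p / aeval u q)⁻¹ ∈ locRing u P ↔ (aeval u p)⁻¹ ∈ locRing u P := by
      constructor
      · intro h2
        have := mul_mem h2 hqi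
        rwa [inv_div, div_eq_mul_inv, mul_comm, ← mul_assoc, inv_mul_cancel₀ hq0, one_mul] at this
      · intro h2
        rw [inv_div, div_eq_mul_inv]
        exact mul_mem (aeval_mem_locRing q) h2
    simp only [h1, ne_eq, div_eq_zero_iff, hq0, or_false]
    tauto
  have hx' := (key hq _).1 hx
  have hy' := (key hq' _).1 hy
  have he : aeval u p / aeval u q + aeval u p' / aeval u q' =
      aeval u (p * q' + q * p') / aeval u (q * q') := by
    rw [map_add, map_mul, map_mul, map_mul, div_add_div _ _ hq0 hq0']
  have hqq : q * q' ∉ P := fun h => (hP.mem_or_mem h).elim hq hq'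
  have hmem : aeval u (p * q' + q * p') / aeval u (q * q') ∈ locRing u P :=
    ⟨_, _, hqq, h.aeval_ne_zero_of_notMem hqq, rfl⟩
  have := (key hqq hmem).2 (P.add_mem (P.mul_mem_right _ hx') (P.mul_mem_left _ hy'))
  convert! this using 1
  exact Subtype.ext he

/-- The structure map from polynomials to a local ring of a chart. -/
@[reducible]
def locRingAlgebra (u : Fin m → K) (P : Ideal (MvPolynomial (Fin m) ℂ)) [P.IsPrime] :
    Algebra (MvPolynomial (Fin m) ℂ) (locRing u P) :=
  (aeval fun i => (⟨u i, coord_mem_locRing i⟩ : locRing u P)).toRingHom.toAlgebra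

/-- Identifies the concrete subring of K with the abstract localization, so that Noetherianity and
the equality of dimension and height become available. -/
theorem IsChart.isLocalization_locRing (h : IsChart u) :
    letI := locRingAlgebra u P
    IsLocalization.AtPrime (locRing u P) P := by
  let _ := locRingAlgebra u P
  have hmap : ∀ p, ((algebraMap (MvPolynomial (Fin m) ℂ) (locRing u P) p : locRing u P) : K) =
      aeval u p := by
    intro p
    change (locRing u P).val (aeval (fun i => (⟨u i, coord_mem_locRing i⟩ : locRing u P)) p) = _
    rw [← AlgHom.comp_apply, comp_aeval]
    rfl
  refine ⟨fun y => ?_, fun z => ?_, fun {x y} hxy => ⟨1, ?_⟩⟩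
  · rw [isUnit_subalgebra_iff, hmap]
    by_contra hcon
    refine y.2 (h.inv_aeval_mem_locRing_iff.1 ?_)
    tauto
  · obtain ⟨_, p, q, hq, hq0, rfl⟩ := z
    refine ⟨⟨p, ⟨q, hq⟩⟩, Subtype.ext ?_⟩
    change aeval u p / aeval u q * _ = _
    rw [hmap, hmap, div_mul_cancel₀ _ hq0]
  · have := congrArg (Subtype.val : locRing u P → K) hxy
    rw [hmap, hmap] at this
    rw [h.injective this]

theorem IsChart.isNoetherianRing_locRing (h : IsChart u) : IsNoetherianRing (locRing u P) := by
  let _ := locRingAlgebra u P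
  have := h.isLocalization_locRing (P := P)
  exact IsLocalization.isNoetherianRing P.primeCompl (locRing u P) inferInstance

theorem IsChart.ringKrullDim_locRing (h : IsChart u) :
    ringKrullDim (locRing u P) = P.height := by
  let _ := locRingAlgebra u P
  have := h.isLocalization_locRing (P := P)
  exact IsLocalization.AtPrime.ringKrullDim_eq_height P (locRing u P)

theorem IsChart.mem_maximalIdeal_locRing (h : IsChart u) [IsLocalRing (locRing u P)]
    (p : MvPolynomial (Fin m) ℂ) :
    (⟨aeval u p, aeval_mem_locRing p⟩ : locRing u P) ∈ IsLocalRing.maximalIdeal (locRing u P) ↔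
      p ∈ P := by
  rw [mem_maximalIdeal_iff]
  exact h.inv_aeval_mem_locRing_iff

theorem IsChart.maximalIdeal_locRing (h : IsChart u) [IsLocalRing (locRing u P)] {e : ℕ}
    (g : Fin e → MvPolynomial (Fin m) ℂ) (hg : P = Ideal.span (Set.range g)) :
    IsLocalRing.maximalIdeal (locRing u P) =
      Ideal.span (Set.range fun i => (⟨aeval u (g i), aeval_mem_locRing _⟩ : locRing u P)) := by
  apply le_antisymm
  · intro x hx
    obtain ⟨_, p, q, hq, hq0, rfl⟩ := x
    have hp : p ∈ P := by
      rw [mem_maximalIdeal_iff] at hx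
      by_contra hp
      have hp0 := h.aeval_ne_zero_of_notMem hp
      rcases hx with hx | hx
      · exact div_ne_zero hp0 hq0 hx
      · exact hx ⟨q, p, hp, hp0, by rw [inv_div]⟩
    rw [hg] at hp
    obtain ⟨c, rfl⟩ := (Ideal.mem_span_range_iff_exists_fun).1 hp
    have hqi : (aeval u q)⁻¹ ∈ locRing u P := ⟨1, q, hq, hq0, by simp⟩
    have hmem : aeval u (∑ i, c i * g i) / aeval u q ∈ locRing u P := ⟨_, q, hq, hq0, rfl⟩
    have : (⟨aeval u (∑ i, c i * g i) / aeval u q, hmem⟩ : locRing u P) =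
        ∑ i, (⟨aeval u (c i), aeval_mem_locRing _⟩ * ⟨_, hqi⟩ : locRing u P) *
          ⟨aeval u (g i), aeval_mem_locRing _⟩ := by
      apply Subtype.ext
      rw [AddSubmonoidClass.coe_finsetSum]
      simp only [map_sum, map_mul, MulMemClass.coe_mul, div_eq_mul_inv, Finset.sum_mul]
      exact Finset.sum_congr rfl fun i _ => by ring
    change (⟨_, hmem⟩ : locRing u P) ∈ _
    rw [this]
    exact Ideal.sum_mem _ fun i _ => Ideal.mul_mem_left _ _ (Ideal.subset_span ⟨i, rfl⟩)
  · rw [Ideal.span_le]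
    rintro _ ⟨i, rfl⟩
    refine (h.mem_maximalIdeal_locRing _).2 ?_
    rw [hg]
    exact Ideal.subset_span ⟨i, rfl⟩

/-- The local ring of the center of a valuation ring on a chart. -/
theorem IsValuationRingOf.exists_centerRing_eq {V : Subalgebra ℂ K} (hV : IsValuationRingOf V)
    (hu : ∀ i, u i ∈ V) :
    ∃ (P : Ideal (MvPolynomial (Fin m) ℂ)) (_ : P.IsPrime),
      centerRing (Algebra.adjoin ℂ (Set.range u)) V = locRing u P ∧
      ∀ p, p ∈ P ↔ aeval u p = 0 ∨ (aeval u p)⁻¹ ∉ V := by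
  have := hV.isLocalRing
  let φ : MvPolynomial (Fin m) ℂ →ₐ[ℂ] V := aeval fun i => ⟨u i, hu i⟩
  have hφ : ∀ p, ((φ p : V) : K) = aeval u p := by
    intro p
    change V.val (φ p) = _
    rw [← AlgHom.comp_apply, comp_aeval]
    rfl
  have hmem : ∀ p, p ∈ (IsLocalRing.maximalIdeal V).comap φ ↔
      aeval u p = 0 ∨ (aeval u p)⁻¹ ∉ V := by
    intro p
    rw [Ideal.mem_comap, mem_maximalIdeal_iff, hφ]
  refine ⟨(IsLocalRing.maximalIdeal V).comap φ, Ideal.comap_isPrime _ _, ?_, hmem⟩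
  ext x
  rw [mem_centerRing, Algebra.adjoin_range_eq_range_aeval]
  constructor
  · rintro ⟨_, ⟨p, rfl⟩, _, ⟨q, rfl⟩, hq0, hqV, rfl⟩
    exact ⟨p, q, by rw [hmem]; exact not_or.2 ⟨hq0, not_not.2 hqV⟩, hq0, rfl⟩
  · rintro ⟨p, q, hq, hq0, rfl⟩
    rw [hmem] at hq
    push Not at hq
    exact ⟨_, ⟨p, rfl⟩, _, ⟨q, rfl⟩, hq0, hq.2, rfl⟩

/-! ### Differentials of local rings -/

theorem IsChart.pd_aeval (h : IsChart u) (i : Fin m) (p : MvPolynomial (Fin m) ℂ) :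
    h.pd i (aeval u p) = aeval u (pderiv i p) := by
  induction p using MvPolynomial.induction_on with
  | C a => simp
  | add p q hp hq => simp [hp, hq]
  | mul_X p j hp =>
    rw [map_mul, aeval_X, Derivation.leibniz, hp, h.pd_coord, Derivation.leibniz, pderiv_X]
    simp only [smul_eq_mul, map_add, map_mul, aeval_X, Pi.single_apply]
    by_cases hij : j = i
    · subst hij; simp
    · simp [hij]

theorem IsChart.pd_mem_locRing (h : IsChart u) (i : Fin m) {x : K} (hx : x ∈ locRing u P) :
    h.pd i x ∈ locRing u P := by
  obtain ⟨p, q, hq, hq0, rfl⟩ := hx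
  have hqi : (aeval u q)⁻¹ ∈ locRing u P := ⟨1, q, hq, hq0, by simp⟩
  rw [div_eq_mul_inv, Derivation.leibniz, Derivation.leibniz_inv, h.pd_aeval, h.pd_aeval]
  simp only [smul_eq_mul]
  refine add_mem (mul_mem (aeval_mem_locRing _) (mul_mem (neg_mem ?_) (aeval_mem_locRing _)))
    (mul_mem hqi (aeval_mem_locRing _))
  exact pow_mem hqi 2

theorem IsChart.jac_mem_locRing {u : Fin 2 → K} {P : Ideal (MvPolynomial (Fin 2) ℂ)} [P.IsPrime]
    (h : IsChart u) {x y : K} (hx : x ∈ locRing u P) (hy : y ∈ locRing u P) :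
    h.jac x y ∈ locRing u P :=
  sub_mem (mul_mem (h.pd_mem_locRing 0 hx) (h.pd_mem_locRing 1 hy))
    (mul_mem (h.pd_mem_locRing 1 hx) (h.pd_mem_locRing 0 hy))

/-- The differentials of the coordinates span the differentials of a local ring. -/
theorem span_D_locRing :
    Submodule.span (locRing u P) (Set.range fun i =>
      KaehlerDifferential.D ℂ (locRing u P) ⟨u i, coord_mem_locRing i⟩) = ⊤ := by
  set N := Submodule.span (locRing u P) (Set.range fun i =>
      KaehlerDifferential.D ℂ (locRing u P) ⟨u i, coord_mem_locRing i⟩) with hN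
  have h1 : ∀ p, KaehlerDifferential.D ℂ (locRing u P) ⟨aeval u p, aeval_mem_locRing p⟩ ∈ N := by
    intro p
    induction p using MvPolynomial.induction_on with
    | C a =>
      have : (⟨aeval u (C a), aeval_mem_locRing (C a)⟩ : locRing u P) =
          algebraMap ℂ (locRing u P) a := Subtype.ext (by simp)
      rw [this, Derivation.map_algebraMap]
      exact N.zero_mem
    | add p q hp hq =>
      have : (⟨aeval u (p + q), aeval_mem_locRing (p + q)⟩ : locRing u P) =
          ⟨aeval u p, aeval_mem_locRing p⟩ + ⟨aeval u q, aeval_mem_locRing q⟩ :=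
        Subtype.ext (by simp)
      rw [this, map_add]
      exact N.add_mem hp hq
    | mul_X p i hp =>
      have : (⟨aeval u (p * X i), aeval_mem_locRing (p * X i)⟩ : locRing u P) =
          ⟨aeval u p, aeval_mem_locRing p⟩ * ⟨u i, coord_mem_locRing i⟩ :=
        Subtype.ext (by simp)
      rw [this, Derivation.leibniz]
      exact N.add_mem (N.smul_mem _ (Submodule.subset_span ⟨i, rfl⟩)) (N.smul_mem _ hp)
  rw [eq_top_iff, ← KaehlerDifferential.span_range_derivation, Submodule.span_le]
  rintro _ ⟨z, rfl⟩
  obtain ⟨p, q, hq, hq0, hzpq⟩ := z.2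
  have hqi : (aeval u q)⁻¹ ∈ locRing u P := ⟨1, q, hq, hq0, by simp⟩
  have hz : z * ⟨aeval u q, aeval_mem_locRing q⟩ = ⟨aeval u p, aeval_mem_locRing p⟩ :=
    Subtype.ext (by
      change (z : K) * aeval u q = _
      rw [hzpq, div_mul_cancel₀ _ hq0])
  have h2 := congrArg (KaehlerDifferential.D ℂ (locRing u P)) hz
  rw [Derivation.leibniz] at h2
  have h3 : (⟨_, hqi⟩ : locRing u P) • ((⟨aeval u q, aeval_mem_locRing q⟩ : locRing u P) •
      KaehlerDifferential.D ℂ (locRing u P) z) = KaehlerDifferential.D ℂ (locRing u P) z := by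
    rw [smul_smul]
    have : (⟨_, hqi⟩ : locRing u P) * ⟨aeval u q, aeval_mem_locRing q⟩ = 1 :=
      Subtype.ext (inv_mul_cancel₀ hq0)
    rw [this, one_smul]
  rw [SetLike.mem_coe, ← h3]
  refine N.smul_mem _ ?_
  rw [eq_sub_of_add_eq' h2]
  exact N.sub_mem (h1 p) (N.smul_mem _ (h1 q))

/-! ### Valuation rings of prime divisors -/

/-- In a fraction in lowest terms, f cannot divide both numerator and denominator, so the fraction
or its inverse has a denominator outside (f). -/
theorem IsChart.isValuationRingOf_locRing (h : IsChart u) {f : MvPolynomial (Fin m) ℂ}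
    (hf : ¬ IsUnit f) (hPf : P = Ideal.span {f}) : IsValuationRingOf (locRing u P) := by
  intro x
  obtain ⟨p, q, hq0, rfl⟩ := exists_eq_div_of_gen h.gen x
  have hq : q ≠ 0 := by rintro rfl; simp at hq0
  obtain ⟨p', q', c, hrel, rfl, rfl⟩ := UniqueFactorizationMonoid.exists_reduced_factors' p q hq
  have hc : aeval u c ≠ 0 := by rw [map_mul] at hq0; exact left_ne_zero_of_mul hq0
  rw [map_mul, map_mul, mul_div_mul_left _ _ hc]
  by_cases hfq : q' ∈ P
  · by_cases hfp : p' ∈ P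
    · rw [hPf, Ideal.mem_span_singleton] at hfq hfp
      exact absurd (hrel hfp hfq) hf
    · right
      exact ⟨q', p', hfp, h.aeval_ne_zero_of_notMem hfp, by rw [inv_div]⟩
  · left
    exact ⟨p', q', hfq, h.aeval_ne_zero_of_notMem hfq, rfl⟩

/-- A rational function regular along every prime divisor of affine space is a polynomial. -/
theorem IsChart.exists_eq_aeval (h : IsChart u) (x : K)
    (hx : ∀ f : MvPolynomial (Fin m) ℂ, Irreducible f → ∃ p q : MvPolynomial (Fin m) ℂ, ¬ f ∣ q ∧
      x * aeval u q = aeval u p) : ∃ p : MvPolynomial (Fin m) ℂ, x = aeval u p := by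
  obtain ⟨p, q, hq0, rfl⟩ := exists_eq_div_of_gen h.gen x
  have hq : q ≠ 0 := by rintro rfl; simp at hq0
  obtain ⟨p', q', c, hrel, rfl, rfl⟩ := UniqueFactorizationMonoid.exists_reduced_factors' p q hq
  have hc : aeval u c ≠ 0 := by rw [map_mul] at hq0; exact left_ne_zero_of_mul hq0
  have hq'0 : aeval u q' ≠ 0 := by rw [map_mul] at hq0; exact right_ne_zero_of_mul hq0
  rw [map_mul, map_mul, mul_div_mul_left _ _ hc] at *
  by_cases hu : IsUnit q'
  · obtain ⟨r, hr⟩ := hu.exists_left_inv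
    refine ⟨r * p', ?_⟩
    rw [div_eq_iff hq'0, ← map_mul]
    congr 1
    linear_combination (-p') * hr
  -- An irreducible factor f of the reduced denominator would also divide the numerator, by
  -- regularity of x along f = 0.
  · obtain ⟨f, hf, hfq⟩ := WfDvdMonoid.exists_irreducible_factor hu (right_ne_zero_of_mul hq)
    obtain ⟨a, b, hb, hab⟩ := hx f hf
    rw [div_mul_eq_mul_div, div_eq_iff hq'0, ← map_mul, ← map_mul] at hab
    have h1 := h.injective hab
    have h2 : f ∣ p' * b := by
      rw [h1]
      exact hfq.mul_left _
    rcases hf.prime.dvd_or_dvd h2 with h3 | h3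
    · exact absurd (hrel h3 hfq) hf.not_isUnit
    · exact absurd h3 hb

end LocalRings

/-! ### Prime ideals of polynomial rings in one and two variables -/

section Primes

variable {m : ℕ}

theorem span_X_sub_C_eq (a : Fin m → ℂ) :
    Ideal.span (Set.range fun i => (X i - C (a i) : MvPolynomial (Fin m) ℂ)) =
      RingHom.ker (MvPolynomial.eval a) := by
  apply le_antisymm
  · rw [Ideal.span_le]
    rintro _ ⟨i, rfl⟩
    simp [RingHom.mem_ker]
  · intro p hp
    -- Every polynomial is congruent to its value at a modulo the linear forms Xᵢ - aᵢ.
    have key : ∀ p : MvPolynomial (Fin m) ℂ, p - C (MvPolynomial.eval a p) ∈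
        Ideal.span (Set.range fun i => (X i - C (a i) : MvPolynomial (Fin m) ℂ)) := by
      intro p
      induction p using MvPolynomial.induction_on with
      | C a => simp
      | add p q hp hq =>
        have := Ideal.add_mem _ hp hq
        convert! this using 1
        simp only [map_add]; ring
      | mul_X p i hp =>
        have := Ideal.add_mem _ (Ideal.mul_mem_right (X i) _ hp)
          (Ideal.mul_mem_left _ (C (MvPolynomial.eval a p)) (Ideal.subset_span ⟨i, rfl⟩))
        convert! this using 1
        simp only [map_mul, eval_X]; ring
    have := key p
    rw [RingHom.mem_ker] at hp
    rwa [hp, map_zero, sub_zero] at this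

/-- This is the Nullstellensatz over ℂ, in terms of explicit generators that later serve as regular
parameters. -/
theorem exists_eq_span_of_isMaximal {P : Ideal (MvPolynomial (Fin m) ℂ)} (hP : P.IsMaximal) :
    ∃ a : Fin m → ℂ, P = Ideal.span (Set.range fun i => X i - C (a i)) := by
  obtain ⟨a, rfl⟩ := MvPolynomial.isMaximal_iff_eq_vanishingIdeal_singleton.1 hP
  refine ⟨a, ?_⟩
  rw [span_X_sub_C_eq]
  ext p
  rw [MvPolynomial.mem_vanishingIdeal_singleton_iff, RingHom.mem_ker]
  simp

theorem height_le_of_mvPolynomial (P : Ideal (MvPolynomial (Fin m) ℂ)) [P.IsPrime] :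
    P.height ≤ m := by
  have h1 := Ideal.height_le_ringKrullDim_of_ne_top (I := P) (Ideal.IsPrime.ne_top ‹_›)
  rw [MvPolynomial.ringKrullDim_of_isNoetherianRing, ringKrullDim_eq_zero_of_field] at h1
  simp only [Nat.card_eq_fintype_card, Fintype.card_fin, zero_add] at h1
  exact_mod_cast h1

/-- A strictly larger maximal ideal would have height above the dimension of affine space. -/
theorem isMaximal_of_le_height {P : Ideal (MvPolynomial (Fin m) ℂ)} [hP : P.IsPrime]
    (h : m ≤ P.height) : P.IsMaximal := by
  obtain ⟨M, hM, hPM⟩ := Ideal.exists_le_maximal P hP.ne_top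
  rcases hPM.lt_or_eq with hlt | rfl
  · have := hM.isPrime
    have h1 := Ideal.height_strict_mono_of_isPrime_of_isPrime hlt
    have h2 := height_le_of_mvPolynomial M
    exact absurd (lt_of_le_of_lt h h1) (not_lt.2 h2)
  · exact hM

theorem one_le_height_of_ne_bot {R : Type} [CommRing R] [IsDomain R] [IsNoetherianRing R]
    {P : Ideal R} [hP : P.IsPrime] (h : P ≠ ⊥) : 1 ≤ P.height := by
  have h1 := Ideal.height_strict_mono_of_isPrime_of_isPrime (I := (⊥ : Ideal R)) (J := P) (bot_lt_iff_ne_bot.2 h)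
  exact Order.one_le_iff_pos.2 (lt_of_le_of_lt zero_le h1)

/-- The points of the affine line. -/
theorem prime_line_cases (P : Ideal (MvPolynomial (Fin 1) ℂ)) [hP : P.IsPrime] :
    P = ⊥ ∨ P.height = 1 ∧ ∃ a : ℂ, P = Ideal.span {X 0 - C a} := by
  by_cases h : P = ⊥
  · exact Or.inl h
  · right
    have h1 := one_le_height_of_ne_bot h
    refine ⟨le_antisymm (by simpa using height_le_of_mvPolynomial P) h1, ?_⟩
    obtain ⟨a, ha⟩ := exists_eq_span_of_isMaximal (isMaximal_of_le_height (P := P) (by simpa using h1))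
    refine ⟨a 0, ?_⟩
    rw [ha]
    congr 1
    ext x
    simp [eq_comm]

/-- The points of the affine plane. -/
theorem prime_plane_cases (P : Ideal (MvPolynomial (Fin 2) ℂ)) [hP : P.IsPrime] :
    P = ⊥ ∨ (P.height = 1 ∧ ∃ f, Irreducible f ∧ P = Ideal.span {f}) ∨
    (P.height = 2 ∧ ∃ a : Fin 2 → ℂ, P = Ideal.span (Set.range fun i => X i - C (a i))) := by
  by_cases h : P = ⊥
  · exact Or.inl h
  right
  obtain ⟨p, hp, hp0⟩ := Submodule.exists_mem_ne_zero_of_ne_bot h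
  -- A nonzero prime of a factorial ring contains a prime element f. Either P = (f), of height one
  -- by the principal ideal theorem, or P is strictly larger, has height two and is a point.
  obtain ⟨f, hfP, hf⟩ := Ideal.IsPrime.exists_mem_prime_of_ne_bot hP h
  have hfp : (Ideal.span {f}).IsPrime := (Ideal.span_singleton_prime hf.ne_zero).2 hf
  have hfle : Ideal.span {f} ≤ P := (Ideal.span_singleton_le_iff_mem _).2 hfP
  have hf1 : 1 ≤ (Ideal.span {f}).height :=
    one_le_height_of_ne_bot (by rw [ne_eq, Ideal.span_singleton_eq_bot]; exact hf.ne_zero)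
  rcases hfle.lt_or_eq with hlt | heq
  · right
    have h1 := Ideal.height_strict_mono_of_isPrime_of_isPrime hlt
    have h2 : (2 : ℕ∞) ≤ P.height := by
      have := Order.add_one_le_of_lt (lt_of_le_of_lt hf1 h1)
      simpa [one_add_one_eq_two] using this
    exact ⟨le_antisymm (height_le_of_mvPolynomial P) h2,
      exists_eq_span_of_isMaximal (isMaximal_of_le_height h2)⟩
  · left
    refine ⟨le_antisymm ?_ (heq ▸ hf1), f, hf.irreducible, heq.symm⟩
    rw [← heq]
    exact Ideal.height_span_singleton_le_one hf.not_isUnit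

end Primes

/-! ### Two-dimensional regular local rings -/

theorem radical_span_pow {R : Type} [CommRing R] {t w : R} (ht : Prime t) (hw : IsUnit w) {k : ℕ} (hk : k ≠ 0) :
    (Ideal.span {w * t ^ k}).radical = Ideal.span {t} := by
  rw [Ideal.span_singleton_mul_left_unit hw, ← Ideal.span_singleton_pow, Ideal.radical_pow _ hk]
  exact ((Ideal.span_singleton_prime ht.ne_zero).2 ht).radical

/-- The intersection of (t₁) and (t₂) is generated by the product, because the prime t₂ does not
divide t₁. -/
theorem radical_span_pow_mul_pow {R : Type} [CommRing R] {t₁ t₂ w : R} (h₁ : Prime t₁) (h₂ : Prime t₂) (h : ¬ t₂ ∣ t₁)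
    (hw : IsUnit w) {k l : ℕ} (hk : k ≠ 0) (hl : l ≠ 0) :
    (Ideal.span {w * t₁ ^ k * t₂ ^ l}).radical = Ideal.span {t₁ * t₂} := by
  rw [mul_assoc, Ideal.span_singleton_mul_left_unit hw, ← Ideal.span_singleton_mul_span_singleton,
    Ideal.radical_mul, ← Ideal.span_singleton_pow, ← Ideal.span_singleton_pow,
    Ideal.radical_pow _ hk, Ideal.radical_pow _ hl,
    ((Ideal.span_singleton_prime h₁.ne_zero).2 h₁).radical,
    ((Ideal.span_singleton_prime h₂.ne_zero).2 h₂).radical]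
  ext x
  rw [Ideal.mem_inf, Ideal.mem_span_singleton, Ideal.mem_span_singleton, Ideal.mem_span_singleton]
  constructor
  · rintro ⟨⟨y, rfl⟩, h3⟩
    exact mul_dvd_mul_left _ ((h₂.dvd_or_dvd h3).resolve_left h)
  · intro h3
    exact ⟨(dvd_mul_right _ _).trans h3, (dvd_mul_left _ _).trans h3⟩

section Regular

variable {R : Type} [CommRing R] [IsNoetherianRing R] [IsLocalRing R]

theorem ringKrullDim_le_one_of_maximalIdeal_eq {t : R}
    (h : IsLocalRing.maximalIdeal R = Ideal.span {t}) : ringKrullDim R ≤ 1 := by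
  rw [← IsLocalRing.maximalIdeal_height_eq_ringKrullDim, h]
  have : ¬ IsUnit t := by
    rw [← mem_nonunits_iff, ← IsLocalRing.mem_maximalIdeal, h]
    exact Ideal.mem_span_singleton_self t
  exact_mod_cast Ideal.height_span_singleton_le_one this

/-- Let p be a minimal prime over t₁, of height at most one. Then t₂ ∉ p, since otherwise p would be
the maximal ideal, of height two. So a·t₁ + b·t₂ ∈ p implies b ∈ p, that is, p ⊆ (t₁) + 𝔪p, and
Nakayama's lemma gives p = (t₁). -/
theorem prime_of_maximalIdeal_eq_span_pair (hdim : ringKrullDim R = 2) {t₁ t₂ : R}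
    (h : IsLocalRing.maximalIdeal R = Ideal.span {t₁, t₂}) : Prime t₁ := by
  have ht1 : t₁ ∈ IsLocalRing.maximalIdeal R := by rw [h]; exact Ideal.subset_span (by simp)
  have ht0 : t₁ ≠ 0 := by
    rintro rfl
    have : IsLocalRing.maximalIdeal R = Ideal.span {t₂} := by rw [h, Ideal.span_insert_zero]
    have := ringKrullDim_le_one_of_maximalIdeal_eq this
    rw [hdim] at this
    exact absurd this (by decide)
  rw [← Ideal.span_singleton_prime ht0]
  have hle : Ideal.span {t₁} ≤ IsLocalRing.maximalIdeal R :=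
    (Ideal.span_singleton_le_iff_mem _).2 ht1
  obtain ⟨p, hp, hpm⟩ := Ideal.exists_minimalPrimes_le hle
  have hpp : p.IsPrime := hp.1.1
  have hph : p.height ≤ 1 := Ideal.height_le_one_of_isPrincipal_of_mem_minimalPrimes _ _ hp
  have ht2 : t₂ ∉ p := by
    intro ht2
    have : IsLocalRing.maximalIdeal R ≤ p := by
      rw [h, Ideal.span_le]
      rintro x (rfl | rfl)
      exacts [hp.1.2 (Ideal.mem_span_singleton_self _), ht2]
    have hpe := le_antisymm hpm this
    have hd := IsLocalRing.maximalIdeal_height_eq_ringKrullDim (R := R)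
    rw [← hpe, hdim] at hd
    have hd' : p.height = 2 := WithBot.coe_injective hd
    rw [hd'] at hph
    exact absurd hph (by decide)
  have : p ≤ Ideal.span {t₁} := by
    refine Submodule.le_of_le_smul_of_le_jacobson_bot (I := IsLocalRing.maximalIdeal R)
      (IsNoetherian.noetherian p) (IsLocalRing.maximalIdeal_le_jacobson _) ?_
    intro x hx
    have hxm := hpm hx
    rw [h, Ideal.mem_span_pair] at hxm
    obtain ⟨a, b, rfl⟩ := hxm
    have hb : b ∈ p := by
      have h1 : b * t₂ ∈ p := by
        have := p.sub_mem hx (p.mul_mem_left a (hp.1.2 (Ideal.mem_span_singleton_self t₁)))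
        simpa using this
      exact (hpp.mem_or_mem h1).resolve_right ht2
    refine Submodule.add_mem_sup (Ideal.mul_mem_left _ _ (Ideal.mem_span_singleton_self _)) ?_
    rw [mul_comm]
    refine Submodule.smul_mem_smul ?_ hb
    rw [h]; exact Ideal.subset_span (by simp)
  rw [← le_antisymm this hp.1.2]
  exact hpp

/-- A divisibility would make the maximal ideal principal and the dimension at most one. -/
theorem not_dvd_of_maximalIdeal_eq_span_pair (hdim : ringKrullDim R = 2) {t₁ t₂ : R}
    (h : IsLocalRing.maximalIdeal R = Ideal.span {t₁, t₂}) : ¬ t₁ ∣ t₂ := by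
  rintro ⟨c, rfl⟩
  have : IsLocalRing.maximalIdeal R = Ideal.span {t₁} := by
    rw [h]
    apply le_antisymm
    · rw [Ideal.span_le]
      rintro x (rfl | rfl)
      exacts [Ideal.mem_span_singleton_self _,
        Ideal.mul_mem_right _ _ (Ideal.mem_span_singleton_self _)]
    · exact Ideal.span_mono (by simp)
  have := ringKrullDim_le_one_of_maximalIdeal_eq this
  rw [hdim] at this
  exact absurd this (by decide)

end Regular

/-! ### Local criteria for logarithmic forms -/

section LogCriteria

variable {K : Type} [Field K] [Algebra ℂ K]

theorem isLogAt_of_top {d e : ℕ} {O : Subalgebra ℂ K} [IsLocalRing O] (t : Fin e → O)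
    (hdim : ringKrullDim O = e) (ht : Ideal.span (Set.range t) = IsLocalRing.maximalIdeal O)
    {η : Forms O} (hη : η ∈ ⋀[O]^d (Ω[O⁄ℂ])) :
    IsLogAt d O ⊤ (formMap O.val η) :=
  ⟨inferInstance, e, 0, d, Nat.zero_le e, t, η, hdim, ht, by simp [Ideal.radical_top], rfl, hη,
    by simp⟩

theorem isLogAt_of_cons {d e : ℕ} {O : Subalgebra ℂ K} [IsLocalRing O] (t : Fin (e + 1) → O)
    (hdim : ringKrullDim O = (e + 1 : ℕ))
    (ht : Ideal.span (Set.range t) = IsLocalRing.maximalIdeal O)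
    {I : Ideal O} (hI : I.radical = Ideal.span {t 0})
    {η : Forms O} (hη : η ∈ ⋀[O]^d (Ω[O⁄ℂ])) :
    IsLogAt (d + 1) O I (formMap O.val η * dlog (t 0 : K)) :=
  ⟨inferInstance, e + 1, 1, d, by omega, t, η, hdim, ht, by simpa using hI, rfl, hη, by simp⟩

variable {m : ℕ}

theorem IsChart.exists_params_of_span {u : Fin m → K} {P : Ideal (MvPolynomial (Fin m) ℂ)}
    [hP : P.IsPrime] (h : IsChart u) [IsLocalRing (locRing u P)] {e : ℕ} (hht : P.height = e)
    (g : Fin e → MvPolynomial (Fin m) ℂ) (hg : P = Ideal.span (Set.range g)) :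
    ringKrullDim (locRing u P) = e ∧
      Ideal.span (Set.range fun i => (⟨aeval u (g i), aeval_mem_locRing _⟩ : locRing u P)) =
        IsLocalRing.maximalIdeal (locRing u P) :=
  ⟨by rw [h.ringKrullDim_locRing, hht]; rfl, (h.maximalIdeal_locRing g hg).symm⟩

section Line

variable {u : Fin 1 → K} {P : Ideal (MvPolynomial (Fin 1) ℂ)} [hP : P.IsPrime]

theorem IsChart.isLogAt_line_top (h : IsChart u) {c : K} (hc : c ∈ locRing u P) :
    IsLogAt 1 (locRing u P) ⊤ (c • dForm (u 0)) := by
  have := h.isLocalRing_locRing (P := P)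
  have hη : (⟨c, hc⟩ : locRing u P) • dForm (⟨u 0, coord_mem_locRing 0⟩ : locRing u P) ∈
      ⋀[locRing u P]^1 (Ω[locRing u P⁄ℂ]) :=
    Submodule.smul_mem _ _ (dForm_mem_exteriorPower_one _)
  have hf : c • dForm (u 0) = formMap (locRing u P).val
      ((⟨c, hc⟩ : locRing u P) • dForm (⟨u 0, coord_mem_locRing 0⟩ : locRing u P)) := by
    rw [formMap_smul, formMap_dForm]; rfl
  rw [hf]
  rcases prime_line_cases P with hbot | ⟨hht, a, ha⟩
  · obtain ⟨h1, h2⟩ := h.exists_params_of_span (P := P) (e := 0) (by rw [hbot]; simp) Fin.elim0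
      (by rw [hbot]; simp)
    exact isLogAt_of_top _ h1 h2 hη
  · obtain ⟨h1, h2⟩ := h.exists_params_of_span (P := P) (e := 1) (by rw [hht]; rfl)
      (fun _ => X 0 - C a) (by rw [ha]; simp)
    exact isLogAt_of_top _ h1 h2 hη

/-- With f = X₀ - a one has df = du₀, so a coefficient with at most a simple pole gives c du₀ =
(c·f) df/f. Only the radical of the ideal matters. -/
theorem IsChart.isLogAt_line_point (h : IsChart u) {a : ℂ} (hPa : P = Ideal.span {X 0 - C a})
    {I : Ideal (locRing u P)}
    (hI : I.radical = Ideal.span {⟨aeval u (X 0 - C a), aeval_mem_locRing _⟩})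
    {c : K} (hc : c * aeval u (X 0 - C a) ∈ locRing u P) :
    IsLogAt 1 (locRing u P) I (c • dForm (u 0)) := by
  have := h.isLocalRing_locRing (P := P)
  have hne : P ≠ ⊥ := by
    rw [hPa, ne_eq, Ideal.span_singleton_eq_bot]
    intro h0
    have := congrArg (MvPolynomial.eval fun _ => a + 1) h0
    simp at this
  rcases prime_line_cases P with hbot | ⟨hht, -⟩
  · exact absurd hbot hne
  obtain ⟨h1, h2⟩ := h.exists_params_of_span (P := P) (e := 1) (by rw [hht]; rfl)
    (fun _ => X 0 - C a) (by rw [hPa]; simp)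
  have hη : (⟨c * aeval u (X 0 - C a), hc⟩ : locRing u P) • (1 : Forms (locRing u P)) ∈
      ⋀[locRing u P]^0 (Ω[locRing u P⁄ℂ]) := mem_exteriorPower_zero.2 ⟨_, rfl⟩
  have := isLogAt_of_cons _ h1 h2 hI hη
  convert! this using 1
  have h0 : aeval u (X 0 - C a : MvPolynomial (Fin 1) ℂ) ≠ 0 :=
    h.aeval_ne_zero fun h0 => hne (by rw [hPa, h0]; simp)
  have hd : dForm (aeval u (X 0 - C a : MvPolynomial (Fin 1) ℂ)) = dForm (u 0) := by
    rw [map_sub, aeval_X, dForm_sub, ← algebraMap_eq, AlgHom.commutes, dForm_algebraMap, sub_zero]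
  rw [formMap_smul, formMap_one, dlog]
  simp only [Subalgebra.coe_val, smul_mul_smul_comm, one_mul]
  rw [hd, mul_assoc, mul_inv_cancel₀ h0, mul_one]

end Line

section Plane

variable {u : Fin 2 → K} {P : Ideal (MvPolynomial (Fin 2) ℂ)} [hP : P.IsPrime]

/-- Off the divisor a regular coefficient suffices. The three kinds of points of the plane differ
only in their systems of parameters. -/
theorem IsChart.isLogAt_plane_top (h : IsChart u) {c : K} (hc : c ∈ locRing u P) :
    IsLogAt 2 (locRing u P) ⊤ (c • (dForm (u 0) * dForm (u 1))) := by
  have := h.isLocalRing_locRing (P := P)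
  have hη : (⟨c, hc⟩ : locRing u P) • (dForm (⟨u 0, coord_mem_locRing 0⟩ : locRing u P) *
      dForm ⟨u 1, coord_mem_locRing 1⟩) ∈ ⋀[locRing u P]^2 (Ω[locRing u P⁄ℂ]) :=
    Submodule.smul_mem _ _ (dForm_mul_mem_exteriorPower_two _ _)
  have hf : c • (dForm (u 0) * dForm (u 1)) = formMap (locRing u P).val
      ((⟨c, hc⟩ : locRing u P) • (dForm (⟨u 0, coord_mem_locRing 0⟩ : locRing u P) *
      dForm ⟨u 1, coord_mem_locRing 1⟩)) := by
    rw [formMap_smul_dForm_mul]; rfl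
  rw [hf]
  rcases prime_plane_cases P with hbot | ⟨hht, f, -, hf⟩ | ⟨hht, a, ha⟩
  · obtain ⟨h1, h2⟩ := h.exists_params_of_span (P := P) (e := 0) (by rw [hbot]; simp) Fin.elim0
      (by rw [hbot]; simp)
    exact isLogAt_of_top _ h1 h2 hη
  · obtain ⟨h1, h2⟩ := h.exists_params_of_span (P := P) (e := 1) (by rw [hht]; rfl)
      (fun _ => f) (by rw [hf]; simp)
    exact isLogAt_of_top _ h1 h2 hη
  · obtain ⟨h1, h2⟩ := h.exists_params_of_span (P := P) (e := 2) (by rw [hht]; rfl) _ ha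
    exact isLogAt_of_top _ h1 h2 hη

/-- The Jacobian determinant as a function on a local ring. -/
def IsChart.jacLoc (h : IsChart u) (x y : locRing u P) : locRing u P :=
  ⟨h.jac x y, h.jac_mem_locRing x.2 y.2⟩

theorem IsChart.jac_mul_left (h : IsChart u) (x y z : K) :
    h.jac (x * y) z = x * h.jac y z + y * h.jac x z := by
  simp only [IsChart.jac, Derivation.leibniz, smul_eq_mul]
  ring

theorem IsChart.jac_swap (h : IsChart u) (x y : K) : h.jac x y = -h.jac y x := by
  simp only [IsChart.jac]; ring

/-- By the product rule every term of the Jacobian of f·x and f·y retains a factor f. Hence two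
functions with a common nonunit factor never have an invertible Jacobian. -/
theorem IsChart.jacLoc_mem_of_mul_mul (h : IsChart u) (f x y : locRing u P) :
    h.jacLoc (f * x) (f * y) ∈ Ideal.span {f} := by
  refine Ideal.mem_span_singleton.2
    ⟨f * h.jacLoc x y + y * h.jacLoc x f + x * h.jacLoc f y, Subtype.ext ?_⟩
  simp only [IsChart.jacLoc, IsChart.jac, MulMemClass.coe_mul, AddMemClass.coe_add,
    Derivation.leibniz, smul_eq_mul]
  ring

theorem IsChart.jacLoc_mem_of_mul_left (h : IsChart u) {Q : Ideal (locRing u P)}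
    {f x s : locRing u P} (hf : f ∈ Q) (hx : x ∈ Q) : h.jacLoc (f * x) s ∈ Q := by
  have : h.jacLoc (f * x) s = f * h.jacLoc x s + x * h.jacLoc f s :=
    Subtype.ext (h.jac_mul_left _ _ _)
  rw [this]
  exact Q.add_mem (Q.mul_mem_right _ hf) (Q.mul_mem_right _ hx)

/-- Two functions vanishing at a point of the plane whose Jacobian does not vanish there are
local parameters. -/
theorem IsChart.maximalIdeal_eq_of_jac (h : IsChart u) [IsLocalRing (locRing u P)] {a : Fin 2 → ℂ}
    (ha : P = Ideal.span (Set.range fun i => X i - C (a i))) {f₁ f₂ : locRing u P}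
    (h₁ : f₁ ∈ IsLocalRing.maximalIdeal (locRing u P))
    (h₂ : f₂ ∈ IsLocalRing.maximalIdeal (locRing u P)) (hJ : IsUnit (h.jacLoc f₁ f₂)) :
    IsLocalRing.maximalIdeal (locRing u P) = Ideal.span {f₁, f₂} := by
  have hm := h.maximalIdeal_locRing (P := P) _ ha
  obtain ⟨A, B, hm', hAK, hBK⟩ : ∃ A B : locRing u P,
      IsLocalRing.maximalIdeal (locRing u P) = Ideal.span {A, B} ∧
      (A : K) = u 0 - algebraMap ℂ K (a 0) ∧ (B : K) = u 1 - algebraMap ℂ K (a 1) := by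
    refine ⟨⟨aeval u (X 0 - C (a 0)), aeval_mem_locRing _⟩,
      ⟨aeval u (X 1 - C (a 1)), aeval_mem_locRing _⟩, ?_, by simp, by simp⟩
    rw [hm]
    congr 1
    ext x
    constructor
    · rintro ⟨i, rfl⟩
      fin_cases i
      exacts [Or.inl rfl, Or.inr rfl]
    · rintro (rfl | rfl)
      exacts [⟨0, rfl⟩, ⟨1, rfl⟩]
  obtain ⟨α₁, β₁, e₁⟩ := Ideal.mem_span_pair.1 (hm' ▸ h₁)
  obtain ⟨α₂, β₂, e₂⟩ := Ideal.mem_span_pair.1 (hm' ▸ h₂)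
  let D : Fin 2 → locRing u P → locRing u P := fun i x => ⟨h.pd i x, h.pd_mem_locRing i x.2⟩
  -- Modulo the maximal ideal, the Jacobian equals the determinant of the matrix expressing f₁, f₂
  -- through A, B. That matrix is therefore invertible, and A, B can be recovered from f₁, f₂.
  have hdet : h.jacLoc f₁ f₂ - (α₁ * β₂ - β₁ * α₂) ∈ IsLocalRing.maximalIdeal (locRing u P) := by
    rw [hm', Ideal.mem_span_pair]
    have hd : ∀ (α β f : locRing u P), α * A + β * B = f → ∀ i : Fin 2, h.pd i f =
        A * h.pd i α + B * h.pd i β + (if i = 0 then (α : K) else β) := by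
      rintro α β _ rfl i
      rw [AddMemClass.coe_add, MulMemClass.coe_mul, MulMemClass.coe_mul, map_add,
        Derivation.leibniz, Derivation.leibniz, hAK, hBK, map_sub, map_sub,
        Derivation.map_algebraMap, Derivation.map_algebraMap, h.pd_coord, h.pd_coord]
      simp only [smul_eq_mul]
      fin_cases i <;> simp <;> ring
    -- The two coefficients come from expanding the partial derivatives by the product rule and
    -- collecting the terms divisible by A and by B.
    refine ⟨D 0 α₁ * (A * D 1 α₂ + B * D 1 β₂ + β₂) + α₁ * D 1 α₂
        - D 1 α₁ * (A * D 0 α₂ + B * D 0 β₂ + α₂) - β₁ * D 0 α₂,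
      D 0 β₁ * (A * D 1 α₂ + B * D 1 β₂ + β₂) + α₁ * D 1 β₂
        - D 1 β₁ * (A * D 0 α₂ + B * D 0 β₂ + α₂) - β₁ * D 0 β₂, Subtype.ext ?_⟩
    have h10 := hd α₁ β₁ f₁ e₁ 0
    have h11 := hd α₁ β₁ f₁ e₁ 1
    have h20 := hd α₂ β₂ f₂ e₂ 0
    have h21 := hd α₂ β₂ f₂ e₂ 1
    simp only [if_true, one_ne_zero, if_false] at h10 h11 h20 h21
    change (h.pd 0 α₁ * (A * h.pd 1 α₂ + B * h.pd 1 β₂ + β₂) + α₁ * h.pd 1 α₂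
        - h.pd 1 α₁ * (A * h.pd 0 α₂ + B * h.pd 0 β₂ + α₂) - β₁ * h.pd 0 α₂ : K) * A +
      (h.pd 0 β₁ * (A * h.pd 1 α₂ + B * h.pd 1 β₂ + β₂) + α₁ * h.pd 1 β₂
        - h.pd 1 β₁ * (A * h.pd 0 α₂ + B * h.pd 0 β₂ + α₂) - β₁ * h.pd 0 β₂) * B =
      h.pd 0 f₁ * h.pd 1 f₂ - h.pd 1 f₁ * h.pd 0 f₂ - (α₁ * β₂ - β₁ * α₂)
    rw [h10, h11, h20, h21]
    ring
  have hdu : IsUnit (α₁ * β₂ - β₁ * α₂) := by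
    by_contra hcon
    have h1 : α₁ * β₂ - β₁ * α₂ ∈ IsLocalRing.maximalIdeal (locRing u P) :=
      (IsLocalRing.mem_maximalIdeal _).2 hcon
    have h2 := Ideal.add_mem _ hdet h1
    rw [sub_add_cancel, IsLocalRing.mem_maximalIdeal] at h2
    exact h2 hJ
  obtain ⟨δ, hδ⟩ := hdu.exists_left_inv
  apply le_antisymm
  · rw [hm', Ideal.span_le]
    rintro x (rfl | rfl)
    · refine Ideal.mem_span_pair.2 ⟨δ * β₂, -(δ * β₁), ?_⟩
      rw [← e₁, ← e₂]
      linear_combination x * hδ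
    · refine Ideal.mem_span_pair.2 ⟨-(δ * α₂), δ * α₁, ?_⟩
      rw [← e₁, ← e₂]
      linear_combination x * hδ
  · rw [Ideal.span_le]
    rintro x (rfl | rfl)
    exacts [h₁, h₂]

/-- An invertible Jacobian J of f and uᵢ makes them local coordinates, and du₀∧du₁ = -J⁻¹ duᵢ∧df, so
that c du₀∧du₁ = η∧df/f with η = -(c·f/J) duᵢ. The multiplicity k and the unit w disappear in the
radical. The generic point is excluded because f is a nonzero nonunit. -/
theorem IsChart.isLogAt_plane_smooth (h : IsChart u) {I : Ideal (locRing u P)}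
    {f w : locRing u P} {k : ℕ} (hk : k ≠ 0) (hw : IsUnit w) (hI : I = Ideal.span {w * f ^ k})
    (hf : ¬ IsUnit f) (i : Fin 2) (hJ : IsUnit (h.jacLoc f ⟨u i, coord_mem_locRing i⟩))
    {c : K} (hc : c * f ∈ locRing u P) :
    IsLogAt 2 (locRing u P) I (c • (dForm (u 0) * dForm (u 1))) := by
  have := h.isLocalRing_locRing (P := P)
  have := h.isNoetherianRing_locRing (P := P)
  have hfm : f ∈ IsLocalRing.maximalIdeal (locRing u P) := (IsLocalRing.mem_maximalIdeal _).2 hf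
  set s : locRing u P := ⟨u i, coord_mem_locRing i⟩ with hs
  obtain ⟨j, hj⟩ := hJ.exists_left_inv
  have hjK : (j : K) * h.jac f (u i) = 1 := congrArg (Subtype.val : locRing u P → K) hj
  have hf0 : (f : K) ≠ 0 := by
    intro h0
    rw [h0] at hjK
    simp [IsChart.jac] at hjK
  set η : Forms (locRing u P) := (-(⟨c * f, hc⟩ * j) : locRing u P) • dForm s with hηdef
  have hη : η ∈ ⋀[locRing u P]^1 (Ω[locRing u P⁄ℂ]) :=
    Submodule.smul_mem _ _ (dForm_mem_exteriorPower_one _)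
  have hform : c • (dForm (u 0) * dForm (u 1)) = formMap (locRing u P).val η * dlog (f : K) := by
    rw [hηdef, formMap_smul, formMap_dForm, dlog, smul_mul_smul_comm]
    simp only [Subalgebra.coe_val, hs, h.dForm_mul_dForm (u i) (f : K), smul_smul]
    congr 1
    rw [h.jac_swap]
    push_cast
    field_simp
    linear_combination (-c) * hjK
  rw [hform]
  rcases prime_plane_cases P with hbot | ⟨hht, g, -, hg⟩ | ⟨hht, a, ha⟩
  · have h1 := h.maximalIdeal_locRing (P := P) (e := 0) Fin.elim0 (by rw [hbot]; simp)
    rw [h1] at hfm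
    simp only [Set.range_eq_empty, Ideal.span_empty, Ideal.mem_bot] at hfm
    exact absurd (by rw [hfm]; rfl) hf0
  · obtain ⟨h1, h2⟩ := h.exists_params_of_span (P := P) (e := 1) (by rw [hht]; rfl)
      (fun _ => g) (by rw [hg]; simp)
    set γ : locRing u P := ⟨aeval u g, aeval_mem_locRing _⟩
    have h3 : Ideal.span {γ} = IsLocalRing.maximalIdeal (locRing u P) := by
      rw [← h2]; simp [γ]
    obtain ⟨x, hx⟩ := Ideal.mem_span_singleton.1 (h3 ▸ hfm)
    -- If f were a product of two elements of the maximal ideal, the Jacobian would lie there too;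
    -- so f itself is a uniformizer.
    have hxu : IsUnit x := by
      by_contra hcon
      have hγ : γ ∈ IsLocalRing.maximalIdeal (locRing u P) := by
        rw [← h3]; exact Ideal.mem_span_singleton_self _
      have := h.jacLoc_mem_of_mul_left (s := s) hγ ((IsLocalRing.mem_maximalIdeal _).2 hcon)
      rw [← hx, IsLocalRing.mem_maximalIdeal] at this
      exact this hJ
    have h4 : Ideal.span {f} = IsLocalRing.maximalIdeal (locRing u P) := by
      rw [hx, Ideal.span_singleton_mul_right_unit hxu, h3]
    have hfp : Prime f := by
      rw [← Ideal.span_singleton_prime (fun h0 => hf0 (by rw [h0]; rfl)), h4]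
      exact (IsLocalRing.maximalIdeal.isMaximal _).isPrime
    refine isLogAt_of_cons (fun _ : Fin 1 => f) h1 (by rw [← h4]; simp) ?_ hη
    rw [hI, radical_span_pow hfp hw hk]
  · obtain ⟨h1, h2⟩ := h.exists_params_of_span (P := P) (e := 2) (by rw [hht]; rfl) _ ha
    set t : locRing u P := ⟨aeval u (X i - C (a i)), aeval_mem_locRing _⟩
    have ht : t ∈ IsLocalRing.maximalIdeal (locRing u P) := by
      rw [← h2]; exact Ideal.subset_span ⟨i, rfl⟩
    have hJt : h.jacLoc f t = h.jacLoc f s := by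
      apply Subtype.ext
      simp [IsChart.jacLoc, IsChart.jac, t, hs, ← algebraMap_eq]
    have hmax := h.maximalIdeal_eq_of_jac ha hfm ht (by rwa [hJt])
    have hp := prime_of_maximalIdeal_eq_span_pair (by rw [h1]; rfl) hmax
    refine isLogAt_of_cons ![f, t] h1 (by rw [hmax]; simp [Set.pair_comm]) ?_ hη
    rw [hI, radical_span_pow hp hw hk]
    rfl

/-- With J the Jacobian of f₁ and f₂, the form equals (c·f₁·f₂/J) df₁/f₁∧df₂/f₂. Invertibility of J
makes f₁, f₂ a system of parameters. -/
theorem IsChart.isLogAt_plane_cross (h : IsChart u) {I : Ideal (locRing u P)}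
    {f₁ f₂ w : locRing u P} {k l : ℕ} (hk : k ≠ 0) (hl : l ≠ 0) (hw : IsUnit w)
    (hI : I = Ideal.span {w * f₁ ^ k * f₂ ^ l}) (hf₁ : ¬ IsUnit f₁) (hf₂ : ¬ IsUnit f₂)
    (hJ : IsUnit (h.jacLoc f₁ f₂)) {c : K} (hc : c * f₁ * f₂ ∈ locRing u P) :
    IsLogAt 2 (locRing u P) I (c • (dForm (u 0) * dForm (u 1))) := by
  have := h.isLocalRing_locRing (P := P)
  have := h.isNoetherianRing_locRing (P := P)
  have hf₁m := (IsLocalRing.mem_maximalIdeal _).2 hf₁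
  have hf₂m := (IsLocalRing.mem_maximalIdeal _).2 hf₂
  obtain ⟨j, hj⟩ := hJ.exists_left_inv
  have hjK : (j : K) * h.jac f₁ f₂ = 1 := congrArg (Subtype.val : locRing u P → K) hj
  have hf₁0 : (f₁ : K) ≠ 0 := by
    intro h0
    rw [h0] at hjK
    simp [IsChart.jac] at hjK
  have hf₂0 : (f₂ : K) ≠ 0 := by
    intro h0
    rw [h0] at hjK
    simp [IsChart.jac] at hjK
  rcases prime_plane_cases P with hbot | ⟨hht, g, -, hg⟩ | ⟨hht, a, ha⟩
  · have h1 := h.maximalIdeal_locRing (P := P) (e := 0) Fin.elim0 (by rw [hbot]; simp)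
    rw [h1] at hf₁m
    simp only [Set.range_eq_empty, Ideal.span_empty, Ideal.mem_bot] at hf₁m
    exact absurd (by rw [hf₁m]; rfl) hf₁0
  · have h1 := h.maximalIdeal_locRing (P := P) (e := 1) (fun _ => g) (by rw [hg]; simp)
    simp only [Set.range_const] at h1
    obtain ⟨x, hx⟩ := Ideal.mem_span_singleton.1 (h1 ▸ hf₁m)
    obtain ⟨y, hy⟩ := Ideal.mem_span_singleton.1 (h1 ▸ hf₂m)
    -- At a point of codimension one both functions would be multiples of the uniformizer,
    -- contradicting the invertible Jacobian; only closed points remain.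
    have h2 := h.jacLoc_mem_of_mul_mul ⟨aeval u g, aeval_mem_locRing _⟩ x y
    rw [← hx, ← hy, ← h1, IsLocalRing.mem_maximalIdeal] at h2
    exact absurd hJ h2
  · have hdim : ringKrullDim (locRing u P) = (2 : ℕ) := by
      rw [h.ringKrullDim_locRing, hht]; rfl
    have hdim' : ringKrullDim (locRing u P) = 2 := hdim
    have hmax := h.maximalIdeal_eq_of_jac ha hf₁m hf₂m hJ
    have hmax' : IsLocalRing.maximalIdeal (locRing u P) = Ideal.span {f₂, f₁} := by
      rw [hmax, Set.pair_comm]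
    have hp₁ := prime_of_maximalIdeal_eq_span_pair hdim' hmax
    have hp₂ := prime_of_maximalIdeal_eq_span_pair hdim' hmax'
    have hnd := not_dvd_of_maximalIdeal_eq_span_pair hdim' hmax'
    refine ⟨inferInstance, 2, 2, 0, le_rfl, ![f₁, f₂],
      ((⟨c * f₁ * f₂, hc⟩ * j : locRing u P) • 1), hdim, ?_, ?_, rfl,
      mem_exteriorPower_zero.2 ⟨_, rfl⟩, ?_⟩
    · rw [hmax]; simp [Set.pair_comm]
    · rw [hI, radical_span_pow_mul_pow hp₁ hp₂ hnd hw hk hl]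
      simp [Fin.prod_univ_two]
    · rw [formMap_smul, formMap_one]
      simp only [dlog, List.ofFn_succ, List.ofFn_zero, List.prod_cons, List.prod_nil]
      change _ = _ * ((f₁ : K)⁻¹ • dForm (f₁ : K) * ((f₂ : K)⁻¹ • dForm (f₂ : K) * 1))
      rw [mul_one, smul_mul_smul_comm, h.dForm_mul_dForm (f₁ : K) (f₂ : K), smul_smul,
        smul_mul_smul_comm, one_mul]
      congr 1
      change c = (c * f₁ * f₂ * j) * _
      field_simp
      linear_combination (-c) * hjK

end Plane

end LogCriteria

/-! ### Dehomogenization -/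

section Varieties

theorem aeval_mul_of_isHomogeneous {σ k R : Type} [CommRing k] [CommRing R] [Algebra k R] {e : ℕ}
    {a : MvPolynomial σ k} (ha : a.IsHomogeneous e) (c : σ → R) (d : R) :
    aeval (fun i => c i * d) a = aeval c a * d ^ e := by
  rw [aeval_def, aeval_def, eval₂_eq, eval₂_eq, Finset.sum_mul]
  refine Finset.sum_congr rfl fun s hs => ?_
  rw [mul_assoc]
  congr 1
  simp only [mul_pow]
  rw [Finset.prod_mul_distrib, Finset.prod_pow_eq_pow_sum]
  congr 2
  have := ha.degree_eq_sum_deg_support hs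
  rw [this]

variable {n : ℕ}

theorem Variety.eq_of_ideal_eq {X Y : Variety n} (h : X.ideal = Y.ideal) : X = Y :=
  ProjectiveSpectrum.ext (HomogeneousIdeal.ext h)

theorem Variety.homogeneousComponent_mem (X : Variety n) {a : CoordRing n} (ha : a ∈ X.ideal)
    (e : ℕ) : homogeneousComponent e a ∈ X.ideal :=
  homogeneousComponent_mem_of_mem X.asHomogeneousIdeal.isHomogeneous ha e

theorem Variety.ideal_le_of_homogeneous (X : Variety n) {J : Ideal (CoordRing n)}
    (h : ∀ (e : ℕ) (a : CoordRing n), a.IsHomogeneous e → a ∈ X.ideal → a ∈ J) : X.ideal ≤ J := by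
  intro a ha
  rw [← sum_homogeneousComponent a]
  exact J.sum_mem fun e _ =>
    h e _ (homogeneousComponent_isHomogeneous e a) (X.homogeneousComponent_mem ha e)

/-- A polynomial without constant term lies in the ideal of the variables, so an ideal containing
all variables contains the irrelevant ideal. -/
theorem Variety.exists_X_notMem (X : Variety n) : ∃ i, (MvPolynomial.X i : CoordRing n) ∉ X.ideal := by
  by_contra! hcon
  apply X.not_irrelevant_le
  intro a ha
  have h0 : constantCoeff a = 0 := by
    rw [HomogeneousIdeal.mem_irrelevant_iff, GradedRing.proj_apply] at ha
    have h1 : homogeneousComponent 0 a = 0 := by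
      rw [← ha]
      exact (MvPolynomial.decomposition.decompose'_apply a 0).symm
    rw [homogeneousComponent_zero] at h1
    simpa [constantCoeff_eq] using h1
  have h1 : a ∈ Ideal.span (Set.range (MvPolynomial.X : Fin (n + 1) → CoordRing n)) := by
    have h2 := span_X_sub_C_eq (0 : Fin (n + 1) → ℂ)
    simp only [Pi.zero_apply, map_zero, sub_zero] at h2
    rw [h2, RingHom.mem_ker]
    have h3 : eval (0 : Fin (n + 1) → ℂ) a = constantCoeff a := DFunLike.congr_fun eval_zero a
    rw [h3, h0]
  exact (Ideal.span_le.2 (by rintro _ ⟨i, rfl⟩; exact hcon i)) h1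

/-- The `i`-th coordinate function of the chart `X_j ≠ 0`. -/
def affCoord (X : Variety n) (j i : Fin (n + 1)) : FunctionField X := coordFn X i j

/-- The function `a / X_j ^ deg a` for a homogeneous polynomial `a`. -/
def dehom (X : Variety n) (j : Fin (n + 1)) : CoordRing n →ₐ[ℂ] FunctionField X :=
  aeval (affCoord X j)

/-- The map from polynomials to the fraction field of the coordinate ring. -/
def coneMap (X : Variety n) : CoordRing n →ₐ[ℂ] ConeField X :=
  (IsScalarTower.toAlgHom ℂ (CoordRing n ⧸ X.ideal) (ConeField X)).comp
    (Ideal.Quotient.mkₐ ℂ X.ideal)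

theorem ratio_eq (X : Variety n) (a b : CoordRing n) :
    ratio X a b = coneMap X a / coneMap X b := rfl

theorem coneMap_eq_zero_iff (X : Variety n) {a : CoordRing n} :
    coneMap X a = 0 ↔ a ∈ X.ideal := by
  constructor
  · intro h
    by_contra ha
    exact coneMap_ne_zero X ha h
  · intro h
    change algebraMap _ (ConeField X) (Ideal.Quotient.mk X.ideal a) = 0
    rw [Ideal.Quotient.eq_zero_iff_mem.2 h, map_zero]

theorem coe_dehom (X : Variety n) {j : Fin (n + 1)} {e : ℕ} {a : CoordRing n}
    (ha : a.IsHomogeneous e) :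
    ((dehom X j a : FunctionField X) : ConeField X) =
      coneMap X a / coneMap X (MvPolynomial.X j) ^ e := by
  have h1 : ((dehom X j a : FunctionField X) : ConeField X) =
      aeval (fun i => coneMap X (MvPolynomial.X i) * (coneMap X (MvPolynomial.X j))⁻¹) a := by
    change (FunctionField X).val (aeval (affCoord X j) a) = _
    rw [← AlgHom.comp_apply, comp_aeval]
    rfl
  rw [h1, aeval_mul_of_isHomogeneous ha, inv_pow, ← div_eq_mul_inv]
  congr 1
  rw [← comp_aeval_apply, aeval_X_left_apply]

theorem dehom_eq_zero_iff (X : Variety n) {j : Fin (n + 1)}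
    (hj : (MvPolynomial.X j : CoordRing n) ∉ X.ideal) {e : ℕ} {a : CoordRing n}
    (ha : a.IsHomogeneous e) : dehom X j a = 0 ↔ a ∈ X.ideal := by
  have h1 : coneMap X (MvPolynomial.X j) ≠ 0 := fun h => hj ((coneMap_eq_zero_iff X).1 h)
  rw [← coneMap_eq_zero_iff, ← ZeroMemClass.coe_eq_zero, coe_dehom X ha, div_eq_zero_iff]
  simp [h1]

theorem dehom_X_self (X : Variety n) {j : Fin (n + 1)}
    (hj : (MvPolynomial.X j : CoordRing n) ∉ X.ideal) : dehom X j (MvPolynomial.X j) = 1 := by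
  have h1 : coneMap X (MvPolynomial.X j) ≠ 0 := fun h => hj ((coneMap_eq_zero_iff X).1 h)
  apply Subtype.ext
  rw [coe_dehom X (isHomogeneous_X ℂ j), pow_one, div_self h1]
  rfl

theorem dehom_X (X : Variety n) (j i : Fin (n + 1)) :
    dehom X j (MvPolynomial.X i) = affCoord X j i := aeval_X _ _

/-- Homogeneous fractions in terms of affine coordinates. -/
theorem coe_eq_ratio_iff (X : Variety n) {j : Fin (n + 1)}
    (hj : (MvPolynomial.X j : CoordRing n) ∉ X.ideal) {e : ℕ} {a b : CoordRing n}
    (ha : a.IsHomogeneous e) (hb : b.IsHomogeneous e) (x : FunctionField X) :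
    (x : ConeField X) = ratio X a b ↔ x = dehom X j a / dehom X j b := by
  have h1 : coneMap X (MvPolynomial.X j) ≠ 0 := fun h => hj ((coneMap_eq_zero_iff X).1 h)
  have : ((dehom X j a / dehom X j b : FunctionField X) : ConeField X) = ratio X a b := by
    rw [IntermediateField.coe_div, coe_dehom X ha, coe_dehom X hb, ratio_eq,
      div_div_div_cancel_right₀ (pow_ne_zero _ h1)]
  rw [← this]
  exact Subtype.ext_iff.symm

theorem exists_eq_dehom_div (X : Variety n) {j : Fin (n + 1)}
    (hj : (MvPolynomial.X j : CoordRing n) ∉ X.ideal) (x : FunctionField X) :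
    ∃ (e : ℕ) (a b : CoordRing n), a.IsHomogeneous e ∧ b.IsHomogeneous e ∧ b ∉ X.ideal ∧
      x = dehom X j a / dehom X j b := by
  obtain ⟨e, a, b, ha, hb, hbX, h⟩ := x.2
  exact ⟨e, a, b, ha, hb, hbX, (coe_eq_ratio_iff X hj ha hb x).1 h⟩

theorem adjoin_affCoord (X : Variety n) {j : Fin (n + 1)}
    (hj : (MvPolynomial.X j : CoordRing n) ∉ X.ideal) :
    IntermediateField.adjoin ℂ (Set.range (affCoord X j)) = ⊤ := by
  rw [eq_top_iff]
  intro x _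
  obtain ⟨e, a, b, -, -, -, rfl⟩ := exists_eq_dehom_div X hj x
  exact (IntermediateField.mem_adjoin_range_iff ℂ _ _).2 ⟨a, b, rfl⟩

theorem affCoord_ne_zero (X : Variety n) {j i : Fin (n + 1)}
    (hj : (MvPolynomial.X j : CoordRing n) ∉ X.ideal)
    (hi : (MvPolynomial.X i : CoordRing n) ∉ X.ideal) : affCoord X j i ≠ 0 := by
  rw [← dehom_X, ne_eq, dehom_eq_zero_iff X hj (isHomogeneous_X ℂ i)]
  exact hi

theorem affCoord_eq_div (X : Variety n) {j k : Fin (n + 1)}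
    (hj : (MvPolynomial.X j : CoordRing n) ∉ X.ideal)
    (i : Fin (n + 1)) : affCoord X k i = affCoord X j i / affCoord X j k := by
  rw [← dehom_X X j, ← dehom_X X j, ← coe_eq_ratio_iff X hj (isHomogeneous_X ℂ i)
    (isHomogeneous_X ℂ k)]
  rfl

/-! ### Local rings of subvarieties -/

theorem mem_localRing_iff {X D : Variety n} {j : Fin (n + 1)}
    (hj : (MvPolynomial.X j : CoordRing n) ∉ X.ideal) {x : FunctionField X} :
    x ∈ localRing X D ↔ ∃ (e : ℕ) (a b : CoordRing n), a.IsHomogeneous e ∧ b.IsHomogeneous e ∧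
      b ∉ D.ideal ∧ x = dehom X j a / dehom X j b := by
  constructor
  · rintro ⟨e, a, b, ha, hb, hbD, h⟩
    exact ⟨e, a, b, ha, hb, hbD, (coe_eq_ratio_iff X hj ha hb x).1 h⟩
  · rintro ⟨e, a, b, ha, hb, hbD, h⟩
    exact ⟨e, a, b, ha, hb, hbD, (coe_eq_ratio_iff X hj ha hb x).2 h⟩

theorem affCoord_mem_localRing {X D : Variety n} {j : Fin (n + 1)}
    (hjD : (MvPolynomial.X j : CoordRing n) ∉ D.ideal) (i : Fin (n + 1)) :
    affCoord X j i ∈ localRing X D :=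
  ⟨1, MvPolynomial.X i, MvPolynomial.X j, isHomogeneous_X ℂ i, isHomogeneous_X ℂ j, hjD, rfl⟩

theorem div_dehom_mem_localRing {X D : Variety n} {j : Fin (n + 1)}
    (hj : (MvPolynomial.X j : CoordRing n) ∉ X.ideal) {e : ℕ} {a b : CoordRing n}
    (ha : a.IsHomogeneous e) (hb : b.IsHomogeneous e) (hbD : b ∉ D.ideal) :
    dehom X j a / dehom X j b ∈ localRing X D :=
  (mem_localRing_iff hj).2 ⟨e, a, b, ha, hb, hbD, rfl⟩

theorem inv_dehom_mem_localRing {X D : Variety n} {j : Fin (n + 1)}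
    (hj : (MvPolynomial.X j : CoordRing n) ∉ X.ideal) {e : ℕ} {a : CoordRing n}
    (ha : a.IsHomogeneous e) (haD : a ∉ D.ideal) : (dehom X j a)⁻¹ ∈ localRing X D := by
  have := div_dehom_mem_localRing (D := D) hj ((isHomogeneous_X ℂ j).pow e)
    (by simpa using ha) haD
  rwa [map_pow, dehom_X_self X hj, one_pow, one_div] at this

/-- A fraction whose numerator vanishes on `D` is not a unit of the local ring at `D`. -/
theorem inv_notMem_of_mem {X D : Variety n} (hXD : X.ideal ≤ D.ideal)
    {V : Subalgebra ℂ (FunctionField X)} (hV : Dominates V (localRing X D)) {j : Fin (n + 1)}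
    (hj : (MvPolynomial.X j : CoordRing n) ∉ X.ideal) {e : ℕ} {a b : CoordRing n}
    (ha : a.IsHomogeneous e) (hb : b.IsHomogeneous e) (haD : a ∈ D.ideal) (hbD : b ∉ D.ideal) :
    dehom X j a / dehom X j b = 0 ∨ (dehom X j a / dehom X j b)⁻¹ ∉ V := by
  by_contra! hcon
  obtain ⟨h0, hmem⟩ := hcon
  obtain ⟨d, p, q, hp, hq, hqD, h⟩ := (mem_localRing_iff hj).1
    (hV.2 _ (div_dehom_mem_localRing hj ha hb hbD) hmem)
  have hq0 : dehom X j q ≠ 0 := fun h => hqD (hXD ((dehom_eq_zero_iff X hj hq).1 h))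
  have ha0 := left_ne_zero_of_mul (div_eq_mul_inv _ (dehom X j b) ▸ h0)
  rw [inv_div, div_eq_div_iff ha0 hq0, ← map_mul, ← map_mul, ← sub_eq_zero, ← map_sub,
    dehom_eq_zero_iff X hj ((hb.mul hq).sub (Nat.add_comm d e ▸ hp.mul ha))] at h
  -- The equality b/a = p/q of fractions means b·q - p·a ∈ I(X), and a vanishes on D.
  have h1 : b * q ∈ D.ideal := by
    have := D.ideal.add_mem (hXD h) (D.ideal.mul_mem_left p haD)
    rwa [sub_add_cancel] at this
  exact (D.isPrime.mem_or_mem h1).elim hbD hqD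

/-- Separatedness: a ring has at most one center. -/
theorem center_le {X Q D : Variety n} (hXQ : X.ideal ≤ Q.ideal) (hXD : X.ideal ≤ D.ideal)
    {V : Subalgebra ℂ (FunctionField X)} (hQ : Dominates V (localRing X Q))
    (hD : Dominates V (localRing X D)) : Q.ideal ≤ D.ideal := by
  refine Q.ideal_le_of_homogeneous fun e a ha haQ => ?_
  by_contra haD
  obtain ⟨k, hk⟩ := Q.exists_X_notMem
  obtain ⟨i, hi⟩ := D.exists_X_notMem
  have hkX : (MvPolynomial.X k : CoordRing n) ∉ X.ideal := fun h => hk (hXQ h)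
  have hiX : (MvPolynomial.X i : CoordRing n) ∉ X.ideal := fun h => hi (hXD h)
  have haX : a ∉ X.ideal := fun h => haD (hXD h)
  have h1 := inv_notMem_of_mem hXQ hQ hkX ha (by simpa using (isHomogeneous_X ℂ k).pow e) haQ
    (fun h => hk (Q.isPrime.mem_of_pow_mem _ h))
  rw [map_pow, dehom_X_self X hkX, one_pow, div_one] at h1
  rcases h1 with h1 | h1
  · exact haX ((dehom_eq_zero_iff X hkX ha).1 h1)
  · apply h1
    -- Both factors, X_i^e/a and (X_k/X_i)^e, are regular at D because a and X_i do not vanish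
    -- there; so a/X_k^e would be a unit of V although a vanishes on Q.
    have h2 : (dehom X k a)⁻¹ =
        (dehom X k (MvPolynomial.X i ^ e) / dehom X k a) * affCoord X i k ^ e := by
      rw [affCoord_eq_div X hkX, ← dehom_X, ← dehom_X, dehom_X_self X hkX, map_pow]
      have := affCoord_ne_zero X hkX hiX
      rw [← dehom_X] at this
      have := mt (dehom_eq_zero_iff X hkX ha).1 haX
      field_simp
      rw [one_div, inv_pow, mul_inv_cancel₀ (pow_ne_zero _ ‹_›)]
    rw [h2]
    exact mul_mem (hD.1 (div_dehom_mem_localRing hkX (by simpa using (isHomogeneous_X ℂ i).pow e)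
      ha haD)) (pow_mem (hD.1 (affCoord_mem_localRing hi k)) e)

theorem center_unique {X Q D : Variety n} (hXQ : X.ideal ≤ Q.ideal) (hXD : X.ideal ≤ D.ideal)
    {V : Subalgebra ℂ (FunctionField X)} (hQ : Dominates V (localRing X Q))
    (hD : Dominates V (localRing X D)) : Q = D :=
  Variety.eq_of_ideal_eq (le_antisymm (center_le hXQ hXD hQ hD) (center_le hXD hXQ hD hQ))

/-- The Zariski closure of the image of a point of an affine scheme. -/
theorem exists_variety_of_prime {R : Type} [CommRing R] [Algebra ℂ R] (𝔪 : Ideal R) [𝔪.IsPrime]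
    (c : Fin (n + 1) → R) {j : Fin (n + 1)} (hj : c j ∉ 𝔪) :
    ∃ Q : Variety n, ∀ (e : ℕ) (a : CoordRing n), a.IsHomogeneous e →
      (a ∈ Q.ideal ↔ aeval c a ∈ 𝔪) := by
  -- The extra variable T records the degree: a homogeneous polynomial of degree e goes to its value
  -- at c times T^e. The preimage of the prime 𝔪[T] is therefore a homogeneous prime, determined by
  -- the values at c.
  let Φ : CoordRing n →ₐ[ℂ] Polynomial R :=
    aeval fun i => Polynomial.C (c i) * Polynomial.X
  have hΦ : ∀ (e : ℕ) (a : CoordRing n), a.IsHomogeneous e →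
      Φ a = Polynomial.monomial e (aeval c a) := by
    intro e a ha
    change aeval (fun i => Polynomial.C (c i) * Polynomial.X) a = _
    rw [aeval_mul_of_isHomogeneous ha, ← Polynomial.C_mul_X_pow_eq_monomial]
    congr 1
    exact (comp_aeval_apply c (Polynomial.CAlgHom (R := ℂ) (A := R)) a).symm
  let J : Ideal (CoordRing n) :=
    ((𝔪).map (Polynomial.C : R →+* Polynomial R)).comap Φ
  have hJmem : ∀ (e : ℕ) (a : CoordRing n), a.IsHomogeneous e →
      (a ∈ J ↔ aeval c a ∈ 𝔪) := by
    intro e a ha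
    rw [Ideal.mem_comap, hΦ e a ha, Ideal.mem_map_C_iff]
    constructor
    · intro h
      simpa using h e
    · intro h k
      rw [Polynomial.coeff_monomial]
      split_ifs
      exacts [h, zero_mem _]
  have hJcomp : ∀ (e : ℕ) (a : CoordRing n), a ∈ J → homogeneousComponent e a ∈ J := by
    intro e a ha
    rw [hJmem e _ (homogeneousComponent_isHomogeneous e a)]
    rw [Ideal.mem_comap, Ideal.mem_map_C_iff] at ha
    have h1 := ha e
    rw [← sum_homogeneousComponent a, map_sum, Polynomial.finsetSum_coeff] at h1
    simp only [hΦ _ _ (homogeneousComponent_isHomogeneous _ a), Polynomial.coeff_monomial] at h1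
    by_cases hdeg : e < a.totalDegree + 1
    · rwa [Finset.sum_ite_eq' , if_pos (Finset.mem_range.2 hdeg)] at h1
    · rw [homogeneousComponent_eq_zero _ _ (by omega), map_zero]
      exact zero_mem _
  have hprime : J.IsPrime := by
    have := Ideal.isPrime_map_C_of_isPrime (P := 𝔪)
    exact Ideal.comap_isPrime _ _
  have hXj : (MvPolynomial.X j : CoordRing n) ∉ J := by
    rw [hJmem 1 _ (isHomogeneous_X ℂ j), aeval_X]
    exact hj
  let Q : Variety n :=
    { asHomogeneousIdeal := ⟨J, fun e a ha => by
        rw [show (DirectSum.decompose (homogeneousSubmodule (Fin (n + 1)) ℂ) a e : CoordRing n) =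
          homogeneousComponent e a from MvPolynomial.decomposition.decompose'_apply a e]
        exact hJcomp e a ha⟩
      isPrime := hprime
      not_irrelevant_le := fun h => hXj (h (by
        rw [HomogeneousIdeal.mem_irrelevant_iff, GradedRing.proj_apply,
          DirectSum.decompose_of_mem_ne _
            ((mem_homogeneousSubmodule 1 _).2 (isHomogeneous_X ℂ j)) one_ne_zero])) }
  exact ⟨Q, hJmem⟩

/-- A local ring containing the coordinate functions of a chart has a center on that chart. -/
theorem exists_center (X : Variety n) {j : Fin (n + 1)}
    (hj : (MvPolynomial.X j : CoordRing n) ∉ X.ideal) (O : Subalgebra ℂ (FunctionField X))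
    [IsLocalRing O] (hO : ∀ i, affCoord X j i ∈ O) :
    ∃ Q : Variety n, X.ideal ≤ Q.ideal ∧ Dominates O (localRing X Q) ∧
      (MvPolynomial.X j : CoordRing n) ∉ Q.ideal ∧
      ∀ (e : ℕ) (a : CoordRing n), a.IsHomogeneous e →
        (a ∈ Q.ideal ↔ dehom X j a = 0 ∨ (dehom X j a)⁻¹ ∉ O) := by
  let c : Fin (n + 1) → O := fun i => ⟨affCoord X j i, hO i⟩
  have hc : ∀ a : CoordRing n, ((aeval c a : O) : FunctionField X) = dehom X j a := by
    intro a
    change O.val (aeval c a) = _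
    rw [← AlgHom.comp_apply, comp_aeval]
    rfl
  have hcj : c j ∉ IsLocalRing.maximalIdeal O := by
    have : c j = 1 := Subtype.ext (by
      change affCoord X j j = 1
      rw [← dehom_X, dehom_X_self X hj])
    rw [this]
    exact fun h => (IsLocalRing.maximalIdeal.isMaximal O).ne_top ((Ideal.eq_top_iff_one _).2 h)
  obtain ⟨Q, hJmem⟩ := exists_variety_of_prime (IsLocalRing.maximalIdeal O) c hcj
  have hQ : ∀ (e : ℕ) (a : CoordRing n), a.IsHomogeneous e →
      (a ∈ Q.ideal ↔ dehom X j a = 0 ∨ (dehom X j a)⁻¹ ∉ O) := by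
    intro e a ha
    rw [hJmem e a ha, mem_maximalIdeal_iff, hc]
  refine ⟨Q, ?_, ⟨?_, ?_⟩, fun h => hcj ?_, hQ⟩
  on_goal 4 => simpa using (hJmem 1 _ (isHomogeneous_X ℂ j)).1 h
  · exact X.ideal_le_of_homogeneous fun e a ha haX =>
      (hQ e a ha).2 (Or.inl ((dehom_eq_zero_iff X hj ha).2 haX))
  · intro x hx
    obtain ⟨e, a, b, ha, hb, hbQ, rfl⟩ := (mem_localRing_iff hj).1 hx
    rw [hQ e b hb] at hbQ
    push Not at hbQ
    rw [div_eq_mul_inv]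
    exact mul_mem (hc a ▸ (aeval c a).2) hbQ.2
  · intro x hx hxO
    obtain ⟨e, a, b, ha, hb, hbQ, rfl⟩ := (mem_localRing_iff hj).1 hx
    by_cases haQ : a ∈ Q.ideal
    · have h1 := (hQ e a ha).1 haQ
      rw [hQ e b hb] at hbQ
      push Not at hbQ
      rcases h1 with h1 | h1
      · rw [h1, zero_div, inv_zero]
        exact (mem_localRing_iff hj).2 ⟨0, 0, 1, isHomogeneous_zero _ _ _, isHomogeneous_one _ _,
          fun h => Q.isPrime.ne_top ((Ideal.eq_top_iff_one _).2 h), by simp⟩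
      · exfalso
        apply h1
        have h2 : (dehom X j a)⁻¹ = (dehom X j a / dehom X j b)⁻¹ * (dehom X j b)⁻¹ := by
          have := hbQ.1
          by_cases h0 : dehom X j a = 0
          · simp [h0]
          · field_simp
        rw [h2]
        exact mul_mem hxO hbQ.2
    · rw [inv_div]
      exact div_dehom_mem_localRing hj hb ha haQ

/-! ### Ideals of closed subsets in local rings -/

theorem pullbackIdeal_eq_top {X Q : Variety n} (hXQ : X.ideal ≤ Q.ideal) {I : Ideal (CoordRing n)}
    {O : Subalgebra ℂ (FunctionField X)} {e : ℕ} {a : CoordRing n} (ha : a.IsHomogeneous e)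
    (haI : a ∈ I) (haQ : a ∉ Q.ideal) : pullbackIdeal X Q I O = ⊤ := by
  rw [Ideal.eq_top_iff_one]
  refine Ideal.subset_span ⟨e, a, a, ha, ha, haI, haQ, ?_⟩
  exact (div_self (coneMap_ne_zero X fun h => haQ (hXQ h))).symm

theorem dehom_mem {X Q : Variety n} {O : Subalgebra ℂ (FunctionField X)}
    (hO : Dominates O (localRing X Q)) {j : Fin (n + 1)}
    (hjQ : (MvPolynomial.X j : CoordRing n) ∉ Q.ideal) (a : CoordRing n) : dehom X j a ∈ O := by
  have : ∀ i, affCoord X j i ∈ O := fun i => hO.1 (affCoord_mem_localRing hjQ i)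
  have h1 : dehom X j a = O.val (aeval (fun i => (⟨affCoord X j i, this i⟩ : O)) a) := by
    rw [← AlgHom.comp_apply, comp_aeval]
    rfl
  rw [h1]
  exact Subtype.prop _

/-- Denominators that do not vanish on Q are units of O, so every generator of the pulled back ideal
is a multiple of F/X_j^e, which is itself a generator. -/
theorem pullbackIdeal_span_singleton {X Q : Variety n} (hXQ : X.ideal ≤ Q.ideal)
    {O : Subalgebra ℂ (FunctionField X)} (hO : Dominates O (localRing X Q)) {j : Fin (n + 1)}
    (hjQ : (MvPolynomial.X j : CoordRing n) ∉ Q.ideal) {e : ℕ} {F : CoordRing n}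
    (hF : F.IsHomogeneous e) :
    pullbackIdeal X Q (Ideal.span {F}) O = Ideal.span {⟨dehom X j F, dehom_mem hO hjQ F⟩} := by
  have hj : (MvPolynomial.X j : CoordRing n) ∉ X.ideal := fun h => hjQ (hXQ h)
  apply le_antisymm
  · rw [pullbackIdeal, Ideal.span_le]
    rintro x ⟨d, a, b, ha, hb, haI, hbQ, hx⟩
    rw [coe_eq_ratio_iff X hj ha hb] at hx
    obtain ⟨g, rfl⟩ := Ideal.mem_span_singleton.1 haI
    refine Ideal.mem_span_singleton.2 ⟨⟨dehom X j g, dehom_mem hO hjQ g⟩ *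
      ⟨(dehom X j b)⁻¹, hO.1 (inv_dehom_mem_localRing hj hb hbQ)⟩, Subtype.ext ?_⟩
    rw [hx, map_mul, div_eq_mul_inv, mul_assoc]
    rfl
  · rw [Ideal.span_singleton_le_iff_mem]
    refine Ideal.subset_span ⟨e, F, MvPolynomial.X j ^ e, hF, by
      simpa using (isHomogeneous_X ℂ j).pow e, Ideal.mem_span_singleton_self F,
      fun h => hjQ (Q.isPrime.mem_of_pow_mem _ h), ?_⟩
    rw [coe_eq_ratio_iff X hj hF (by simpa using (isHomogeneous_X ℂ j).pow e), map_pow,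
      dehom_X_self X hj, one_pow, div_one]

/-! ### Logarithmic forms are regular away from their poles -/

theorem formMap_mem_exteriorPower {A B : Type} [CommRing A] [CommRing B] [Algebra ℂ A]
    [Algebra ℂ B] (φ : A →ₐ[ℂ] B) {d : ℕ} {ω : Forms A} (hω : ω ∈ ⋀[A]^d (Ω[A⁄ℂ])) :
    formMap φ ω ∈ ⋀[B]^d (Ω[B⁄ℂ]) := by
  have h1 : ∀ x ∈ LinearMap.range (ExteriorAlgebra.ι A (M := Ω[A⁄ℂ])),
      formMap φ x ∈ LinearMap.range (ExteriorAlgebra.ι B (M := Ω[B⁄ℂ])) := by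
    rintro _ ⟨x, rfl⟩
    have hx : x ∈ Submodule.span A (Set.range (KaehlerDifferential.D ℂ A)) := by
      rw [KaehlerDifferential.span_range_derivation]; trivial
    induction hx using Submodule.span_induction with
    | mem x h => obtain ⟨f, rfl⟩ := h; exact ⟨_, (formMap_dForm φ f).symm⟩
    | zero => simp only [map_zero]; exact zero_mem _
    | add x y _ _ hx hy => simp only [map_add]; exact add_mem hx hy
    | smul a x _ hx => rw [map_smul, formMap_smul]; exact Submodule.smul_mem _ _ hx
  rw [ExteriorAlgebra.exteriorPower] at hω ⊢
  induction hω using Submodule.pow_induction_on_left' with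
  | algebraMap r =>
    rw [pow_zero, Algebra.algebraMap_eq_smul_one, formMap_smul, formMap_one,
      ← Algebra.algebraMap_eq_smul_one]
    exact Submodule.algebraMap_mem _
  | add x y i _ _ hx hy => rw [map_add]; exact add_mem hx hy
  | mem_mul m hm i x _ hx =>
    rw [map_mul, pow_succ']
    exact Submodule.mul_mem_mul (h1 m hm) hx

/-- When the divisor is empty, the product of its local equations is a unit, although each equation
lies in the maximal ideal. So there are no equations and no poles. -/
theorem IsLogAt.isRegularForm {K : Type} [Field K] [Algebra ℂ K] {d : ℕ} {O : Subalgebra ℂ K}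
    {ω : Forms K} (h : IsLogAt d O ⊤ ω) : IsRegularForm d O ω := by
  obtain ⟨hloc, e, r, s, hre, t, η, -, ht, hrad, hs, hη, rfl⟩ := h
  rcases r.eq_zero_or_pos with rfl | hr
  · exact ⟨η, by simpa [← hs] using hη, by simp⟩
  · exfalso
    rw [Ideal.radical_top, eq_comm, Ideal.span_singleton_eq_top] at hrad
    have h1 : IsUnit (t (Fin.castLE hre ⟨0, hr⟩)) :=
      isUnit_of_dvd_unit (Finset.dvd_prod_of_mem (fun i : Fin r => t (Fin.castLE hre i))
        (Finset.mem_univ (⟨0, hr⟩ : Fin r))) hrad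
    have h2 : t (Fin.castLE hre ⟨0, hr⟩) ∈ IsLocalRing.maximalIdeal O := by
      rw [← ht]; exact Ideal.subset_span ⟨_, rfl⟩
    exact (IsLocalRing.mem_maximalIdeal _).1 h2 h1

theorem IsRegularForm.mono {K : Type} [Field K] [Algebra ℂ K] {d : ℕ} {O V : Subalgebra ℂ K}
    (hOV : O ≤ V) {ω : Forms K} (h : IsRegularForm d O ω) : IsRegularForm d V ω := by
  obtain ⟨η, hη, rfl⟩ := h
  refine ⟨formMap (Subalgebra.inclusion hOV) η, formMap_mem_exteriorPower _ hη, ?_⟩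
  rw [formMap_comp]
  rfl

/-- By completeness V dominates a local ring O of the resolution, and by separatedness O lies over
the same center D as V. If D is not contained in the closed set, the pulled back ideal is the unit
ideal at O, so the form is regular at O and hence at V. -/
theorem IsLogarithmic.isRegularForm {d : ℕ} {X : Variety n} {I : Ideal (CoordRing n)}
    {ω : Forms (FunctionField X)} (h : IsLogarithmic d X I ω) {V : Subalgebra ℂ (FunctionField X)}
    (hV : IsValuationRingOf V) {D : Variety n} (hXD : X.ideal ≤ D.ideal)
    (hD : Dominates V (localRing X D)) {e : ℕ} {a : CoordRing n} (ha : a.IsHomogeneous e)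
    (haI : a ∈ I) (haD : a ∉ D.ideal) : IsRegularForm d V ω := by
  obtain ⟨-, M, hM, hlog⟩ := h
  obtain ⟨O, ⟨hOM, hVO⟩, -⟩ := hM.valuative V hV
  obtain ⟨Q, hXQ, hOQ, hO⟩ := hlog O hOM
  have hVQ : Dominates V (localRing X Q) :=
    ⟨hOQ.1.trans hVO.1, fun x hx hxV => hOQ.2 x hx (hVO.2 x (hOQ.1 hx) hxV)⟩
  rw [center_unique hXQ hXD hVQ hD] at hO
  rw [pullbackIdeal_eq_top hXD ha haI haD] at hO
  exact hO.isRegularForm.mono hVO.1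

/-! ### Restriction of functions to a subvariety -/

theorem eq_of_dominates {K : Type} [Field K] [Algebra ℂ K] {V W : Subalgebra ℂ K}
    (hW : IsValuationRingOf W) (h : Dominates V (W : Set K)) : V = W := by
  refine le_antisymm (fun x hx => ?_) h.1
  rcases hW x with h1 | h1
  · exact h1
  · have := h.2 _ h1 (by rwa [inv_inv])
    rwa [inv_inv] at this

theorem residueMap_eq_zero_iff {K : Type} [Field K] [Algebra ℂ K] {V : Subalgebra ℂ K}
    [IsLocalRing V] (x : V) : residueMap V x = 0 ↔ (x : K) = 0 ∨ (x : K)⁻¹ ∉ V := by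
  rw [← mem_maximalIdeal_iff]
  exact IsLocalRing.residue_eq_zero_iff x

/-- A field whose elements are homogeneous fractions maps to any field in which the same
homogeneous polynomials vanish. -/
theorem exists_algHom_of_homogeneous {K κ : Type} [Field K] [Field κ] [Algebra ℂ K] [Algebra ℂ κ]
    (f : CoordRing n →ₐ[ℂ] K) (h : CoordRing n →ₐ[ℂ] κ)
    (hfh : ∀ (e : ℕ) (a : CoordRing n), a.IsHomogeneous e → (f a = 0 ↔ h a = 0))
    (hf : ∀ y : K, ∃ (e : ℕ) (a b : CoordRing n), a.IsHomogeneous e ∧ b.IsHomogeneous e ∧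
      f b ≠ 0 ∧ y = f a / f b) :
    ∃ j : K →ₐ[ℂ] κ, ∀ (e : ℕ) (a b : CoordRing n), a.IsHomogeneous e → b.IsHomogeneous e →
      f b ≠ 0 → j (f a / f b) = h a / h b := by
  choose deg num den hnum hden hden0 heq using hf
  have hh0 : ∀ {e : ℕ} {b : CoordRing n}, b.IsHomogeneous e → f b ≠ 0 → h b ≠ 0 :=
    fun hb hb0 => mt (hfh _ _ hb).2 hb0
  -- The map is defined through a chosen representation as a fraction. Two representations differ by
  -- a homogeneous relation, which holds in K exactly when it holds in κ, so the choice is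
  -- immaterial.
  have key : ∀ {e : ℕ} {a b : CoordRing n} {y : K}, a.IsHomogeneous e → b.IsHomogeneous e →
      f b ≠ 0 → y = f a / f b → h (num y) / h (den y) = h a / h b := by
    intro e a b y ha hb hb0 hy
    have hhom := ((hnum y).mul hb).sub (Nat.add_comm e (deg y) ▸ ha.mul (hden y))
    rw [heq y, div_eq_div_iff (hden0 y) hb0, ← map_mul, ← map_mul, ← sub_eq_zero, ← map_sub,
      hfh _ _ hhom, map_sub, map_mul, map_mul, sub_eq_zero] at hy
    exact (div_eq_div_iff (hh0 (hden y) (hden0 y)) (hh0 hb hb0)).2 hy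
  have hc : ∀ c : ℂ, h (num (algebraMap ℂ K c)) / h (den (algebraMap ℂ K c)) =
      algebraMap ℂ κ c := by
    intro c
    rw [key (isHomogeneous_C _ c) (isHomogeneous_one _ _) (by rw [map_one]; exact one_ne_zero)
      (by rw [map_one, div_one, ← algebraMap_eq, AlgHom.commutes]), map_one, div_one,
      ← algebraMap_eq, AlgHom.commutes]
  refine ⟨{ toFun := fun y => h (num y) / h (den y)
            map_one' := by simpa using hc 1
            map_mul' := fun y z => ?_
            map_zero' := by simpa using hc 0
            map_add' := fun y z => ?_
            commutes' := hc }, fun e a b ha hb hb0 => key ha hb hb0 rfl⟩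
  · rw [key ((hnum y).mul (hnum z)) ((hden y).mul (hden z))
      (by rw [map_mul]; exact mul_ne_zero (hden0 y) (hden0 z)), map_mul, map_mul,
      div_mul_div_comm]
    rw [map_mul, map_mul, ← div_mul_div_comm, ← heq y, ← heq z]
  · change _ = h (num y) / h (den y) + h (num z) / h (den z)
    rw [key (((hnum y).mul (hden z)).add ((hden y).mul (hnum z))) ((hden y).mul (hden z))
      (by rw [map_mul]; exact mul_ne_zero (hden0 y) (hden0 z)),
      div_add_div _ _ (hh0 (hden y) (hden0 y)) (hh0 (hden z) (hden0 z)), map_add, map_mul,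
      map_mul, map_mul]
    rw [map_add, map_mul, map_mul, map_mul, ← div_add_div _ _ (hden0 y) (hden0 z), ← heq y,
      ← heq z]

/-- Domination means that a homogeneous polynomial vanishes in the residue field of V exactly when
it vanishes on D. -/
theorem exists_isRestriction {X D : Variety n} (hXD : X.ideal ≤ D.ideal) (V : Place X D) :
    ∃ j : FunctionField D →ₐ[ℂ] IsLocalRing.ResidueField V.1, IsRestriction V j := by
  obtain ⟨k, hkD⟩ := D.exists_X_notMem
  have hk : (MvPolynomial.X k : CoordRing n) ∉ X.ideal := fun h => hkD (hXD h)
  let g : CoordRing n →ₐ[ℂ] V.1 :=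
    aeval fun i => ⟨affCoord X k i, V.2.2.1 (affCoord_mem_localRing hkD i)⟩
  have hg : ∀ a : CoordRing n, ((g a : V.1) : FunctionField X) = dehom X k a := by
    intro a
    change V.1.val (aeval _ a) = _
    rw [← AlgHom.comp_apply, comp_aeval]
    rfl
  have hXk : ∀ e, (MvPolynomial.X k ^ e : CoordRing n) ∉ D.ideal :=
    fun e h => hkD (D.isPrime.mem_of_pow_mem _ h)
  have hiff : ∀ (e : ℕ) (a : CoordRing n), a.IsHomogeneous e →
      (residueMap V.1 (g a) = 0 ↔ a ∈ D.ideal) := by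
    intro e a ha
    rw [residueMap_eq_zero_iff, hg]
    constructor
    · contrapose!
      intro haD
      exact ⟨fun h => haD (hXD ((dehom_eq_zero_iff X hk ha).1 h)),
        V.2.2.1 (inv_dehom_mem_localRing hk ha haD)⟩
    · intro haD
      have := inv_notMem_of_mem hXD V.2.2 hk ha (by simpa using (isHomogeneous_X ℂ k).pow e) haD
        (hXk e)
      rwa [map_pow, dehom_X_self X hk, one_pow, div_one] at this
  obtain ⟨j, hj⟩ := exists_algHom_of_homogeneous (dehom D k) ((residueMap V.1).comp g)
    (fun e a ha => (dehom_eq_zero_iff D hkD ha).trans (hiff e a ha).symm)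
    (fun y => by
      obtain ⟨e, a, b, ha, hb, hbD, h⟩ := exists_eq_dehom_div D hkD y
      exact ⟨e, a, b, ha, hb, mt (dehom_eq_zero_iff D hkD hb).1 hbD, h⟩)
  refine ⟨j, fun e a b ha hb hbD x y hx hy => ?_⟩
  rw [coe_eq_ratio_iff X hk ha hb] at hx
  rw [coe_eq_ratio_iff D hkD ha hb] at hy
  have hb0 : residueMap V.1 (g b) ≠ 0 := mt (hiff e b hb).1 hbD
  have hx' : x * g b = g a := by
    apply Subtype.ext
    have : dehom X k b ≠ 0 := fun h => hbD (hXD ((dehom_eq_zero_iff X hk hb).1 h))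
    rw [MulMemClass.coe_mul, hg, hg, hx, div_mul_cancel₀ _ this]
  rw [hy, hj e a b ha hb (mt (dehom_eq_zero_iff D hkD hb).1 hbD)]
  exact (div_eq_iff hb0).2 ((congrArg (residueMap V.1) hx').symm.trans (map_mul _ _ _))

theorem IsRestriction.surjective {X D : Variety n} {V : Place X D}
    {j : FunctionField D →ₐ[ℂ] IsLocalRing.ResidueField V.1} (hj : IsRestriction V j)
    (hV : (V.1 : Set (FunctionField X)) ⊆ localRing X D) : Function.Surjective j := by
  intro z
  obtain ⟨x, rfl⟩ := IsLocalRing.residue_surjective z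
  obtain ⟨e, a, b, ha, hb, hbD, hx⟩ := hV x.2
  exact ⟨⟨ratio D a b, ⟨e, a, b, ha, hb, hbD, rfl⟩⟩, hj e a b ha hb hbD x _ hx rfl⟩

end Varieties

/-! ### Regularity and residues in terms of a local equation -/

section Residues

variable {K : Type} [Field K] [Algebra ℂ K] {V : Subalgebra ℂ K}

theorem formMap_val_smul_one (a : V) : formMap V.val (a • 1) = (a : K) • 1 := by
  rw [formMap_smul, formMap_one]; rfl

theorem formMap_val_smul_dForm (a f : V) :
    formMap V.val (a • dForm f) = (a : K) • dForm (f : K) := by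
  rw [formMap_smul, formMap_dForm]; rfl

theorem formMap_val_smul_dForm_mul (a f g : V) :
    formMap V.val (a • (dForm f * dForm g)) = (a : K) • (dForm (f : K) * dForm (g : K)) := by
  rw [formMap_smul_dForm_mul]; rfl

/-- A surface chart has as coordinates near a point any two functions with invertible Jacobian. -/
theorem span_D_pair_of_isUnit {u₀ u₁ f s : V}
    (hu : Submodule.span V {KaehlerDifferential.D ℂ V u₀, KaehlerDifferential.D ℂ V u₁} = ⊤)
    (hinj : ∀ c d : K, c • (dForm (u₀ : K) * dForm (u₁ : K)) =
      d • (dForm (u₀ : K) * dForm (u₁ : K)) → c = d)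
    {J : V} (hJ : IsUnit J)
    (hfs : dForm (f : K) * dForm (s : K) = (J : K) • (dForm (u₀ : K) * dForm (u₁ : K))) :
    Submodule.span V {KaehlerDifferential.D ℂ V f, KaehlerDifferential.D ℂ V s} = ⊤ := by
  have hex : ∀ g : V, ∃ a b : V, a • KaehlerDifferential.D ℂ V u₀ + b • KaehlerDifferential.D ℂ V u₁
      = KaehlerDifferential.D ℂ V g := fun g => by
    rw [← Submodule.mem_span_pair, hu]; trivial
  obtain ⟨a, b, hf⟩ := hex f
  obtain ⟨a', b', hs⟩ := hex s
  have hd : ∀ {g p q : V}, p • KaehlerDifferential.D ℂ V u₀ + q • KaehlerDifferential.D ℂ V u₁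
      = KaehlerDifferential.D ℂ V g →
      dForm (g : K) = (p : K) • dForm (u₀ : K) + (q : K) • dForm (u₁ : K) := by
    intro g p q h
    have h1 : dForm g = p • dForm u₀ + q • dForm u₁ := by
      simp only [dForm]
      rw [← h, map_add, map_smul, map_smul]
    have h2 := congrArg (formMap V.val) h1
    rwa [map_add, formMap_val_smul_dForm, formMap_val_smul_dForm, formMap_dForm] at h2
  have hJ' : J = a * b' - a' * b := by
    apply Subtype.ext
    apply hinj
    rw [← hfs, hd hf, hd hs]
    simp only [add_mul, mul_add, smul_mul_assoc, mul_smul_comm, dForm_mul_self,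
      dForm_mul_comm (u₁ : K) (u₀ : K), AddSubgroupClass.coe_sub, MulMemClass.coe_mul]
    module
  -- J is the determinant of the matrix expressing df, ds through du₀, du₁, and Cramer's rule
  -- inverts this matrix.
  obtain ⟨w, hw⟩ := hJ.exists_left_inv
  have h0 : KaehlerDifferential.D ℂ V u₀ = (w * b') • KaehlerDifferential.D ℂ V f
      + (-(w * b)) • KaehlerDifferential.D ℂ V s := by
    have : KaehlerDifferential.D ℂ V u₀ = (w * J) • KaehlerDifferential.D ℂ V u₀ := by
      rw [hw, one_smul]
    rw [this, hJ', ← hf, ← hs]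
    module
  have h1 : KaehlerDifferential.D ℂ V u₁ = (-(w * a')) • KaehlerDifferential.D ℂ V f
      + (w * a) • KaehlerDifferential.D ℂ V s := by
    have : KaehlerDifferential.D ℂ V u₁ = (w * J) • KaehlerDifferential.D ℂ V u₁ := by
      rw [hw, one_smul]
    rw [this, hJ', ← hf, ← hs]
    module
  rw [eq_top_iff, ← hu, Submodule.span_le]
  rintro _ (rfl | rfl)
  · exact Submodule.mem_span_pair.2 ⟨_, _, h0.symm⟩
  · exact Submodule.mem_span_pair.2 ⟨_, _, h1.symm⟩

theorem isRegularForm_two_iff {f s : V}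
    (h : Submodule.span V {KaehlerDifferential.D ℂ V f, KaehlerDifferential.D ℂ V s} = ⊤)
    (hinj : ∀ c d : K, c • (dForm (f : K) * dForm (s : K)) =
      d • (dForm (f : K) * dForm (s : K)) → c = d) (g : K) :
    IsRegularForm 2 V (g • (dForm (f : K) * dForm (s : K))) ↔ g ∈ V := by
  constructor
  · rintro ⟨η, hη, hg⟩
    obtain ⟨c, rfl⟩ := mem_exteriorPower_two_pair h hη
    rw [formMap_val_smul_dForm_mul] at hg
    rw [← hinj _ _ hg]
    exact c.2
  · intro hg
    exact ⟨(⟨g, hg⟩ : V) • (dForm f * dForm s),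
      Submodule.smul_mem _ _ (dForm_mul_mem_exteriorPower_two f s),
      formMap_val_smul_dForm_mul _ _ _⟩

theorem isRegularForm_one_iff {f : V}
    (h : Submodule.span V {KaehlerDifferential.D ℂ V f} = ⊤)
    (hinj : ∀ c d : K, c • dForm (f : K) = d • dForm (f : K) → c = d) (g : K) :
    IsRegularForm 1 V (g • dForm (f : K)) ↔ g ∈ V := by
  constructor
  · rintro ⟨η, hη, hg⟩
    obtain ⟨c, rfl⟩ := mem_exteriorPower_one_single h hη
    rw [formMap_val_smul_dForm] at hg
    rw [← hinj _ _ hg]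
    exact c.2
  · intro hg
    exact ⟨(⟨g, hg⟩ : V) • dForm f, Submodule.smul_mem _ _ (dForm_mem_exteriorPower_one f),
      formMap_val_smul_dForm _ _⟩

variable [IsLocalRing V]

theorem exists_isUnit_mul_eq {f f' : V} (hf : IsLocalRing.maximalIdeal V = Ideal.span {f})
    (hf' : IsLocalRing.maximalIdeal V = Ideal.span {f'}) : ∃ w w' : V, f' = f * w ∧ w * w' = 1 := by
  obtain ⟨w, hw⟩ := Ideal.span_singleton_eq_span_singleton.1 (hf.symm.trans hf')
  exact ⟨w, (w⁻¹ : Vˣ), hw.symm, by simp⟩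

theorem residueMap_of_mem {f : V} (hf : IsLocalRing.maximalIdeal V = Ideal.span {f}) :
    residueMap V f = 0 := by
  rw [show residueMap V f = IsLocalRing.residue V f from rfl, IsLocalRing.residue_eq_zero_iff, hf]
  exact Ideal.mem_span_singleton_self f

/-- The Poincaré residue on a surface. -/
theorem isResidueAt_one_iff {f s : V} (hf0 : f ≠ 0)
    (hf : IsLocalRing.maximalIdeal V = Ideal.span {f})
    (h : Submodule.span V {KaehlerDifferential.D ℂ V f, KaehlerDifferential.D ℂ V s} = ⊤)
    (hinj : ∀ c d : K, c • (dForm (f : K) * dForm (s : K)) =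
      d • (dForm (f : K) * dForm (s : K)) → c = d) (g : K)
    (ψ : Forms (IsLocalRing.ResidueField V)) :
    IsResidueAt 1 V (g • (dForm (f : K) * dForm (s : K))) ψ ↔
      ∃ b : V, (b : K) = g * f ∧ ψ = residueMap V b • dForm (residueMap V s) := by
  have hfK : (f : K) ≠ 0 := fun h => hf0 (Subtype.ext h)
  constructor
  · rintro ⟨f', η, η', -, hf', hη, hη', hg, rfl⟩
    -- Independence of the local equation: for f' = f·w one has df'/f' = df/f + dw/w. After
    -- expanding dw in df and ds, all additional terms in g·f carry a factor f and vanish on the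
    -- divisor.
    obtain ⟨w, w', rfl, hw⟩ := exists_isUnit_mul_eq hf hf'
    obtain ⟨a, b, rfl⟩ := mem_exteriorPower_one_pair h hη
    obtain ⟨c, rfl⟩ := mem_exteriorPower_two_pair h hη'
    obtain ⟨w₁, w₂, hdw⟩ := mem_exteriorPower_one_pair h (dForm_mem_exteriorPower_one w)
    have hdw' := congrArg (formMap V.val) hdw
    rw [map_add, formMap_val_smul_dForm, formMap_val_smul_dForm, formMap_dForm] at hdw'
    have hwK : (w : K) * (w' : K) = 1 := congrArg Subtype.val hw
    have hw0 : (w : K) ≠ 0 := left_ne_zero_of_mul_eq_one hwK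
    have hg' : g = ((f : K) * w)⁻¹ * ((f * w₁ + w) * b - f * w₂ * a) + c := by
      apply hinj
      rw [hg, map_add, formMap_val_smul_dForm, formMap_val_smul_dForm, formMap_val_smul_dForm_mul,
        dlog, MulMemClass.coe_mul, dForm_mul]
      rw [show dForm (w : K) = _ from hdw']
      simp only [add_mul, mul_add, smul_mul_assoc, mul_smul_comm, dForm_mul_self,
        dForm_mul_comm (s : K) (f : K), smul_add]
      module
    refine ⟨b + f * (w' * (w₁ * b - w₂ * a) + c), ?_, ?_⟩
    · push_cast
      rw [hg', eq_inv_of_mul_eq_one_right hwK]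
      field_simp
      ring
    · have hb : residueMap V (b + f * (w' * (w₁ * b - w₂ * a) + c)) = residueMap V b := by
        rw [map_add, map_mul, residueMap_of_mem hf, zero_mul, add_zero]
      rw [hb, map_add, formMap_smul, formMap_smul, formMap_dForm, formMap_dForm,
        residueMap_of_mem hf]
      simp [dForm]
  · rintro ⟨b, hb, rfl⟩
    refine ⟨f, b • dForm s, 0, hf0, hf, Submodule.smul_mem _ _ (dForm_mem_exteriorPower_one s),
      zero_mem _, ?_, ?_⟩
    · rw [map_zero, add_zero, formMap_val_smul_dForm, dlog, smul_mul_assoc, mul_smul_comm, smul_smul,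
        hb]
      congr 1
      field_simp
    · rw [formMap_smul, formMap_dForm]

/-- The Poincaré residue on a curve. -/
theorem isResidueAt_zero_iff {f : V} (hf0 : f ≠ 0)
    (hf : IsLocalRing.maximalIdeal V = Ideal.span {f})
    (h : Submodule.span V {KaehlerDifferential.D ℂ V f} = ⊤)
    (hinj : ∀ c d : K, c • dForm (f : K) = d • dForm (f : K) → c = d) (g : K)
    (ψ : Forms (IsLocalRing.ResidueField V)) :
    IsResidueAt 0 V (g • dForm (f : K)) ψ ↔
      ∃ b : V, (b : K) = g * f ∧ ψ = residueMap V b • 1 := by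
  have hfK : (f : K) ≠ 0 := fun h => hf0 (Subtype.ext h)
  constructor
  · rintro ⟨f', η, η', -, hf', hη, hη', hg, rfl⟩
    obtain ⟨w, w', rfl, hw⟩ := exists_isUnit_mul_eq hf hf'
    obtain ⟨b, rfl⟩ := mem_exteriorPower_zero.1 hη
    obtain ⟨c, rfl⟩ := mem_exteriorPower_one_single h hη'
    obtain ⟨w₁, hdw⟩ := mem_exteriorPower_one_single h (dForm_mem_exteriorPower_one w)
    have hdw' := congrArg (formMap V.val) hdw
    rw [formMap_val_smul_dForm, formMap_dForm] at hdw'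
    have hwK : (w : K) * (w' : K) = 1 := congrArg Subtype.val hw
    have hw0 : (w : K) ≠ 0 := left_ne_zero_of_mul_eq_one hwK
    have hg' : g = ((f : K) * w)⁻¹ * ((f * w₁ + w) * b) + c := by
      apply hinj
      rw [hg, formMap_val_smul_dForm, formMap_val_smul_one, dlog, MulMemClass.coe_mul, dForm_mul]
      rw [show dForm (w : K) = _ from hdw']
      simp only [add_mul, mul_add, mul_smul_comm, smul_add, mul_one]
      module
    refine ⟨b + f * (w' * (w₁ * b) + c), ?_, ?_⟩
    · push_cast
      rw [hg', eq_inv_of_mul_eq_one_right hwK]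
      field_simp
      ring
    · rw [map_add, map_mul (residueMap V) f, residueMap_of_mem hf, zero_mul, add_zero,
        formMap_smul, formMap_one]
  · rintro ⟨b, hb, rfl⟩
    refine ⟨f, b • 1, 0, hf0, hf, mem_exteriorPower_zero.2 ⟨b, rfl⟩, zero_mem _, ?_, ?_⟩
    · rw [map_zero, add_zero, formMap_val_smul_one, dlog, smul_mul_assoc, mul_smul_comm, smul_smul,
        mul_one, hb]
      congr 1
      field_simp
    · rw [formMap_smul, formMap_one]

end Residues

/-! ### Ideals of sets of real points -/

section RealPoints

variable {n : ℕ}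

theorem aeval_self_eq_eval {σ k : Type} [CommRing k] (v : σ → k) (f : MvPolynomial σ k) :
    aeval v f = eval v f := DFunLike.congr_fun (coe_aeval_eq_eval v) f

theorem eval_smul_of_isHomogeneous {σ k : Type} [CommRing k] {e : ℕ} {f : MvPolynomial σ k}
    (hf : f.IsHomogeneous e) (c : k) (v : σ → k) : eval (c • v) f = c ^ e * eval v f := by
  have h := aeval_mul_of_isHomogeneous hf v c
  rw [aeval_self_eq_eval, aeval_self_eq_eval, mul_comm] at h
  rw [← show (fun i => v i * c) = c • v from funext fun i => mul_comm _ _]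
  exact h

theorem mk_eq_mk_iff_exists {v w : Fin (n + 1) → ℝ} {hv : v ≠ 0} {hw : w ≠ 0} :
    (Projectivization.mk ℝ v hv : RealProj n) = Projectivization.mk ℝ w hw ↔
      ∃ c : ℝ, c ≠ 0 ∧ v = c • w := by
  rw [Projectivization.mk_eq_mk_iff']
  constructor
  · rintro ⟨c, rfl⟩
    exact ⟨c, fun h => hv (by rw [h, zero_smul]), rfl⟩
  · rintro ⟨c, -, rfl⟩
    exact ⟨c, rfl⟩

theorem exists_rep_eq_smul (v : Fin (n + 1) → ℝ) (hv : v ≠ 0) :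
    ∃ c : ℝ, c ≠ 0 ∧ (Projectivization.mk ℝ v hv : RealProj n).rep = c • v := by
  obtain ⟨c, hc⟩ := Projectivization.exists_smul_eq_mk_rep ℝ v hv
  exact ⟨c, c.ne_zero, hc.symm⟩

theorem ofReal_smul_eq (c : ℝ) (v : Fin (n + 1) → ℝ) :
    (fun i => (((c • v) i : ℝ) : ℂ)) = (c : ℂ) • fun i => (v i : ℂ) := by
  ext i; simp

theorem vanishingIdeal_union (S T : Set (RealProj n)) :
    vanishingIdeal (S ∪ T) = vanishingIdeal S ⊓ vanishingIdeal T := by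
  ext f
  constructor
  · exact fun h => ⟨fun v hv hS => h v hv (Or.inl hS), fun v hv hS => h v hv (Or.inr hS)⟩
  · rintro ⟨h1, h2⟩ v hv (hS | hS)
    exacts [h1 v hv hS, h2 v hv hS]

/-- For a fixed representative v, the function c ↦ f(c·v) is a polynomial whose coefficients are the
values of the homogeneous components of f. It vanishes for all real c ≠ 0, hence identically. -/
theorem vanishingIdeal_homogeneousComponent {S : Set (RealProj n)} {f : CoordRing n}
    (hf : f ∈ vanishingIdeal S) (e : ℕ) : homogeneousComponent e f ∈ vanishingIdeal S := by
  intro v hv hS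
  let w : Fin (n + 1) → ℂ := fun i => (v i : ℂ)
  let q : Polynomial ℂ := ∑ e ∈ Finset.range (f.totalDegree + 1),
    Polynomial.monomial e (eval w (homogeneousComponent e f))
  have hq : q = 0 := by
    apply Polynomial.eq_zero_of_infinite_isRoot
    refine Set.Infinite.mono (s := (fun c : ℝ => (c : ℂ)) '' {0}ᶜ) ?_
      (Set.Infinite.image Complex.ofReal_injective.injOn (Set.finite_singleton _).infinite_compl)
    rintro _ ⟨c, hc, rfl⟩
    have h1 := hf (c • v) (smul_ne_zero hc hv)
      ((mk_eq_mk_iff_exists.2 ⟨c, hc, rfl⟩ : Projectivization.mk ℝ (c • v) _ = _) ▸ hS)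
    rw [ofReal_smul_eq, ← sum_homogeneousComponent f, map_sum] at h1
    change Polynomial.eval _ q = 0
    rw [Polynomial.eval_finsetSum, ← h1]
    refine Finset.sum_congr rfl fun e _ => ?_
    rw [Polynomial.eval_monomial, eval_smul_of_isHomogeneous
      (homogeneousComponent_isHomogeneous e f), mul_comm]
  by_cases he : e < f.totalDegree + 1
  · have := congrArg (fun q => Polynomial.coeff q e) hq
    simpa [q, Polynomial.finsetSum_coeff, Polynomial.coeff_monomial, Finset.sum_ite_eq', he] using this
  · rw [homogeneousComponent_eq_zero _ _ (by omega), map_zero]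

theorem Variety.ideal_eq_of_homogeneous (X : Variety n) {I : Ideal (CoordRing n)}
    (hI : ∀ f ∈ I, ∀ e, homogeneousComponent e f ∈ I)
    (h : ∀ (e : ℕ) (a : CoordRing n), a.IsHomogeneous e → (a ∈ X.ideal ↔ a ∈ I)) : X.ideal = I := by
  refine le_antisymm (X.ideal_le_of_homogeneous fun e a ha => (h e a ha).1) fun a ha => ?_
  rw [← sum_homogeneousComponent a]
  exact X.ideal.sum_mem fun e _ =>
    (h e _ (homogeneousComponent_isHomogeneous e a)).2 (hI a ha e)

theorem mem_vanishingIdeal_singleton {v : Fin (n + 1) → ℝ} {hv : v ≠ 0} {e : ℕ} {f : CoordRing n}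
    (hf : f.IsHomogeneous e) : f ∈ vanishingIdeal {Projectivization.mk ℝ v hv} ↔
      eval (fun i => (v i : ℂ)) f = 0 := by
  constructor
  · exact fun h => h v hv rfl
  · intro h w hw hS
    obtain ⟨c, -, rfl⟩ := mk_eq_mk_iff_exists.1 hS
    rw [ofReal_smul_eq, eval_smul_of_isHomogeneous hf, h, mul_zero]

/-- At real points the real and imaginary parts of a polynomial vanish separately, so the ideal is
generated by real polynomials. This supplies the condition of being defined over ℝ. -/
theorem exists_map_eq_vanishingIdeal (S : Set (RealProj n)) :
    ∃ J : Ideal (MvPolynomial (Fin (n + 1)) ℝ),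
      J.map (MvPolynomial.map (algebraMap ℝ ℂ)) = vanishingIdeal S := by
  refine ⟨(vanishingIdeal S).comap (MvPolynomial.map (algebraMap ℝ ℂ)),
    le_antisymm Ideal.map_comap_le fun f hf => ?_⟩
  let f₁ : MvPolynomial (Fin (n + 1)) ℝ := ∑ s ∈ f.support, monomial s (coeff s f).re
  let f₂ : MvPolynomial (Fin (n + 1)) ℝ := ∑ s ∈ f.support, monomial s (coeff s f).im
  have hfeq : f = MvPolynomial.map (algebraMap ℝ ℂ) f₁ +
      C Complex.I * MvPolynomial.map (algebraMap ℝ ℂ) f₂ := by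
    conv_lhs => rw [f.as_sum]
    rw [map_sum, map_sum, Finset.mul_sum, ← Finset.sum_add_distrib]
    refine Finset.sum_congr rfl fun s _ => ?_
    rw [map_monomial, map_monomial, C_mul_monomial, ← map_add]
    congr 1
    rw [mul_comm]
    exact (Complex.re_add_im _).symm
  have heval : ∀ (g : MvPolynomial (Fin (n + 1)) ℝ) (v : Fin (n + 1) → ℝ),
      eval (fun i => (v i : ℂ)) (MvPolynomial.map (algebraMap ℝ ℂ) g) = (eval v g : ℂ) := by
    intro g v
    rw [eval_map]
    exact (eval₂_comp_left (algebraMap ℝ ℂ) (RingHom.id ℝ) v g).symm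
  have hmem : ∀ (v : Fin (n + 1) → ℝ) (hv : v ≠ 0), Projectivization.mk ℝ v hv ∈ S →
      eval v f₁ = 0 ∧ eval v f₂ = 0 := by
    intro v hv hS
    have h := hf v hv hS
    rw [hfeq, map_add, map_mul, heval, heval, eval_C] at h
    have h1 := congrArg Complex.re h
    have h2 := congrArg Complex.im h
    simp at h1 h2
    exact ⟨h1, h2⟩
  rw [hfeq]
  refine Ideal.add_mem _ (Ideal.mem_map_of_mem _ fun v hv hS => ?_)
    (Ideal.mul_mem_left _ _ (Ideal.mem_map_of_mem _ fun v hv hS => ?_))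
  · rw [heval, (hmem v hv hS).1, Complex.ofReal_zero]
  · rw [heval, (hmem v hv hS).2, Complex.ofReal_zero]

theorem mk_mem_realPoints_iff {X : Variety n} {v : Fin (n + 1) → ℝ} {hv : v ≠ 0} :
    Projectivization.mk ℝ v hv ∈ realPoints X ↔
      ∀ (e : ℕ) (f : CoordRing n), f.IsHomogeneous e → f ∈ X.ideal →
        eval (fun i => (v i : ℂ)) f = 0 := by
  obtain ⟨c, hc, hrep⟩ := exists_rep_eq_smul v hv
  have hc' : (c : ℂ) ≠ 0 := Complex.ofReal_ne_zero.2 hc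
  constructor
  · intro h e f hf hfX
    have := h f hfX
    rw [hrep, ofReal_smul_eq, eval_smul_of_isHomogeneous hf] at this
    exact (mul_eq_zero.1 this).resolve_left (pow_ne_zero _ hc')
  · intro h f hfX
    rw [hrep, ← sum_homogeneousComponent f, map_sum]
    refine Finset.sum_eq_zero fun e _ => ?_
    rw [ofReal_smul_eq, eval_smul_of_isHomogeneous (homogeneousComponent_isHomogeneous e f),
      h e _ (homogeneousComponent_isHomogeneous e f) (X.homogeneousComponent_mem hfX e), mul_zero]

theorem mem_realPoints_of_vanishingIdeal {X : Variety n} {S : Set (RealProj n)}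
    (h : X.ideal ≤ vanishingIdeal S) : S ⊆ realPoints X := by
  intro p hp
  induction p using Projectivization.ind with
  | h v hv => exact mk_mem_realPoints_iff.2 fun e f _ hfX => h hfX v hv hp

theorem realPoints_projSpace : realPoints (projSpace n) = Set.univ := by
  ext p
  refine iff_of_true (fun f hf => ?_) trivial
  have : f = 0 := by
    have h : f ∈ (⊥ : HomogeneousIdeal _).toIdeal := hf
    rwa [HomogeneousIdeal.toIdeal_bot] at h
  rw [this, map_zero]

/-! ### Basic closed semialgebraic sets -/

namespace IsSemialgebraic

variable {m : ℕ}

theorem nonneg (p : MvPolynomial (Fin m) ℝ) : IsSemialgebraic {v | 0 ≤ eval v p} := by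
  convert IsSemialgebraic.compl _ (IsSemialgebraic.pos (-p)) using 1
  ext v
  simp

theorem univ : IsSemialgebraic (Set.univ : Set (Fin m → ℝ)) := by
  convert nonneg (0 : MvPolynomial (Fin m) ℝ) using 1
  ext v
  simp

theorem iInter {ι : Type} [Finite ι] {S : ι → Set (Fin m → ℝ)} (h : ∀ i, IsSemialgebraic (S i)) :
    IsSemialgebraic (⋂ i, S i) := by
  have := Fintype.ofFinite ι
  have key : ∀ s : Finset ι, IsSemialgebraic (⋂ i ∈ s, S i) := by
    classical
    intro s
    induction s using Finset.induction_on with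
    | empty => simpa using univ
    | insert a s _ ih =>
      rw [Finset.set_biInter_insert]
      exact .inter _ _ (h a) ih
  simpa using key Finset.univ

theorem ne_zero : IsSemialgebraic {v : Fin m → ℝ | v ≠ 0} := by
  have h : IsSemialgebraic (⋂ i : Fin m, {v : Fin m → ℝ | 0 ≤ eval v (-(X i ^ 2))}) :=
    iInter fun i => nonneg _
  convert IsSemialgebraic.compl _ h using 1
  ext v
  simp only [Set.mem_ofPred_eq, Set.mem_compl_iff, Set.mem_iInter, not_iff_not, map_neg, map_pow,
    eval_X]
  constructor
  · rintro rfl i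
    simp
  · intro h
    funext i
    have := h i
    have h2 := sq_nonneg (v i)
    have : v i ^ 2 = 0 := by linarith
    simpa using this

end IsSemialgebraic

/-- The set of points where some homogeneous polynomials of even degree are nonnegative. -/
def basicSet {ι : Type} (F : ι → MvPolynomial (Fin (n + 1)) ℝ) : Set (RealProj n) :=
  {p | ∀ i, 0 ≤ eval p.rep (F i)}

variable {ι : Type} {F : ι → MvPolynomial (Fin (n + 1)) ℝ} {d : ι → ℕ}

/-- Rescaling the representative by c multiplies a form of degree 2d by c^(2d) > 0, so its sign is
well defined. -/
theorem mk_mem_basicSet (hF : ∀ i, (F i).IsHomogeneous (2 * d i)) {v : Fin (n + 1) → ℝ}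
    {hv : v ≠ 0} : Projectivization.mk ℝ v hv ∈ basicSet F ↔ ∀ i, 0 ≤ eval v (F i) := by
  obtain ⟨c, hc, hrep⟩ := exists_rep_eq_smul v hv
  refine forall_congr' fun i => ?_
  rw [hrep, eval_smul_of_isHomogeneous (hF i), pow_mul]
  exact mul_nonneg_iff_of_pos_left (by positivity)

theorem isClosed_basicSet (hF : ∀ i, (F i).IsHomogeneous (2 * d i)) : IsClosed (basicSet F) := by
  rw [isClosed_coinduced]
  have : (fun v : {v : Fin (n + 1) → ℝ // v ≠ 0} => Projectivization.mk ℝ v.1 v.2) ⁻¹' basicSet F =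
      ⋂ i, {v | 0 ≤ eval v.1 (F i)} := by
    ext v
    rw [Set.mem_preimage, mk_mem_basicSet hF, Set.mem_iInter]
    rfl
  rw [this]
  exact isClosed_iInter fun i => isClosed_le continuous_const
    ((MvPolynomial.continuous_eval (F i)).comp continuous_subtype_val)

theorem isSemialgebraic_cone_basicSet [Finite ι] (hF : ∀ i, (F i).IsHomogeneous (2 * d i)) :
    IsSemialgebraic (cone (basicSet F)) := by
  have : cone (basicSet F) = {v | v ≠ 0} ∩ ⋂ i, {v | 0 ≤ eval v (F i)} := by
    ext v
    simp only [cone, Set.mem_ofPred_eq, Set.mem_inter_iff, Set.mem_iInter]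
    constructor
    · rintro ⟨hv, h⟩
      exact ⟨hv, (mk_mem_basicSet hF).1 h⟩
    · rintro ⟨hv, h⟩
      exact ⟨hv, (mk_mem_basicSet hF).2 h⟩
  rw [this]
  exact .inter _ _ IsSemialgebraic.ne_zero (IsSemialgebraic.iInter fun i => IsSemialgebraic.nonneg _)

theorem isAdmissible_basicSet [Finite ι] (hF : ∀ i, (F i).IsHomogeneous (2 * d i)) {e : ℕ}
    {X : Variety n} (hdim : Algebra.trdeg ℂ (FunctionField X) = e)
    (hne : (basicSet F).Nonempty) (hfull : vanishingIdeal (basicSet F) = X.ideal) :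
    IsAdmissible e X (basicSet F) where
  dim := hdim
  real := hfull ▸ exists_map_eq_vanishingIdeal _
  subset := mem_realPoints_of_vanishingIdeal hfull.ge
  nonempty := hne
  closed := isClosed_basicSet hF
  semialgebraic := isSemialgebraic_cone_basicSet hF
  full := hfull

/-! ### Points -/

theorem exists_variety_point (v : Fin (n + 1) → ℝ) (hv : v ≠ 0) :
    ∃ P : Variety n, P.ideal = vanishingIdeal {Projectivization.mk ℝ v hv} := by
  obtain ⟨j, hj⟩ := Function.ne_iff.1 hv
  have hj' : ((v j : ℝ) : ℂ) ∉ (⊥ : Ideal ℂ) := by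
    simpa using hj
  obtain ⟨P, hP⟩ := exists_variety_of_prime (⊥ : Ideal ℂ) (fun i => (v i : ℂ)) hj'
  refine ⟨P, P.ideal_eq_of_homogeneous (fun f hf => vanishingIdeal_homogeneousComponent hf) ?_⟩
  intro e a ha
  rw [hP e a ha, mem_vanishingIdeal_singleton ha, Ideal.mem_bot, aeval_self_eq_eval]

/-- The polynomials are minus the squares of the 2×2 minors of two representatives; they are all
nonnegative only if the vectors are proportional. -/
theorem singleton_eq_basicSet (v : Fin (n + 1) → ℝ) (hv : v ≠ 0) :
    (∀ i : Fin (n + 1) × Fin (n + 1),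
      (-(C (v i.1) * X i.2 - C (v i.2) * X i.1) ^ 2 :
        MvPolynomial (Fin (n + 1)) ℝ).IsHomogeneous (2 * 1)) ∧
    ({Projectivization.mk ℝ v hv} : Set (RealProj n)) = basicSet
      fun i : Fin (n + 1) × Fin (n + 1) => -(C (v i.1) * X i.2 - C (v i.2) * X i.1) ^ 2 := by
  have hF : ∀ i : Fin (n + 1) × Fin (n + 1),
      (-(C (v i.1) * X i.2 - C (v i.2) * X i.1) ^ 2 :
        MvPolynomial (Fin (n + 1)) ℝ).IsHomogeneous (2 * 1) := by
    intro i
    have : (C (v i.1) * X i.2 - C (v i.2) * X i.1 :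
        MvPolynomial (Fin (n + 1)) ℝ).IsHomogeneous 1 :=
      ((isHomogeneous_X ℝ i.2).C_mul _).sub ((isHomogeneous_X ℝ i.1).C_mul _)
    exact (this.pow 2).neg
  refine ⟨hF, ?_⟩
  ext p
  induction p using Projectivization.ind with
  | h w hw =>
    rw [mk_mem_basicSet hF, Set.mem_singleton_iff, mk_eq_mk_iff_exists]
    simp only [map_neg, map_pow, map_sub, map_mul, eval_C, eval_X]
    constructor
    · rintro ⟨c, -, rfl⟩ i
      simp only [Pi.smul_apply, smul_eq_mul]
      ring_nf
      exact le_refl _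
    · intro h
      obtain ⟨j, hj⟩ := Function.ne_iff.1 hv
      simp only [Pi.zero_apply] at hj
      have h1 : ∀ i, v j * w i = v i * w j := by
        intro i
        have h1 := h (j, i)
        have h2 := sq_nonneg (v j * w i - v i * w j)
        have h3 : (v j * w i - v i * w j) ^ 2 = 0 := by
          simp only at h1
          linarith
        exact sub_eq_zero.1 (pow_eq_zero_iff (two_ne_zero)|>.1 h3)
      have hwv : w = (w j / v j) • v := by
        funext i
        have := h1 i
        simp only [Pi.smul_apply, smul_eq_mul]
        field_simp
        linarith
      refine ⟨w j / v j, fun h0 => hw ?_, hwv⟩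
      rw [hwv, h0, zero_smul]

/-- On a point the coordinate functions are the constants vᵢ/v_k, so the function field is ℂ. -/
theorem exists_eq_algebraMap_of_point {v : Fin (n + 1) → ℝ} {hv : v ≠ 0} {P : Variety n}
    (hP : P.ideal = vanishingIdeal {Projectivization.mk ℝ v hv}) (y : FunctionField P) :
    ∃ c : ℂ, algebraMap ℂ _ c = y := by
  obtain ⟨k, hk⟩ := P.exists_X_notMem
  have hk' := hk
  rw [hP, mem_vanishingIdeal_singleton (isHomogeneous_X ℂ k), eval_X] at hk'
  obtain ⟨e, a, b, ha, hb, -, rfl⟩ := exists_eq_dehom_div P hk y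
  have hcoord : ∀ i, affCoord P k i = algebraMap ℂ _ ((v i : ℂ) / v k) := by
    intro i
    have h1 : (MvPolynomial.X i - C ((v i : ℂ) / v k) * MvPolynomial.X k : CoordRing n) ∈ P.ideal := by
      have hhom : (MvPolynomial.X i - C ((v i : ℂ) / v k) * MvPolynomial.X k :
        CoordRing n).IsHomogeneous 1 := (isHomogeneous_X ℂ i).sub ((isHomogeneous_X ℂ k).C_mul _)
      rw [hP, mem_vanishingIdeal_singleton hhom]
      simp only [map_sub, map_mul, eval_X, eval_C]
      field_simp
      ring
    rw [← dehom_eq_zero_iff P hk ((isHomogeneous_X ℂ i).sub ((isHomogeneous_X ℂ k).C_mul _)),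
      map_sub, map_mul, dehom_X_self P hk, mul_one, dehom_X, sub_eq_zero, ← algebraMap_eq,
      AlgHom.commutes] at h1
    exact h1
  have hdehom : ∀ a : CoordRing n, dehom P k a =
      algebraMap ℂ _ (eval (fun i => (v i : ℂ) / v k) a) := by
    intro a
    rw [dehom, funext hcoord, ← aeval_self_eq_eval]
    exact aeval_algebraMap_apply _ _ a
  exact ⟨_, by rw [hdehom, hdehom, map_div₀]⟩

theorem isAdmissible_point {v : Fin (n + 1) → ℝ} {hv : v ≠ 0} {P : Variety n}
    (hP : P.ideal = vanishingIdeal {Projectivization.mk ℝ v hv}) :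
    IsAdmissible 0 P {Projectivization.mk ℝ v hv} := by
  obtain ⟨hF, heq⟩ := singleton_eq_basicSet v hv
  have hchart : IsChart (![] : Fin 0 → FunctionField P) := by
    refine ⟨algebraicIndependent_empty_type_iff.2 (algebraMap ℂ (FunctionField P)).injective, ?_⟩
    rw [eq_top_iff]
    intro y _
    obtain ⟨c, rfl⟩ := exists_eq_algebraMap_of_point hP y
    exact IntermediateField.algebraMap_mem _ c
  rw [heq] at hP ⊢
  exact isAdmissible_basicSet hF (by simpa using hchart.trdeg) (heq ▸ Set.singleton_nonempty _)
    hP.symm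

end RealPoints

/-! ### Places and forms on the line -/

section Line

variable {K : Type} [Field K] [Algebra ℂ K]

theorem dForm_inv {x : K} (hx : x ≠ 0) : dForm x⁻¹ = -(x⁻¹ ^ 2) • dForm x := by
  have h := dForm_mul x x⁻¹
  rw [mul_inv_cancel₀ hx, ← map_one (algebraMap ℂ K), dForm_algebraMap] at h
  have h1 : dForm x⁻¹ = x⁻¹ • (x • dForm x⁻¹ + x⁻¹ • dForm x) - (x⁻¹ ^ 2) • dForm x := by
    rw [smul_add, smul_smul, inv_mul_cancel₀ hx, one_smul, smul_smul, ← pow_two]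
    abel
  rw [h1, ← h, smul_zero, zero_sub, neg_smul]

theorem dForm_sub_algebraMap (x : K) (a : ℂ) : dForm (x - algebraMap ℂ K a) = dForm x := by
  rw [dForm_sub, dForm_algebraMap, sub_zero]

/-- The prime ideal of the point `a` of the affine line. -/
def linePrime (a : ℂ) : Ideal (MvPolynomial (Fin 1) ℂ) :=
  RingHom.ker (MvPolynomial.eval fun _ : Fin 1 => a)

instance (a : ℂ) : (linePrime a).IsMaximal :=
  RingHom.ker_isMaximal_of_surjective _ fun c => ⟨C c, eval_C c⟩

theorem mem_linePrime {a : ℂ} {p : MvPolynomial (Fin 1) ℂ} :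
    p ∈ linePrime a ↔ eval (fun _ => a) p = 0 := Iff.rfl

theorem linePrime_eq_span (a : ℂ) : linePrime a = Ideal.span {X 0 - C a} := by
  rw [linePrime, ← span_X_sub_C_eq]
  congr 1
  ext p
  simp [Fin.exists_fin_one, eq_comm]

/-- The local ring of the affine line with coordinate `t` at the point `a`. -/
def linePlace (t : K) (a : ℂ) : Subalgebra ℂ K := locRing ![t] (linePrime a)

variable {t : K}

theorem aeval_coord_eq (t : K) (p : Polynomial ℂ) :
    aeval ![t] (Polynomial.aeval (X 0 : MvPolynomial (Fin 1) ℂ) p) = Polynomial.aeval t p := by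
  rw [← Polynomial.aeval_algHom_apply, aeval_X]
  rfl

theorem polynomial_mem_linePlace (t : K) (p : Polynomial ℂ) (a : ℂ) :
    Polynomial.aeval t p ∈ linePlace t a := by
  rw [← aeval_coord_eq]
  exact aeval_mem_locRing _

theorem self_mem_linePlace (t : K) (a : ℂ) : t ∈ linePlace t a := coord_mem_locRing 0

theorem sub_mem_linePlace (t : K) (a b : ℂ) : t - algebraMap ℂ K b ∈ linePlace t a :=
  sub_mem (self_mem_linePlace t a) (Subalgebra.algebraMap_mem _ b)

theorem IsChart.ne_algebraMap (h : IsChart ![t]) (a : ℂ) : t - algebraMap ℂ K a ≠ 0 := by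
  have := h.aeval_ne_zero (p := X 0 - C a) (fun h0 => by
    have h1 := congrArg (eval fun _ => a + 1) h0
    simp at h1)
  simpa [← algebraMap_eq] using this

theorem IsChart.ne_zero (h : IsChart ![t]) : t ≠ 0 := by
  simpa using h.ne_algebraMap 0

theorem IsChart.polynomial_inv_mem_linePlace_iff (h : IsChart ![t]) (p : Polynomial ℂ) (a : ℂ) :
    (Polynomial.aeval t p = 0 ∨ (Polynomial.aeval t p)⁻¹ ∉ linePlace t a) ↔ p.eval a = 0 := by
  rw [← aeval_coord_eq, linePlace, h.inv_aeval_mem_locRing_iff, mem_linePrime,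
    ← aeval_self_eq_eval, ← Polynomial.aeval_algHom_apply, aeval_X, Polynomial.coe_aeval_eq_eval]

theorem IsChart.polynomial_inv_mem_linePlace (h : IsChart ![t]) {p : Polynomial ℂ} {a : ℂ}
    (hp : p.eval a ≠ 0) : (Polynomial.aeval t p)⁻¹ ∈ linePlace t a := by
  by_contra hcon
  exact hp ((h.polynomial_inv_mem_linePlace_iff p a).1 (Or.inr hcon))

theorem IsChart.sub_inv_notMem_linePlace (h : IsChart ![t]) (a : ℂ) :
    (t - algebraMap ℂ K a)⁻¹ ∉ linePlace t a := by
  have := (h.polynomial_inv_mem_linePlace_iff (Polynomial.X - Polynomial.C a) a).2 (by simp)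
  rw [map_sub, Polynomial.aeval_X, Polynomial.aeval_C] at this
  exact this.resolve_left (h.ne_algebraMap a)

theorem IsChart.isValuationRingOf_linePlace (h : IsChart ![t]) (a : ℂ) :
    IsValuationRingOf (linePlace t a) := by
  refine h.isValuationRingOf_locRing (f := X 0 - C a) (fun hu => ?_) (linePrime_eq_span a)
  exact (inferInstance : (linePrime a).IsMaximal).ne_top
    (by rw [linePrime_eq_span, Ideal.span_singleton_eq_top]; exact hu)

/-- A valuation ring centered at a closed point of the line is the local ring there. -/
theorem IsChart.eq_linePlace (h : IsChart ![t]) {V : Subalgebra ℂ K} (hV : IsValuationRingOf V)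
    (htV : t ∈ V) {a : ℂ} (ha : (t - algebraMap ℂ K a)⁻¹ ∉ V) : V = linePlace t a := by
  have hu : ∀ i, ![t] i ∈ V := fun i => by fin_cases i; exact htV
  obtain ⟨P, hP, hc, hPV⟩ := hV.exists_centerRing_eq hu
  have hle : linePrime a ≤ P := by
    rw [linePrime_eq_span, Ideal.span_singleton_le_iff_mem, hPV]
    right
    simpa [← algebraMap_eq] using ha
  have hPa : linePrime a = P := (inferInstance : (linePrime a).IsMaximal).eq_of_le hP.ne_top hle
  subst hPa
  refine eq_of_dominates (h.isValuationRingOf_linePlace a) ?_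
  rw [linePlace, ← hc]
  exact dominates_centerRing (Algebra.adjoin_le (by rintro _ ⟨i, rfl⟩; exact hu i))

/-! Local structure. -/

theorem IsChart.maximalIdeal_linePlace (h : IsChart ![t]) (a : ℂ) [IsLocalRing (linePlace t a)] :
    IsLocalRing.maximalIdeal (linePlace t a) =
      Ideal.span {⟨t - algebraMap ℂ K a, sub_mem_linePlace t a a⟩} := by
  have hloc : IsLocalRing (locRing ![t] (linePrime a)) := ‹IsLocalRing (linePlace t a)›
  have := h.maximalIdeal_locRing (P := linePrime a) (e := 1) (fun _ => X 0 - C a)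
    (by rw [linePrime_eq_span, Set.range_const])
  refine this.trans ?_
  rw [Set.range_const]
  refine congrArg (fun x : linePlace t a => Ideal.span {x}) (Subtype.ext ?_)
  simp [← algebraMap_eq]

theorem span_D_linePlace (t : K) (a b : ℂ) :
    Submodule.span (linePlace t a) {KaehlerDifferential.D ℂ (linePlace t a)
      ⟨t - algebraMap ℂ K b, sub_mem_linePlace t a b⟩} = ⊤ := by
  have h1 : (⟨t - algebraMap ℂ K b, sub_mem_linePlace t a b⟩ : linePlace t a) =
    ⟨t, self_mem_linePlace t a⟩ - algebraMap ℂ _ b := rfl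
  have h2 := span_D_locRing (u := ![t]) (P := linePrime a)
  rw [h1, Derivation.map_sub, Derivation.map_algebraMap, sub_zero]
  rw [Set.range_unique] at h2
  exact h2

theorem IsChart.smul_dForm_sub_injective (h : IsChart ![t]) (a : ℂ) (c d : K)
    (hcd : c • dForm (t - algebraMap ℂ K a) = d • dForm (t - algebraMap ℂ K a)) : c = d := by
  rw [dForm_sub_algebraMap] at hcd
  exact h.smul_dForm_injective hcd

theorem IsChart.isRegularForm_linePlace_iff (h : IsChart ![t]) (a : ℂ) (g : K) :
    IsRegularForm 1 (linePlace t a) (g • dForm t) ↔ g ∈ linePlace t a := by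
  have := isRegularForm_one_iff (span_D_linePlace t a a) (h.smul_dForm_sub_injective a) g
  rwa [dForm_sub_algebraMap] at this

theorem IsChart.isResidueAt_linePlace_iff (h : IsChart ![t]) (a : ℂ) [IsLocalRing (linePlace t a)]
    (g : K) (ψ : Forms (IsLocalRing.ResidueField (linePlace t a))) :
    IsResidueAt 0 (linePlace t a) (g • dForm t) ψ ↔
      ∃ b : linePlace t a, (b : K) = g * (t - algebraMap ℂ K a) ∧
        ψ = residueMap (linePlace t a) b • 1 := by
  have := isResidueAt_zero_iff (fun h0 => h.ne_algebraMap a (congrArg Subtype.val h0))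
    (h.maximalIdeal_linePlace a) (span_D_linePlace t a a) (h.smul_dForm_sub_injective a) g ψ
  rwa [dForm_sub_algebraMap] at this

theorem IsChart.residueMap_polynomial (h : IsChart ![t]) (a : ℂ) [IsLocalRing (linePlace t a)]
    (p : Polynomial ℂ) :
    residueMap (linePlace t a) ⟨_, polynomial_mem_linePlace t p a⟩ =
      algebraMap ℂ _ (p.eval a) := by
  rw [← sub_eq_zero, ← AlgHom.commutes (residueMap (linePlace t a)), ← map_sub,
    residueMap_eq_zero_iff]
  have := (h.polynomial_inv_mem_linePlace_iff (p - Polynomial.C (p.eval a)) a).2 (by simp)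
  rwa [map_sub, Polynomial.aeval_C] at this

theorem IsChart.exists_residueMap_eq (h : IsChart ![t]) (a : ℂ) [IsLocalRing (linePlace t a)]
    (z : IsLocalRing.ResidueField (linePlace t a)) : ∃ c : ℂ, z = algebraMap ℂ _ c := by
  have hmv : ∀ p : MvPolynomial (Fin 1) ℂ,
      residueMap (linePlace t a) ⟨aeval ![t] p, aeval_mem_locRing p⟩ =
        algebraMap ℂ _ (eval (fun _ => a) p) := by
    intro p
    rw [← sub_eq_zero, ← AlgHom.commutes (residueMap (linePlace t a)), ← map_sub,
      residueMap_eq_zero_iff]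
    have := (h.inv_aeval_mem_locRing_iff (P := linePrime a) (p := p - C (eval (fun _ => a) p))).2
      (by rw [mem_linePrime, map_sub, eval_C, sub_self])
    rwa [map_sub, ← algebraMap_eq, AlgHom.commutes] at this
  obtain ⟨⟨x, p, q, hq, hq0, rfl⟩, rfl⟩ := IsLocalRing.residue_surjective z
  refine ⟨eval (fun _ => a) p / eval (fun _ => a) q, ?_⟩
  have hmul := congrArg (residueMap (linePlace t a)) (Subtype.ext (div_mul_cancel₀ (aeval ![t] p) hq0) :
    (⟨aeval ![t] p / aeval ![t] q, p, q, hq, hq0, rfl⟩ * ⟨aeval ![t] q, aeval_mem_locRing q⟩ :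
      linePlace t a) = ⟨aeval ![t] p, aeval_mem_locRing p⟩)
  rw [map_mul, hmv, hmv] at hmul
  rw [map_div₀]
  refine (eq_div_iff ?_).2 hmul
  exact (map_ne_zero _).2 hq

/-! Global forms. -/

/-- Here t has a pole at V. If p(t) ∈ V, then (p(t) - p(0))/t ∈ V as well, and by induction on the
degree this quotient is a constant c. If c ≠ 0, then t = c⁻¹(p(t) - p(0)) would be in V. -/
theorem exists_eq_C_of_aeval_mem {V : Subalgebra ℂ K} (hV : t⁻¹ ∈ V) (htV : t ∉ V)
    (p : Polynomial ℂ) (hp : Polynomial.aeval t p ∈ V) : ∃ c, p = Polynomial.C c := by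
  have ht0 : t ≠ 0 := fun h => htV (h ▸ V.zero_mem)
  induction hn : p.natDegree generalizing p with
  | zero => exact ⟨_, Polynomial.eq_C_of_natDegree_eq_zero hn⟩
  | succ k ih =>
    exfalso
    have hq : Polynomial.aeval t p.divX = t⁻¹ * (Polynomial.aeval t p - algebraMap ℂ K (p.coeff 0)) := by
      conv_rhs => rw [← p.divX_mul_X_add]
      simp
      field_simp
    have hqV : Polynomial.aeval t p.divX ∈ V :=
      hq ▸ V.mul_mem hV (V.sub_mem hp (V.algebraMap_mem _))
    obtain ⟨c, hc⟩ := ih p.divX hqV (by rw [Polynomial.natDegree_divX_eq_natDegree_tsub_one, hn]; rfl)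
    have hp' := p.divX_mul_X_add
    rw [hc] at hp'
    have hc0 : c ≠ 0 := by
      rintro rfl
      rw [map_zero, zero_mul, zero_add] at hp'
      rw [← hp', Polynomial.natDegree_C] at hn
      omega
    apply htV
    have : t = algebraMap ℂ K c⁻¹ * (Polynomial.aeval t p - algebraMap ℂ K (p.coeff 0)) := by
      have hcK : algebraMap ℂ K c ≠ 0 := (map_ne_zero _).2 hc0
      conv_rhs => rw [← hp']
      simp
      field_simp
    rw [this]
    exact V.mul_mem (V.algebraMap_mem _) (V.sub_mem hp (V.algebraMap_mem _))

theorem IsChart.exists_eq_polynomial (h : IsChart ![t]) (x : K) (hx : ∀ a : ℂ, x ∈ linePlace t a) :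
    ∃ p : Polynomial ℂ, x = Polynomial.aeval t p := by
  obtain ⟨p, rfl⟩ := h.exists_eq_aeval x fun f hf => by
    have hprime : (Ideal.span {f}).IsPrime :=
      (Ideal.span_singleton_prime hf.ne_zero).2 hf.prime
    obtain hbot | ⟨-, a, ha⟩ := prime_line_cases (Ideal.span {f})
    · exact absurd (Ideal.span_singleton_eq_bot.1 hbot) hf.ne_zero
    · obtain ⟨p, q, hq, hq0, hxeq⟩ := hx a
      rw [linePrime_eq_span, ← ha, Ideal.mem_span_singleton] at hq
      exact ⟨p, q, hq, by rw [hxeq, div_mul_cancel₀ _ hq0]⟩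
  refine ⟨aeval (fun _ => Polynomial.X) p, ?_⟩
  rw [← AlgHom.comp_apply, comp_aeval]
  congr 2
  funext i
  fin_cases i
  simp

/-- Multiplication by t² - 1 removes both simple poles and leaves a polynomial in t. Since dt = -t²
d(t⁻¹), regularity of g dt at infinity makes this polynomial bounded there, hence constant. -/
theorem IsChart.exists_eq_const_div (h : IsChart ![t]) (h' : IsChart ![t⁻¹]) {g : K}
    (hreg : ∀ a : ℂ, a ^ 2 ≠ 1 → g ∈ linePlace t a)
    (h₁ : g * (t - 1) ∈ linePlace t 1) (h₂ : g * (t + 1) ∈ linePlace t (-1))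
    (hinf : g * t ^ 2 ∈ linePlace t⁻¹ 0) : ∃ c : ℂ, g = algebraMap ℂ K c / (t ^ 2 - 1) := by
  have ht0 := h.ne_zero
  have hsq : t ^ 2 - 1 ≠ 0 := by
    have e1 := h.ne_algebraMap 1
    have e2 := h.ne_algebraMap (-1)
    rw [map_neg, map_one, sub_neg_eq_add] at e2
    rw [map_one] at e1
    rw [show t ^ 2 - 1 = (t - 1) * (t + 1) by ring]
    exact mul_ne_zero e1 e2
  obtain ⟨p, hp⟩ := h.exists_eq_polynomial (g * (t ^ 2 - 1)) fun a => by
    have hm := self_mem_linePlace t a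
    by_cases ha : a ^ 2 = 1
    · rcases mul_self_eq_one_iff.1 ((pow_two a).symm.trans ha) with rfl | rfl
      · rw [show g * (t ^ 2 - 1) = g * (t - 1) * (t + 1) by ring]
        exact mul_mem h₁ (add_mem hm (one_mem _))
      · rw [show g * (t ^ 2 - 1) = g * (t + 1) * (t - 1) by ring]
        exact mul_mem h₂ (sub_mem hm (one_mem _))
    · exact mul_mem (hreg a ha) (sub_mem (pow_mem hm 2) (one_mem _))
  have hinv : t⁻¹ ∈ linePlace t⁻¹ 0 := self_mem_linePlace _ _
  obtain ⟨c, rfl⟩ := exists_eq_C_of_aeval_mem (V := linePlace t⁻¹ 0) hinv (by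
    have := h'.sub_inv_notMem_linePlace 0
    rwa [map_zero, sub_zero, inv_inv] at this) p (by
    rw [← hp, show g * (t ^ 2 - 1) = g * t ^ 2 * (1 - t⁻¹ ^ 2) by field_simp]
    exact mul_mem hinf (sub_mem (one_mem _) (pow_mem hinv 2)))
  rw [Polynomial.aeval_C] at hp
  exact ⟨c, (eq_div_iff hsq).2 hp⟩

end Line

/-! ### Places lying over a subvariety with a unique place -/

section UniquePlace

variable {n : ℕ}

theorem mem_minimalPrimes_inf_iff {R : Type} [CommRing R] {P Q : Ideal R} [hP : P.IsPrime]
    [hQ : Q.IsPrime] (h₁ : ¬ P ≤ Q) (h₂ : ¬ Q ≤ P) {J : Ideal R} :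
    J ∈ (P ⊓ Q).minimalPrimes ↔ J = P ∨ J = Q := by
  constructor
  · rintro ⟨⟨hJ, hle⟩, hmin⟩
    rcases hJ.inf_le.1 hle with h | h
    · exact Or.inl (le_antisymm (hmin ⟨hP, inf_le_left⟩ h) h)
    · exact Or.inr (le_antisymm (hmin ⟨hQ, inf_le_right⟩ h) h)
  · rintro (rfl | rfl)
    · refine ⟨⟨hP, inf_le_left⟩, fun J' ⟨hJ', hle⟩ h => ?_⟩
      exact (hJ'.inf_le.1 hle).elim id fun h' => absurd (h'.trans h) h₂
    · refine ⟨⟨hQ, inf_le_right⟩, fun J' ⟨hJ', hle⟩ h => ?_⟩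
      exact (hJ'.inf_le.1 hle).elim (fun h' => absurd (h'.trans h) h₁) id

/-- With a single place the sum of pushforwards has one term. The restriction is an isomorphism of
fields, so the pushforward is the inverse of the pullback. -/
theorem isResidue_iff_of_unique {d : ℕ} {X D : Variety n} (V₀ : Place X D)
    (huniq : ∀ V : Place X D, V = V₀)
    (hsurj : ∀ j : FunctionField D →ₐ[ℂ] IsLocalRing.ResidueField V₀.1,
      IsRestriction V₀ j → Function.Surjective j)
    {ω : Forms (FunctionField X)} {θ : Forms (FunctionField D)} :
    IsResidue d X D ω θ ↔ ∃ (j : FunctionField D →ₐ[ℂ] IsLocalRing.ResidueField V₀.1)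
      (ψ : Forms (IsLocalRing.ResidueField V₀.1)),
      IsRestriction V₀ j ∧ IsResidueAt d V₀.1 ω ψ ∧ formMap j θ = ψ := by
  let _ : Unique (Place X D) := ⟨⟨V₀⟩, huniq⟩
  constructor
  · rintro ⟨res, hres, hθ⟩
    have hθ' : θ = res V₀ := hθ.trans (finsum_unique res)
    rw [hθ']
    exact (hres V₀).imp fun j hj => hj.imp fun ψ hψ =>
      ⟨hψ.1, hψ.2.1, (isPushforward_iff j (hsurj j hψ.1) ψ _).1 hψ.2.2⟩
  · rintro ⟨j, ψ, hj, hψ, hp⟩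
    have key : ∃ (j : FunctionField D →ₐ[ℂ] IsLocalRing.ResidueField V₀.1)
        (ψ : Forms (IsLocalRing.ResidueField V₀.1)),
        IsRestriction V₀ j ∧ IsResidueAt d V₀.1 ω ψ ∧ IsPushforward j ψ θ :=
      ⟨j, ψ, hj, hψ, (isPushforward_iff j (hsurj j hj) ψ _).2 hp⟩
    exact ⟨fun _ => θ, fun V => huniq V ▸ key,
      (finsum_unique (fun _ : Place X D => θ)).symm⟩

theorem formMap_one_eq_smul_one_iff {A B : Type} [CommRing A] [CommRing B] [Algebra ℂ A]
    [Algebra ℂ B] (φ : A →ₐ[ℂ] B) (x : B) : formMap φ 1 = x • 1 ↔ x = 1 := by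
  rw [map_one, ← Algebra.algebraMap_eq_smul_one, ← map_one (algebraMap B (Forms B)),
    (ExteriorAlgebra.algebraMap_leftInverse (R := B) _).injective.eq_iff, eq_comm]

theorem formMap_neg_one_eq_smul_one_iff {A B : Type} [CommRing A] [CommRing B] [Algebra ℂ A]
    [Algebra ℂ B] (φ : A →ₐ[ℂ] B) (x : B) : formMap φ (-1) = x • 1 ↔ x = -1 := by
  rw [map_neg, neg_eq_iff_eq_neg, ← neg_smul, formMap_one_eq_smul_one_iff, neg_eq_iff_eq_neg]

theorem hasPole_iff_of_unique {d : ℕ} {X D : Variety n} (V₀ : Place X D)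
    (huniq : ∀ V : Place X D, V = V₀) {ω : Forms (FunctionField X)} :
    HasPole d X D ω ↔ ¬ IsRegularForm d V₀.1 ω :=
  ⟨fun ⟨V, hV⟩ => huniq V ▸ hV, fun h => ⟨V₀, h⟩⟩

end UniquePlace

/-! ### Monomial rational curves -/

/-- `D` is the closure of the image of `τ ↦ (τ ^ d i)ᵢ`, where some exponent is `0` and two
exponents differ by `1`. -/
structure IsMonomialCurve {n : ℕ} (D : Variety n) (d : Fin (n + 1) → ℕ) (j k l m : Fin (n + 1)) :
    Prop where
  mem_ideal_iff : ∀ (e : ℕ) (a : CoordRing n), a.IsHomogeneous e →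
    (a ∈ D.ideal ↔ aeval (fun i => (Polynomial.X ^ d i : Polynomial ℂ)) a = 0)
  eq_zero : d j = 0
  le_max : ∀ i, d i ≤ d k
  eq_succ : d m = d l + 1

namespace IsMonomialCurve

variable {n : ℕ} {D : Variety n} {d : Fin (n + 1) → ℕ} {j k l m : Fin (n + 1)}
  (h : IsMonomialCurve D d j k l m)

include h

theorem X_notMem (i : Fin (n + 1)) : (MvPolynomial.X i : CoordRing n) ∉ D.ideal := by
  rw [h.mem_ideal_iff 1 _ (isHomogeneous_X ℂ i), aeval_X]
  exact pow_ne_zero _ Polynomial.X_ne_zero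

/-- The parametrization embeds the function field into ℂ(τ), where identities between coordinates
can be read off from exponents. -/
theorem exists_algHom : ∃ φ : FunctionField D →ₐ[ℂ] RatFunc ℂ,
    ∀ i i', φ (affCoord D i i') = RatFunc.X ^ d i' / RatFunc.X ^ d i := by
  obtain ⟨φ, hφ⟩ := exists_algHom_of_homogeneous (dehom D j)
    ((IsScalarTower.toAlgHom ℂ (Polynomial ℂ) (RatFunc ℂ)).comp
      (aeval fun i => (Polynomial.X ^ d i : Polynomial ℂ)))
    (fun e a ha => by
      rw [dehom_eq_zero_iff D (h.X_notMem j) ha, h.mem_ideal_iff e a ha, AlgHom.comp_apply]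
      exact (map_eq_zero_iff _ (IsFractionRing.injective (Polynomial ℂ) (RatFunc ℂ))).symm)
    (fun y => by
      obtain ⟨e, a, b, ha, hb, hbD, hy⟩ := exists_eq_dehom_div D (h.X_notMem j) y
      exact ⟨e, a, b, ha, hb, mt (dehom_eq_zero_iff D (h.X_notMem j) hb).1 hbD, hy⟩)
  refine ⟨φ, fun i i' => ?_⟩
  rw [affCoord_eq_div D (h.X_notMem j), ← dehom_X, ← dehom_X, hφ 1 _ _ (isHomogeneous_X ℂ i')
    (isHomogeneous_X ℂ i)]
  · simp only [AlgHom.comp_apply, aeval_X, map_pow, IsScalarTower.coe_toAlgHom', RatFunc.algebraMap_X]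
  · exact mt (dehom_eq_zero_iff D (h.X_notMem j) (isHomogeneous_X ℂ i)).1 (h.X_notMem i)

theorem coord_ne_zero : affCoord D l m ≠ 0 := affCoord_ne_zero D (h.X_notMem l) (h.X_notMem m)

theorem affCoord_eq (i i' : Fin (n + 1)) :
    affCoord D i i' = affCoord D l m ^ d i' / affCoord D l m ^ d i := by
  obtain ⟨φ, hφ⟩ := h.exists_algHom
  refine φ.injective (?_ : φ _ = φ _)
  have hX : (RatFunc.X : RatFunc ℂ) ≠ 0 := RatFunc.X_ne_zero
  have ht : φ (affCoord D l m) = RatFunc.X := by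
    rw [hφ, h.eq_succ, pow_succ, mul_div_cancel_left₀ _ (pow_ne_zero _ hX)]
  rw [map_div₀, map_pow, map_pow, ht, hφ]

/-- The exponents of X_m and X_l differ by one, so t = X_m/X_l maps to τ; it is transcendental, and
all coordinates are quotients of powers of it. -/
theorem isChart : IsChart ![affCoord D l m] := by
  refine ⟨?_, ?_⟩
  · rw [algebraicIndependent_unique_type_iff]
    obtain ⟨φ, hφ⟩ := h.exists_algHom
    have hX : (RatFunc.X : RatFunc ℂ) ≠ 0 := RatFunc.X_ne_zero
    have ht : φ (affCoord D l m) = RatFunc.X := by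
      rw [hφ, h.eq_succ, pow_succ, mul_div_cancel_left₀ _ (pow_ne_zero _ hX)]
    intro halg
    have h1 : IsAlgebraic ℂ (RatFunc.X : RatFunc ℂ) := by
      rw [← ht]
      exact halg.algHom φ
    rw [← RatFunc.algebraMap_X, isAlgebraic_algebraMap_iff
      (IsFractionRing.injective (Polynomial ℂ) (RatFunc ℂ))] at h1
    exact Polynomial.transcendental_X ℂ h1
  · rw [eq_top_iff, ← adjoin_affCoord D (h.X_notMem j), IntermediateField.adjoin_le_iff]
    rintro _ ⟨i, rfl⟩
    have ht : affCoord D l m ∈ IntermediateField.adjoin ℂ (Set.range ![affCoord D l m]) :=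
      IntermediateField.subset_adjoin _ _ ⟨0, rfl⟩
    rw [h.affCoord_eq j i]
    exact div_mem (pow_mem ht _) (pow_mem ht _)

theorem isChart_inv : IsChart ![(affCoord D l m)⁻¹] := by
  refine isChart_of_trdeg ?_ h.isChart.trdeg
  rw [eq_top_iff, ← h.isChart.gen, IntermediateField.adjoin_le_iff]
  rintro _ ⟨i, rfl⟩
  have ht : (affCoord D l m)⁻¹ ∈ IntermediateField.adjoin ℂ (Set.range ![(affCoord D l m)⁻¹]) :=
      IntermediateField.subset_adjoin _ _ ⟨0, rfl⟩
  fin_cases i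
  simpa using inv_mem ht

theorem trdeg_eq_one : Algebra.trdeg ℂ (FunctionField D) = (1 : ℕ) := h.isChart.trdeg

theorem affCoord_zero (i : Fin (n + 1)) : affCoord D j i = affCoord D l m ^ d i := by
  rw [h.affCoord_eq, h.eq_zero, pow_zero, div_one]

/-- Dividing by the coordinate of highest exponent leaves nonnegative powers of t⁻¹; this chart
contains the point τ = ∞. -/
theorem affCoord_infty (i : Fin (n + 1)) :
    affCoord D k i = (affCoord D l m)⁻¹ ^ (d k - d i) := by
  have := h.coord_ne_zero
  rw [h.affCoord_eq, inv_pow, div_eq_iff (pow_ne_zero _ this),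
    ← Nat.sub_add_cancel (h.le_max i), pow_add, Nat.add_sub_cancel,
    inv_mul_cancel_left₀ (pow_ne_zero _ this)]

theorem dehom_eq (a : CoordRing n) : dehom D j a =
    Polynomial.aeval (affCoord D l m) (aeval (fun i => (Polynomial.X ^ d i : Polynomial ℂ)) a) := by
  rw [dehom, funext h.affCoord_zero, ← AlgHom.comp_apply, comp_aeval]
  simp

omit h in
theorem eval_aeval_eq (a : CoordRing n) (τ : ℂ) :
    Polynomial.eval τ (aeval (fun i => (Polynomial.X ^ d i : Polynomial ℂ)) a) =
      eval (fun i => τ ^ d i) a := by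
  rw [← Polynomial.coe_aeval_eq_eval, ← AlgHom.comp_apply, comp_aeval, ← aeval_self_eq_eval]
  simp

end IsMonomialCurve

/-! ### The forms c dt/(t² - 1) and their residues -/

section LineForms

variable {K : Type} [Field K] [Algebra ℂ K] {t : K}

theorem IsChart.sq_sub_one_ne_zero (h : IsChart ![t]) : t ^ 2 - 1 ≠ 0 := by
  have e1 := h.ne_algebraMap 1
  have e2 := h.ne_algebraMap (-1)
  rw [map_neg, map_one, sub_neg_eq_add] at e2
  rw [map_one] at e1
  rw [show t ^ 2 - 1 = (t - 1) * (t + 1) by ring]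
  exact mul_ne_zero e1 e2

theorem sq_sub_one_eq (t : K) {τ : ℂ} (hτ : τ ^ 2 = 1) :
    t ^ 2 - 1 = (t - algebraMap ℂ K τ) * (t + algebraMap ℂ K τ) := by
  have : algebraMap ℂ K τ ^ 2 = 1 := by rw [← map_pow, hτ, map_one]
  linear_combination this

theorem IsChart.const_div_mul_mem_linePlace (h : IsChart ![t]) {τ : ℂ} (hτ : τ ^ 2 = 1) (c : ℂ) :
    algebraMap ℂ K c / (t ^ 2 - 1) * (t - algebraMap ℂ K τ) ∈ linePlace t τ := by
  have hτ0 : τ ≠ 0 := by rintro rfl; norm_num at hτ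
  have hm := h.polynomial_inv_mem_linePlace (p := Polynomial.X + Polynomial.C τ) (a := τ)
    (by simpa using hτ0)
  rw [map_add, Polynomial.aeval_X, Polynomial.aeval_C] at hm
  have h1 := h.ne_algebraMap τ
  have h2 := h.ne_algebraMap (-τ)
  rw [map_neg, sub_neg_eq_add] at h2
  rw [sq_sub_one_eq t hτ, show algebraMap ℂ K c / ((t - algebraMap ℂ K τ) * (t + algebraMap ℂ K τ)) *
    (t - algebraMap ℂ K τ) = algebraMap ℂ K c * (t + algebraMap ℂ K τ)⁻¹ by field_simp]
  exact mul_mem (Subalgebra.algebraMap_mem _ _) hm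

/-- The residues of `c dt / (t ^ 2 - 1)` at `1` and `-1` are `c / 2` and `-c / 2`. -/
theorem IsChart.residue_const_div_iff (h : IsChart ![t]) {τ : ℂ} (hτ : τ ^ 2 = 1)
    [IsLocalRing (linePlace t τ)] (c : ℂ) :
    (∃ b : linePlace t τ, (b : K) = algebraMap ℂ K c / (t ^ 2 - 1) * (t - algebraMap ℂ K τ) ∧
      (residueMap (linePlace t τ) b = 1 ∨ residueMap (linePlace t τ) b = -1)) ↔
      c = 2 ∨ c = -2 := by
  have hτ0 : τ ≠ 0 := by rintro rfl; norm_num at hτ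
  let b₀ : linePlace t τ := ⟨_, h.const_div_mul_mem_linePlace hτ c⟩
  -- Multiplying by t + τ turns b₀ into the constant c, and t + τ has the value 2τ at τ.
  have hres : residueMap (linePlace t τ) b₀ = algebraMap ℂ _ (c / (2 * τ)) := by
    have h1 := h.residueMap_polynomial τ (Polynomial.X + Polynomial.C τ)
    rw [Polynomial.eval_add, Polynomial.eval_X, Polynomial.eval_C, ← two_mul] at h1
    rw [map_div₀, eq_div_iff ((map_ne_zero _).2 (mul_ne_zero two_ne_zero hτ0)), ← h1, ← map_mul,
      ← AlgHom.commutes (residueMap (linePlace t τ))]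
    congr 1
    apply Subtype.ext
    change algebraMap ℂ K c / (t ^ 2 - 1) * (t - algebraMap ℂ K τ) * Polynomial.aeval t _ =
      algebraMap ℂ K c
    have := h.sq_sub_one_ne_zero
    rw [map_add, Polynomial.aeval_X, Polynomial.aeval_C, mul_assoc, ← sq_sub_one_eq t hτ,
      div_mul_cancel₀ _ this]
  have hiff : (residueMap (linePlace t τ) b₀ = 1 ∨ residueMap (linePlace t τ) b₀ = -1) ↔
      c = 2 ∨ c = -2 := by
    have hinj : ∀ x y : ℂ, algebraMap ℂ (IsLocalRing.ResidueField (linePlace t τ)) x =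
        algebraMap ℂ _ y ↔ x = y := fun x y =>
      (algebraMap ℂ (IsLocalRing.ResidueField (linePlace t τ))).injective.eq_iff
    have e1 : (1 : IsLocalRing.ResidueField (linePlace t τ)) = algebraMap ℂ _ 1 := (map_one _).symm
    have e2 : (-1 : IsLocalRing.ResidueField (linePlace t τ)) = algebraMap ℂ _ (-1) := by
      rw [map_neg, map_one]
    rw [hres, e2, e1, hinj, hinj, div_eq_iff (mul_ne_zero two_ne_zero hτ0),
      div_eq_iff (mul_ne_zero two_ne_zero hτ0)]
    rcases mul_self_eq_one_iff.1 ((pow_two τ).symm.trans hτ) with rfl | rfl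
    · simp
    · simp [or_comm]
  rw [← hiff]
  constructor
  · rintro ⟨b, hb, h'⟩
    rwa [show b = b₀ from Subtype.ext hb] at h'
  · intro h'
    exact ⟨b₀, rfl, h'⟩

theorem IsChart.const_div_notMem_linePlace (h : IsChart ![t]) {τ : ℂ} (hτ : τ ^ 2 = 1) {c : ℂ}
    (hc : c ≠ 0) : algebraMap ℂ K c / (t ^ 2 - 1) ∉ linePlace t τ := by
  intro hmem
  apply h.sub_inv_notMem_linePlace τ
  have h0 := h.sq_sub_one_ne_zero
  have hcK : algebraMap ℂ K c ≠ 0 := (map_ne_zero _).2 hc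
  have h1 : (t - algebraMap ℂ K τ)⁻¹ = algebraMap ℂ K c / (t ^ 2 - 1) *
      (t + algebraMap ℂ K τ) * algebraMap ℂ K c⁻¹ := by
    have h2 : t - algebraMap ℂ K τ ≠ 0 := h.ne_algebraMap τ
    rw [sq_sub_one_eq t hτ] at h0 ⊢
    have h3 := right_ne_zero_of_mul h0
    rw [map_inv₀]
    field_simp
  rw [h1]
  exact mul_mem (mul_mem hmem (add_mem (self_mem_linePlace t τ) (Subalgebra.algebraMap_mem _ _)))
    (Subalgebra.algebraMap_mem _ _)

theorem isAtlas_line (ht : t ≠ 0) : IsAtlas ({Algebra.adjoin ℂ (Set.range ![t]),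
    Algebra.adjoin ℂ (Set.range ![t⁻¹])} : Set (Subalgebra ℂ K)) := by
  have hw : ∀ i, (![t, 1] : Fin 2 → K) i ≠ 0 := by
    intro i; fin_cases i
    exacts [ht, one_ne_zero]
  have hA : ∀ s : K, Algebra.adjoin ℂ ({1, s} : Set K) = Algebra.adjoin ℂ (Set.range ![s]) := by
    intro s
    rw [Matrix.range_cons, Matrix.range_empty, Set.union_empty]
    refine le_antisymm (adjoin_pair_le.2 ⟨one_mem _, Algebra.subset_adjoin rfl⟩)
      (Algebra.adjoin_mono (by simp))
  have hpair : ∀ {α : Type} (f : Fin 2 → α), Set.range f = {f 0, f 1} := by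
    intro α f
    ext x
    simp [Fin.exists_fin_two, eq_comm]
  have h := isAtlas_standard (![t, 1] : Fin 2 → K) hw
  rw [hpair, hpair, hpair] at h
  simp only [Matrix.cons_val_zero, Matrix.cons_val_one, div_self ht, div_one, one_div] at h
  rw [hA, Set.pair_comm t 1, hA, Set.pair_comm] at h
  exact h

end LineForms

/-! ### Real points of a monomial curve and the places over them -/

namespace IsMonomialCurve

variable {n : ℕ} {D : Variety n} {d : Fin (n + 1) → ℕ} {j k l m : Fin (n + 1)}
  (h : IsMonomialCurve D d j k l m)

/-- The real point with parameter `τ`. -/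
def realPoint (d : Fin (n + 1) → ℕ) (τ : ℝ) : Fin (n + 1) → ℝ := fun i => τ ^ d i

include h

theorem realPoint_ne_zero (τ : ℝ) : realPoint d τ ≠ 0 := fun h0 => by
  have := congrFun h0 j
  simp [realPoint, h.eq_zero] at this

omit h in
theorem eval_realPoint (τ : ℝ) (a : CoordRing n) :
    eval (fun i => (realPoint d τ i : ℂ)) a =
      Polynomial.eval (τ : ℂ) (aeval (fun i => (Polynomial.X ^ d i : Polynomial ℂ)) a) := by
  rw [eval_aeval_eq]
  simp [realPoint]

theorem realPoint_mem (τ : ℝ) :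
    Projectivization.mk ℝ (realPoint d τ) (h.realPoint_ne_zero τ) ∈ realPoints D := by
  rw [mk_mem_realPoints_iff]
  intro e f hf hfD
  rw [eval_realPoint, (h.mem_ideal_iff e f hf).1 hfD, Polynomial.eval_zero]

/-- A homogeneous polynomial vanishing on S pulls back to a polynomial in τ with infinitely many
roots, so infinitely many points of the curve are Zariski dense in it. -/
theorem vanishingIdeal_eq {S : Set (RealProj n)} (hS : S ⊆ realPoints D)
    (hinf : {τ : ℝ | Projectivization.mk ℝ (realPoint d τ) (h.realPoint_ne_zero τ) ∈ S}.Infinite) :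
    vanishingIdeal S = D.ideal := by
  refine (D.ideal_eq_of_homogeneous (fun f hf => vanishingIdeal_homogeneousComponent hf) ?_).symm
  intro e a ha
  constructor
  · intro haD v hv hvS
    exact mk_mem_realPoints_iff.1 (hS hvS) e a ha haD
  · intro haS
    rw [h.mem_ideal_iff e a ha]
    apply Polynomial.eq_zero_of_infinite_isRoot
    refine (hinf.image Complex.ofReal_injective.injOn).mono ?_
    rintro _ ⟨τ, hτ, rfl⟩
    change Polynomial.eval _ _ = 0
    rw [← eval_realPoint]
    exact haS _ _ hτ

section Point

variable {τ : ℝ} {P : Variety n}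
  (hP : P.ideal = vanishingIdeal {Projectivization.mk ℝ (realPoint d τ) (h.realPoint_ne_zero τ)})

include hP

theorem mem_point_iff {e : ℕ} {a : CoordRing n} (ha : a.IsHomogeneous e) :
    a ∈ P.ideal ↔
      Polynomial.eval (τ : ℂ) (aeval (fun i => (Polynomial.X ^ d i : Polynomial ℂ)) a) = 0 := by
  rw [hP, mem_vanishingIdeal_singleton ha, eval_realPoint]

theorem ideal_le_point : D.ideal ≤ P.ideal :=
  D.ideal_le_of_homogeneous fun e a ha haD => by
    rw [h.mem_point_iff hP ha, (h.mem_ideal_iff e a ha).1 haD, Polynomial.eval_zero]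

/-- A homogeneous b does not vanish at the point exactly when its pullback has nonzero value at τ,
that is, when it is a unit in the local ring of the parameter line. Domination is all that is
claimed: at a cusp the local ring of the curve is strictly smaller. -/
theorem dominates_linePlace : Dominates (linePlace (affCoord D l m) τ) (localRing D P) := by
  constructor
  · intro x hx
    obtain ⟨e, a, b, ha, hb, hbP, rfl⟩ := (mem_localRing_iff (h.X_notMem j)).1 hx
    rw [h.mem_point_iff hP hb] at hbP
    rw [h.dehom_eq, h.dehom_eq, div_eq_mul_inv]
    exact mul_mem (polynomial_mem_linePlace _ _ _) (h.isChart.polynomial_inv_mem_linePlace hbP)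
  · intro x hx hxV
    obtain ⟨e, a, b, ha, hb, hbP, rfl⟩ := (mem_localRing_iff (h.X_notMem j)).1 hx
    by_cases haP : a ∈ P.ideal
    · rw [h.mem_point_iff hP ha, ← h.isChart.polynomial_inv_mem_linePlace_iff, ← h.dehom_eq] at haP
      rcases haP with h0 | h0
      · rw [h0, zero_div, inv_zero]
        exact (mem_localRing_iff (h.X_notMem j)).2 ⟨e, 0, b, isHomogeneous_zero _ _ _, hb, hbP,
          by simp⟩
      · exfalso
        apply h0
        have hb0 : dehom D j b ≠ 0 := fun hb0 =>
          hbP (h.ideal_le_point hP ((dehom_eq_zero_iff D (h.X_notMem j) hb).1 hb0))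
        rw [h.mem_point_iff hP hb] at hbP
        rw [show (dehom D j a)⁻¹ = (dehom D j a / dehom D j b)⁻¹ * (dehom D j b)⁻¹ by
          rw [inv_div, div_mul_eq_mul_div, mul_inv_cancel₀ hb0, one_div]]
        refine mul_mem hxV ?_
        rw [h.dehom_eq]
        exact h.isChart.polynomial_inv_mem_linePlace hbP
    · rw [inv_div]
      exact div_dehom_mem_localRing (h.X_notMem j) hb ha haP

/-- The place over the point with parameter `τ`. -/
def pointPlace : Place D P :=
  ⟨linePlace (affCoord D l m) τ, h.isChart.isValuationRingOf_linePlace _, h.dominates_linePlace hP⟩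

/-- For τ ≠ 0 no coordinate vanishes at the point, so t = X_m/X_l is regular there, while X_m - τX_l
vanishes. Any place over the point is thus centered at t = τ on the parameter line. -/
theorem place_eq (hτ : τ ≠ 0) (V : Place D P) : V = h.pointPlace hP := by
  have hne : ∀ i, (MvPolynomial.X i : CoordRing n) ∉ P.ideal := by
    intro i
    rw [h.mem_point_iff hP (isHomogeneous_X ℂ i), aeval_X, Polynomial.eval_pow, Polynomial.eval_X]
    exact pow_ne_zero _ (Complex.ofReal_ne_zero.2 hτ)
  apply Subtype.ext
  refine h.isChart.eq_linePlace V.2.1 (V.2.2.1 (affCoord_mem_localRing (hne l) m)) ?_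
  have hhom : (MvPolynomial.X m - C (τ : ℂ) * MvPolynomial.X l : CoordRing n).IsHomogeneous 1 :=
    (isHomogeneous_X ℂ m).sub ((isHomogeneous_X ℂ l).C_mul _)
  have h1 := inv_notMem_of_mem (h.ideal_le_point hP) V.2.2 (h.X_notMem l) hhom (isHomogeneous_X ℂ l)
    (by
      rw [h.mem_point_iff hP hhom, map_sub, map_mul, aeval_X, aeval_X, ← algebraMap_eq,
        AlgHom.commutes, h.eq_succ, Polynomial.algebraMap_eq]
      simp only [Polynomial.eval_sub, Polynomial.eval_mul, Polynomial.eval_pow, Polynomial.eval_X,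
        Polynomial.eval_C]
      ring) (hne l)
  rw [dehom_X_self D (h.X_notMem l), div_one, map_sub, map_mul, dehom_X_self D (h.X_notMem l),
    mul_one, dehom_X, ← algebraMap_eq, AlgHom.commutes] at h1
  exact h1.resolve_left (h.isChart.ne_algebraMap _)

/-- The residue field at τ is ℂ, which makes the restriction map surjective; the residue of g dt is
the value of g·(t - τ). -/
theorem exists_isResidue_iff (hτ : τ ≠ 0) [IsLocalRing (linePlace (affCoord D l m) (τ : ℂ))]
    (g : FunctionField D) :
    (∃ θ, IsResidue 0 D P (g • dForm (affCoord D l m)) θ ∧ (θ = 1 ∨ θ = -1)) ↔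
      ∃ b : linePlace (affCoord D l m) (τ : ℂ),
        (b : FunctionField D) = g * (affCoord D l m - algebraMap ℂ _ (τ : ℂ)) ∧
        (residueMap (linePlace (affCoord D l m) (τ : ℂ)) b = 1 ∨
          residueMap (linePlace (affCoord D l m) (τ : ℂ)) b = -1) := by
  have hsurj : ∀ j : FunctionField P →ₐ[ℂ] IsLocalRing.ResidueField (h.pointPlace hP).1,
      IsRestriction (h.pointPlace hP) j → Function.Surjective j := by
    intro j _ z
    obtain ⟨c, rfl⟩ := h.isChart.exists_residueMap_eq (τ : ℂ) z
    exact ⟨algebraMap ℂ _ c, j.commutes c⟩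
  have hiff : ∀ θ, IsResidue 0 D P (g • dForm (affCoord D l m)) θ ↔ _ := fun θ =>
    isResidue_iff_of_unique (h.pointPlace hP) (h.place_eq hP hτ) hsurj
  constructor
  · refine fun hex => hex.elim fun θ hθ => ((hiff θ).1 hθ.1).elim fun i hi => hi.elim fun ψ hψ => ?_
    refine ((h.isChart.isResidueAt_linePlace_iff (τ : ℂ) g _).1 hψ.2.1).imp fun b hb =>
      ⟨hb.1, ?_⟩
    have heq := hψ.2.2.trans hb.2
    rcases hθ.2 with h' | h'
    · rw [h'] at heq
      exact Or.inl ((formMap_one_eq_smul_one_iff i _).1 heq)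
    · rw [h'] at heq
      exact Or.inr ((formMap_neg_one_eq_smul_one_iff i _).1 heq)
  · refine fun hex => hex.elim fun b hb => ?_
    refine (exists_isRestriction (h.ideal_le_point hP) (h.pointPlace hP)).elim fun i hi => ?_
    have hψ := (h.isChart.isResidueAt_linePlace_iff (τ : ℂ) g _).2 ⟨b, hb.1, rfl⟩
    rcases hb.2 with h' | h'
    · exact ⟨1, (hiff 1).2 ⟨i, _, hi, hψ, (formMap_one_eq_smul_one_iff i _).2 h'⟩, Or.inl rfl⟩
    · exact ⟨-1, (hiff (-1)).2 ⟨i, _, hi, hψ, (formMap_neg_one_eq_smul_one_iff i _).2 h'⟩,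
        Or.inr rfl⟩

theorem hasPole_iff (hτ : τ ≠ 0) (g : FunctionField D) :
    HasPole 1 D P (g • dForm (affCoord D l m)) ↔ g ∉ linePlace (affCoord D l m) (τ : ℂ) := by
  rw [hasPole_iff_of_unique (h.pointPlace hP) (h.place_eq hP hτ)]
  exact not_congr (h.isChart.isRegularForm_linePlace_iff (τ : ℂ) g)

end Point

end IsMonomialCurve

theorem realPoints_point {n : ℕ} {v : Fin (n + 1) → ℝ} {hv : v ≠ 0} {P : Variety n}
    (hP : P.ideal = vanishingIdeal {Projectivization.mk ℝ v hv}) :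
    realPoints P = {Projectivization.mk ℝ v hv} := by
  refine Set.Subset.antisymm (fun p hp => ?_) (mem_realPoints_of_vanishingIdeal hP.le)
  obtain ⟨hF, heq⟩ := singleton_eq_basicSet v hv
  rw [heq]
  induction p using Projectivization.ind with
  | h w hw =>
    rw [mk_mem_basicSet hF]
    intro i
    have hhom : (C (v i.1 : ℂ) * MvPolynomial.X i.2 - C (v i.2 : ℂ) * MvPolynomial.X i.1 :
        CoordRing n).IsHomogeneous 1 :=
      ((isHomogeneous_X ℂ i.2).C_mul _).sub ((isHomogeneous_X ℂ i.1).C_mul _)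
    have h := mk_mem_realPoints_iff.1 hp 1 _ hhom (by
      rw [hP, mem_vanishingIdeal_singleton hhom]
      simp only [map_sub, map_mul, eval_X, eval_C]
      ring)
    simp only [map_sub, map_mul, eval_X, eval_C] at h
    have h' : v i.1 * w i.2 - v i.2 * w i.1 = 0 := by exact_mod_cast h
    simp only [map_neg, map_pow, map_sub, map_mul, eval_X, eval_C, h']
    norm_num

/-! ### Logarithmic forms on a monomial curve with poles at ±1 -/

namespace IsMonomialCurve

variable {n : ℕ} {D : Variety n} {d : Fin (n + 1) → ℕ} {j k l m : Fin (n + 1)}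
  (h : IsMonomialCurve D d j k l m)

include h

theorem max_pos : d k ≠ 0 := by
  have h1 := h.le_max m
  have h2 := h.eq_succ
  omega

theorem dehom_infty : dehom D k (MvPolynomial.X k ^ 2 - MvPolynomial.X j ^ 2) =
    aeval ![(affCoord D l m)⁻¹] (1 - MvPolynomial.X 0 ^ (2 * d k) : MvPolynomial (Fin 1) ℂ) := by
  rw [map_sub, map_pow, map_pow, dehom_X, dehom_X, h.affCoord_infty, h.affCoord_infty, h.eq_zero]
  simp only [map_sub, map_one, map_pow, aeval_X, Matrix.cons_val_zero, Nat.sub_self, Nat.sub_zero,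
    pow_zero, one_pow, ← pow_mul, mul_comm 2]

theorem form_eq_infty (g : FunctionField D) : g • dForm (affCoord D l m) =
    (-(g * affCoord D l m ^ 2)) • dForm (affCoord D l m)⁻¹ := by
  have h0 := h.coord_ne_zero
  rw [dForm_inv h0, smul_smul]
  congr 1
  field_simp

/-- All of I vanishes at τ, which gives one inclusion. For the other, r restricts to (t - τ)(t + τ),
and the second factor is a unit at τ. -/
theorem pullbackIdeal_point {τ : ℂ} (hτ : τ ^ 2 = 1) {I : Ideal (CoordRing n)}
    (hI : ∀ (e : ℕ) (a : CoordRing n), a.IsHomogeneous e → a ∈ I →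
      Polynomial.eval τ (aeval (fun i => (Polynomial.X ^ d i : Polynomial ℂ)) a) = 0)
    {e : ℕ} {r : CoordRing n} (hr : r.IsHomogeneous e) (hrI : r ∈ I)
    (hrd : aeval (fun i => (Polynomial.X ^ d i : Polynomial ℂ)) r = Polynomial.X ^ 2 - 1)
    {Q : Variety n} (hDQ : D.ideal ≤ Q.ideal) (hjQ : (MvPolynomial.X j : CoordRing n) ∉ Q.ideal)
    (hdom : Dominates (linePlace (affCoord D l m) τ) (localRing D Q)) :
    pullbackIdeal D Q I (linePlace (affCoord D l m) τ) =
      Ideal.span {⟨affCoord D l m - algebraMap ℂ _ τ, sub_mem_linePlace _ τ τ⟩} := by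
  have hloc : IsLocalRing (linePlace (affCoord D l m) τ) :=
    (h.isChart.isValuationRingOf_linePlace τ).isLocalRing
  have hj := h.X_notMem j
  apply le_antisymm
  · rw [← h.isChart.maximalIdeal_linePlace, pullbackIdeal, Ideal.span_le]
    rintro x ⟨e, a, b, ha, hb, haI, hbQ, hx⟩
    rw [coe_eq_ratio_iff D hj ha hb] at hx
    have h1 := (h.isChart.polynomial_inv_mem_linePlace_iff _ τ).2 (hI e a ha haI)
    rw [← h.dehom_eq] at h1
    rw [SetLike.mem_coe, mem_maximalIdeal_iff, hx]
    rcases h1 with h1 | h1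
    · left
      rw [h1, zero_div]
    · right
      intro hcon
      apply h1
      have hbinv := hdom.1 (inv_dehom_mem_localRing hj hb hbQ)
      have hb0 : dehom D j b ≠ 0 := fun h0 => hbQ (hDQ ((dehom_eq_zero_iff D hj hb).1 h0))
      rw [show (dehom D j a)⁻¹ = (dehom D j a / dehom D j b)⁻¹ * (dehom D j b)⁻¹ by
        rw [inv_div, div_mul_eq_mul_div, mul_inv_cancel₀ hb0, one_div]]
      exact mul_mem hcon hbinv
  · rw [Ideal.span_singleton_le_iff_mem]
    have hτ0 : τ ≠ 0 := by rintro rfl; norm_num at hτ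
    have hXe : (MvPolynomial.X j ^ e : CoordRing n).IsHomogeneous e := by
      simpa using (isHomogeneous_X ℂ j).pow e
    have hrt : dehom D j r = affCoord D l m ^ 2 - 1 := by
      rw [h.dehom_eq, hrd, map_sub, map_pow, Polynomial.aeval_X, map_one]
    have hmem : (⟨dehom D j r, by rw [h.dehom_eq]; exact polynomial_mem_linePlace _ _ _⟩ :
        linePlace (affCoord D l m) τ) ∈ pullbackIdeal D Q I (linePlace (affCoord D l m) τ) := by
      refine Ideal.subset_span ⟨e, r, MvPolynomial.X j ^ e, hr, hXe, hrI,
        fun h0 => hjQ (Q.isPrime.mem_of_pow_mem _ h0), ?_⟩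
      rw [coe_eq_ratio_iff D hj hr hXe, map_pow, dehom_X_self D hj, one_pow, div_one]
    have hm := h.isChart.polynomial_inv_mem_linePlace (p := Polynomial.X + Polynomial.C τ) (a := τ)
      (by simpa using hτ0)
    rw [map_add, Polynomial.aeval_X, Polynomial.aeval_C] at hm
    have hne : affCoord D l m + algebraMap ℂ _ τ ≠ 0 := by
      have := h.isChart.ne_algebraMap (-τ)
      rwa [map_neg, sub_neg_eq_add] at this
    refine (congrArg (· ∈ _) (Subtype.ext ?_)).mpr (Ideal.mul_mem_right ⟨_, hm⟩ _ hmem)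
    change _ = dehom D j r * (affCoord D l m + algebraMap ℂ _ τ)⁻¹
    rw [hrt, sq_sub_one_eq _ hτ, mul_inv_cancel_right₀ hne]

/-- Where r vanishes the center is one of the points τ = ±1 and the pole is simple; elsewhere 1/(t²
- 1) is regular and the divisor is empty. -/
theorem isLogAt_finite {I : Ideal (CoordRing n)}
    (hI : ∀ (e : ℕ) (a : CoordRing n), a.IsHomogeneous e → a ∈ I → ∀ τ : ℂ, τ ^ 2 = 1 →
      Polynomial.eval τ (aeval (fun i => (Polynomial.X ^ d i : Polynomial ℂ)) a) = 0)
    {e : ℕ} {r : CoordRing n} (hr : r.IsHomogeneous e) (hrI : r ∈ I)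
    (hrd : aeval (fun i => (Polynomial.X ^ d i : Polynomial ℂ)) r = Polynomial.X ^ 2 - 1)
    (c : ℂ) (P : Ideal (MvPolynomial (Fin 1) ℂ)) [hP : P.IsPrime] :
    ∃ Q : Variety n, D.ideal ≤ Q.ideal ∧
      Dominates (locRing ![affCoord D l m] P) (localRing D Q) ∧
      IsLogAt 1 (locRing ![affCoord D l m] P) (pullbackIdeal D Q I (locRing ![affCoord D l m] P))
        ((algebraMap ℂ _ c / (affCoord D l m ^ 2 - 1)) • dForm (affCoord D l m)) := by
  have hloc := h.isChart.isLocalRing_locRing (P := P)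
  have htO : affCoord D l m ∈ locRing ![affCoord D l m] P := coord_mem_locRing 0
  obtain ⟨Q, hDQ, hdom, hjQ, hQ⟩ := exists_center D (h.X_notMem j) (locRing ![affCoord D l m] P)
    (fun i => by rw [h.affCoord_zero]; exact pow_mem htO _)
  refine ⟨Q, hDQ, hdom, ?_⟩
  have hrt : dehom D j r = affCoord D l m ^ 2 - 1 := by
    rw [h.dehom_eq, hrd, map_sub, map_pow, Polynomial.aeval_X, map_one]
  by_cases hrQ : r ∈ Q.ideal
  · have hrt' : dehom D j r = aeval ![affCoord D l m] (MvPolynomial.X 0 ^ 2 - 1 :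
        MvPolynomial (Fin 1) ℂ) := by rw [hrt]; simp
    have hPm := (hQ e r hr).1 hrQ
    rw [hrt', h.isChart.inv_aeval_mem_locRing_iff] at hPm
    obtain ⟨τ, hτ, hτP⟩ : ∃ τ : ℂ, τ ^ 2 = 1 ∧
        (MvPolynomial.X 0 - C τ : MvPolynomial (Fin 1) ℂ) ∈ P := by
      rw [show (MvPolynomial.X 0 ^ 2 - 1 : MvPolynomial (Fin 1) ℂ) =
        (MvPolynomial.X 0 - C 1) * (MvPolynomial.X 0 - C (-1)) by simp; ring] at hPm
      rcases hP.mem_or_mem hPm with h1 | h1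
      · exact ⟨1, one_pow _, h1⟩
      · exact ⟨-1, by norm_num, h1⟩
    have hPτ : linePrime τ = P := (inferInstance : (linePrime τ).IsMaximal).eq_of_le hP.ne_top
      (by rwa [linePrime_eq_span, Ideal.span_singleton_le_iff_mem])
    subst hPτ
    have hloc' : IsLocalRing (linePlace (affCoord D l m) τ) := hloc
    refine h.isChart.isLogAt_line_point (linePrime_eq_span τ) ?_ ?_
    · have hpb := h.pullbackIdeal_point hτ (fun e a ha haI => hI e a ha haI τ hτ) hr hrI hrd
        hDQ hjQ hdom
      have hmax := h.isChart.maximalIdeal_linePlace τ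
      have hfun : (⟨aeval ![affCoord D l m] (MvPolynomial.X 0 - C τ : MvPolynomial (Fin 1) ℂ),
          aeval_mem_locRing _⟩ : locRing ![affCoord D l m] (linePrime τ)) =
          ⟨affCoord D l m - algebraMap ℂ _ τ, sub_mem_linePlace _ τ τ⟩ := by
        apply Subtype.ext
        simp [← algebraMap_eq]
      rw [hfun]
      refine (congrArg Ideal.radical (hpb.trans hmax.symm)).trans
        (Eq.trans ?_ hmax)
      exact (IsLocalRing.maximalIdeal.isMaximal _).isPrime.radical
    · have := h.isChart.const_div_mul_mem_linePlace hτ c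
      rw [map_sub, aeval_X, ← algebraMap_eq, AlgHom.commutes]
      exact this
  · rw [pullbackIdeal_eq_top hDQ hr hrI hrQ]
    rw [hQ e r hr, hrt] at hrQ
    push Not at hrQ
    refine h.isChart.isLogAt_line_top ?_
    rw [div_eq_mul_inv]
    exact mul_mem (Subalgebra.algebraMap_mem _ _) hrQ.2

/-- In s = t⁻¹ the form is -c/(1 - s²) ds, regular at s = 0. The element X_k² - X_j² of I becomes 1
- s^(2 d k), so the divisor is empty there. -/
theorem isLogAt_infty {I : Ideal (CoordRing n)}
    (hr' : MvPolynomial.X k ^ 2 - MvPolynomial.X j ^ 2 ∈ I) (c : ℂ)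
    (P : Ideal (MvPolynomial (Fin 1) ℂ)) [hP : P.IsPrime] (hX0 : MvPolynomial.X 0 ∈ P) :
    ∃ Q : Variety n, D.ideal ≤ Q.ideal ∧
      Dominates (locRing ![(affCoord D l m)⁻¹] P) (localRing D Q) ∧
      IsLogAt 1 (locRing ![(affCoord D l m)⁻¹] P)
        (pullbackIdeal D Q I (locRing ![(affCoord D l m)⁻¹] P))
        ((algebraMap ℂ _ c / (affCoord D l m ^ 2 - 1)) • dForm (affCoord D l m)) := by
  have hsq := h.isChart.sq_sub_one_ne_zero
  have ht0 := h.coord_ne_zero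
  have hloc := h.isChart_inv.isLocalRing_locRing (P := P)
  have htO : (affCoord D l m)⁻¹ ∈ locRing ![(affCoord D l m)⁻¹] P := coord_mem_locRing 0
  have hinv : ∀ s : ℕ, s ≠ 0 → (1 - (affCoord D l m)⁻¹ ^ s) ≠ 0 ∧
      (1 - (affCoord D l m)⁻¹ ^ s)⁻¹ ∈ locRing ![(affCoord D l m)⁻¹] P := by
    intro s hs
    have hnP : (1 - MvPolynomial.X 0 ^ s : MvPolynomial (Fin 1) ℂ) ∉ P := fun hmem =>
      hP.ne_top ((Ideal.eq_top_iff_one _).2 (by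
        simpa using P.add_mem hmem (P.pow_mem_of_mem hX0 s (Nat.pos_of_ne_zero hs))))
    rw [← h.isChart_inv.inv_aeval_mem_locRing_iff] at hnP
    push Not at hnP
    simpa using hnP
  obtain ⟨Q, hDQ, hdom, hkQ, hQ⟩ := exists_center D (h.X_notMem k)
    (locRing ![(affCoord D l m)⁻¹] P) (fun i => by rw [h.affCoord_infty]; exact pow_mem htO _)
  refine ⟨Q, hDQ, hdom, ?_⟩
  have hr2 : (MvPolynomial.X k ^ 2 - MvPolynomial.X j ^ 2 : CoordRing n).IsHomogeneous (1 * 2) :=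
    ((isHomogeneous_X ℂ k).pow 2).sub ((isHomogeneous_X ℂ j).pow 2)
  have hrQ : (MvPolynomial.X k ^ 2 - MvPolynomial.X j ^ 2 : CoordRing n) ∉ Q.ideal := by
    rw [hQ _ _ hr2, h.dehom_infty]
    push Not
    have := hinv (2 * d k) (by have := h.max_pos; omega)
    simpa using this
  rw [pullbackIdeal_eq_top hDQ hr2 hr' hrQ, h.form_eq_infty]
  refine h.isChart_inv.isLogAt_line_top ?_
  rw [show -(algebraMap ℂ _ c / (affCoord D l m ^ 2 - 1) * affCoord D l m ^ 2) =
    algebraMap ℂ _ (-c) * (1 - (affCoord D l m)⁻¹ ^ 2)⁻¹ by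
      rw [map_neg, show 1 - (affCoord D l m)⁻¹ ^ 2 =
        (affCoord D l m ^ 2 - 1) / affCoord D l m ^ 2 by field_simp, inv_div]
      ring]
  exact mul_mem (Subalgebra.algebraMap_mem _ _) (hinv 2 two_ne_zero).2


theorem isLogarithmic {I : Ideal (CoordRing n)}
    (hI : ∀ (e : ℕ) (a : CoordRing n), a.IsHomogeneous e → a ∈ I → ∀ τ : ℂ, τ ^ 2 = 1 →
      Polynomial.eval τ (aeval (fun i => (Polynomial.X ^ d i : Polynomial ℂ)) a) = 0)
    {e : ℕ} {r : CoordRing n} (hr : r.IsHomogeneous e) (hrI : r ∈ I)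
    (hrd : aeval (fun i => (Polynomial.X ^ d i : Polynomial ℂ)) r = Polynomial.X ^ 2 - 1)
    (hr' : MvPolynomial.X k ^ 2 - MvPolynomial.X j ^ 2 ∈ I) (c : ℂ) :
    IsLogarithmic 1 D I
      ((algebraMap ℂ _ c / (affCoord D l m ^ 2 - 1)) • dForm (affCoord D l m)) := by
  classical
  have hAt := isAtlas_line h.coord_ne_zero
  refine ⟨Submodule.smul_mem _ _ (dForm_mem_exteriorPower_one _), _, IsAtlas.isCompleteModel
    (𝒜 := {Algebra.adjoin ℂ (Set.range ![affCoord D l m]),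
      Algebra.adjoin ℂ (Set.range ![(affCoord D l m)⁻¹])}) (by rwa [Finset.coe_pair]) ?_, ?_⟩
  · intro A hA
    rcases Finset.mem_insert.1 hA with rfl | hA
    · exact ⟨Subalgebra.fg_def.2 ⟨_, Set.finite_range _, rfl⟩, h.isChart.isFractionRing_adjoin⟩
    · rw [Finset.mem_singleton.1 hA]
      exact ⟨Subalgebra.fg_def.2 ⟨_, Set.finite_range _, rfl⟩, h.isChart_inv.isFractionRing_adjoin⟩
  intro O hO
  rw [Finset.coe_pair] at hO
  obtain ⟨V, hV, hOV⟩ := hAt.exists_eq_centerRing hO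
  by_cases htV : affCoord D l m ∈ V
  · have hu : ∀ i, ![affCoord D l m] i ∈ V := fun i => by fin_cases i; exact htV
    obtain ⟨P, hP, hc, -⟩ := hV.exists_centerRing_eq hu
    rw [(hOV _ (Or.inl rfl) (Algebra.adjoin_le (by rintro _ ⟨i, rfl⟩; exact hu i))).trans hc]
    exact h.isLogAt_finite hI hr hrI hrd c P
  -- If t is not in V, then t⁻¹ is a nonunit of V, so the center is the origin of the chart at
  -- infinity.
  · have hu : ∀ i, ![(affCoord D l m)⁻¹] i ∈ V := fun i => by
      fin_cases i; exact (hV _).resolve_left htV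
    obtain ⟨P, hP, hc, hPV⟩ := hV.exists_centerRing_eq hu
    rw [(hOV _ (Or.inr rfl) (Algebra.adjoin_le (by rintro _ ⟨i, rfl⟩; exact hu i))).trans hc]
    refine h.isLogAt_infty hr' c P ?_
    rw [hPV]
    right
    simpa using htV

end IsMonomialCurve

theorem exists_two_div_smul_iff {K : Type} [Field K] [Algebra ℂ K] (x : K) (η ω : Forms K) :
    (∃ c : ℂ, (c = 2 ∨ c = -2) ∧ ω = (algebraMap ℂ K c / x) • η) ↔
      ω = (2 / x) • η ∨ ω = -((2 / x) • η) := by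
  have h2 : algebraMap ℂ K 2 = 2 := map_ofNat _ 2
  constructor
  · rintro ⟨c, rfl | rfl, rfl⟩
    · left
      rw [h2]
    · right
      rw [map_neg, h2, neg_div, neg_smul]
  · rintro (rfl | rfl)
    · exact ⟨2, Or.inl rfl, by rw [h2]⟩
    · exact ⟨-2, Or.inr rfl, by rw [map_neg, h2, neg_div, neg_smul]⟩

/-! ### Canonical forms of a monomial curve with boundary points ±1 -/

namespace IsMonomialCurve

variable {n : ℕ} {D : Variety n} {d : Fin (n + 1) → ℕ} {j k l m : Fin (n + 1)}
  (h : IsMonomialCurve D d j k l m)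

include h

/-- A form with simple poles at `1` and `-1` whose residues are `1` or `-1`. -/
theorem exists_eq_of_isLogarithmic {I : Ideal (CoordRing n)} {e : ℕ} {r : CoordRing n}
    (hr : r.IsHomogeneous e) (hrI : r ∈ I)
    (hrd : aeval (fun i => (Polynomial.X ^ d i : Polynomial ℂ)) r = Polynomial.X ^ 2 - 1)
    (hr' : MvPolynomial.X k ^ 2 - MvPolynomial.X j ^ 2 ∈ I) {ω : Forms (FunctionField D)}
    (hlog : IsLogarithmic 1 D I ω)
    (hres : ∀ τ : ℂ, τ ^ 2 = 1 → ∀ g : FunctionField D, ω = g • dForm (affCoord D l m) →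
      g * (affCoord D l m - algebraMap ℂ _ τ) ∈ linePlace (affCoord D l m) τ) :
    ∃ c : ℂ, ω = (algebraMap ℂ _ c / (affCoord D l m ^ 2 - 1)) • dForm (affCoord D l m) := by
  obtain ⟨g, rfl⟩ := mem_exteriorPower_one_single (f := affCoord D l m) (by
    have := h.isChart.span_D
    rwa [Set.range_unique] at this) hlog.1
  have hloc : ∀ τ, IsLocalRing (linePlace (affCoord D l m) τ) := fun τ =>
    (h.isChart.isValuationRingOf_linePlace τ).isLocalRing
  have hloc' : IsLocalRing (linePlace (affCoord D l m)⁻¹ 0) :=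
    (h.isChart_inv.isValuationRingOf_linePlace 0).isLocalRing
  -- The element r of I restricts to t² - 1, so it does not vanish at the center of any other finite
  -- point, and a logarithmic form is regular there.
  have hreg : ∀ a : ℂ, a ^ 2 ≠ 1 → g ∈ linePlace (affCoord D l m) a := by
    intro a ha
    obtain ⟨Q, hDQ, hdom, hjQ, hQ⟩ := exists_center D (h.X_notMem j) (linePlace (affCoord D l m) a)
      (fun i => by rw [h.affCoord_zero]; exact pow_mem (self_mem_linePlace _ a) _)
    rw [← h.isChart.isRegularForm_linePlace_iff]
    refine hlog.isRegularForm (h.isChart.isValuationRingOf_linePlace a) hDQ hdom hr hrI fun hrQ => ?_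
    rw [hQ e r hr, h.dehom_eq, hrd, h.isChart.polynomial_inv_mem_linePlace_iff] at hrQ
    apply ha
    simpa [sub_eq_zero] using hrQ
  -- The factor t² comes from dt = -t² d(t⁻¹), so this is regularity of the form at τ = ∞.
  have hinf : g * affCoord D l m ^ 2 ∈ linePlace (affCoord D l m)⁻¹ 0 := by
    obtain ⟨Q, hDQ, hdom, hkQ, hQ⟩ := exists_center D (h.X_notMem k)
      (linePlace (affCoord D l m)⁻¹ 0)
      (fun i => by rw [h.affCoord_infty]; exact pow_mem (self_mem_linePlace _ 0) _)
    have hr2 : (MvPolynomial.X k ^ 2 - MvPolynomial.X j ^ 2 : CoordRing n).IsHomogeneous (1 * 2) :=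
      ((isHomogeneous_X ℂ k).pow 2).sub ((isHomogeneous_X ℂ j).pow 2)
    have hreg := hlog.isRegularForm (h.isChart_inv.isValuationRingOf_linePlace 0) hDQ hdom hr2 hr'
      fun hrQ => by
        rw [hQ _ _ hr2, h.dehom_infty, linePlace, h.isChart_inv.inv_aeval_mem_locRing_iff,
          mem_linePrime] at hrQ
        have := h.max_pos
        simp [this] at hrQ
    rw [h.form_eq_infty, h.isChart_inv.isRegularForm_linePlace_iff] at hreg
    simpa using neg_mem hreg
  obtain ⟨c, hc⟩ := h.isChart.exists_eq_const_div h.isChart_inv hreg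
    (by simpa using hres 1 (one_pow _) g rfl)
    (by simpa using hres (-1) (by norm_num) g rfl) hinf
  exact ⟨c, by rw [hc]⟩

section Boundary

variable {S : Set (RealProj n)}
  (hS : boundary D S = {Projectivization.mk ℝ (realPoint d 1) (h.realPoint_ne_zero 1),
    Projectivization.mk ℝ (realPoint d (-1)) (h.realPoint_ne_zero (-1))})
include hS

theorem boundaryIdeal_eq : boundaryIdeal D S =
    vanishingIdeal {Projectivization.mk ℝ (realPoint d 1) (h.realPoint_ne_zero 1)} ⊓
    vanishingIdeal {Projectivization.mk ℝ (realPoint d (-1)) (h.realPoint_ne_zero (-1))} := by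
  rw [boundaryIdeal, hS, Set.insert_eq, vanishingIdeal_union]

theorem mem_boundaryIdeal_iff {e : ℕ} {a : CoordRing n} (ha : a.IsHomogeneous e) :
    a ∈ boundaryIdeal D S ↔
      Polynomial.eval (1 : ℂ) (aeval (fun i => (Polynomial.X ^ d i : Polynomial ℂ)) a) = 0 ∧
      Polynomial.eval (-1 : ℂ) (aeval (fun i => (Polynomial.X ^ d i : Polynomial ℂ)) a) = 0 := by
  rw [h.boundaryIdeal_eq hS, Submodule.mem_inf, mem_vanishingIdeal_singleton ha,
    mem_vanishingIdeal_singleton ha, eval_realPoint, eval_realPoint]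
  simp

/-- The two points are distinct because X_m - cX_l pulls back to τ^(d l)·(τ - c), which for c = ±1
vanishes at just one of τ = 1 and τ = -1. -/
theorem isBoundaryComponent_iff {Q : Variety n} : IsBoundaryComponent D S Q ↔
    Q.ideal = vanishingIdeal {Projectivization.mk ℝ (realPoint d 1) (h.realPoint_ne_zero 1)} ∨
    Q.ideal =
      vanishingIdeal {Projectivization.mk ℝ (realPoint d (-1)) (h.realPoint_ne_zero (-1))} := by
  obtain ⟨P₁, hP₁⟩ := exists_variety_point (realPoint d 1) (h.realPoint_ne_zero 1)
  obtain ⟨P₂, hP₂⟩ := exists_variety_point (realPoint d (-1)) (h.realPoint_ne_zero (-1))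
  rw [IsBoundaryComponent, h.boundaryIdeal_eq hS, ← hP₁, ← hP₂]
  have := P₁.isPrime
  have := P₂.isPrime
  have hhom : ∀ c : ℂ, (MvPolynomial.X m - C c * MvPolynomial.X l : CoordRing n).IsHomogeneous 1 :=
    fun c => (isHomogeneous_X ℂ m).sub ((isHomogeneous_X ℂ l).C_mul _)
  have heval : ∀ τ c : ℂ, Polynomial.eval τ (aeval (fun i => (Polynomial.X ^ d i : Polynomial ℂ))
      (MvPolynomial.X m - C c * MvPolynomial.X l : CoordRing n)) = τ ^ d l * (τ - c) := by
    intro τ c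
    rw [eval_aeval_eq]
    simp [h.eq_succ]
    ring
  refine mem_minimalPrimes_inf_iff (fun hle => ?_) (fun hle => ?_)
  · have h1 := hle ((h.mem_point_iff hP₁ (hhom 1)).2 (by rw [heval]; simp))
    rw [h.mem_point_iff hP₂ (hhom 1), heval] at h1
    norm_num at h1
  · have h1 := hle ((h.mem_point_iff hP₂ (hhom (-1))).2 (by rw [heval]; simp))
    rw [h.mem_point_iff hP₁ (hhom (-1)), heval] at h1
    norm_num at h1

variable {e : ℕ} {r : CoordRing n} (hr : r.IsHomogeneous e)
  (hrd : aeval (fun i => (Polynomial.X ^ d i : Polynomial ℂ)) r = Polynomial.X ^ 2 - 1)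

include hr hrd

theorem exists_isCanonicalForm_iff {ω : Forms (FunctionField D)} :
    IsCanonicalForm 1 D S ω ↔ ∃ c : ℂ, (c = 2 ∨ c = -2) ∧
      ω = (algebraMap ℂ _ c / (affCoord D l m ^ 2 - 1)) • dForm (affCoord D l m) := by
  obtain ⟨P₁, hP₁⟩ := exists_variety_point (realPoint d 1) (h.realPoint_ne_zero 1)
  obtain ⟨P₂, hP₂⟩ := exists_variety_point (realPoint d (-1)) (h.realPoint_ne_zero (-1))
  have hloc : ∀ τ, IsLocalRing (linePlace (affCoord D l m) τ) := fun τ =>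
    (h.isChart.isValuationRingOf_linePlace τ).isLocalRing
  have hrI : r ∈ boundaryIdeal D S := (h.mem_boundaryIdeal_iff hS hr).2 (by rw [hrd]; simp)
  have hr2 : (MvPolynomial.X k ^ 2 - MvPolynomial.X j ^ 2 : CoordRing n).IsHomogeneous (1 * 2) :=
    ((isHomogeneous_X ℂ k).pow 2).sub ((isHomogeneous_X ℂ j).pow 2)
  have hr' : (MvPolynomial.X k ^ 2 - MvPolynomial.X j ^ 2 : CoordRing n) ∈ boundaryIdeal D S := by
    refine (h.mem_boundaryIdeal_iff hS hr2).2 ?_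
    simp [h.eq_zero, ← pow_mul]
  have hsq : ∀ τ : ℂ, τ ^ 2 = 1 → τ = ((1 : ℝ) : ℂ) ∨ τ = ((-1 : ℝ) : ℂ) := by
    intro τ hτ
    rcases mul_self_eq_one_iff.1 ((pow_two τ).symm.trans hτ) with h | h <;> simp [h]
  constructor
  · rintro ⟨hlog, hcomp⟩
    have h₁ := (hcomp P₁ ((h.isBoundaryComponent_iff hS).2 (Or.inl hP₁))).2
    have h₂ := (hcomp P₂ ((h.isBoundaryComponent_iff hS).2 (Or.inr hP₂))).2
    obtain ⟨c, rfl⟩ := h.exists_eq_of_isLogarithmic hr hrI hrd hr' hlog (by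
      rintro τ hτ g rfl
      rcases hsq τ hτ with rfl | rfl
      · obtain ⟨b, hb, -⟩ := (h.exists_isResidue_iff hP₁ one_ne_zero g).1 h₁
        rw [← hb]
        exact b.2
      · obtain ⟨b, hb, -⟩ := (h.exists_isResidue_iff hP₂ (by norm_num) g).1 h₂
        rw [← hb]
        exact b.2)
    -- The residue at τ = 1 alone fixes c up to sign; at τ = -1 the residue is then also 1 or -1.
    have := (h.exists_isResidue_iff hP₁ one_ne_zero _).1 h₁
    rw [h.isChart.residue_const_div_iff (by simp)] at this
    exact ⟨c, this, rfl⟩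
  · rintro ⟨c, hc, rfl⟩
    refine ⟨h.isLogarithmic (fun e a ha haI τ hτ => ?_) hr hrI hrd hr' c, fun Q hQ => ?_⟩
    · rw [h.mem_boundaryIdeal_iff hS ha] at haI
      rcases mul_self_eq_one_iff.1 ((pow_two τ).symm.trans hτ) with rfl | rfl
      exacts [haI.1, haI.2]
    · have hc0 : c ≠ 0 := by rcases hc with rfl | rfl <;> norm_num
      rcases (h.isBoundaryComponent_iff hS).1 hQ with hQ | hQ
      · exact ⟨(h.hasPole_iff hQ one_ne_zero _).2 (h.isChart.const_div_notMem_linePlace (by simp) hc0),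
          (h.exists_isResidue_iff hQ one_ne_zero _).2
            ((h.isChart.residue_const_div_iff (by simp) c).2 hc)⟩
      · exact ⟨(h.hasPole_iff hQ (by norm_num) _).2
            (h.isChart.const_div_notMem_linePlace (by simp) hc0),
          (h.exists_isResidue_iff hQ (by norm_num) _).2
            ((h.isChart.residue_const_div_iff (by simp) c).2 hc)⟩

theorem isCanonicalForm_iff {ω : Forms (FunctionField D)} :
    IsCanonicalForm 1 D S ω ↔
      ω = (2 / (affCoord D l m ^ 2 - 1)) • dForm (affCoord D l m) ∨
      ω = -((2 / (affCoord D l m ^ 2 - 1)) • dForm (affCoord D l m)) := by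
  exact (h.exists_isCanonicalForm_iff hS hr hrd).trans (exists_two_div_smul_iff _ _ _)

theorem isPositiveGeometry (hadm : IsAdmissible 1 D S)
    (h₁ : Projectivization.mk ℝ (realPoint d 1) (h.realPoint_ne_zero 1) ∈ S)
    (h₂ : Projectivization.mk ℝ (realPoint d (-1)) (h.realPoint_ne_zero (-1)) ∈ S) :
    IsPositiveGeometry 1 D S := by
  refine ⟨hadm, fun Q hQ => ?_, _, (h.isCanonicalForm_iff hS hr hrd).2 (Or.inl rfl), fun ω' hω' =>
    (h.isCanonicalForm_iff hS hr hrd).1 hω'⟩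
  rcases (h.isBoundaryComponent_iff hS).1 hQ with hQ | hQ
  · rw [realPoints_point hQ, Set.inter_eq_left.2 (Set.singleton_subset_iff.2 h₁)]
    exact isAdmissible_point hQ
  · rw [realPoints_point hQ, Set.inter_eq_left.2 (Set.singleton_subset_iff.2 h₂)]
    exact isAdmissible_point hQ

end Boundary

end IsMonomialCurve

/-! ### Logarithmic forms in polynomial coordinates -/

section PolynomialCharts

variable {K : Type} [Field K] [Algebra ℂ K] {u : Fin 2 → K}
  {P : Ideal (MvPolynomial (Fin 2) ℂ)} [hP : P.IsPrime]

/-- The Jacobian determinant of two polynomials. -/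
def polyJac (p q : MvPolynomial (Fin 2) ℂ) : MvPolynomial (Fin 2) ℂ :=
  pderiv 0 p * pderiv 1 q - pderiv 1 p * pderiv 0 q

theorem IsChart.jac_aeval (h : IsChart u) (p q : MvPolynomial (Fin 2) ℂ) :
    h.jac (aeval u p) (aeval u q) = aeval u (polyJac p q) := by
  simp only [IsChart.jac, polyJac, h.pd_aeval, map_sub, map_mul]

/-- An element congruent to a nonzero constant modulo f is a unit wherever f vanishes. This is how
the strict transforms are seen to avoid exceptional curves. -/
theorem notMem_of_dvd_sub {R : Type} [CommRing R] [Algebra ℂ R] {P : Ideal R} [hP : P.IsPrime]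
    {f w : R} (hf : f ∈ P) (c : ℂ) (hc : c ≠ 0) (h : f ∣ w - algebraMap ℂ R c) : w ∉ P := by
  intro hw
  have h1 : algebraMap ℂ R c ∈ P := by
    have := P.sub_mem hw (P.mem_of_dvd h hf)
    rwa [sub_sub_cancel] at this
  exact hP.ne_top (P.eq_top_of_isUnit_mem h1 ((IsUnit.mk0 c hc).map (algebraMap ℂ R)))

theorem IsChart.isUnit_aeval_iff (h : IsChart u) (p : MvPolynomial (Fin 2) ℂ) :
    IsUnit (⟨aeval u p, aeval_mem_locRing p⟩ : locRing u P) ↔ p ∉ P := by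
  rw [isUnit_subalgebra_iff, ← h.inv_aeval_mem_locRing_iff (P := P)]
  simp

theorem IsChart.div_mem_locRing {q r : MvPolynomial (Fin 2) ℂ} (h : IsChart u) (hr : r ∉ P) :
    aeval u q / aeval u r ∈ locRing u P :=
  ⟨q, r, hr, h.aeval_ne_zero_of_notMem hr, rfl⟩

variable {F : locRing u P} {c : K} {q r : MvPolynomial (Fin 2) ℂ}

theorem IsChart.isLogAt_poly_top (h : IsChart u) {f : MvPolynomial (Fin 2) ℂ}
    (hF : (F : K) = aeval u f) (hf : f ∉ P) (hr : r ∉ P) (hc : c = aeval u q / aeval u r) :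
    IsLogAt 2 (locRing u P) (Ideal.span {F}) (c • (dForm (u 0) * dForm (u 1))) := by
  have hFu : F = ⟨aeval u f, aeval_mem_locRing f⟩ := Subtype.ext hF
  rw [Ideal.span_singleton_eq_top.2 (hFu ▸ (h.isUnit_aeval_iff f).2 hf)]
  exact h.isLogAt_plane_top (hc ▸ h.div_mem_locRing hr)

theorem IsChart.isLogAt_poly_smooth (h : IsChart u) {w f : MvPolynomial (Fin 2) ℂ} {k : ℕ}
    (hk : k ≠ 0) (hF : (F : K) = aeval u (w * f ^ k)) (hw : w ∉ P) (hf : f ∈ P) (i : Fin 2)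
    (hJ : polyJac f (X i) ∉ P) (hr : r ∉ P) (hc : c * aeval u f = aeval u q / aeval u r) :
    IsLogAt 2 (locRing u P) (Ideal.span {F}) (c • (dForm (u 0) * dForm (u 1))) := by
  refine h.isLogAt_plane_smooth (f := ⟨aeval u f, aeval_mem_locRing f⟩)
    (w := ⟨aeval u w, aeval_mem_locRing w⟩) hk ((h.isUnit_aeval_iff w).2 hw) ?_
    (fun hu => (h.isUnit_aeval_iff f).1 hu hf) i ?_ ?_
  · congr 2
    exact Subtype.ext (by rw [hF, map_mul, map_pow]; rfl)
  · have : h.jacLoc (⟨aeval u f, aeval_mem_locRing f⟩ : locRing u P) ⟨u i, coord_mem_locRing i⟩ =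
        ⟨aeval u (polyJac f (X i)), aeval_mem_locRing _⟩ := by
      apply Subtype.ext
      change h.jac (aeval u f) (u i) = aeval u (polyJac f (X i))
      rw [← h.jac_aeval, aeval_X]
    rw [this, h.isUnit_aeval_iff]
    exact hJ
  · rw [hc]
    exact h.div_mem_locRing hr

theorem IsChart.isLogAt_poly_cross (h : IsChart u) {w f₁ f₂ : MvPolynomial (Fin 2) ℂ} {k l : ℕ}
    (hk : k ≠ 0) (hl : l ≠ 0) (hF : (F : K) = aeval u (w * f₁ ^ k * f₂ ^ l)) (hw : w ∉ P)
    (hf₁ : f₁ ∈ P) (hf₂ : f₂ ∈ P) (hJ : polyJac f₁ f₂ ∉ P) (hr : r ∉ P)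
    (hc : c * aeval u f₁ * aeval u f₂ = aeval u q / aeval u r) :
    IsLogAt 2 (locRing u P) (Ideal.span {F}) (c • (dForm (u 0) * dForm (u 1))) := by
  refine h.isLogAt_plane_cross (f₁ := ⟨aeval u f₁, aeval_mem_locRing f₁⟩)
    (f₂ := ⟨aeval u f₂, aeval_mem_locRing f₂⟩)
    (w := ⟨aeval u w, aeval_mem_locRing w⟩) hk hl ((h.isUnit_aeval_iff w).2 hw) ?_
    (fun hu => (h.isUnit_aeval_iff f₁).1 hu hf₁) (fun hu => (h.isUnit_aeval_iff f₂).1 hu hf₂) ?_ ?_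
  · congr 2
    exact Subtype.ext (by rw [hF, map_mul, map_mul, map_pow, map_pow]; rfl)
  · have : h.jacLoc (⟨aeval u f₁, aeval_mem_locRing f₁⟩ : locRing u P)
        ⟨aeval u f₂, aeval_mem_locRing f₂⟩ = ⟨aeval u (polyJac f₁ f₂), aeval_mem_locRing _⟩ :=
      Subtype.ext (h.jac_aeval f₁ f₂)
    rw [this, h.isUnit_aeval_iff]
    exact hJ
  · change c * aeval u f₁ * aeval u f₂ ∈ _
    rw [hc]
    exact h.div_mem_locRing hr

/-! The six charts of the resolution. -/

theorem polyJac_X_zero_X_one : polyJac (X 0) (X 1) = 1 := by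
  simp [polyJac, pderiv_X]

theorem two_notMem : (2 : MvPolynomial (Fin 2) ℂ) ∉ P :=
  notMem_of_dvd_sub P.zero_mem 2 two_ne_zero
    ⟨0, by rw [map_ofNat, sub_self, mul_zero]⟩

theorem pow_notMem {p : MvPolynomial (Fin 2) ℂ} (hp : p ∉ P) (k : ℕ) : p ^ k ∉ P :=
  fun h => hp (hP.mem_of_pow_mem _ h)

variable {a b : K} {P : Ideal (MvPolynomial (Fin 2) ℂ)} [hP : P.IsPrime] {F : locRing ![a, b] P}

/-- Here a = y/x and b = 1/x. The line b = 1 and the cubic a²b = 1 cross transversally: their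
Jacobian is 2ab, and a, b are units on the cubic. The four cases say which of the two curves passes
through the center. -/
theorem IsChart.isLogAt_chart_x (h : IsChart ![a, b])
    (hF : (F : K) = (1 - b) * (a ^ 2 * b - 1)) :
    IsLogAt 2 (locRing ![a, b] P) (Ideal.span {F})
      ((-2 / ((1 - b) * (a ^ 2 * b - 1))) • (dForm a * dForm b)) := by
  have h1 : (1 - b : K) ≠ 0 := by
    have := h.aeval_ne_zero (p := 1 - X 1) (fun h0 => by
      have := congrArg (eval fun _ => 0) h0; simp at this)
    simpa using this
  have h2 : (a ^ 2 * b - 1 : K) ≠ 0 := by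
    have := h.aeval_ne_zero (p := X 0 ^ 2 * X 1 - 1) (fun h0 => by
      have := congrArg (eval fun _ => 0) h0; simp at this)
    simpa using this
  have hunit : (X 0 ^ 2 * X 1 - 1 : MvPolynomial (Fin 2) ℂ) ∈ P → X 0 ∉ P ∧ X 1 ∉ P := fun hm =>
    ⟨fun h0 => notMem_of_dvd_sub h0 (-1) (by norm_num) ⟨X 0 * X 1, by simp; ring⟩ hm,
      fun h0 => notMem_of_dvd_sub h0 (-1) (by norm_num) ⟨X 0 ^ 2, by simp; ring⟩ hm⟩
  have e1 : aeval ![a, b] (1 - X 1 : MvPolynomial (Fin 2) ℂ) = 1 - b := by simp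
  have e2 : aeval ![a, b] (X 0 ^ 2 * X 1 - 1 : MvPolynomial (Fin 2) ℂ) = a ^ 2 * b - 1 := by simp
  rw [← e1, ← e2, ← map_mul] at hF
  by_cases hb : (1 - X 1 : MvPolynomial (Fin 2) ℂ) ∈ P <;>
    by_cases ha : (X 0 ^ 2 * X 1 - 1 : MvPolynomial (Fin 2) ℂ) ∈ P
  · refine h.isLogAt_poly_cross (k := 1) (l := 1) (w := 1) (q := -2) (r := 1) one_ne_zero one_ne_zero
      (by rw [hF, one_mul, pow_one, pow_one]) (hP.one_notMem) hb ha ?_ hP.one_notMem ?_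
    · have : polyJac (1 - X 1) (X 0 ^ 2 * X 1 - 1) = 2 * X 0 * X 1 := by
        simp [polyJac, Derivation.leibniz_pow, pderiv_X]
        ring
      rw [this]
      exact hP.mul_notMem (hP.mul_notMem two_notMem (hunit ha).1) (hunit ha).2
    · rw [e1, e2, map_neg, map_one, map_ofNat]
      generalize a ^ 2 * b - 1 = p at *
      generalize 1 - b = q at *
      field_simp
  · refine h.isLogAt_poly_smooth (k := 1) (w := X 0 ^ 2 * X 1 - 1) (q := -2)
      (r := X 0 ^ 2 * X 1 - 1) one_ne_zero (by rw [hF, mul_comm, pow_one]) ha hb 0 ?_ ha ?_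
    · have : polyJac (1 - X 1) (X 0) = 1 := by simp [polyJac, pderiv_X]
      rw [this]
      exact hP.one_notMem
    · rw [e1, e2, map_neg, map_ofNat]
      generalize a ^ 2 * b - 1 = p at *
      generalize 1 - b = q at *
      field_simp
  · refine h.isLogAt_poly_smooth (k := 1) (w := 1 - X 1) (q := -2)
      (r := 1 - X 1) one_ne_zero (by rw [hF, pow_one]) hb ha 0 ?_ hb ?_
    · have : polyJac (X 0 ^ 2 * X 1 - 1) (X 0) = - X 0 ^ 2 := by
        simp [polyJac, Derivation.leibniz_pow, pderiv_X]
      rw [this, neg_mem_iff]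
      exact pow_notMem (hunit ha).1 2
    · rw [e1, e2, map_neg, map_ofNat]
      generalize a ^ 2 * b - 1 = p at *
      generalize 1 - b = q at *
      field_simp
  · refine h.isLogAt_poly_top (q := -2) hF (hP.mul_notMem hb ha) (hP.mul_notMem hb ha) ?_
    rw [map_mul, e1, e2, map_neg, map_ofNat]

/-- Here a = x/y and b = 1/y, and points with a ≠ 0 belong to the preceding chart. On a = 0 the
curves a = b and b = a³ pass only through the origin (0 : 1 : 0), where the Jacobian 1 - 3a² is a
unit. -/
theorem IsChart.isLogAt_chart_y (h : IsChart ![a, b]) (ha : X 0 ∈ P)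
    (hF : (F : K) = (a - b) * (b - a ^ 3)) :
    IsLogAt 2 (locRing ![a, b] P) (Ideal.span {F})
      ((2 * a / ((a - b) * (b - a ^ 3))) • (dForm a * dForm b)) := by
  have h1 : (a - b : K) ≠ 0 := by
    have := h.aeval_ne_zero (p := X 0 - X 1) (fun h0 => by
      have := congrArg (eval ![0, 1]) h0; simp at this)
    simpa using this
  have h2 : (b - a ^ 3 : K) ≠ 0 := by
    have := h.aeval_ne_zero (p := X 1 - X 0 ^ 3) (fun h0 => by
      have := congrArg (eval ![0, 1]) h0; simp at this)
    simpa using this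
  have e1 : aeval ![a, b] (X 0 - X 1 : MvPolynomial (Fin 2) ℂ) = a - b := by simp
  have e2 : aeval ![a, b] (X 1 - X 0 ^ 3 : MvPolynomial (Fin 2) ℂ) = b - a ^ 3 := by simp
  have e3 : aeval ![a, b] (2 * X 0 : MvPolynomial (Fin 2) ℂ) = 2 * a := by simp
  rw [← e1, ← e2, ← map_mul] at hF
  have ha3 : (X 0 ^ 3 : MvPolynomial (Fin 2) ℂ) ∈ P := P.pow_mem_of_mem ha 3 (by norm_num)
  by_cases hb : (X 1 : MvPolynomial (Fin 2) ℂ) ∈ P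
  · refine h.isLogAt_poly_cross (k := 1) (l := 1) (w := 1) (q := 2 * X 0) (r := 1) one_ne_zero
      one_ne_zero (by rw [hF, one_mul, pow_one, pow_one]) hP.one_notMem (P.sub_mem ha hb)
      (P.sub_mem hb ha3) ?_ hP.one_notMem ?_
    · have : polyJac (X 0 - X 1) (X 1 - X 0 ^ 3) = 1 - 3 * X 0 ^ 2 := by
        simp [polyJac, Derivation.leibniz_pow, pderiv_X]
      rw [this]
      exact notMem_of_dvd_sub ha 1 one_ne_zero ⟨- 3 * X 0, by simp; ring⟩
    · rw [e1, e2, e3, map_one]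
      generalize b - a ^ 3 = p at *
      generalize a - b = q at *
      field_simp
  · have hw : (X 0 - X 1) * (X 1 - X 0 ^ 3) ∉ P :=
      hP.mul_notMem (fun h' => hb (by simpa using P.sub_mem ha h'))
        (fun h' => hb (by simpa using P.add_mem h' ha3))
    refine h.isLogAt_poly_top (q := 2 * X 0) hF hw hw ?_
    rw [e3, map_mul, e1, e2]

/-- Here a = y and b = x/y, and a = 0 is the first exceptional curve, of multiplicity 2 in the total
transform. Both strict transforms avoid it, their equations being congruent to nonzero constants
modulo a. -/
theorem IsChart.isLogAt_chart_one (h : IsChart ![a, b]) (ha : X 0 ∈ P)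
    (hF : (F : K) = (a * b - 1) * (1 - a * b ^ 3) * a ^ 2) :
    IsLogAt 2 (locRing ![a, b] P) (Ideal.span {F})
      ((2 * b / ((a * b - 1) * (1 - a * b ^ 3))) • (dForm a * dForm b)) := by
  have e1 : aeval ![a, b] ((X 0 * X 1 - 1) * (1 - X 0 * X 1 ^ 3) : MvPolynomial (Fin 2) ℂ) =
    (a * b - 1) * (1 - a * b ^ 3) := by simp
  have e3 : aeval ![a, b] (2 * X 1 * X 0 : MvPolynomial (Fin 2) ℂ) = 2 * b * a := by simp
  have e2 : aeval ![a, b] (X 0 : MvPolynomial (Fin 2) ℂ) = a := by simp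
  have hw : (X 0 * X 1 - 1) * (1 - X 0 * X 1 ^ 3) ∉ P :=
    hP.mul_notMem (notMem_of_dvd_sub ha (-1) (by norm_num) ⟨X 1, by simp⟩)
      (notMem_of_dvd_sub ha 1 (by norm_num) ⟨- X 1 ^ 3, by simp⟩)
  refine h.isLogAt_poly_smooth (k := 2) (q := 2 * X 1 * X 0) two_ne_zero
    (by rw [map_mul, map_pow, e1, e2, hF]) hw ha 1 ?_ hw ?_
  · rw [polyJac_X_zero_X_one]
    exact hP.one_notMem
  · rw [e1, e2, e3, div_mul_eq_mul_div]

/-- Here a = x and b = y/x², and a = 0 is the second exceptional curve, of multiplicity 3 and away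
from both strict transforms on this chart. -/
theorem IsChart.isLogAt_chart_two (h : IsChart ![a, b]) (ha : X 0 ∈ P)
    (hF : (F : K) = (a - 1) * (a * b ^ 2 - 1) * a ^ 3) :
    IsLogAt 2 (locRing ![a, b] P) (Ideal.span {F})
      ((-2 / ((a - 1) * (a * b ^ 2 - 1))) • (dForm a * dForm b)) := by
  have e1 : aeval ![a, b] ((X 0 - 1) * (X 0 * X 1 ^ 2 - 1) : MvPolynomial (Fin 2) ℂ) =
    (a - 1) * (a * b ^ 2 - 1) := by simp
  have e3 : aeval ![a, b] (-2 * X 0 : MvPolynomial (Fin 2) ℂ) = -2 * a := by simp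
  have e2 : aeval ![a, b] (X 0 : MvPolynomial (Fin 2) ℂ) = a := by simp
  have hw : (X 0 - 1) * (X 0 * X 1 ^ 2 - 1) ∉ P :=
    hP.mul_notMem (notMem_of_dvd_sub ha (-1) (by norm_num) ⟨1, by simp⟩)
      (notMem_of_dvd_sub ha (-1) (by norm_num) ⟨X 1 ^ 2, by simp⟩)
  refine h.isLogAt_poly_smooth (k := 3) (q := -2 * X 0) three_ne_zero
    (by rw [map_mul, map_pow, e1, e2, hF]) hw ha 1 ?_ hw ?_
  · rw [polyJac_X_zero_X_one]
    exact hP.one_notMem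
  · rw [e1, e2, e3, div_mul_eq_mul_div]

/-- Here a = y/x and b = x³/y². The last exceptional curve a = 0, of multiplicity 6, meets the first
one at b = 0, of multiplicity 2, and the strict transform of the cubic at b = 1. The cases are these
two crossings and the remaining points of a = 0. -/
theorem IsChart.isLogAt_chart_three (h : IsChart ![a, b]) (ha : X 0 ∈ P)
    (hF : (F : K) = (a ^ 2 * b - 1) * (1 - b) * a ^ 6 * b ^ 2) :
    IsLogAt 2 (locRing ![a, b] P) (Ideal.span {F})
      ((2 / ((a ^ 2 * b - 1) * (1 - b))) • (dForm a * dForm b)) := by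
  have h1 : (1 - b : K) ≠ 0 := by
    have := h.aeval_ne_zero (p := 1 - X 1) (fun h0 => by
      have := congrArg (eval fun _ => 0) h0; simp at this)
    simpa using this
  have e1 : aeval ![a, b] (1 - X 1 : MvPolynomial (Fin 2) ℂ) = 1 - b := by simp
  have e2 : aeval ![a, b] (X 0 ^ 2 * X 1 - 1 : MvPolynomial (Fin 2) ℂ) = a ^ 2 * b - 1 := by simp
  have e3 : aeval ![a, b] (X 0 : MvPolynomial (Fin 2) ℂ) = a := by simp
  have e4 : aeval ![a, b] (X 1 : MvPolynomial (Fin 2) ℂ) = b := by simp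
  have hw : (X 0 ^ 2 * X 1 - 1) ∉ P :=
    notMem_of_dvd_sub ha (-1) (by norm_num) ⟨X 0 * X 1, by simp; ring⟩
  by_cases hb : (X 1 : MvPolynomial (Fin 2) ℂ) ∈ P
  · have hw' : (X 0 ^ 2 * X 1 - 1) * (1 - X 1) ∉ P :=
      hP.mul_notMem hw (notMem_of_dvd_sub hb 1 one_ne_zero ⟨-1, by simp⟩)
    refine h.isLogAt_poly_cross (k := 6) (l := 2) (q := 2 * X 0 * X 1) (by norm_num) two_ne_zero
      (by simp only [map_mul, map_pow, e1, e2, e3, e4, hF]) hw' ha hb ?_ hw' ?_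
    · rw [polyJac_X_zero_X_one]
      exact hP.one_notMem
    · simp only [map_mul, e1, e2, e3, e4, map_ofNat, div_mul_eq_mul_div]
  · by_cases hb1 : (1 - X 1 : MvPolynomial (Fin 2) ℂ) ∈ P
    · refine h.isLogAt_poly_cross (f₁ := X 0) (f₂ := 1 - X 1) (k := 6) (l := 1)
        (w := (X 0 ^ 2 * X 1 - 1) * X 1 ^ 2) (q := 2 * X 0) (r := X 0 ^ 2 * X 1 - 1)
        (by norm_num) one_ne_zero
        (by simp only [map_mul, map_pow, e1, e2, e3, e4, hF]; ring)
        (hP.mul_notMem hw (pow_notMem hb 2)) ha hb1 ?_ hw ?_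
      · have : polyJac (X 0) (1 - X 1) = - 1 := by simp [polyJac, pderiv_X]
        rw [this, neg_mem_iff]
        exact hP.one_notMem
      · simp only [map_mul, e1, e2, e3, map_ofNat, div_mul_eq_mul_div]
        rw [mul_div_mul_right _ _ h1]
    · refine h.isLogAt_poly_smooth (k := 6) (f := X 0)
        (w := (X 0 ^ 2 * X 1 - 1) * (1 - X 1) * X 1 ^ 2) (q := 2 * X 0)
        (r := (X 0 ^ 2 * X 1 - 1) * (1 - X 1)) (by norm_num)
        (by simp only [map_mul, map_pow, e1, e2, e3, e4, hF]; ring)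
        (hP.mul_notMem (hP.mul_notMem hw hb1) (pow_notMem hb 2)) ha 1 ?_ (hP.mul_notMem hw hb1) ?_
      · rw [polyJac_X_zero_X_one]
        exact hP.one_notMem
      · simp only [map_mul, e1, e2, e3, map_ofNat, div_mul_eq_mul_div]

/-- Here a = x²/y and b = y²/x³. Only the origin is not on another chart: it is the crossing of the
last exceptional curve a = 0 with the second one b = 0, of multiplicities 6 and 3. -/
theorem IsChart.isLogAt_chart_four (h : IsChart ![a, b]) (ha : X 0 ∈ P) (hb : X 1 ∈ P)
    (hF : (F : K) = (a ^ 2 * b - 1) * (b - 1) * a ^ 6 * b ^ 3) :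
    IsLogAt 2 (locRing ![a, b] P) (Ideal.span {F})
      ((-2 / ((a ^ 2 * b - 1) * (b - 1))) • (dForm a * dForm b)) := by
  have e1 : aeval ![a, b] ((X 0 ^ 2 * X 1 - 1) * (X 1 - 1) : MvPolynomial (Fin 2) ℂ) =
    (a ^ 2 * b - 1) * (b - 1) := by simp
  have e3 : aeval ![a, b] (X 0 : MvPolynomial (Fin 2) ℂ) = a := by simp
  have e4 : aeval ![a, b] (X 1 : MvPolynomial (Fin 2) ℂ) = b := by simp
  have e5 : aeval ![a, b] (-2 * X 0 * X 1 : MvPolynomial (Fin 2) ℂ) = -2 * a * b := by simp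
  have hw : (X 0 ^ 2 * X 1 - 1) * (X 1 - 1) ∉ P :=
    hP.mul_notMem (notMem_of_dvd_sub ha (-1) (by norm_num) ⟨X 0 * X 1, by simp; ring⟩)
      (notMem_of_dvd_sub hb (-1) (by norm_num) ⟨1, by simp⟩)
  refine h.isLogAt_poly_cross (k := 6) (l := 3) (q := -2 * X 0 * X 1) (by norm_num) three_ne_zero
    (by rw [map_mul, map_mul, map_pow, map_pow, e1, e3, e4, hF]) hw ha hb ?_ hw ?_
  · rw [polyJac_X_zero_X_one]
    exact hP.one_notMem
  · rw [e1, e3, e4, e5, div_mul_eq_mul_div, div_mul_eq_mul_div]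

end PolynomialCharts

/-! ### Resolution of the cuspidal cubic together with a transversal line -/

section Resolution

variable {K : Type} [Field K] [Algebra ℂ K] {x y a b : K}

theorem range_pair {α : Type} (a b : α) : Set.range ![a, b] = {a, b} := by
  rw [Matrix.range_cons, Matrix.range_cons, Matrix.range_empty, Set.union_empty, Set.singleton_union]

theorem adjoin_range_one {ι : Type} [Fintype ι] {w : ι → K} {a b : K}
    (h : ∀ i, w i = 1 ∨ w i = a ∨ w i = b) (ha : ∃ i, w i = a) (hb : ∃ i, w i = b) :
    Algebra.adjoin ℂ (Set.range w) = Algebra.adjoin ℂ {a, b} := by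
  apply le_antisymm
  · refine Algebra.adjoin_le ?_
    rintro _ ⟨i, rfl⟩
    rcases h i with h | h | h <;> rw [h]
    · exact one_mem _
    · exact left_mem_adjoin_pair a b
    · exact right_mem_adjoin_pair a b
  · exact adjoin_pair_le.2 ⟨Algebra.subset_adjoin ha, Algebra.subset_adjoin hb⟩

/-- The blow-up of the plane in the cusp, in the point where the strict transform of the cubic
touches the exceptional curve, and in the resulting triple point. -/
theorem isAtlas_cusp (hx : x ≠ 0) (hy : y ≠ 0) :
    IsAtlas ({Algebra.adjoin ℂ {y / x, x⁻¹}, Algebra.adjoin ℂ {x / y, y⁻¹},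
      Algebra.adjoin ℂ {y, x / y}, Algebra.adjoin ℂ {x, y / x ^ 2},
      Algebra.adjoin ℂ {y / x, x ^ 3 / y ^ 2}, Algebra.adjoin ℂ {x ^ 2 / y, y ^ 2 / x ^ 3}} :
      Set (Subalgebra ℂ K)) := by
  have h0 : IsAtlas (insert (Algebra.adjoin ℂ {x, y}) {Algebra.adjoin ℂ {y / x, x⁻¹},
      Algebra.adjoin ℂ {x / y, y⁻¹}}) := by
    have := isAtlas_standard ![x, y, 1] (fun i => by fin_cases i <;> simp [hx, hy])
    convert this using 1
    ext A
    have e1 : Algebra.adjoin ℂ (Set.range fun i => ![x, y, 1] i / ![x, y, 1] 0) =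
        Algebra.adjoin ℂ {y / x, x⁻¹} :=
      adjoin_range_one (by intro i; fin_cases i <;> simp [hx]) ⟨1, rfl⟩ ⟨2, by simp⟩
    have e2 : Algebra.adjoin ℂ (Set.range fun i => ![x, y, 1] i / ![x, y, 1] 1) =
        Algebra.adjoin ℂ {x / y, y⁻¹} :=
      adjoin_range_one (by intro i; fin_cases i <;> simp [hy]) ⟨0, rfl⟩ ⟨2, by simp⟩
    have e3 : Algebra.adjoin ℂ (Set.range fun i => ![x, y, 1] i / ![x, y, 1] 2) =
        Algebra.adjoin ℂ {x, y} :=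
      adjoin_range_one (by intro i; fin_cases i <;> simp) ⟨0, by simp⟩ ⟨1, by simp⟩
    rw [Set.mem_range, Fin.exists_fin_succ, Fin.exists_fin_two]
    simp only [Fin.succ_zero_eq_one, Fin.succ_one_eq_two, e1, e2, e3, Set.mem_insert_iff,
      Set.mem_singleton_iff]
    tauto
  -- Each of the two charts at infinity contains x⁻¹ or y⁻¹, so the cusp lies only on the finite
  -- chart.
  have i0 : IsIsolatedOrigin {Algebra.adjoin ℂ {y / x, x⁻¹}, Algebra.adjoin ℂ {x / y, y⁻¹}} x y := by
    rintro B (rfl | rfl) V - hB - -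
    · exact Or.inl (hB (right_mem_adjoin_pair _ _))
    · exact Or.inr (hB (right_mem_adjoin_pair _ _))
  have hyx : y / x ≠ 0 := div_ne_zero hy hx
  -- Blow-up of the cusp. With p = y/x the cubic becomes x²(p² - x), whose strict transform touches
  -- the exceptional curve x = 0 at the origin of the chart x, p.
  have h1 := h0.blowup hx hy i0
  have i1 := (i0.blowup hx hy).symm
  rw [Set.pair_comm x (y / x)] at h1
  -- Blow-up of this point of tangency. With q = x/p the strict transform is p = q, and it passes
  -- through the origin together with the exceptional curves p = 0 and q = 0.
  have h2 := h1.blowup hyx hx i1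
  have i2 := i1.blowup hyx hx
  -- Blow-up of this triple point, which separates the three branches.
  have h3 := h2.blowup hyx (div_ne_zero hx hyx) i2
  convert h3 using 1
  have e1 : x / (y / x) = x ^ 2 / y := by field_simp
  have e2 : x / (y / x) / (y / x) = x ^ 3 / y ^ 2 := by field_simp
  have e3 : y / x / (x / (y / x)) = y ^ 2 / x ^ 3 := by field_simp
  have e4 : y / x / x = y / x ^ 2 := by field_simp
  rw [e2, e3, e1, e4]
  ext A
  simp only [Set.mem_insert_iff, Set.mem_singleton_iff]
  tauto

theorem IsChart.of_mem_adjoin (h : IsChart ![x, y])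
    (hx : x ∈ IntermediateField.adjoin ℂ {a, b}) (hy : y ∈ IntermediateField.adjoin ℂ {a, b}) :
    IsChart ![a, b] := by
  refine isChart_of_trdeg ?_ h.trdeg
  rw [range_pair, eq_top_iff, ← h.gen, range_pair, IntermediateField.adjoin_le_iff]
  rintro _ (rfl | rfl)
  exacts [hx, hy]

/-- If x and y are Laurent monomials in a and b, then a and b generate the field, and the
transcendence degree makes them independent. -/
theorem IsChart.isChart_of_eq_pow (h : IsChart ![x, y]) {i j k l : ℤ} (hx : x = a ^ i * b ^ j)
    (hy : y = a ^ k * b ^ l) : IsChart ![a, b] := by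
  have ha : a ∈ IntermediateField.adjoin ℂ ({a, b} : Set K) :=
    IntermediateField.subset_adjoin _ _ (by simp)
  have hb : b ∈ IntermediateField.adjoin ℂ ({a, b} : Set K) :=
    IntermediateField.subset_adjoin _ _ (by simp)
  exact h.of_mem_adjoin (hx ▸ mul_mem (zpow_mem ha _) (zpow_mem hb _))
    (hy ▸ mul_mem (zpow_mem ha _) (zpow_mem hb _))

/-- The canonical form of the cuspidal region in the coordinates `x`, `y`. -/
def cuspForm (x y : K) : Forms K :=
  (-2 * x / ((x - 1) * (y ^ 2 - x ^ 3))) • (dForm x * dForm y)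

theorem IsChart.left_ne_zero (h : IsChart ![a, b]) : a ≠ 0 := by
  simpa using h.aeval_ne_zero (X_ne_zero (0 : Fin 2))

theorem IsChart.right_ne_zero (h : IsChart ![a, b]) : b ≠ 0 := by
  simpa using h.aeval_ne_zero (X_ne_zero (1 : Fin 2))

theorem IsChart.dForm_mul_dForm_aeval (h : IsChart ![a, b]) (p q : MvPolynomial (Fin 2) ℂ) :
    dForm (aeval ![a, b] p) * dForm (aeval ![a, b] q) =
      aeval ![a, b] (polyJac p q) • (dForm a * dForm b) := by
  rw [← h.jac_aeval]
  exact h.dForm_mul_dForm _ _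

/-- The powers of b cancel: dx∧dy contributes b⁻³, x contributes b⁻¹, and the denominator b⁻⁴. The
form has neither zero nor pole along the line at infinity b = 0. -/
theorem IsChart.cuspForm_chart_x (h : IsChart ![a, b]) (hx : x = b⁻¹) (hy : y = a * b⁻¹) :
    cuspForm x y = (-2 / ((1 - b) * (a ^ 2 * b - 1))) • (dForm a * dForm b) := by
  have hb := h.right_ne_zero
  have e : dForm x * dForm y = (b⁻¹ ^ 3) • (dForm a * dForm b) := by
    rw [hx, hy, dForm_mul, dForm_inv hb]
    simp only [mul_add, smul_mul_assoc, mul_smul_comm, dForm_mul_self, smul_zero, zero_add,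
      dForm_mul_comm b a]
    module
  rw [cuspForm, e, smul_smul]
  congr 1
  have e1 : x - 1 = (1 - b) / b := by rw [hx]; field_simp
  have e2 : y ^ 2 - x ^ 3 = (a ^ 2 * b - 1) / b ^ 3 := by rw [hx, hy]; field_simp
  rw [e1, e2, hx]
  -- Both sides have the same two boundary factors in the denominator; as atoms they need not be
  -- expanded.
  generalize 1 - b = p
  generalize a ^ 2 * b - 1 = q
  field_simp

theorem IsChart.cuspForm_chart_y (h : IsChart ![a, b]) (hx : x = a * b⁻¹) (hy : y = b⁻¹) :
    cuspForm x y = (2 * a / ((a - b) * (b - a ^ 3))) • (dForm a * dForm b) := by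
  have hb := h.right_ne_zero
  have e : dForm x * dForm y = (-(b⁻¹ ^ 3)) • (dForm a * dForm b) := by
    rw [hx, hy, dForm_mul, dForm_inv hb]
    simp only [add_mul, smul_mul_assoc, mul_smul_comm, dForm_mul_self, smul_zero, zero_add]
    module
  rw [cuspForm, e, smul_smul]
  congr 1
  have e1 : x - 1 = (a - b) / b := by rw [hx]; field_simp
  have e2 : y ^ 2 - x ^ 3 = (b - a ^ 3) / b ^ 3 := by rw [hx, hy]; field_simp
  rw [e1, e2, hx]
  generalize a - b = p
  generalize b - a ^ 3 = q
  field_simp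

/-- Along a = 0, the orders of dx∧dy, x and y² - x³ are 1, 1 and 2, and they cancel. -/
theorem IsChart.cuspForm_chart_one (h : IsChart ![a, b]) (hx : x = a * b) (hy : y = a) :
    cuspForm x y = (2 * b / ((a * b - 1) * (1 - a * b ^ 3))) • (dForm a * dForm b) := by
  have ha := h.left_ne_zero
  have e : dForm x * dForm y = (-a) • (dForm a * dForm b) := by
    have := h.dForm_mul_dForm_aeval (X 0 * X 1) (X 0)
    simpa [polyJac, pderiv_X, hx, hy] using this
  rw [cuspForm, e, smul_smul]
  congr 1
  have e2 : y ^ 2 - x ^ 3 = a ^ 2 * (1 - a * b ^ 3) := by rw [hx, hy]; ring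
  rw [e2, hx]
  generalize a * b - 1 = p
  generalize 1 - a * b ^ 3 = q
  field_simp

/-- Along a = 0 the orders are 2 + 1 - 3 = 0. -/
theorem IsChart.cuspForm_chart_two (h : IsChart ![a, b]) (hx : x = a) (hy : y = a ^ 2 * b) :
    cuspForm x y = (-2 / ((a - 1) * (a * b ^ 2 - 1))) • (dForm a * dForm b) := by
  have ha := h.left_ne_zero
  have e : dForm x * dForm y = (a ^ 2) • (dForm a * dForm b) := by
    have := h.dForm_mul_dForm_aeval (X 0) (X 0 ^ 2 * X 1)
    simpa [polyJac, pderiv_X, hx, hy] using this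
  rw [cuspForm, e, smul_smul]
  congr 1
  have e2 : y ^ 2 - x ^ 3 = a ^ 3 * (a * b ^ 2 - 1) := by rw [hx, hy]; ring
  rw [e2, hx]
  generalize a - 1 = p
  generalize a * b ^ 2 - 1 = q
  field_simp

/-- The orders are 4 + 2 - 6 = 0 along a = 0 and 1 + 1 - 2 = 0 along b = 0. -/
theorem IsChart.cuspForm_chart_three (h : IsChart ![a, b]) (hx : x = a ^ 2 * b)
    (hy : y = a ^ 3 * b) :
    cuspForm x y = (2 / ((a ^ 2 * b - 1) * (1 - b))) • (dForm a * dForm b) := by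
  have ha := h.left_ne_zero
  have hb := h.right_ne_zero
  have e : dForm x * dForm y = (-(a ^ 4 * b)) • (dForm a * dForm b) := by
    have := h.dForm_mul_dForm_aeval (X 0 ^ 2 * X 1) (X 0 ^ 3 * X 1)
    rw [hx, hy]
    simp only [map_mul, map_pow, aeval_X] at this
    refine this.trans ?_
    congr 1
    simp [polyJac, pderiv_X, Derivation.leibniz_pow]
    ring
  rw [cuspForm, e, smul_smul]
  congr 1
  have e2 : y ^ 2 - x ^ 3 = a ^ 6 * b ^ 2 * (1 - b) := by rw [hx, hy]; ring
  rw [e2, hx]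
  generalize a ^ 2 * b - 1 = p
  generalize 1 - b = q
  field_simp

/-- The orders are 4 + 2 - 6 = 0 along a = 0 and 2 + 1 - 3 = 0 along b = 0. -/
theorem IsChart.cuspForm_chart_four (h : IsChart ![a, b]) (hx : x = a ^ 2 * b)
    (hy : y = a ^ 3 * b ^ 2) :
    cuspForm x y = (-2 / ((a ^ 2 * b - 1) * (b - 1))) • (dForm a * dForm b) := by
  have ha := h.left_ne_zero
  have hb := h.right_ne_zero
  have e : dForm x * dForm y = (a ^ 4 * b ^ 2) • (dForm a * dForm b) := by
    have := h.dForm_mul_dForm_aeval (X 0 ^ 2 * X 1) (X 0 ^ 3 * X 1 ^ 2)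
    rw [hx, hy]
    simp only [map_mul, map_pow, aeval_X] at this
    refine this.trans ?_
    congr 1
    simp [polyJac, pderiv_X, Derivation.leibniz_pow]
    ring
  rw [cuspForm, e, smul_smul]
  congr 1
  have e2 : y ^ 2 - x ^ 3 = a ^ 6 * b ^ 3 * (b - 1) := by rw [hx, hy]; ring
  rw [e2, hx]
  generalize a ^ 2 * b - 1 = p
  generalize b - 1 = q
  field_simp

end Resolution

/-! ### The projective plane -/

section Plane

theorem projSpace_ideal (n : ℕ) : (projSpace n).ideal = ⊥ := HomogeneousIdeal.toIdeal_bot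

theorem X_notMem_projSpace (n : ℕ) (i : Fin (n + 1)) :
    (MvPolynomial.X i : CoordRing n) ∉ (projSpace n).ideal := by
  rw [projSpace_ideal]
  exact X_ne_zero (R := ℂ) i

theorem projSpace_ideal_le {n : ℕ} (D : Variety n) : (projSpace n).ideal ≤ D.ideal := by
  rw [projSpace_ideal]
  exact bot_le

/-- The coordinate `x` of the plane. -/
abbrev planeX : FunctionField (projSpace 2) := affCoord (projSpace 2) 2 0

/-- The coordinate `y` of the plane. -/
abbrev planeY : FunctionField (projSpace 2) := affCoord (projSpace 2) 2 1

/-- Homogeneity recovers all values of a off X₂ = 0 from its dehomogenization, so a·X₂ vanishes at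
every point. -/
theorem eq_zero_of_aeval_eq_zero {e : ℕ} {a : CoordRing 2} (ha : a.IsHomogeneous e)
    (h0 : aeval ![X 0, X 1, (1 : MvPolynomial (Fin 2) ℂ)] a = 0) : a = 0 := by
  have h1 : a * X 2 = 0 := by
    refine MvPolynomial.funext fun v => ?_
    rw [map_mul, eval_X, map_zero, mul_eq_zero, or_iff_not_imp_right]
    intro hv
    have h2 := congrArg (eval ![v 0 / v 2, v 1 / v 2]) h0
    have h3 : eval ![v 0 / v 2, v 1 / v 2] (aeval ![X 0, X 1, (1 : MvPolynomial (Fin 2) ℂ)] a) =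
        aeval (fun i => v i * (v 2)⁻¹) a := by
      rw [← aeval_eq_eval, ← AlgHom.comp_apply, comp_aeval]
      congr 1
      ext i
      fin_cases i <;> simp [hv, div_eq_mul_inv]
    rw [h3, aeval_mul_of_isHomogeneous ha, map_zero, mul_eq_zero] at h2
    have := h2.resolve_right (pow_ne_zero _ (inv_ne_zero hv))
    rwa [← aeval_eq_eval]
  exact (mul_eq_zero.1 h1).resolve_right (X_ne_zero 2)

theorem affCoord_self {n : ℕ} {X : Variety n} {j : Fin (n + 1)}
    (hj : (MvPolynomial.X j : CoordRing n) ∉ X.ideal) : affCoord X j j = 1 := by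
  rw [← dehom_X, dehom_X_self X hj]

/-- Dehomogenization embeds the function field into the fraction field of ℂ[X₀, X₁], carrying the
two coordinates to the variables. -/
theorem isChart_plane : IsChart ![planeX, planeY] := by
  have hj := X_notMem_projSpace 2 2
  let A := MvPolynomial (Fin 2) ℂ
  let h : CoordRing 2 →ₐ[ℂ] FractionRing A :=
    (IsScalarTower.toAlgHom ℂ A (FractionRing A)).comp (aeval ![X 0, X 1, (1 : A)])
  have hinj : Function.Injective (algebraMap A (FractionRing A)) := IsFractionRing.injective _ _
  obtain ⟨j, hjj⟩ := exists_algHom_of_homogeneous (dehom (projSpace 2) 2) h (fun e a ha => by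
    rw [dehom_eq_zero_iff _ hj ha, projSpace_ideal, Ideal.mem_bot]
    constructor
    · rintro rfl; rw [map_zero]
    · intro h0
      exact eq_zero_of_aeval_eq_zero ha (hinj (by rw [map_zero]; exact h0))) (fun y => by
    obtain ⟨e, a, b, ha, hb, hbX, hy⟩ := exists_eq_dehom_div (projSpace 2) hj y
    exact ⟨e, a, b, ha, hb, fun h0 => hbX ((dehom_eq_zero_iff _ hj hb).1 h0), hy⟩)
  have hX : ∀ i : Fin 3, j (affCoord (projSpace 2) 2 i) =
      algebraMap A (FractionRing A) (![X 0, X 1, (1 : A)] i) := by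
    intro i
    have := hjj 1 (X i) (X 2) (isHomogeneous_X ℂ i) (isHomogeneous_X ℂ 2)
      (by rw [dehom_X_self _ hj]; exact one_ne_zero)
    rw [dehom_X_self _ hj, div_one, dehom_X] at this
    rw [this]
    simp [h]
  constructor
  · refine (injective_iff_map_eq_zero _).2 fun p hp => ?_
    apply hinj
    have h1 : j (aeval ![planeX, planeY] p) = algebraMap A (FractionRing A) p := by
      rw [← AlgHom.comp_apply, comp_aeval]
      have : (aeval fun i => j (![planeX, planeY] i)) =
          (IsScalarTower.toAlgHom ℂ A (FractionRing A)) := by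
        ext i
        fin_cases i
        · exact (aeval_X _ _).trans (hX 0)
        · exact (aeval_X _ _).trans (hX 1)
      rw [this]
      rfl
    rw [← h1, hp, map_zero, map_zero]
  · rw [eq_top_iff, ← adjoin_affCoord (projSpace 2) hj, IntermediateField.adjoin_le_iff]
    rintro _ ⟨i, rfl⟩
    fin_cases i
    · exact IntermediateField.subset_adjoin _ _ ⟨0, rfl⟩
    · exact IntermediateField.subset_adjoin _ _ ⟨1, rfl⟩
    · change affCoord (projSpace 2) 2 2 ∈ _
      rw [affCoord_self hj]
      exact one_mem _

theorem planeX_ne_zero : planeX ≠ 0 := isChart_plane.left_ne_zero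

theorem planeY_ne_zero : planeY ≠ 0 := isChart_plane.right_ne_zero

theorem affCoord_plane_x : affCoord (projSpace 2) 0 = ![1, planeY / planeX, planeX⁻¹] := by
  have hj := X_notMem_projSpace 2 2
  funext i
  rw [affCoord_eq_div (projSpace 2) hj]
  fin_cases i
  · exact div_self planeX_ne_zero
  · rfl
  · change affCoord _ 2 2 / _ = _
    rw [affCoord_self hj, one_div]
    rfl

theorem affCoord_plane_y : affCoord (projSpace 2) 1 = ![planeX / planeY, 1, planeY⁻¹] := by
  have hj := X_notMem_projSpace 2 2
  funext i
  rw [affCoord_eq_div (projSpace 2) hj]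
  fin_cases i
  · rfl
  · exact div_self planeY_ne_zero
  · change affCoord _ 2 2 / _ = _
    rw [affCoord_self hj, one_div]
    rfl

theorem affCoord_plane_z : affCoord (projSpace 2) 2 = ![planeX, planeY, 1] := by
  have hj := X_notMem_projSpace 2 2
  funext i
  fin_cases i
  · rfl
  · rfl
  · exact affCoord_self hj

/-- The equation of the union of the line `x = 1` and the cuspidal cubic. -/
def cuspBoundary : CoordRing 2 := (X 0 - X 2) * (X 1 ^ 2 * X 2 - X 0 ^ 3)

theorem isHomogeneous_line : (X 0 - X 2 : CoordRing 2).IsHomogeneous 1 :=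
  (isHomogeneous_X ℂ 0).sub (isHomogeneous_X ℂ 2)

theorem isHomogeneous_cubic : (X 1 ^ 2 * X 2 - X 0 ^ 3 : CoordRing 2).IsHomogeneous 3 :=
  (((isHomogeneous_X ℂ 1).pow 2).mul (isHomogeneous_X ℂ 2)).sub ((isHomogeneous_X ℂ 0).pow 3)

theorem isHomogeneous_cuspBoundary : cuspBoundary.IsHomogeneous 4 :=
  isHomogeneous_line.mul isHomogeneous_cubic

theorem dehom_cuspBoundary (j : Fin 3) : dehom (projSpace 2) j cuspBoundary =
    (affCoord (projSpace 2) j 0 - affCoord (projSpace 2) j 2) *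
      (affCoord (projSpace 2) j 1 ^ 2 * affCoord (projSpace 2) j 2 -
        affCoord (projSpace 2) j 0 ^ 3) := by
  simp only [cuspBoundary, map_mul, map_sub, map_pow, dehom_X]

/-- Being logarithmic at the center of a valuation ring on a chart. -/
theorem exists_isLogAt_center {n : ℕ} {X : Variety n} {a b : FunctionField X} (h : IsChart ![a, b])
    {V : Subalgebra ℂ (FunctionField X)} (hV : IsValuationRingOf V)
    (hab : Algebra.adjoin ℂ {a, b} ≤ V) {j : Fin (n + 1)}
    (hj : (MvPolynomial.X j : CoordRing n) ∉ X.ideal)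
    (hcoord : ∀ i, affCoord X j i ∈ Algebra.adjoin ℂ {a, b}) {d e : ℕ} {G : CoordRing n}
    (hG : G.IsHomogeneous e) {ω : Forms (FunctionField X)}
    (hlog : ∀ (P : Ideal (MvPolynomial (Fin 2) ℂ)) [P.IsPrime] (F : locRing ![a, b] P),
      (a⁻¹ ∉ V → MvPolynomial.X 0 ∈ P) → (b⁻¹ ∉ V → MvPolynomial.X 1 ∈ P) →
      (F : FunctionField X) = dehom X j G → IsLogAt d (locRing ![a, b] P) (Ideal.span {F}) ω) :
    ∃ Q : Variety n, X.ideal ≤ Q.ideal ∧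
      Dominates (centerRing (Algebra.adjoin ℂ {a, b}) V) (localRing X Q) ∧
      IsLogAt d (centerRing (Algebra.adjoin ℂ {a, b}) V)
        (pullbackIdeal X Q (Ideal.span {G}) (centerRing (Algebra.adjoin ℂ {a, b}) V)) ω := by
  obtain ⟨P, hP, hc, hPV⟩ := hV.exists_centerRing_eq (u := ![a, b])
    (fun i => by
      fin_cases i
      · exact hab (left_mem_adjoin_pair a b)
      · exact hab (right_mem_adjoin_pair a b))
  rw [range_pair] at hc
  have hcoord' : ∀ i, affCoord X j i ∈ locRing ![a, b] P := fun i =>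
    hc ▸ le_centerRing _ _ (hcoord i)
  rw [hc]
  have hloc := h.isLocalRing_locRing (P := P)
  obtain ⟨Q, hXQ, hdom, hjQ, -⟩ := exists_center X hj (locRing ![a, b] P) hcoord'
  refine ⟨Q, hXQ, hdom, ?_⟩
  rw [pullbackIdeal_span_singleton hXQ hdom hjQ hG]
  refine hlog P _ (fun h0 => (hPV _).2 (Or.inr ?_)) (fun h0 => (hPV _).2 (Or.inr ?_)) rfl
  · simpa using h0
  · simpa using h0

/-- This chart and the next are the affine charts X₀ ≠ 0 and X₁ ≠ 0, so the boundary quartic is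
divided by a power of X₀ or X₁. The other four charts lie over X₂ ≠ 0. -/
theorem isLogAt_cusp_x {V : Subalgebra ℂ (FunctionField (projSpace 2))}
    (hV : IsValuationRingOf V) (hAV : Algebra.adjoin ℂ {planeY / planeX, planeX⁻¹} ≤ V) :
    ∃ Q : Variety 2, (projSpace 2).ideal ≤ Q.ideal ∧
      Dominates (centerRing (Algebra.adjoin ℂ {planeY / planeX, planeX⁻¹}) V) (localRing (projSpace 2) Q) ∧
      IsLogAt 2 (centerRing (Algebra.adjoin ℂ {planeY / planeX, planeX⁻¹}) V)
        (pullbackIdeal (projSpace 2) Q (Ideal.span {cuspBoundary})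
          (centerRing (Algebra.adjoin ℂ {planeY / planeX, planeX⁻¹}) V)) (cuspForm planeX planeY) := by
  have hx0 := planeX_ne_zero
  have hy0 := planeY_ne_zero
  have hx : planeX = (planeX⁻¹)⁻¹ := by field_simp
  have hy : planeY = planeY / planeX * (planeX⁻¹)⁻¹ := by field_simp
  have hc := isChart_plane.isChart_of_eq_pow (a := planeY / planeX) (b := planeX⁻¹) (i := 0) (j := -1) (k := 1)
    (l := -1) (hx.trans (by generalize planeX⁻¹ = b; generalize planeY / planeX = a; simp)) 
    (hy.trans (by generalize planeX⁻¹ = b; generalize planeY / planeX = a; simp))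
  refine exists_isLogAt_center hc hV hAV (X_notMem_projSpace 2 0) (fun i => ?_)
    isHomogeneous_cuspBoundary fun P _ F h0 h1 hF => ?_
  · rw [affCoord_plane_x]
    fin_cases i
    · exact one_mem _
    · exact left_mem_adjoin_pair _ _
    · exact right_mem_adjoin_pair _ _
  · rw [hc.cuspForm_chart_x hx hy]
    refine hc.isLogAt_chart_x ?_
    rw [hF, dehom_cuspBoundary, affCoord_plane_x]
    change (1 - planeX⁻¹) * ((planeY / planeX) ^ 2 * planeX⁻¹ - 1 ^ 3) = _
    rw [one_pow]

theorem isLogAt_cusp_y {V : Subalgebra ℂ (FunctionField (projSpace 2))}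
    (hV : IsValuationRingOf V) (hAV : Algebra.adjoin ℂ {planeX / planeY, planeY⁻¹} ≤ V)
    (hm : (planeX / planeY)⁻¹ ∉ V) :
    ∃ Q : Variety 2, (projSpace 2).ideal ≤ Q.ideal ∧
      Dominates (centerRing (Algebra.adjoin ℂ {planeX / planeY, planeY⁻¹}) V) (localRing (projSpace 2) Q) ∧
      IsLogAt 2 (centerRing (Algebra.adjoin ℂ {planeX / planeY, planeY⁻¹}) V)
        (pullbackIdeal (projSpace 2) Q (Ideal.span {cuspBoundary})
          (centerRing (Algebra.adjoin ℂ {planeX / planeY, planeY⁻¹}) V)) (cuspForm planeX planeY) := by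
  have hx0 := planeX_ne_zero
  have hy0 := planeY_ne_zero
  have hx : planeX = planeX / planeY * (planeY⁻¹)⁻¹ := by field_simp
  have hy : planeY = (planeY⁻¹)⁻¹ := by field_simp
  have hc := isChart_plane.isChart_of_eq_pow (a := planeX / planeY) (b := planeY⁻¹) (i := 1) (j := -1) (k := 0)
    (l := -1) (hx.trans (by generalize planeY⁻¹ = b; generalize planeX / planeY = a; simp)) 
    (hy.trans (by generalize planeY⁻¹ = b; generalize planeX / planeY = a; simp))
  refine exists_isLogAt_center hc hV hAV (X_notMem_projSpace 2 1) (fun i => ?_)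
    isHomogeneous_cuspBoundary fun P _ F h0 h1 hF => ?_
  · rw [affCoord_plane_y]
    fin_cases i
    · exact left_mem_adjoin_pair _ _
    · exact one_mem _
    · exact right_mem_adjoin_pair _ _
  · rw [hc.cuspForm_chart_y hx hy]
    -- The hypothesis that x/y is not invertible in V puts the center on a = 0; the later charts use
    -- their hypotheses in the same way.
    refine hc.isLogAt_chart_y (h0 hm) ?_
    rw [hF, dehom_cuspBoundary, affCoord_plane_y]
    simp

theorem isLogAt_cusp_one {V : Subalgebra ℂ (FunctionField (projSpace 2))}
    (hV : IsValuationRingOf V) (hAV : Algebra.adjoin ℂ {planeY, planeX / planeY} ≤ V)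
    (hm : planeY⁻¹ ∉ V) :
    ∃ Q : Variety 2, (projSpace 2).ideal ≤ Q.ideal ∧
      Dominates (centerRing (Algebra.adjoin ℂ {planeY, planeX / planeY}) V) (localRing (projSpace 2) Q) ∧
      IsLogAt 2 (centerRing (Algebra.adjoin ℂ {planeY, planeX / planeY}) V)
        (pullbackIdeal (projSpace 2) Q (Ideal.span {cuspBoundary})
          (centerRing (Algebra.adjoin ℂ {planeY, planeX / planeY}) V)) (cuspForm planeX planeY) := by
  have hx0 := planeX_ne_zero
  have hy0 := planeY_ne_zero
  have hx : planeX = (planeY) * (planeX / planeY) := by field_simp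
  have hy : planeY = (planeY) := by field_simp
  have hc := isChart_plane.isChart_of_eq_pow (a := planeY) (b := planeX / planeY) (i := 1) (j := 1) (k := 1)
    (l := 0) (hx.trans (by generalize planeX / planeY = b; generalize planeY = a; simp)) 
    (hy.trans (by generalize planeX / planeY = b; generalize planeY = a; simp))
  refine exists_isLogAt_center hc hV hAV (X_notMem_projSpace 2 2) (fun i => ?_)
    isHomogeneous_cuspBoundary fun P _ F h0 h1 hF => ?_
  · rw [affCoord_plane_z]
    fin_cases i
    · exact (congrArg (· ∈ Algebra.adjoin ℂ {planeY, planeX / planeY}) hx).mpr (mul_mem (left_mem_adjoin_pair (planeY) (planeX / planeY)) (right_mem_adjoin_pair (planeY) (planeX / planeY)))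
    · exact (congrArg (· ∈ Algebra.adjoin ℂ {planeY, planeX / planeY}) hy).mpr (left_mem_adjoin_pair (planeY) (planeX / planeY))
    · exact one_mem _
  · rw [hc.cuspForm_chart_one hx hy]
    refine hc.isLogAt_chart_one (h0 hm) ?_
    rw [hF, dehom_cuspBoundary, affCoord_plane_z]
    change (planeX - 1) * (planeY ^ 2 * 1 - planeX ^ 3) = _
    field_simp

theorem isLogAt_cusp_two {V : Subalgebra ℂ (FunctionField (projSpace 2))}
    (hV : IsValuationRingOf V) (hAV : Algebra.adjoin ℂ {planeX, planeY / planeX ^ 2} ≤ V)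
    (hm : planeX⁻¹ ∉ V) :
    ∃ Q : Variety 2, (projSpace 2).ideal ≤ Q.ideal ∧
      Dominates (centerRing (Algebra.adjoin ℂ {planeX, planeY / planeX ^ 2}) V) (localRing (projSpace 2) Q) ∧
      IsLogAt 2 (centerRing (Algebra.adjoin ℂ {planeX, planeY / planeX ^ 2}) V)
        (pullbackIdeal (projSpace 2) Q (Ideal.span {cuspBoundary})
          (centerRing (Algebra.adjoin ℂ {planeX, planeY / planeX ^ 2}) V)) (cuspForm planeX planeY) := by
  have hx0 := planeX_ne_zero
  have hy0 := planeY_ne_zero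
  have hx : planeX = (planeX) := by field_simp
  have hy : planeY = (planeX) ^ 2 * (planeY / planeX ^ 2) := by field_simp
  have hc := isChart_plane.isChart_of_eq_pow (a := planeX) (b := planeY / planeX ^ 2) (i := 1) (j := 0) (k := 2)
    (l := 1) (hx.trans (by generalize planeY / planeX ^ 2 = b; generalize planeX = a; simp)) 
    (hy.trans (by generalize planeY / planeX ^ 2 = b; generalize planeX = a; simp))
  refine exists_isLogAt_center hc hV hAV (X_notMem_projSpace 2 2) (fun i => ?_)
    isHomogeneous_cuspBoundary fun P _ F h0 h1 hF => ?_
  · rw [affCoord_plane_z]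
    fin_cases i
    · exact (congrArg (· ∈ Algebra.adjoin ℂ {planeX, planeY / planeX ^ 2}) hx).mpr (left_mem_adjoin_pair (planeX) (planeY / planeX ^ 2))
    · exact (congrArg (· ∈ Algebra.adjoin ℂ {planeX, planeY / planeX ^ 2}) hy).mpr (mul_mem (pow_mem (left_mem_adjoin_pair (planeX) (planeY / planeX ^ 2)) 2) (right_mem_adjoin_pair (planeX) (planeY / planeX ^ 2)))
    · exact one_mem _
  · rw [hc.cuspForm_chart_two hx hy]
    refine hc.isLogAt_chart_two (h0 hm) ?_
    rw [hF, dehom_cuspBoundary, affCoord_plane_z]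
    change (planeX - 1) * (planeY ^ 2 * 1 - planeX ^ 3) = _
    field_simp

theorem isLogAt_cusp_three {V : Subalgebra ℂ (FunctionField (projSpace 2))}
    (hV : IsValuationRingOf V) (hAV : Algebra.adjoin ℂ {planeY / planeX, planeX ^ 3 / planeY ^ 2} ≤ V)
    (hm : (planeY / planeX)⁻¹ ∉ V) :
    ∃ Q : Variety 2, (projSpace 2).ideal ≤ Q.ideal ∧
      Dominates (centerRing (Algebra.adjoin ℂ {planeY / planeX, planeX ^ 3 / planeY ^ 2}) V) (localRing (projSpace 2) Q) ∧
      IsLogAt 2 (centerRing (Algebra.adjoin ℂ {planeY / planeX, planeX ^ 3 / planeY ^ 2}) V)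
        (pullbackIdeal (projSpace 2) Q (Ideal.span {cuspBoundary})
          (centerRing (Algebra.adjoin ℂ {planeY / planeX, planeX ^ 3 / planeY ^ 2}) V)) (cuspForm planeX planeY) := by
  have hx0 := planeX_ne_zero
  have hy0 := planeY_ne_zero
  have hx : planeX = (planeY / planeX) ^ 2 * (planeX ^ 3 / planeY ^ 2) := by field_simp
  have hy : planeY = (planeY / planeX) ^ 3 * (planeX ^ 3 / planeY ^ 2) := by field_simp
  have hc := isChart_plane.isChart_of_eq_pow (a := planeY / planeX) (b := planeX ^ 3 / planeY ^ 2) (i := 2) (j := 1) (k := 3)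
    (l := 1) (hx.trans (by generalize planeX ^ 3 / planeY ^ 2 = b; generalize planeY / planeX = a; simp)) 
    (hy.trans (by generalize planeX ^ 3 / planeY ^ 2 = b; generalize planeY / planeX = a; simp))
  refine exists_isLogAt_center hc hV hAV (X_notMem_projSpace 2 2) (fun i => ?_)
    isHomogeneous_cuspBoundary fun P _ F h0 h1 hF => ?_
  · rw [affCoord_plane_z]
    fin_cases i
    · exact (congrArg (· ∈ Algebra.adjoin ℂ {planeY / planeX, planeX ^ 3 / planeY ^ 2}) hx).mpr (mul_mem (pow_mem (left_mem_adjoin_pair (planeY / planeX) (planeX ^ 3 / planeY ^ 2)) 2) (right_mem_adjoin_pair (planeY / planeX) (planeX ^ 3 / planeY ^ 2)))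
    · exact (congrArg (· ∈ Algebra.adjoin ℂ {planeY / planeX, planeX ^ 3 / planeY ^ 2}) hy).mpr (mul_mem (pow_mem (left_mem_adjoin_pair (planeY / planeX) (planeX ^ 3 / planeY ^ 2)) 3) (right_mem_adjoin_pair (planeY / planeX) (planeX ^ 3 / planeY ^ 2)))
    · exact one_mem _
  · rw [hc.cuspForm_chart_three hx hy]
    refine hc.isLogAt_chart_three (h0 hm) ?_
    rw [hF, dehom_cuspBoundary, affCoord_plane_z]
    change (planeX - 1) * (planeY ^ 2 * 1 - planeX ^ 3) = _
    field_simp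

theorem isLogAt_cusp_four {V : Subalgebra ℂ (FunctionField (projSpace 2))}
    (hV : IsValuationRingOf V) (hAV : Algebra.adjoin ℂ {planeX ^ 2 / planeY, planeY ^ 2 / planeX ^ 3} ≤ V)
    (hm : (planeX ^ 2 / planeY)⁻¹ ∉ V)
    (hm' : (planeY ^ 2 / planeX ^ 3)⁻¹ ∉ V) :
    ∃ Q : Variety 2, (projSpace 2).ideal ≤ Q.ideal ∧
      Dominates (centerRing (Algebra.adjoin ℂ {planeX ^ 2 / planeY, planeY ^ 2 / planeX ^ 3}) V) (localRing (projSpace 2) Q) ∧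
      IsLogAt 2 (centerRing (Algebra.adjoin ℂ {planeX ^ 2 / planeY, planeY ^ 2 / planeX ^ 3}) V)
        (pullbackIdeal (projSpace 2) Q (Ideal.span {cuspBoundary})
          (centerRing (Algebra.adjoin ℂ {planeX ^ 2 / planeY, planeY ^ 2 / planeX ^ 3}) V)) (cuspForm planeX planeY) := by
  have hx0 := planeX_ne_zero
  have hy0 := planeY_ne_zero
  have hx : planeX = (planeX ^ 2 / planeY) ^ 2 * (planeY ^ 2 / planeX ^ 3) := by field_simp
  have hy : planeY = (planeX ^ 2 / planeY) ^ 3 * (planeY ^ 2 / planeX ^ 3) ^ 2 := by field_simp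
  have hc := isChart_plane.isChart_of_eq_pow (a := planeX ^ 2 / planeY) (b := planeY ^ 2 / planeX ^ 3) (i := 2) (j := 1) (k := 3)
    (l := 2) (hx.trans (by generalize planeY ^ 2 / planeX ^ 3 = b; generalize planeX ^ 2 / planeY = a; simp)) 
    (hy.trans (by generalize planeY ^ 2 / planeX ^ 3 = b; generalize planeX ^ 2 / planeY = a; simp))
  refine exists_isLogAt_center hc hV hAV (X_notMem_projSpace 2 2) (fun i => ?_)
    isHomogeneous_cuspBoundary fun P _ F h0 h1 hF => ?_
  · rw [affCoord_plane_z]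
    fin_cases i
    · exact (congrArg (· ∈ Algebra.adjoin ℂ {planeX ^ 2 / planeY, planeY ^ 2 / planeX ^ 3}) hx).mpr (mul_mem (pow_mem (left_mem_adjoin_pair (planeX ^ 2 / planeY) (planeY ^ 2 / planeX ^ 3)) 2) (right_mem_adjoin_pair (planeX ^ 2 / planeY) (planeY ^ 2 / planeX ^ 3)))
    · exact (congrArg (· ∈ Algebra.adjoin ℂ {planeX ^ 2 / planeY, planeY ^ 2 / planeX ^ 3}) hy).mpr (mul_mem (pow_mem (left_mem_adjoin_pair (planeX ^ 2 / planeY) (planeY ^ 2 / planeX ^ 3)) 3) (pow_mem (right_mem_adjoin_pair (planeX ^ 2 / planeY) (planeY ^ 2 / planeX ^ 3)) 2))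
    · exact one_mem _
  · rw [hc.cuspForm_chart_four hx hy]
    refine hc.isLogAt_chart_four (h0 hm) (h1 hm') ?_
    rw [hF, dehom_cuspBoundary, affCoord_plane_z]
    change (planeX - 1) * (planeY ^ 2 * 1 - planeX ^ 3) = _
    field_simp

end Plane

/-! ### The form is logarithmic -/

section CuspCharts

variable {K : Type} [Field K] [Algebra ℂ K] {x y : K}

/-- The six charts of the resolution. -/
def cuspCharts (x y : K) : Set (Subalgebra ℂ K) :=
  {Algebra.adjoin ℂ {y / x, x⁻¹}, Algebra.adjoin ℂ {x / y, y⁻¹},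
    Algebra.adjoin ℂ {y, x / y}, Algebra.adjoin ℂ {x, y / x ^ 2},
    Algebra.adjoin ℂ {y / x, x ^ 3 / y ^ 2}, Algebra.adjoin ℂ {x ^ 2 / y, y ^ 2 / x ^ 3}}

theorem notMem_of_adjoin_le {V : Subalgebra ℂ K} {x y a b : K}
    (hne : ¬ Algebra.adjoin ℂ {a, b} ≤ V) (hle : Algebra.adjoin ℂ {x, y} ≤ V) {z : K}
    (h : x ∈ V → y ∈ V → z ∈ V → a ∈ V ∧ b ∈ V) : z ∉ V := fun hz =>
  hne (adjoin_pair_le.2 (h (hle (left_mem_adjoin_pair x y)) (hle (right_mem_adjoin_pair x y)) hz))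

theorem IsChart.isCompleteModel_cusp (h : IsChart ![x, y]) :
    IsCompleteModel (atlasModel (cuspCharts x y)) := by
  classical
  have hx0 := h.left_ne_zero
  have hy0 := h.right_ne_zero
  have key : ∀ (a b : K) (i j k l : ℤ), x = a ^ i * b ^ j → y = a ^ k * b ^ l →
      (Algebra.adjoin ℂ {a, b}).FG ∧ IsFractionRing (Algebra.adjoin ℂ {a, b}) K := by
    intro a b i j k l hx hy
    rw [← range_pair]
    exact ⟨Subalgebra.fg_def.2 ⟨_, Set.finite_range _, rfl⟩,
      (h.isChart_of_eq_pow hx hy).isFractionRing_adjoin⟩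
  have hfin : (cuspCharts x y).Finite := by simp [cuspCharts]
  have hAt := isAtlas_cusp hx0 hy0
  rw [← hfin.coe_toFinset]
  refine IsAtlas.isCompleteModel (by rwa [hfin.coe_toFinset]) fun A hA => ?_
  rw [hfin.mem_toFinset] at hA
  rcases hA with rfl | rfl | rfl | rfl | rfl | rfl
  · exact key _ _ 0 (-1) 1 (-1) (by simp) (by field_simp)
  · exact key _ _ 1 (-1) 0 (-1) (by field_simp) (by simp)
  · exact key _ _ 1 1 1 0 (by field_simp) (by simp)
  · exact key _ _ 1 0 2 1 (by simp) (by field_simp)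
  · exact key _ _ 2 1 3 1 (by field_simp) (by field_simp)
  · exact key _ _ 2 1 3 2 (by field_simp) (by field_simp)

/-- Every valuation ring is centered on the part of one of the charts that matters. -/
theorem exists_cuspChart (hx0 : x ≠ 0) (hy0 : y ≠ 0) {V : Subalgebra ℂ K}
    (hV : IsValuationRingOf V) :
    Algebra.adjoin ℂ {y / x, x⁻¹} ≤ V ∨
    (Algebra.adjoin ℂ {x / y, y⁻¹} ≤ V ∧ (x / y)⁻¹ ∉ V) ∨
    (Algebra.adjoin ℂ {y, x / y} ≤ V ∧ y⁻¹ ∉ V) ∨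
    (Algebra.adjoin ℂ {x, y / x ^ 2} ≤ V ∧ x⁻¹ ∉ V) ∨
    (Algebra.adjoin ℂ {y / x, x ^ 3 / y ^ 2} ≤ V ∧ (y / x)⁻¹ ∉ V) ∨
    (Algebra.adjoin ℂ {x ^ 2 / y, y ^ 2 / x ^ 3} ≤ V ∧ (x ^ 2 / y)⁻¹ ∉ V ∧
      (y ^ 2 / x ^ 3)⁻¹ ∉ V) := by
  by_cases h1 : Algebra.adjoin ℂ {y / x, x⁻¹} ≤ V
  · exact Or.inl h1
  refine Or.inr ?_
  by_cases h2 : Algebra.adjoin ℂ {x / y, y⁻¹} ≤ V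
  · refine Or.inl ⟨h2, notMem_of_adjoin_le h1 h2 fun ha hb hz => ?_⟩
    rw [inv_div] at hz
    refine ⟨hz, ?_⟩
    have := mul_mem hz hb
    rwa [div_mul_eq_mul_div, mul_inv_cancel₀ hy0, one_div] at this
  refine Or.inr ?_
  by_cases h3 : Algebra.adjoin ℂ {y, x / y} ≤ V
  · exact Or.inl ⟨h3, notMem_of_adjoin_le h2 h3 fun ha hb hz => ⟨hb, hz⟩⟩
  refine Or.inr ?_
  by_cases h4 : Algebra.adjoin ℂ {x, y / x ^ 2} ≤ V
  · refine Or.inl ⟨h4, notMem_of_adjoin_le h1 h4 fun ha hb hz => ⟨?_, hz⟩⟩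
    have := mul_mem ha hb
    have e : x * (y / x ^ 2) = y / x := by field_simp
    rwa [e] at this
  refine Or.inr ?_
  by_cases h5 : Algebra.adjoin ℂ {y / x, x ^ 3 / y ^ 2} ≤ V
  · refine Or.inl ⟨h5, notMem_of_adjoin_le h3 h5 fun ha hb hz => ?_⟩
    have := mul_mem (pow_mem ha 3) hb
    have e : (y / x) ^ 3 * (x ^ 3 / y ^ 2) = y := by field_simp
    rw [e] at this
    exact ⟨this, by rwa [inv_div] at hz⟩
  have h6 : Algebra.adjoin ℂ {x ^ 2 / y, y ^ 2 / x ^ 3} ≤ V := by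
    -- The first five charts have been excluded, so the covering property leaves the sixth. If one
    -- of its coordinates were invertible, the center would lie on the fourth or the fifth chart.
    obtain ⟨A, hA, hAV⟩ := (isAtlas_cusp hx0 hy0).cover V hV
    rcases hA with rfl | rfl | rfl | rfl | rfl | rfl <;> first | contradiction | exact hAV
  have hx : (x ^ 2 / y) ^ 2 * (y ^ 2 / x ^ 3) = x := by field_simp
  have hyx : (x ^ 2 / y) * (y ^ 2 / x ^ 3) = y / x := by field_simp
  refine Or.inr ⟨h6, notMem_of_adjoin_le h4 h6 fun ha hb hz => ?_,
    notMem_of_adjoin_le h5 h6 fun ha hb hz => ?_⟩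
  · have := mul_mem (pow_mem ha 2) hb
    rw [hx] at this
    exact ⟨this, by rwa [inv_div] at hz⟩
  · have := mul_mem ha hb
    rw [hyx] at this
    exact ⟨this, by rwa [inv_div] at hz⟩

end CuspCharts

theorem isLogarithmic_cusp :
    IsLogarithmic 2 (projSpace 2) (Ideal.span {cuspBoundary}) (cuspForm planeX planeY) := by
  refine ⟨Submodule.smul_mem _ _ (dForm_mul_mem_exteriorPower_two _ _), _,
    isChart_plane.isCompleteModel_cusp, fun O hO => ?_⟩
  obtain ⟨V, hV, hOV⟩ :=
    (isAtlas_cusp planeX_ne_zero planeY_ne_zero).exists_eq_centerRing hO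
  rcases exists_cuspChart planeX_ne_zero planeY_ne_zero hV with
    h | ⟨h, h1⟩ | ⟨h, h1⟩ | ⟨h, h1⟩ | ⟨h, h1⟩ | ⟨h, h1, h2⟩
  · rw [hOV _ (Or.inl rfl) h]
    exact isLogAt_cusp_x hV h
  · rw [hOV _ (Or.inr (Or.inl rfl)) h]
    exact isLogAt_cusp_y hV h h1
  · rw [hOV _ (Or.inr (Or.inr (Or.inl rfl))) h]
    exact isLogAt_cusp_one hV h h1
  · rw [hOV _ (Or.inr (Or.inr (Or.inr (Or.inl rfl)))) h]
    exact isLogAt_cusp_two hV h h1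
  · rw [hOV _ (Or.inr (Or.inr (Or.inr (Or.inr (Or.inl rfl))))) h]
    exact isLogAt_cusp_three hV h h1
  · rw [hOV _ (Or.inr (Or.inr (Or.inr (Or.inr (Or.inr rfl))))) h]
    exact isLogAt_cusp_four hV h h1 h2

/-! ### Prime divisors of the plane -/

section PlaneDivisors

theorem span_D_pair_locRing {K : Type} [Field K] [Algebra ℂ K] (a b : K)
    (P : Ideal (MvPolynomial (Fin 2) ℂ)) [P.IsPrime] :
    Submodule.span (locRing ![a, b] P)
      {KaehlerDifferential.D ℂ (locRing ![a, b] P) ⟨a, coord_mem_locRing (u := ![a, b]) 0⟩,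
        KaehlerDifferential.D ℂ (locRing ![a, b] P) ⟨b, coord_mem_locRing (u := ![a, b]) 1⟩} = ⊤ := by
  rw [← span_D_locRing (u := ![a, b]) (P := P)]
  congr 1
  ext z
  simp only [Set.mem_insert_iff, Set.mem_singleton_iff, Set.mem_range, Fin.exists_fin_two]
  exact or_congr eq_comm eq_comm

theorem IsChart.isRegularForm_iff {K : Type} [Field K] [Algebra ℂ K] {a b : K}
    (h : IsChart ![a, b]) (P : Ideal (MvPolynomial (Fin 2) ℂ)) [P.IsPrime] (c : K) :
    IsRegularForm 2 (locRing ![a, b] P) (c • (dForm a * dForm b)) ↔ c ∈ locRing ![a, b] P :=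
  isRegularForm_two_iff (span_D_pair_locRing a b P) (fun _ _ => h.smul_dForm_mul_injective) c

/-- The residue of a two-form along the divisor `g = 0` of a chart, when `s` is a coordinate on this
divisor. -/
theorem IsChart.isResidueAt_divisor_iff {K : Type} [Field K] [Algebra ℂ K] {a b : K}
    (h : IsChart ![a, b]) {g : MvPolynomial (Fin 2) ℂ} (hg : g ≠ 0) [(Ideal.span {g}).IsPrime]
    [IsLocalRing (locRing ![a, b] (Ideal.span {g}))] (s J : locRing ![a, b] (Ideal.span {g}))
    (hJu : IsUnit J) (hJ : dForm (aeval ![a, b] g) * dForm (s : K) = (J : K) • (dForm a * dForm b))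
    (c : K) (ψ : Forms (IsLocalRing.ResidueField (locRing ![a, b] (Ideal.span {g})))) :
    IsResidueAt 1 (locRing ![a, b] (Ideal.span {g})) (c • (dForm a * dForm b)) ψ ↔
      ∃ z : locRing ![a, b] (Ideal.span {g}), (z : K) = c / J * aeval ![a, b] g ∧
        ψ = residueMap (locRing ![a, b] (Ideal.span {g})) z •
          dForm (residueMap (locRing ![a, b] (Ideal.span {g})) s) := by
  have hJ0 : (J : K) ≠ 0 := ((isUnit_subalgebra_iff _).1 hJu).1
  have hinj : ∀ c d : K, c • (dForm a * dForm b) = d • (dForm a * dForm b) → c = d := fun _ _ =>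
    h.smul_dForm_mul_injective
  have hform : c • (dForm a * dForm b) = (c / J) • (dForm (aeval ![a, b] g) * dForm (s : K)) := by
    rw [hJ, smul_smul, div_mul_cancel₀ _ hJ0]
  have hmax := h.maximalIdeal_locRing (P := Ideal.span {g}) (e := 1) ![g] (by simp)
  rw [Set.range_unique] at hmax
  rw [hform]
  refine isResidueAt_one_iff (f := ⟨aeval ![a, b] g, aeval_mem_locRing g⟩)
    (fun h0 => h.aeval_ne_zero hg (congrArg Subtype.val h0)) hmax
    (span_D_pair_of_isUnit (span_D_pair_locRing a b (Ideal.span {g})) hinj hJu hJ) ?_ (c / J) ψ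
  intro c d hcd
  rw [hJ, smul_smul, smul_smul] at hcd
  exact mul_right_cancel₀ hJ0 (hinj _ _ hcd)

/-- Dehomogenization with respect to the last coordinate. -/
def planeDehom : CoordRing 2 →ₐ[ℂ] MvPolynomial (Fin 2) ℂ := aeval ![X 0, X 1, 1]

theorem dehom_plane (a : CoordRing 2) :
    dehom (projSpace 2) 2 a = aeval ![planeX, planeY] (planeDehom a) := by
  rw [dehom, affCoord_plane_z, planeDehom, ← AlgHom.comp_apply, comp_aeval]
  congr 2
  funext i
  fin_cases i <;> simp

theorem planeDehom_X_two_pow_mul (k : ℕ) (a : CoordRing 2) :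
    planeDehom (X 2 ^ k * a) = planeDehom a := by
  simp [planeDehom]

theorem exists_planeDehom_eq (p : MvPolynomial (Fin 2) ℂ) :
    ∃ (e : ℕ) (a : CoordRing 2), a.IsHomogeneous e ∧ planeDehom a = p := by
  induction p using MvPolynomial.induction_on with
  | C c => exact ⟨0, C c, isHomogeneous_C _ _, by simp [planeDehom]⟩
  | add p q hp hq =>
    obtain ⟨e, a, ha, rfl⟩ := hp
    obtain ⟨e', a', ha', rfl⟩ := hq
    refine ⟨e + e', X 2 ^ e' * a + X 2 ^ e * a', ?_, ?_⟩
    · refine IsHomogeneous.add ?_ ?_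
      · simpa [add_comm] using ((isHomogeneous_X ℂ (2 : Fin 3)).pow e').mul ha
      · simpa [add_comm] using ((isHomogeneous_X ℂ (2 : Fin 3)).pow e).mul ha'
    · rw [map_add, planeDehom_X_two_pow_mul, planeDehom_X_two_pow_mul]
  | mul_X p i hp =>
    obtain ⟨e, a, ha, rfl⟩ := hp
    refine ⟨e + 1, a * X (Fin.castSucc i), ha.mul (isHomogeneous_X ℂ _), ?_⟩
    rw [map_mul]
    congr 1
    fin_cases i <;> simp [planeDehom]

/-- `D` is the closure of the affine curve `g = 0`. -/
structure IsPlaneDivisor (D : Variety 2) (g : MvPolynomial (Fin 2) ℂ) : Prop where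
  prime : Prime g
  mem_ideal_iff : ∀ (e : ℕ) (a : CoordRing 2), a.IsHomogeneous e →
    (a ∈ D.ideal ↔ g ∣ planeDehom a)

theorem exists_isPlaneDivisor {g : MvPolynomial (Fin 2) ℂ} (hg : Prime g) :
    ∃ D : Variety 2, IsPlaneDivisor D g := by
  have := (Ideal.span_singleton_prime hg.ne_zero).2 hg
  obtain ⟨D, hD⟩ := exists_variety_of_prime (Ideal.span {g}) ![X 0, X 1, 1] (j := 2)
    (fun h => this.one_notMem h)
  exact ⟨D, hg, fun e a ha => (hD e a ha).trans Ideal.mem_span_singleton⟩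

/-- `β` is the restriction to `D` of the rational function `z` on the plane. -/
def Restricts (D : Variety 2) (z : FunctionField (projSpace 2)) (β : FunctionField D) : Prop :=
  ∃ (e : ℕ) (a b : CoordRing 2), a.IsHomogeneous e ∧ b.IsHomogeneous e ∧ b ∉ D.ideal ∧
    z = dehom (projSpace 2) 2 a / dehom (projSpace 2) 2 b ∧ β = dehom D 2 a / dehom D 2 b

namespace IsPlaneDivisor

variable {D : Variety 2} {g : MvPolynomial (Fin 2) ℂ} (h : IsPlaneDivisor D g)

include h

theorem X_two_notMem : (X 2 : CoordRing 2) ∉ D.ideal := by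
  rw [h.mem_ideal_iff 1 _ (isHomogeneous_X ℂ 2)]
  intro h1
  have : planeDehom (X 2) = 1 := by simp [planeDehom]
  rw [this] at h1
  exact h.prime.not_isUnit (isUnit_of_dvd_one h1)

variable [hP : (Ideal.span {g}).IsPrime]

/-- Fractions of affine polynomials become fractions of homogeneous polynomials of equal degree
after multiplication by powers of X₂, and being off D means not being divisible by g. -/
theorem coe_locRing : (locRing ![planeX, planeY] (Ideal.span {g}) :
    Set (FunctionField (projSpace 2))) = localRing (projSpace 2) D := by
  have hj := X_notMem_projSpace 2 2
  ext z
  rw [mem_localRing_iff hj]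
  constructor
  · rintro ⟨p, q, hq, hq0, rfl⟩
    obtain ⟨e, a, ha, rfl⟩ := exists_planeDehom_eq p
    obtain ⟨e', b, hb, rfl⟩ := exists_planeDehom_eq q
    refine ⟨e + e', X 2 ^ e' * a, X 2 ^ e * b, ?_, ?_, ?_, ?_⟩
    · simpa [add_comm] using ((isHomogeneous_X ℂ (2 : Fin 3)).pow e').mul ha
    · simpa [add_comm] using ((isHomogeneous_X ℂ (2 : Fin 3)).pow e).mul hb
    · rw [h.mem_ideal_iff (e + e') _
        (by simpa [add_comm] using ((isHomogeneous_X ℂ (2 : Fin 3)).pow e).mul hb),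
        planeDehom_X_two_pow_mul]
      exact fun h1 => hq (Ideal.mem_span_singleton.2 h1)
    · rw [dehom_plane, dehom_plane, planeDehom_X_two_pow_mul, planeDehom_X_two_pow_mul]
  · rintro ⟨e, a, b, ha, hb, hbD, rfl⟩
    rw [dehom_plane, dehom_plane]
    refine isChart_plane.div_mem_locRing fun h1 => hbD ?_
    rw [h.mem_ideal_iff e b hb]
    exact Ideal.mem_span_singleton.1 h1

theorem isValuationRingOf_locRing :
    IsValuationRingOf (locRing ![planeX, planeY] (Ideal.span {g})) :=
  isChart_plane.isValuationRingOf_locRing h.prime.not_isUnit rfl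

theorem dominates_locRing :
    Dominates (locRing ![planeX, planeY] (Ideal.span {g})) (localRing (projSpace 2) D) := by
  rw [← h.coe_locRing]
  exact ⟨subset_rfl, fun _ _ => id⟩

/-- The only place of the plane over the divisor. -/
def place : Place (projSpace 2) D :=
  ⟨locRing ![planeX, planeY] (Ideal.span {g}), h.isValuationRingOf_locRing, h.dominates_locRing⟩

/-- The local ring at the divisor is already a valuation ring, and a valuation ring is dominated
only by itself. -/
theorem eq_place (V : Place (projSpace 2) D) : V = h.place := by
  have key : ∀ W : Subalgebra ℂ (FunctionField (projSpace 2)),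
      Dominates W (localRing (projSpace 2) D) →
      Dominates W (locRing ![planeX, planeY] (Ideal.span {g}) : Set _) := fun W hW => by
    rw [h.coe_locRing]
    exact hW
  exact Subtype.ext (eq_of_dominates h.isValuationRingOf_locRing (key _ V.2.2))

theorem hasPole_iff (c : FunctionField (projSpace 2)) :
    HasPole 2 (projSpace 2) D (c • (dForm planeX * dForm planeY)) ↔
      c ∉ locRing ![planeX, planeY] (Ideal.span {g}) := by
  rw [hasPole_iff_of_unique h.place h.eq_place, not_iff_not]
  exact isChart_plane.isRegularForm_iff (Ideal.span {g}) c

theorem exists_restricts {z : FunctionField (projSpace 2)}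
    (hz : z ∈ locRing ![planeX, planeY] (Ideal.span {g})) : ∃ β, Restricts D z β := by
  have h1 : z ∈ localRing (projSpace 2) D := by rw [← h.coe_locRing]; exact hz
  obtain ⟨e, a, b, ha, hb, hbD, hz⟩ := (mem_localRing_iff (X_notMem_projSpace 2 2)).1 h1
  exact ⟨_, e, a, b, ha, hb, hbD, hz, rfl⟩

theorem mem_of_restricts {z : FunctionField (projSpace 2)} {β : FunctionField D}
    (hz : Restricts D z β) : z ∈ locRing ![planeX, planeY] (Ideal.span {g}) := by
  obtain ⟨e, a, b, ha, hb, hbD, rfl, -⟩ := hz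
  rw [← SetLike.mem_coe, h.coe_locRing]
  exact div_dehom_mem_localRing (X_notMem_projSpace 2 2) ha hb hbD

theorem restriction_apply {j : FunctionField D →ₐ[ℂ] IsLocalRing.ResidueField h.place.1}
    (hj : IsRestriction h.place j) {z : FunctionField (projSpace 2)} {β : FunctionField D}
    (hz : Restricts D z β) : j β = residueMap h.place.1 ⟨z, h.mem_of_restricts hz⟩ := by
  obtain ⟨e, a, b, ha, hb, hbD, hz, hβ⟩ := hz
  exact hj e a b ha hb hbD _ _ ((coe_eq_ratio_iff _ (X_notMem_projSpace 2 2) ha hb _).2 hz)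
    ((coe_eq_ratio_iff _ h.X_two_notMem ha hb _).2 hβ)

theorem restricts_unique {z : FunctionField (projSpace 2)} {β β' : FunctionField D}
    (hz : Restricts D z β) (hz' : Restricts D z β') : β = β' := by
  obtain ⟨j, hj⟩ := exists_isRestriction (projSpace_ideal_le D) h.place
  exact j.injective ((h.restriction_apply hj hz).trans (h.restriction_apply hj hz').symm)

omit hP in
theorem restricts_coord (i : Fin 3) :
    Restricts D (affCoord (projSpace 2) 2 i) (affCoord D 2 i) := by
  refine ⟨1, X i, X 2, isHomogeneous_X ℂ i, isHomogeneous_X ℂ 2, h.X_two_notMem, ?_, ?_⟩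
  · rw [dehom_X_self _ (X_notMem_projSpace 2 2), div_one, dehom_X]
  · rw [dehom_X_self _ h.X_two_notMem, div_one, dehom_X]

/-- The residue of a two-form of the plane along a divisor on which `X i` is a coordinate. -/
theorem isResidue_iff {i : Fin 3} {J : FunctionField (projSpace 2)}
    (hJ : dForm (aeval ![planeX, planeY] g) * dForm (affCoord (projSpace 2) 2 i) =
      J • (dForm planeX * dForm planeY)) (hJ0 : J ≠ 0)
    (hJm : J ∈ locRing ![planeX, planeY] (Ideal.span {g}))
    (hJi : J⁻¹ ∈ locRing ![planeX, planeY] (Ideal.span {g}))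
    (c : FunctionField (projSpace 2)) (θ : Forms (FunctionField D)) :
    IsResidue 1 (projSpace 2) D (c • (dForm planeX * dForm planeY)) θ ↔
      ∃ β, Restricts D (c / J * aeval ![planeX, planeY] g) β ∧
        θ = β • dForm (affCoord D 2 i) := by
  have hsurj : ∀ j : FunctionField D →ₐ[ℂ] IsLocalRing.ResidueField h.place.1,
      IsRestriction h.place j → Function.Surjective j := fun j hj =>
    hj.surjective h.coe_locRing.subset
  have hloc : IsLocalRing (locRing ![planeX, planeY] (Ideal.span {g})) :=
    h.isValuationRingOf_locRing.isLocalRing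
  have key : ∀ ψ : Forms (IsLocalRing.ResidueField h.place.1),
      IsResidueAt 1 h.place.1 (c • (dForm planeX * dForm planeY)) ψ ↔
      ∃ z : h.place.1, (z : FunctionField (projSpace 2)) = c / J * aeval ![planeX, planeY] g ∧
        ψ = residueMap h.place.1 z • dForm (residueMap h.place.1
          ⟨affCoord (projSpace 2) 2 i, h.mem_of_restricts (h.restricts_coord i)⟩) :=
    isChart_plane.isResidueAt_divisor_iff h.prime.ne_zero
      ⟨affCoord (projSpace 2) 2 i, h.mem_of_restricts (h.restricts_coord i)⟩ ⟨J, hJm⟩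
      ((isUnit_subalgebra_iff _).2 ⟨hJ0, hJi⟩) hJ c
  have key' : ∀ j : FunctionField D →ₐ[ℂ] IsLocalRing.ResidueField h.place.1,
      IsRestriction h.place j → ∀ (z : h.place.1) (β : FunctionField D), Restricts D z β →
      formMap j (β • dForm (affCoord D 2 i)) = residueMap h.place.1 z • dForm (residueMap h.place.1
          ⟨affCoord (projSpace 2) 2 i, h.mem_of_restricts (h.restricts_coord i)⟩) :=
    fun j hj z β hβ => (formMap_smul j _ _).trans (congrArg₂ (· • ·) (h.restriction_apply hj hβ)
      ((formMap_dForm j _).trans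
        (congrArg dForm (h.restriction_apply hj (h.restricts_coord i)))))
  refine (isResidue_iff_of_unique h.place h.eq_place hsurj).trans ⟨?_, ?_⟩
  · rintro ⟨j, ψ, hj, hψ, hθ⟩
    refine ((key ψ).1 hψ).elim fun b hb => ?_
    obtain ⟨β, hβ⟩ := h.exists_restricts b.2
    exact ⟨β, hb.1 ▸ hβ, (formMap_bijective j ⟨j.injective, hsurj j hj⟩).1
      ((hθ.trans hb.2).trans (key' j hj b β hβ).symm)⟩
  · rintro ⟨β, hβ, rfl⟩
    exact (exists_isRestriction (projSpace_ideal_le D) h.place).imp fun j hj =>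
      ⟨_, hj, (key (formMap j (β • dForm (affCoord D 2 i)))).2
        ⟨⟨_, h.mem_of_restricts hβ⟩, rfl, key' j hj ⟨_, h.mem_of_restricts hβ⟩ β hβ⟩, rfl⟩

end IsPlaneDivisor

end PlaneDivisors

/-! ### The line and the cuspidal cubic -/

section LineAndCubic

/-- The affine equation of the cuspidal cubic. -/
def cubicEq : MvPolynomial (Fin 2) ℂ := X 1 ^ 2 - X 0 ^ 3

/-- The equation of the line. -/
def lineEq : MvPolynomial (Fin 2) ℂ := X 0 - 1

/-- Modulo x - 1 every polynomial is congruent to p(1, y). -/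
theorem lineEq_dvd_iff (p : MvPolynomial (Fin 2) ℂ) :
    lineEq ∣ p ↔ aeval ![(1 : Polynomial ℂ), Polynomial.X] p = 0 := by
  have key : ∀ p : MvPolynomial (Fin 2) ℂ, lineEq ∣ p - Polynomial.aeval (X 1 : MvPolynomial (Fin 2) ℂ)
      (aeval ![(1 : Polynomial ℂ), Polynomial.X] p) := by
    intro p
    induction p using MvPolynomial.induction_on with
    | C c => simp [algebraMap_eq]
    | add p q hp hq =>
      rw [map_add, map_add, add_sub_add_comm]
      exact dvd_add hp hq
    | mul_X p i hp =>
      rw [map_mul, map_mul, aeval_X]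
      fin_cases i
      · obtain ⟨q, hq⟩ := hp
        refine ⟨q + p, ?_⟩
        simp only [Fin.zero_eta, Matrix.cons_val_zero, map_one, mul_one, lineEq] at hq ⊢
        linear_combination hq
      · obtain ⟨q, hq⟩ := hp
        refine ⟨q * X 1, ?_⟩
        simp only [Fin.mk_one, Matrix.cons_val_one, Matrix.cons_val_fin_one, Polynomial.aeval_X]
        rw [← sub_mul, hq, mul_assoc]
  constructor
  · rintro ⟨q, rfl⟩
    simp [lineEq]
  · intro h
    have := key p
    rwa [h, map_zero, sub_zero] at this

/-- Modulo y² - x³ every polynomial has the form u(x) + v(x)y. Substituting x = τ² and y = τ³ gives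
the even part u(τ²) and the odd part v(τ²)τ³, which vanish together only if u = v = 0. -/
theorem cubicEq_dvd_iff (p : MvPolynomial (Fin 2) ℂ) :
    cubicEq ∣ p ↔ aeval ![(Polynomial.X ^ 2 : Polynomial ℂ), Polynomial.X ^ 3] p = 0 := by
  have key : ∀ p : MvPolynomial (Fin 2) ℂ, ∃ u v : Polynomial ℂ, cubicEq ∣ p -
      (Polynomial.aeval (X 0 : MvPolynomial (Fin 2) ℂ) u + Polynomial.aeval (X 0) v * X 1) := by
    intro p
    induction p using MvPolynomial.induction_on with
    | C c => exact ⟨Polynomial.C c, 0, by simp [algebraMap_eq]⟩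
    | add p q hp hq =>
      obtain ⟨u, v, h⟩ := hp
      obtain ⟨u', v', h'⟩ := hq
      refine ⟨u + u', v + v', ?_⟩
      have := dvd_add h h'
      convert this using 1
      simp only [map_add]
      ring
    | mul_X p i hp =>
      obtain ⟨u, v, q, h⟩ := hp
      fin_cases i
      · refine ⟨u * Polynomial.X, v * Polynomial.X, q * X 0, ?_⟩
        rw [← mul_assoc, ← h]
        simp only [Fin.zero_eta, map_mul, Polynomial.aeval_X]
        ring
      · refine ⟨v * Polynomial.X ^ 3, u, q * X 1 + Polynomial.aeval (X 0) v, ?_⟩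
        rw [mul_add, ← mul_assoc, ← h]
        simp only [Fin.mk_one, map_mul, map_pow, Polynomial.aeval_X, cubicEq]
        ring
  have hcub : aeval ![(Polynomial.X ^ 2 : Polynomial ℂ), Polynomial.X ^ 3] cubicEq = 0 := by
    simp [cubicEq]
    ring
  constructor
  · rintro ⟨q, rfl⟩
    rw [map_mul, hcub, zero_mul]
  · intro h
    obtain ⟨u, v, hd⟩ := key p
    have h1 : aeval ![(Polynomial.X ^ 2 : Polynomial ℂ), Polynomial.X ^ 3] (p -
      (Polynomial.aeval (X 0 : MvPolynomial (Fin 2) ℂ) u + Polynomial.aeval (X 0) v * X 1)) = 0 := by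
      obtain ⟨q, hq⟩ := hd
      rw [hq, map_mul, hcub, zero_mul]
    have h2 : ∀ w : Polynomial ℂ, aeval ![(Polynomial.X ^ 2 : Polynomial ℂ), Polynomial.X ^ 3]
        (Polynomial.aeval (X 0 : MvPolynomial (Fin 2) ℂ) w) = w.comp (Polynomial.X ^ 2) := by
      intro w
      rw [← Polynomial.aeval_algHom_apply, aeval_X]
      rfl
    rw [map_sub, h, zero_sub, neg_eq_zero, map_add, map_mul, h2, h2, aeval_X] at h1
    have h1' : u.comp (Polynomial.X ^ 2) + v.comp (Polynomial.X ^ 2) * Polynomial.X ^ 3 = 0 := h1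
    -- Replacing τ by -τ separates the even part from the odd part.
    have h3 := congrArg (fun r => r.comp (-Polynomial.X)) h1'
    have e : (-Polynomial.X : Polynomial ℂ) ^ 2 = Polynomial.X ^ 2 := by ring
    simp only [Polynomial.add_comp, Polynomial.mul_comp, Polynomial.comp_assoc, Polynomial.pow_comp,
      Polynomial.X_comp, e, Polynomial.zero_comp] at h3
    have h4 : v.comp (Polynomial.X ^ 2) * Polynomial.X ^ 3 = 0 := by
      have : (2 : Polynomial ℂ) * (v.comp (Polynomial.X ^ 2) * Polynomial.X ^ 3) = 0 := by
        linear_combination h1' - h3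
      exact (mul_eq_zero.1 this).resolve_left two_ne_zero
    have hcomp : ∀ w : Polynomial ℂ, w.comp (Polynomial.X ^ 2) = 0 → w = 0 := by
      intro w hw
      rw [← Polynomial.expand_eq_comp_X_pow] at hw
      exact (Polynomial.expand_eq_zero (by norm_num)).1 hw
    have hv := hcomp v ((mul_eq_zero.1 h4).resolve_right (pow_ne_zero _ Polynomial.X_ne_zero))
    rw [h4, add_zero] at h1'
    have hu := hcomp u h1'
    rw [hu, hv] at hd
    simpa using hd

theorem prime_lineEq : Prime lineEq := by
  have h0 : lineEq ≠ 0 := fun h => by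
    have := congrArg (eval fun _ => 0) h
    simp [lineEq] at this
  rw [← Ideal.span_singleton_prime h0]
  have : Ideal.span {lineEq} = RingHom.ker (aeval ![(1 : Polynomial ℂ), Polynomial.X]) := by
    ext p
    rw [Ideal.mem_span_singleton, lineEq_dvd_iff, RingHom.mem_ker]
  rw [this]
  exact RingHom.ker_isPrime _

theorem prime_cubicEq : Prime cubicEq := by
  have h0 : cubicEq ≠ 0 := fun h => by
    have := congrArg (eval ![0, 1]) h
    simp [cubicEq] at this
  rw [← Ideal.span_singleton_prime h0]
  have : Ideal.span {cubicEq} =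
      RingHom.ker (aeval ![(Polynomial.X ^ 2 : Polynomial ℂ), Polynomial.X ^ 3]) := by
    ext p
    rw [Ideal.mem_span_singleton, cubicEq_dvd_iff, RingHom.mem_ker]
  rw [this]
  exact RingHom.ker_isPrime _

theorem exists_isMonomialCurve {n : ℕ} {d : Fin (n + 1) → ℕ} {j k l m : Fin (n + 1)} (hj : d j = 0)
    (hk : ∀ i, d i ≤ d k) (hm : d m = d l + 1) : ∃ D : Variety n, IsMonomialCurve D d j k l m := by
  obtain ⟨D, hD⟩ := exists_variety_of_prime (⊥ : Ideal (Polynomial ℂ))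
    (fun i => (Polynomial.X ^ d i : Polynomial ℂ)) (j := j) (by simp [hj])
  exact ⟨D, hD, hj, hk, hm⟩

theorem aeval_planeDehom {R : Type} [CommRing R] [Algebra ℂ R] (a b : R) (p : CoordRing 2) :
    aeval ![a, b] (planeDehom p) = aeval ![a, b, 1] p := by
  rw [planeDehom, ← AlgHom.comp_apply, comp_aeval]
  congr 2
  funext i
  fin_cases i <;> simp

theorem isPlaneDivisor_line {L : Variety 2} (hL : IsMonomialCurve L ![0, 1, 0] 2 1 2 1) :
    IsPlaneDivisor L lineEq := by
  refine ⟨prime_lineEq, fun e a ha => ?_⟩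
  rw [hL.mem_ideal_iff e a ha, lineEq_dvd_iff, aeval_planeDehom]
  have : (fun i => (Polynomial.X ^ (![0, 1, 0] : Fin 3 → ℕ) i : Polynomial ℂ)) =
      ![1, Polynomial.X, 1] := by
    funext i
    fin_cases i <;> simp
  rw [this]

theorem isPlaneDivisor_cubic {D : Variety 2} (hD : IsMonomialCurve D ![2, 3, 0] 2 1 0 1) :
    IsPlaneDivisor D cubicEq := by
  refine ⟨prime_cubicEq, fun e a ha => ?_⟩
  rw [hD.mem_ideal_iff e a ha, cubicEq_dvd_iff, aeval_planeDehom]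
  have : (fun i => (Polynomial.X ^ (![2, 3, 0] : Fin 3 → ℕ) i : Polynomial ℂ)) =
      ![Polynomial.X ^ 2, Polynomial.X ^ 3, 1] := by
    funext i
    fin_cases i <;> simp
  rw [this]

/-- Rehomogenizing the affine divisibility makes G divide a power of X₂ times a. The prime X₂ does
not divide G, so the power can be cancelled. -/
theorem dvd_of_planeDehom_dvd {e d : ℕ} {a G : CoordRing 2} (ha : a.IsHomogeneous e)
    (hG : G.IsHomogeneous d) (hX : ¬ X 2 ∣ G) (h : planeDehom G ∣ planeDehom a) : G ∣ a := by
  obtain ⟨q, hq⟩ := h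
  obtain ⟨f, b, hb, rfl⟩ := exists_planeDehom_eq q
  have h1 : X 2 ^ (d + f) * a - G * (X 2 ^ e * b) = 0 := by
    refine eq_zero_of_aeval_eq_zero (e := e + d + f) (IsHomogeneous.sub ?_ ?_) ?_
    · have := ((isHomogeneous_X ℂ (2 : Fin 3)).pow (d + f)).mul ha
      rwa [one_mul, show d + f + e = e + d + f by ring] at this
    · have := hG.mul (((isHomogeneous_X ℂ (2 : Fin 3)).pow e).mul hb)
      rwa [one_mul, show d + (e + f) = e + d + f by ring] at this
    · change planeDehom _ = 0
      rw [map_sub, planeDehom_X_two_pow_mul, map_mul, planeDehom_X_two_pow_mul, hq, sub_self]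
  rw [sub_eq_zero] at h1
  have hp : Prime (X 2 : CoordRing 2) := X_prime
  obtain ⟨c, hc⟩ := hp.pow_dvd_of_dvd_mul_left (d + f) hX ⟨a, h1.symm⟩
  refine ⟨c, mul_left_cancel₀ (pow_ne_zero (d + f) hp.ne_zero) ?_⟩
  rw [h1, hc]
  ring

theorem planeDehom_line : planeDehom (X 0 - X 2) = lineEq := by
  simp [planeDehom, lineEq]

theorem planeDehom_cubic : planeDehom (X 1 ^ 2 * X 2 - X 0 ^ 3) = cubicEq := by
  simp [planeDehom, cubicEq]

theorem notMem_of_eval_ne_zero {G : CoordRing 2} (h : eval ![1, 1, 0] G ≠ 0) : ¬ X 2 ∣ G := by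
  rintro ⟨q, rfl⟩
  simp at h

variable {L D : Variety 2}

theorem ideal_cubic (hD : IsPlaneDivisor D cubicEq) :
    D.ideal = Ideal.span {X 1 ^ 2 * X 2 - X 0 ^ 3} := by
  apply le_antisymm
  · refine D.ideal_le_of_homogeneous fun e a ha haD => Ideal.mem_span_singleton.2 ?_
    refine dvd_of_planeDehom_dvd ha isHomogeneous_cubic (notMem_of_eval_ne_zero (by simp)) ?_
    rw [planeDehom_cubic]
    exact (hD.mem_ideal_iff e a ha).1 haD
  · rw [Ideal.span_singleton_le_iff_mem]
    exact (hD.mem_ideal_iff 3 _ isHomogeneous_cubic).2 planeDehom_cubic.symm.dvd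

theorem not_cubicEq_dvd_lineEq : ¬ cubicEq ∣ lineEq := by
  rw [cubicEq_dvd_iff]
  intro h
  have := congrArg (Polynomial.eval 0) h
  simp [lineEq] at this

theorem not_lineEq_dvd_cubicEq : ¬ lineEq ∣ cubicEq := by
  rw [lineEq_dvd_iff]
  intro h
  have := congrArg (Polynomial.eval 0) h
  simp [cubicEq] at this

/-- The two affine equations are primes, neither of which divides the other, so divisibility by both
is divisibility by the product; this is then lifted to homogeneous polynomials. -/
theorem inf_ideal_eq (hL : IsPlaneDivisor L lineEq) (hD : IsPlaneDivisor D cubicEq) :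
    L.ideal ⊓ D.ideal = Ideal.span {cuspBoundary} := by
  apply le_antisymm
  · intro a ha
    rw [← sum_homogeneousComponent a]
    refine Ideal.sum_mem _ fun e _ => ?_
    have hL' := L.homogeneousComponent_mem ha.1 e
    have hD' := D.homogeneousComponent_mem ha.2 e
    have hom := homogeneousComponent_isHomogeneous e a
    rw [hL.mem_ideal_iff e _ hom] at hL'
    rw [hD.mem_ideal_iff e _ hom] at hD'
    refine Ideal.mem_span_singleton.2 (dvd_of_planeDehom_dvd hom isHomogeneous_cuspBoundary
      (notMem_of_eval_ne_zero (by simp [cuspBoundary])) ?_)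
    rw [cuspBoundary, map_mul, planeDehom_line, planeDehom_cubic]
    obtain ⟨q, hq⟩ := hL'
    rw [hq] at hD' ⊢
    exact mul_dvd_mul_left _ ((prime_cubicEq.dvd_or_dvd hD').resolve_left not_cubicEq_dvd_lineEq)
  · rw [Ideal.span_singleton_le_iff_mem]
    refine ⟨(hL.mem_ideal_iff _ _ isHomogeneous_cuspBoundary).2 ?_,
      (hD.mem_ideal_iff _ _ isHomogeneous_cuspBoundary).2 ?_⟩
    · rw [cuspBoundary, map_mul, planeDehom_line]
      exact dvd_mul_right _ _
    · rw [cuspBoundary, map_mul, planeDehom_cubic]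
      exact dvd_mul_left _ _

theorem not_line_le_cubic (hL : IsPlaneDivisor L lineEq) (hD : IsPlaneDivisor D cubicEq) :
    ¬ L.ideal ≤ D.ideal := fun h => not_cubicEq_dvd_lineEq (by
  have := h ((hL.mem_ideal_iff 1 _ isHomogeneous_line).2 planeDehom_line.symm.dvd)
  rwa [hD.mem_ideal_iff 1 _ isHomogeneous_line, planeDehom_line] at this)

theorem not_cubic_le_line (hL : IsPlaneDivisor L lineEq) (hD : IsPlaneDivisor D cubicEq) :
    ¬ D.ideal ≤ L.ideal := fun h => not_lineEq_dvd_cubicEq (by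
  have := h ((hD.mem_ideal_iff 3 _ isHomogeneous_cubic).2 planeDehom_cubic.symm.dvd)
  rwa [hL.mem_ideal_iff 3 _ isHomogeneous_cubic, planeDehom_cubic] at this)

end LineAndCubic

/-! ### Regular two-forms on the plane vanish -/

section RegularForms

variable {K : Type} [Field K] [Algebra ℂ K] {x y : K}

theorem exists_aeval_mul_pow_eq (hx : x ≠ 0) (p : MvPolynomial (Fin 2) ℂ) :
    ∃ (M : ℕ) (q : MvPolynomial (Fin 2) ℂ),
      aeval ![x, y] p = aeval ![y / x, x⁻¹] q * x ^ M := by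
  induction p using MvPolynomial.induction_on with
  | C c => exact ⟨0, C c, by simp⟩
  | add p q hp hq =>
    obtain ⟨M, p', hp'⟩ := hp
    obtain ⟨N, q', hq'⟩ := hq
    refine ⟨M + N, p' * X 1 ^ N + q' * X 1 ^ M, ?_⟩
    rw [map_add, hp', hq']
    simp only [map_add, map_mul, map_pow, aeval_X, Matrix.cons_val_one, Matrix.cons_val_fin_one]
    generalize aeval ![y / x, x⁻¹] p' = u
    generalize aeval ![y / x, x⁻¹] q' = v
    rw [inv_pow, inv_pow, pow_add]
    field_simp
  | mul_X p i hp =>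
    obtain ⟨M, p', hp'⟩ := hp
    rw [map_mul, aeval_X, hp']
    fin_cases i
    · refine ⟨M + 1, p', ?_⟩
      simp only [Fin.zero_eta, Matrix.cons_val_zero]
      ring
    · refine ⟨M + 1, p' * X 0, ?_⟩
      simp only [Fin.mk_one, Matrix.cons_val_one, Matrix.cons_val_fin_one, map_mul, aeval_X,
        Matrix.cons_val_zero]
      field_simp
      ring

/-- A monomial (y/x)^i (1/x)^j times a large power x^M is a monomial of degree at most M in x and y.
The degree bound is what makes the form vanish in `IsChart.eq_zero_of_isRegular`. -/
theorem exists_totalDegree_le_aeval_eq (hx : x ≠ 0) (r : MvPolynomial (Fin 2) ℂ) :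
    ∃ (M : ℕ) (R : MvPolynomial (Fin 2) ℂ), R.totalDegree ≤ M ∧
      aeval ![x, y] R = aeval ![y / x, x⁻¹] r * x ^ M := by
  induction r using MvPolynomial.induction_on with
  | C c => exact ⟨0, C c, by simp, by simp⟩
  | add p q hp hq =>
    obtain ⟨M, p', hpM, hp'⟩ := hp
    obtain ⟨N, q', hqN, hq'⟩ := hq
    refine ⟨M + N, p' * X 0 ^ N + q' * X 0 ^ M, ?_, ?_⟩
    · refine (totalDegree_add _ _).trans (max_le ?_ ?_)
      · refine (totalDegree_mul _ _).trans ?_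
        rw [totalDegree_X_pow]
        omega
      · refine (totalDegree_mul _ _).trans ?_
        rw [totalDegree_X_pow]
        omega
    · simp only [map_add, map_mul, map_pow, aeval_X, Matrix.cons_val_zero, hp', hq']
      ring
  | mul_X p i hp =>
    obtain ⟨M, p', hpM, hp'⟩ := hp
    fin_cases i
    · refine ⟨M + 1, p' * X 1, (totalDegree_mul _ _).trans ?_, ?_⟩
      · rw [totalDegree_X]
        omega
      · simp only [map_mul, aeval_X, hp', Fin.zero_eta, Matrix.cons_val_zero, Matrix.cons_val_one,
          Matrix.cons_val_fin_one]
        field_simp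
        ring
    · refine ⟨M + 1, p', hpM.trans (Nat.le_succ M), ?_⟩
      simp only [map_mul, aeval_X, hp', Fin.mk_one, Matrix.cons_val_one, Matrix.cons_val_fin_one]
      field_simp
      ring

theorem IsChart.chart_infinity (h : IsChart ![x, y]) : IsChart ![y / x, x⁻¹] := by
  have hx := h.left_ne_zero
  exact h.isChart_of_eq_pow (i := 0) (j := -1) (k := 1) (l := -1) (by simp) (by field_simp)

theorem IsChart.dForm_mul_dForm_infinity (h : IsChart ![x, y]) :
    dForm x * dForm y = x ^ 3 • (dForm (y / x) * dForm x⁻¹) := by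
  have hx := h.left_ne_zero
  have e : y = y / x * x := by field_simp
  have h1 : dForm y = (y / x) • dForm x + x • dForm (y / x) := by
    conv_lhs => rw [e]
    exact dForm_mul _ _
  rw [h1, dForm_inv hx]
  simp only [mul_add, mul_smul_comm, dForm_mul_self, smul_zero, zero_add, dForm_mul_comm x (y / x),
    smul_smul]
  rw [smul_neg, ← neg_smul]
  congr 1
  field_simp

/-- A two-form that is regular on the affine plane and along the line at infinity vanishes. -/
theorem IsChart.eq_zero_of_isRegular (h : IsChart ![x, y]) {c : K}
    (hc : ∀ f : MvPolynomial (Fin 2) ℂ, Irreducible f → ∀ [(Ideal.span {f}).IsPrime],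
      c ∈ locRing ![x, y] (Ideal.span {f}))
    [(Ideal.span {(X 1 : MvPolynomial (Fin 2) ℂ)}).IsPrime]
    (hinf : IsRegularForm 2 (locRing ![y / x, x⁻¹] (Ideal.span {X 1}))
      (c • (dForm x * dForm y))) : c = 0 := by
  have hx := h.left_ne_zero
  have h' := h.chart_infinity
  obtain ⟨p₀, hp₀⟩ := h.exists_eq_aeval c fun f hf => by
    have := (Ideal.span_singleton_prime hf.ne_zero).2 hf.prime
    obtain ⟨p, q, hq, hq0, e⟩ := hc f hf
    exact ⟨p, q, fun hd => hq (Ideal.mem_span_singleton.2 hd), by rw [e, div_mul_cancel₀ _ hq0]⟩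
  rw [h.dForm_mul_dForm_infinity, smul_smul, h'.isRegularForm_iff] at hinf
  -- Since dx∧dy = x³ d(y/x)∧d(1/x), the coefficient at infinity is c·x³. It is regular along X₁ = 0
  -- by hypothesis and along the other divisors of this chart because c is a polynomial in x and y.
  obtain ⟨r, hr⟩ := h'.exists_eq_aeval (c * x ^ 3) fun f hf => by
    by_cases hf1 : f ∣ X 1
    · obtain ⟨p, q, hq, hq0, e⟩ := hinf
      refine ⟨p, q, fun hd => hq (Ideal.mem_span_singleton.2 ?_), by rw [e, div_mul_cancel₀ _ hq0]⟩
      exact ((hf.associated_of_dvd X_prime.irreducible hf1).dvd_iff_dvd_left).1 hd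
    · obtain ⟨M, q, hq⟩ := exists_aeval_mul_pow_eq (y := y) hx p₀
      refine ⟨q, X 1 ^ (M + 3), fun hd => hf1 (hf.prime.dvd_of_dvd_pow hd), ?_⟩
      rw [hp₀, hq, map_pow, aeval_X]
      simp only [Matrix.cons_val_one, Matrix.cons_val_fin_one]
      rw [inv_pow, pow_add]
      field_simp
  obtain ⟨M, R, hRM, hR⟩ := exists_totalDegree_le_aeval_eq (y := y) hx r
  have heq : p₀ * X 0 ^ (M + 3) = R := by
    apply h.injective
    rw [hR, ← hr, hp₀]
    simp only [map_mul, map_pow, aeval_X, Matrix.cons_val_zero]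
    ring
  by_contra hc0
  have hp : p₀ ≠ 0 := by
    rintro rfl
    exact hc0 (by rw [hp₀, map_zero])
  -- The left side of `heq` has degree deg p₀ + M + 3 and the right side at most M. The surplus 3
  -- reflects that the canonical class of the plane has degree -3.
  have := totalDegree_mul_of_isDomain hp (pow_ne_zero (M + 3) (X_ne_zero (R := ℂ) (0 : Fin 2)))
  rw [heq, totalDegree_X_pow] at this
  omega

theorem IsChart.dForm_lineEq (h : IsChart ![x, y]) :
    dForm (aeval ![x, y] lineEq) * dForm y = (1 : K) • (dForm x * dForm y) := by
  have := h.dForm_mul_dForm_aeval lineEq (X 1)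
  rw [aeval_X] at this
  refine this.trans ?_
  congr 1
  simp [polyJac, lineEq, pderiv_X]

theorem IsChart.dForm_cubicEq (h : IsChart ![x, y]) :
    dForm (aeval ![x, y] cubicEq) * dForm x = (-2 * y) • (dForm x * dForm y) := by
  have := h.dForm_mul_dForm_aeval cubicEq (X 0)
  rw [aeval_X] at this
  refine this.trans ?_
  congr 1
  simp [polyJac, cubicEq, pderiv_X, Derivation.leibniz_pow]

end RegularForms

/-! ### Restriction to divisors -/

section Restriction

variable {D : Variety 2} {g : MvPolynomial (Fin 2) ℂ} (h : IsPlaneDivisor D g)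
  {z z' : FunctionField (projSpace 2)} {β β' : FunctionField D}

theorem dehom_ne_zero_of_notMem {n : ℕ} {X : Variety n} {j : Fin (n + 1)}
    (hj : (MvPolynomial.X j : CoordRing n) ∉ X.ideal) {e : ℕ} {a : CoordRing n}
    (ha : a.IsHomogeneous e) (haX : a ∉ X.ideal) : dehom X j a ≠ 0 :=
  mt (dehom_eq_zero_iff X hj ha).1 haX

include h

theorem IsPlaneDivisor.dehom_ne_zero {e : ℕ} {a : CoordRing 2} (ha : a.IsHomogeneous e)
    (haD : a ∉ D.ideal) : dehom (projSpace 2) 2 a ≠ 0 ∧ dehom D 2 a ≠ 0 :=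
  ⟨dehom_ne_zero_of_notMem (X_notMem_projSpace 2 2) ha fun h0 => haD (projSpace_ideal_le D h0),
    dehom_ne_zero_of_notMem h.X_two_notMem ha haD⟩

omit h in
theorem restricts_algebraMap (c : ℂ) :
    Restricts D (algebraMap ℂ _ c) (algebraMap ℂ _ c) :=
  ⟨0, C c, 1, isHomogeneous_C _ _, isHomogeneous_one _ _, D.isPrime.one_notMem,
    by rw [map_one, div_one, ← algebraMap_eq, AlgHom.commutes],
    by rw [map_one, div_one, ← algebraMap_eq, AlgHom.commutes]⟩

theorem IsPlaneDivisor.restricts_add (hz : Restricts D z β) (hz' : Restricts D z' β') :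
    Restricts D (z + z') (β + β') := by
  obtain ⟨e, a, b, ha, hb, hbD, rfl, rfl⟩ := hz
  obtain ⟨e', a', b', ha', hb', hbD', rfl, rfl⟩ := hz'
  refine ⟨e + e', a * b' + b * a', b * b', (ha.mul hb').add (hb.mul ha'), hb.mul hb',
    D.isPrime.mul_notMem hbD hbD', ?_, ?_⟩
  · rw [map_add, map_mul, map_mul, map_mul,
      div_add_div _ _ (h.dehom_ne_zero hb hbD).1 (h.dehom_ne_zero hb' hbD').1]
  · rw [map_add, map_mul, map_mul, map_mul,
      div_add_div _ _ (h.dehom_ne_zero hb hbD).2 (h.dehom_ne_zero hb' hbD').2]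

omit h in
theorem Restricts.mul (hz : Restricts D z β) (hz' : Restricts D z' β') :
    Restricts D (z * z') (β * β') := by
  obtain ⟨e, a, b, ha, hb, hbD, rfl, rfl⟩ := hz
  obtain ⟨e', a', b', ha', hb', hbD', rfl, rfl⟩ := hz'
  refine ⟨e + e', a * a', b * b', ha.mul ha', hb.mul hb',
    D.isPrime.mul_notMem hbD hbD', ?_, ?_⟩
  · rw [map_mul, map_mul, div_mul_div_comm]
  · rw [map_mul, map_mul, div_mul_div_comm]

theorem IsPlaneDivisor.restricts_inv (hz : Restricts D z β) (hβ : β ≠ 0) :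
    Restricts D z⁻¹ β⁻¹ := by
  obtain ⟨e, a, b, ha, hb, hbD, rfl, rfl⟩ := hz
  refine ⟨e, b, a, hb, ha, fun haD => hβ ?_, inv_div _ _, inv_div _ _⟩
  rw [(dehom_eq_zero_iff D h.X_two_notMem ha).2 haD, zero_div]

theorem IsPlaneDivisor.restricts_aeval (p : MvPolynomial (Fin 2) ℂ) :
    Restricts D (aeval ![planeX, planeY] p) (aeval ![affCoord D 2 0, affCoord D 2 1] p) := by
  induction p using MvPolynomial.induction_on with
  | C c =>
    rw [← algebraMap_eq, AlgHom.commutes, AlgHom.commutes]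
    exact restricts_algebraMap c
  | add p q hp hq =>
    rw [map_add, map_add]
    exact h.restricts_add hp hq
  | mul_X p i hp =>
    rw [map_mul, map_mul, aeval_X, aeval_X]
    refine hp.mul ?_
    fin_cases i
    · exact h.restricts_coord 0
    · exact h.restricts_coord 1

/-- A function that restricts to zero has its numerator in the ideal of D, and this numerator is
divisible by g. -/
theorem IsPlaneDivisor.div_mem_of_restricts_zero [(Ideal.span {g}).IsPrime]
    (hz : Restricts D z 0) :
    z / aeval ![planeX, planeY] g ∈ locRing ![planeX, planeY] (Ideal.span {g}) := by
  obtain ⟨e, a, b, ha, hb, hbD, rfl, h0⟩ := hz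
  have haD : a ∈ D.ideal := by
    rw [← dehom_eq_zero_iff D h.X_two_notMem ha]
    exact (div_eq_zero_iff.1 h0.symm).resolve_right (h.dehom_ne_zero hb hbD).2
  obtain ⟨q, hq⟩ := (h.mem_ideal_iff e a ha).1 haD
  rw [dehom_plane, dehom_plane, hq, map_mul, div_right_comm,
    mul_div_cancel_left₀ _ (isChart_plane.aeval_ne_zero h.prime.ne_zero)]
  refine isChart_plane.div_mem_locRing fun h1 => hbD ?_
  rw [h.mem_ideal_iff e b hb]
  exact Ideal.mem_span_singleton.1 h1

end Restriction

/-! ### Logarithmic forms on the plane with prescribed residues -/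

section PlaneResidues

theorem locRing_congr {K : Type} [Field K] [Algebra ℂ K] {m : ℕ} (u : Fin m → K)
    {P Q : Ideal (MvPolynomial (Fin m) ℂ)} [P.IsPrime] [Q.IsPrime] (h : P = Q) :
    locRing u P = locRing u Q := by
  subst h
  rfl

instance isPrime_lineEq : (Ideal.span {lineEq}).IsPrime :=
  (Ideal.span_singleton_prime prime_lineEq.ne_zero).2 prime_lineEq

instance isPrime_cubicEq : (Ideal.span {cubicEq}).IsPrime :=
  (Ideal.span_singleton_prime prime_cubicEq.ne_zero).2 prime_cubicEq

instance isPrime_X_one : (Ideal.span {(X 1 : MvPolynomial (Fin 2) ℂ)}).IsPrime :=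
  (Ideal.span_singleton_prime (X_ne_zero 1)).2 X_prime

section Generic

variable {K : Type} [Field K] [Algebra ℂ K] {x y : K}

/-- The coefficient of the canonical form. -/
def cuspCoeff (x y : K) : K := -2 * x / ((x - 1) * (y ^ 2 - x ^ 3))

theorem aeval_lineEq : aeval ![x, y] lineEq = x - 1 := by simp [lineEq]

theorem aeval_cubicEq : aeval ![x, y] cubicEq = y ^ 2 - x ^ 3 := by simp [cubicEq]

theorem IsChart.cuspCoeff_mul_lineEq (h : IsChart ![x, y]) :
    cuspCoeff x y / 1 * aeval ![x, y] lineEq =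
      aeval ![x, y] (-2 * X 0 : MvPolynomial (Fin 2) ℂ) * (aeval ![x, y] cubicEq)⁻¹ := by
  have h1 := h.aeval_ne_zero prime_lineEq.ne_zero
  have h2 := h.aeval_ne_zero prime_cubicEq.ne_zero
  have h3 : aeval ![x, y] (-2 * X 0 : MvPolynomial (Fin 2) ℂ) = -2 * x := by simp
  rw [h3, cuspCoeff, ← aeval_lineEq (y := y), ← aeval_cubicEq]
  field_simp

theorem IsChart.cuspCoeff_mul_cubicEq (h : IsChart ![x, y]) :
    cuspCoeff x y / (-2 * y) * aeval ![x, y] cubicEq =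
      aeval ![x, y] (X 0 : MvPolynomial (Fin 2) ℂ) * (aeval ![x, y] (lineEq * X 1))⁻¹ := by
  have h1 := h.aeval_ne_zero prime_lineEq.ne_zero
  have h2 := h.aeval_ne_zero prime_cubicEq.ne_zero
  have h0 := h.right_ne_zero
  -- Needed to cancel the factor 2 that comes from d(y²).
  have : CharZero K := charZero_of_injective_algebraMap (algebraMap ℂ K).injective
  rw [map_mul, aeval_X, aeval_X, cuspCoeff, ← aeval_lineEq (y := y), ← aeval_cubicEq]
  simp only [Matrix.cons_val_one, Matrix.cons_val_fin_one, Matrix.cons_val_zero]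
  field_simp

end Generic

theorem cuspForm_eq {K : Type} [Field K] [Algebra ℂ K] (x y : K) :
    cuspForm x y = cuspCoeff x y • (dForm x * dForm y) := rfl

theorem isLogarithmic_cuspCoeff : IsLogarithmic 2 (projSpace 2) (Ideal.span {cuspBoundary})
    (cuspCoeff planeX planeY • (dForm planeX * dForm planeY)) :=
  (cuspForm_eq planeX planeY).symm ▸ isLogarithmic_cusp

variable {L D : Variety 2}

theorem coords_line (hL : IsMonomialCurve L ![0, 1, 0] 2 1 2 1) :
    ![affCoord L 2 0, affCoord L 2 1] = ![1, affCoord L 2 1] := by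
  rw [hL.affCoord_zero 0]
  simp

theorem coords_cubic (hD : IsMonomialCurve D ![2, 3, 0] 2 1 0 1) :
    ![affCoord D 2 0, affCoord D 2 1] = ![affCoord D 0 1 ^ 2, affCoord D 0 1 ^ 3] := by
  rw [hD.affCoord_zero 0, hD.affCoord_zero 1]
  simp

/-- Removing the factor x - 1 leaves -2x/(y² - x³), which is -2/(y² - 1) on x = 1. -/
theorem restricts_cuspCoeff_line (hL : IsMonomialCurve L ![0, 1, 0] 2 1 2 1) :
    Restricts L (cuspCoeff planeX planeY / 1 * aeval ![planeX, planeY] lineEq)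
      (-(2 / (affCoord L 2 1 ^ 2 - 1))) := by
  have h := isPlaneDivisor_line hL
  have hsq := hL.isChart.sq_sub_one_ne_zero
  have e : aeval ![affCoord L 2 0, affCoord L 2 1] cubicEq = affCoord L 2 1 ^ 2 - 1 := by
    rw [coords_line hL, aeval_cubicEq, one_pow]
  have e' : aeval ![affCoord L 2 0, affCoord L 2 1] (-2 * X 0 : MvPolynomial (Fin 2) ℂ) = -2 := by
    rw [coords_line hL, map_mul, aeval_X, map_neg, map_ofNat, Matrix.cons_val_zero, mul_one]
  rw [isChart_plane.cuspCoeff_mul_lineEq]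
  have := (h.restricts_aeval (-2 * X 0)).mul
    (h.restricts_inv (h.restricts_aeval cubicEq) (by rw [e]; exact hsq))
  rw [e, e'] at this
  convert this using 1
  rw [neg_mul, div_eq_mul_inv]

/-- After division by -2y and removal of the cubic factor there remains x/((x - 1)y); its value at x
= t², y = t³ is the stated expression. -/
theorem restricts_cuspCoeff_cubic (hD : IsMonomialCurve D ![2, 3, 0] 2 1 0 1) :
    Restricts D (cuspCoeff planeX planeY / (-2 * planeY) * aeval ![planeX, planeY] cubicEq)
      (affCoord D 0 1 ^ 2 * ((affCoord D 0 1 ^ 2 - 1) * affCoord D 0 1 ^ 3)⁻¹) := by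
  have h := isPlaneDivisor_cubic hD
  have hsq := hD.isChart.sq_sub_one_ne_zero
  have ht := hD.coord_ne_zero
  have e : aeval ![affCoord D 2 0, affCoord D 2 1] (lineEq * X 1) =
      (affCoord D 0 1 ^ 2 - 1) * affCoord D 0 1 ^ 3 := by
    rw [coords_cubic hD, map_mul, aeval_lineEq, aeval_X]
    rfl
  have e' : aeval ![affCoord D 2 0, affCoord D 2 1] (X 0 : MvPolynomial (Fin 2) ℂ) =
      affCoord D 0 1 ^ 2 := by
    rw [coords_cubic hD, aeval_X]
    rfl
  rw [isChart_plane.cuspCoeff_mul_cubicEq]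
  have := (h.restricts_aeval (X 0)).mul
    (h.restricts_inv (h.restricts_aeval (lineEq * X 1))
      (by rw [e]; exact mul_ne_zero hsq (pow_ne_zero 3 ht)))
  rwa [e, e'] at this

variable {c : FunctionField (projSpace 2)}

theorem mem_locRing_of_isLogarithmic
    (hlog : IsLogarithmic 2 (projSpace 2) (Ideal.span {cuspBoundary})
      (c • (dForm planeX * dForm planeY))) {f : MvPolynomial (Fin 2) ℂ} (hf : Irreducible f)
    (hfF : ¬ f ∣ lineEq * cubicEq) [(Ideal.span {f}).IsPrime] :
    c ∈ locRing ![planeX, planeY] (Ideal.span {f}) := by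
  obtain ⟨D, hD⟩ := exists_isPlaneDivisor hf.prime
  rw [← isChart_plane.isRegularForm_iff]
  refine hlog.isRegularForm hD.isValuationRingOf_locRing (projSpace_ideal_le D)
    hD.dominates_locRing isHomogeneous_cuspBoundary (Ideal.mem_span_singleton_self _) ?_
  rwa [hD.mem_ideal_iff _ _ isHomogeneous_cuspBoundary, cuspBoundary, map_mul, planeDehom_line,
    planeDehom_cubic]

/-- The line at infinity is not contained in the boundary, since the quartic does not vanish at its
generic point. -/
theorem isRegularForm_infinity_of_isLogarithmic
    (hlog : IsLogarithmic 2 (projSpace 2) (Ideal.span {cuspBoundary})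
      (c • (dForm planeX * dForm planeY))) :
    IsRegularForm 2 (locRing ![planeY / planeX, planeX⁻¹] (Ideal.span {X 1}))
      (c • (dForm planeX * dForm planeY)) := by
  have h' := isChart_plane.chart_infinity
  have hloc := h'.isLocalRing_locRing (P := Ideal.span {X 1})
  have hcoord : ∀ i, affCoord (projSpace 2) 0 i ∈
      locRing ![planeY / planeX, planeX⁻¹] (Ideal.span {X 1}) := fun i => by
    rw [affCoord_plane_x]
    fin_cases i
    · exact one_mem _
    · exact coord_mem_locRing 0
    · exact coord_mem_locRing 1
  obtain ⟨Q, hXQ, hdom, -, hQ⟩ := exists_center (projSpace 2) (X_notMem_projSpace 2 0)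
    (locRing ![planeY / planeX, planeX⁻¹] (Ideal.span {X 1})) hcoord
  refine hlog.isRegularForm (h'.isValuationRingOf_locRing X_prime.not_isUnit rfl) hXQ hdom
    isHomogeneous_cuspBoundary (Ideal.mem_span_singleton_self _) ?_
  have e : dehom (projSpace 2) 0 cuspBoundary = aeval ![planeY / planeX, planeX⁻¹]
      ((1 - X 1) * (X 0 ^ 2 * X 1 - 1) : MvPolynomial (Fin 2) ℂ) := by
    rw [dehom_cuspBoundary, affCoord_plane_x]
    simp only [map_mul, map_sub, map_one, map_pow, aeval_X]
    change _ * (_ - (1 : FunctionField (projSpace 2)) ^ 3) = _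
    rw [one_pow]
    rfl
  rw [hQ _ _ isHomogeneous_cuspBoundary, e, h'.inv_aeval_mem_locRing_iff]
  -- With a = y/x and b = 1/x the quartic is (1 - b)(a²b - 1) = -1 + b(a² - a²b + 1), which is -1 on
  -- the line at infinity b = 0.
  refine notMem_of_dvd_sub (Ideal.mem_span_singleton_self _) (-1) (by norm_num)
    ⟨X 0 ^ 2 - X 0 ^ 2 * X 1 + 1, ?_⟩
  rw [map_neg, map_one]
  ring

theorem IsPlaneDivisor.restricts_sub_mul {g : MvPolynomial (Fin 2) ℂ} (h : IsPlaneDivisor D g)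
    {c c' J : FunctionField (projSpace 2)} {β : FunctionField D} {s s' : ℂ}
    (hc : Restricts D (c / J * aeval ![planeX, planeY] g) (algebraMap ℂ _ s * β))
    (hc' : Restricts D (c' / J * aeval ![planeX, planeY] g) β) :
    Restricts D ((c - algebraMap ℂ _ s' * c') / J * aeval ![planeX, planeY] g)
      (algebraMap ℂ _ (s - s') * β) := by
  have := h.restricts_add hc ((restricts_algebraMap (-s')).mul hc')
  convert this using 1
  · rw [map_neg]; ring
  · rw [map_neg, map_sub]; ring

end PlaneResidues

/-! ### A logarithmic form on the plane is determined by its residues -/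

section PlaneUniqueness

variable {L D : Variety 2} {c : FunctionField (projSpace 2)} {s s' : ℂ}

theorem locRing_eq_of_dvd {K : Type} [Field K] [Algebra ℂ K] {m : ℕ} (u : Fin m → K)
    {f g : MvPolynomial (Fin m) ℂ} [(Ideal.span {f}).IsPrime] [(Ideal.span {g}).IsPrime]
    (hf : Irreducible f) (hg : Irreducible g) (h : f ∣ g) :
    locRing u (Ideal.span {f}) = locRing u (Ideal.span {g}) :=
  locRing_congr u (Ideal.span_singleton_eq_span_singleton.2 (hf.associated_of_dvd hg h))

theorem isRegularForm_infinity_sub {c' : FunctionField (projSpace 2)}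
    (h : IsRegularForm 2 (locRing ![planeY / planeX, planeX⁻¹] (Ideal.span {X 1}))
      (c • (dForm planeX * dForm planeY)))
    (h' : IsRegularForm 2 (locRing ![planeY / planeX, planeX⁻¹] (Ideal.span {X 1}))
      (c' • (dForm planeX * dForm planeY))) (s : ℂ) :
    IsRegularForm 2 (locRing ![planeY / planeX, planeX⁻¹] (Ideal.span {X 1}))
      ((c - algebraMap ℂ _ s * c') • (dForm planeX * dForm planeY)) := by
  rw [isChart_plane.dForm_mul_dForm_infinity, smul_smul,
    isChart_plane.chart_infinity.isRegularForm_iff] at h h' ⊢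
  rw [sub_mul, mul_assoc]
  exact sub_mem h (mul_mem (Subalgebra.algebraMap_mem _ s) h')

/-- A vanishing residue coefficient (c/J)·g is divisible by g, so c/J and hence c is regular along
the divisor. -/
theorem IsPlaneDivisor.mem_of_restricts_mul_zero {g : MvPolynomial (Fin 2) ℂ}
    (h : IsPlaneDivisor D g) [(Ideal.span {g}).IsPrime] {J : FunctionField (projSpace 2)}
    (hJ : J ≠ 0) (hJm : J ∈ locRing ![planeX, planeY] (Ideal.span {g}))
    (hc : Restricts D (c / J * aeval ![planeX, planeY] g) 0) :
    c ∈ locRing ![planeX, planeY] (Ideal.span {g}) := by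
  have := mul_mem (h.div_mem_of_restricts_zero hc) hJm
  rwa [mul_div_cancel_right₀ _ (isChart_plane.aeval_ne_zero h.prime.ne_zero),
    div_mul_cancel₀ _ hJ] at this

/-- Clearing denominators gives κ(t², t³)(t² - 1) + 2r·t² = 0, and t = 1 yields r = 0.
Geometrically, without a pole along the line the residue on the cubic has no pole at a point where
the two curves meet. -/
theorem eq_zero_of_aeval_cusp_eq (hD : IsMonomialCurve D ![2, 3, 0] 2 1 0 1)
    (κ : MvPolynomial (Fin 2) ℂ) {r : ℂ}
    (h : aeval ![affCoord D 0 1 ^ 2, affCoord D 0 1 ^ 3] κ =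
      -2 * affCoord D 0 1 ^ 3 * (algebraMap ℂ _ r *
        (affCoord D 0 1 ^ 2 * ((affCoord D 0 1 ^ 2 - 1) * affCoord D 0 1 ^ 3)⁻¹))) : r = 0 := by
  have ht := hD.coord_ne_zero
  have hsq := hD.isChart.sq_sub_one_ne_zero
  have e : Polynomial.aeval (affCoord D 0 1) (aeval ![(Polynomial.X : Polynomial ℂ) ^ 2,
      Polynomial.X ^ 3] κ) = aeval ![affCoord D 0 1 ^ 2, affCoord D 0 1 ^ 3] κ := by
    rw [← AlgHom.comp_apply]
    congr 1
    ext i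
    fin_cases i <;> simp
  have := (hD.isChart.polynomial_inv_mem_linePlace_iff
    (aeval ![(Polynomial.X : Polynomial ℂ) ^ 2, Polynomial.X ^ 3] κ * (Polynomial.X ^ 2 - 1) +
      Polynomial.C (2 * r) * Polynomial.X ^ 2) 1).1 (Or.inl ?_)
  · simpa using this
  · rw [map_add, map_mul, e, h, map_mul, Polynomial.aeval_C, map_sub, map_pow, Polynomial.aeval_X,
      map_one, map_mul, map_ofNat]
    generalize affCoord D 0 1 = t at ht hsq ⊢
    field_simp
    ring

theorem neg_two_mul_planeY_ne_zero : -2 * planeY ≠ 0 :=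
  mul_ne_zero (neg_ne_zero.2 two_ne_zero) isChart_plane.right_ne_zero

theorem aeval_neg_two_mul_X {K : Type} [Field K] [Algebra ℂ K] (x y : K) :
    aeval ![x, y] (-2 * X 1 : MvPolynomial (Fin 2) ℂ) = -2 * y := by simp

theorem eq_zero_of_restricts_cubic (hD : IsMonomialCurve D ![2, 3, 0] 2 1 0 1)
    {k w : FunctionField (projSpace 2)} {r : ℂ} {κ : MvPolynomial (Fin 2) ℂ}
    (hw : Restricts D w (algebraMap ℂ _ r *
        (affCoord D 0 1 ^ 2 * ((affCoord D 0 1 ^ 2 - 1) * affCoord D 0 1 ^ 3)⁻¹)))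
    (hκ : k = -2 * planeY * w) (hk : k = aeval ![planeX, planeY] κ) : r = 0 := by
  have hPD := isPlaneDivisor_cubic hD
  have h1 := hPD.restricts_aeval κ
  have h2 := (hPD.restricts_aeval (-2 * X 1)).mul hw
  rw [aeval_neg_two_mul_X, ← hκ, hk] at h2
  have h3 := hPD.restricts_unique h1 h2
  rw [coords_cubic hD, aeval_neg_two_mul_X] at h3
  exact eq_zero_of_aeval_cusp_eq hD κ h3

-- The two residues a priori carry independent constants s and s'. Subtracting s times the model
-- form removes the pole along the line, the crossing at τ = 1 then forces s' = s, and the resulting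
-- form is regular everywhere, hence zero.
set_option maxHeartbeats 800000 in
theorem eq_smul_of_restricts (hL : IsMonomialCurve L ![0, 1, 0] 2 1 2 1)
    (hD : IsMonomialCurve D ![2, 3, 0] 2 1 0 1)
    (hlog : IsLogarithmic 2 (projSpace 2) (Ideal.span {cuspBoundary})
      (c • (dForm planeX * dForm planeY)))
    (hc : Restricts L (c / 1 * aeval ![planeX, planeY] lineEq)
      (algebraMap ℂ _ s * -(2 / (affCoord L 2 1 ^ 2 - 1))))
    (hc' : Restricts D (c / (-2 * planeY) * aeval ![planeX, planeY] cubicEq)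
      (algebraMap ℂ _ s' *
        (affCoord D 0 1 ^ 2 * ((affCoord D 0 1 ^ 2 - 1) * affCoord D 0 1 ^ 3)⁻¹))) :
    s = s' ∧ c = algebraMap ℂ _ s * cuspCoeff planeX planeY := by
  have hPL := isPlaneDivisor_line hL
  have hPD := isPlaneDivisor_cubic hD
  have hJ0 := neg_two_mul_planeY_ne_zero
  have hJm : -2 * planeY ∈ locRing ![planeX, planeY] (Ideal.span {cubicEq}) := by
    rw [← aeval_neg_two_mul_X planeX]
    exact aeval_mem_locRing _
  set k := c - algebraMap ℂ _ s * cuspCoeff planeX planeY with hk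
  have hline : k ∈ locRing ![planeX, planeY] (Ideal.span {lineEq}) := by
    have := hPL.restricts_sub_mul (s' := s) hc (restricts_cuspCoeff_line hL)
    rw [sub_self, map_zero, zero_mul] at this
    exact hPL.mem_of_restricts_mul_zero one_ne_zero (one_mem _) this
  have hw := hPD.restricts_sub_mul (s' := s) hc' (restricts_cuspCoeff_cubic hD)
  have hother : ∀ f : MvPolynomial (Fin 2) ℂ, Irreducible f → ∀ [(Ideal.span {f}).IsPrime],
      ¬ f ∣ cubicEq → k ∈ locRing ![planeX, planeY] (Ideal.span {f}) := fun f hf _ hfc => by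
    by_cases hfl : f ∣ lineEq
    · rwa [locRing_eq_of_dvd _ hf prime_lineEq.irreducible hfl]
    · have hfF : ¬ f ∣ lineEq * cubicEq := fun h => (hf.prime.dvd_or_dvd h).elim hfl hfc
      exact sub_mem (mem_locRing_of_isLogarithmic hlog hf hfF)
        (mul_mem (Subalgebra.algebraMap_mem _ s)
          (mem_locRing_of_isLogarithmic isLogarithmic_cuspCoeff hf hfF))
  have hkey : k * aeval ![planeX, planeY] cubicEq =
      -2 * planeY * (k / (-2 * planeY) * aeval ![planeX, planeY] cubicEq) := by
    rw [← mul_assoc, mul_div_cancel₀ _ hJ0]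
  -- At most a simple pole along the cubic is left in k, so multiplication by the cubic equation
  -- gives a function regular along all affine divisors, that is, a polynomial.
  obtain ⟨κ, hκ⟩ := isChart_plane.exists_eq_aeval (k * aeval ![planeX, planeY] cubicEq)
    fun f hf => by
      have := (Ideal.span_singleton_prime hf.ne_zero).2 hf.prime
      have hm : k * aeval ![planeX, planeY] cubicEq ∈
          locRing ![planeX, planeY] (Ideal.span {f}) := by
        by_cases hfc : f ∣ cubicEq
        · rw [locRing_eq_of_dvd _ hf prime_cubicEq.irreducible hfc, hkey]
          exact mul_mem hJm (hPD.mem_of_restricts hw)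
        · exact mul_mem (hother f hf hfc) (aeval_mem_locRing _)
      obtain ⟨p, q, hq, hq0, e⟩ := hm
      exact ⟨p, q, fun hd => hq (Ideal.mem_span_singleton.2 hd), by rw [e, div_mul_cancel₀ _ hq0]⟩
  have hs : s' - s = 0 := eq_zero_of_restricts_cubic hD hw hkey hκ
  have hs' : s = s' := (sub_eq_zero.1 hs).symm
  refine ⟨hs', ?_⟩
  -- With equal constants the residue along the cubic vanishes as well, so k is regular there too.
  rw [hs, map_zero, zero_mul] at hw
  have hcubic := hPD.mem_of_restricts_mul_zero hJ0 hJm hw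
  refine sub_eq_zero.1 (isChart_plane.eq_zero_of_isRegular (c := k) (fun f hf _ => ?_) ?_)
  · by_cases hfc : f ∣ cubicEq
    · rwa [locRing_eq_of_dvd _ hf prime_cubicEq.irreducible hfc]
    · exact hother f hf hfc
  · exact isRegularForm_infinity_sub (isRegularForm_infinity_of_isLogarithmic hlog)
      (isRegularForm_infinity_of_isLogarithmic isLogarithmic_cuspCoeff) s

end PlaneUniqueness

/-! ### Canonical forms on the plane -/

section PlaneCanonical

section Generic

variable {K : Type} [Field K] [Algebra ℂ K] {t b β : K}

theorem dForm_sq (t : K) : dForm (t ^ 2) = (2 * t) • dForm t := by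
  rw [pow_two, dForm_mul, ← add_smul, two_mul]

theorem IsChart.exists_eq_smul {x y : K} (h : IsChart ![x, y]) {ω : Forms K}
    (hω : ω ∈ ⋀[K]^2 (Ω[K⁄ℂ])) : ∃ c : K, ω = c • (dForm x * dForm y) := by
  refine mem_exteriorPower_two_pair ?_ hω
  rw [← range_pair, ← h.span_D]
  exact congrArg (fun f => Submodule.span _ (Set.range f)) (funext fun i => by fin_cases i <;> rfl)

theorem smul_eq_or_eq_neg {s : ℂ} (hs : s = 1 ∨ s = -1) (h : β = algebraMap ℂ K s * b)
    (ω : Forms K) : β • ω = b • ω ∨ β • ω = -(b • ω) := by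
  rcases hs with rfl | rfl
  · left
    rw [h, map_one, one_mul]
  · right
    rw [h, map_neg, map_one, neg_one_mul, neg_smul]

theorem exists_sign_of_neg_smul_dForm_eq (h : IsChart ![t])
    (hb : β • dForm t = b • dForm t ∨ β • dForm t = -(b • dForm t)) :
    ∃ s : ℂ, (s = 1 ∨ s = -1) ∧ β = algebraMap ℂ K s * -b := by
  rcases hb with hb | hb
  · exact ⟨-1, Or.inr rfl, by
      rw [map_neg, map_one, neg_mul_neg, one_mul]; exact h.smul_dForm_injective hb⟩
  · rw [← neg_smul] at hb
    exact ⟨1, Or.inl rfl, by rw [map_one, one_mul]; exact h.smul_dForm_injective hb⟩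

theorem exists_sign_of_smul_dForm_eq (h : IsChart ![t])
    (hb : β • dForm t = b • dForm t ∨ β • dForm t = -(b • dForm t)) :
    ∃ s : ℂ, (s = 1 ∨ s = -1) ∧ β = algebraMap ℂ K s * b := by
  rcases hb with hb | hb
  · exact ⟨1, Or.inl rfl, by rw [map_one, one_mul]; exact h.smul_dForm_injective hb⟩
  · rw [← neg_smul] at hb
    exact ⟨-1, Or.inr rfl, by
      rw [map_neg, map_one, neg_one_mul]; exact h.smul_dForm_injective hb⟩

omit [Algebra ℂ K] in
theorem cusp_residue_eq (ht : t ≠ 0) (hsq : t ^ 2 - 1 ≠ 0) :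
    (t ^ 2 * ((t ^ 2 - 1) * t ^ 3)⁻¹) * (2 * t) = 2 / (t ^ 2 - 1) := by
  field_simp

theorem eq_of_mul_two_mul_eq (ht : t ≠ 0) (hsq : t ^ 2 - 1 ≠ 0)
    (h : β * (2 * t) = b * (2 / (t ^ 2 - 1))) :
    β = b * (t ^ 2 * ((t ^ 2 - 1) * t ^ 3)⁻¹) := by
  have : CharZero K := charZero_of_injective_algebraMap (algebraMap ℂ K).injective
  refine mul_right_cancel₀ (mul_ne_zero two_ne_zero ht) (h.trans ?_)
  rw [mul_assoc, cusp_residue_eq ht hsq]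

end Generic

variable {L D : Variety 2} {c : FunctionField (projSpace 2)}

theorem isResidue_line_iff (hL : IsMonomialCurve L ![0, 1, 0] 2 1 2 1)
    {θ : Forms (FunctionField L)} :
    IsResidue 1 (projSpace 2) L (c • (dForm planeX * dForm planeY)) θ ↔
      ∃ β, Restricts L (c / 1 * aeval ![planeX, planeY] lineEq) β ∧
        θ = β • dForm (affCoord L 2 1) :=
  (isPlaneDivisor_line hL).isResidue_iff (i := 1) isChart_plane.dForm_lineEq one_ne_zero
    (one_mem _) (by rw [inv_one]; exact one_mem _) c θ

theorem neg_two_mul_planeY_mem :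
    -2 * planeY ∈ locRing ![planeX, planeY] (Ideal.span {cubicEq}) := by
  rw [← aeval_neg_two_mul_X planeX]
  exact aeval_mem_locRing _

theorem neg_two_mul_planeY_inv_mem (hD : IsMonomialCurve D ![2, 3, 0] 2 1 0 1) :
    (-2 * planeY)⁻¹ ∈ locRing ![planeX, planeY] (Ideal.span {cubicEq}) := by
  have hPD := isPlaneDivisor_cubic hD
  have h := hPD.restricts_aeval (-2 * X 1)
  rw [aeval_neg_two_mul_X, aeval_neg_two_mul_X, hD.affCoord_zero 1] at h
  exact hPD.mem_of_restricts (hPD.restricts_inv h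
    (mul_ne_zero (neg_ne_zero.2 two_ne_zero) (pow_ne_zero _ hD.coord_ne_zero)))

theorem isResidue_cubic_iff (hD : IsMonomialCurve D ![2, 3, 0] 2 1 0 1)
    {θ : Forms (FunctionField D)} :
    IsResidue 1 (projSpace 2) D (c • (dForm planeX * dForm planeY)) θ ↔
      ∃ β, Restricts D (c / (-2 * planeY) * aeval ![planeX, planeY] cubicEq) β ∧
        θ = (β * (2 * affCoord D 0 1)) • dForm (affCoord D 0 1) := by
  have e : dForm (affCoord D 2 0) = (2 * affCoord D 0 1) • dForm (affCoord D 0 1) :=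
    (congrArg dForm (hD.affCoord_zero 0)).trans (dForm_sq _)
  refine ((isPlaneDivisor_cubic hD).isResidue_iff (i := 0) isChart_plane.dForm_cubicEq
    neg_two_mul_planeY_ne_zero neg_two_mul_planeY_mem (neg_two_mul_planeY_inv_mem hD) c θ).trans ?_
  simp only [e, smul_smul]

theorem isResidue_cuspForm_line (hL : IsMonomialCurve L ![0, 1, 0] 2 1 2 1)
    {θ : Forms (FunctionField L)} :
    IsResidue 1 (projSpace 2) L (cuspForm planeX planeY) θ ↔
      θ = -((2 / (affCoord L 2 1 ^ 2 - 1)) • dForm (affCoord L 2 1)) := by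
  have hr := restricts_cuspCoeff_line hL
  rw [cuspForm_eq, isResidue_line_iff hL, ← neg_smul]
  constructor
  · rintro ⟨β, hβ, rfl⟩
    rw [(isPlaneDivisor_line hL).restricts_unique hβ hr]
  · exact fun h => ⟨_, hr, h⟩

theorem isResidue_cuspForm_cubic (hD : IsMonomialCurve D ![2, 3, 0] 2 1 0 1)
    {θ : Forms (FunctionField D)} :
    IsResidue 1 (projSpace 2) D (cuspForm planeX planeY) θ ↔
      θ = (2 / (affCoord D 0 1 ^ 2 - 1)) • dForm (affCoord D 0 1) := by
  have hr := restricts_cuspCoeff_cubic hD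
  rw [cuspForm_eq, isResidue_cubic_iff hD,
    ← cusp_residue_eq hD.coord_ne_zero hD.isChart.sq_sub_one_ne_zero]
  constructor
  · rintro ⟨β, hβ, rfl⟩
    rw [(isPlaneDivisor_cubic hD).restricts_unique hβ hr]
  · exact fun h => ⟨_, hr, h⟩

/-- If c were regular along D, then (c/J)·g would restrict to zero together with g, contradicting a
nonzero residue coefficient. -/
theorem IsPlaneDivisor.hasPole_of_restricts {g : MvPolynomial (Fin 2) ℂ} (h : IsPlaneDivisor D g)
    [(Ideal.span {g}).IsPrime] {J : FunctionField (projSpace 2)}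
    (hJi : J⁻¹ ∈ locRing ![planeX, planeY] (Ideal.span {g})) {β : FunctionField D}
    (hβ : Restricts D (c / J * aeval ![planeX, planeY] g) β) (hβ0 : β ≠ 0)
    (hg : aeval ![affCoord D 2 0, affCoord D 2 1] g = 0) :
    HasPole 2 (projSpace 2) D (c • (dForm planeX * dForm planeY)) := by
  rw [h.hasPole_iff]
  intro hc
  obtain ⟨γ, hγ⟩ := h.exists_restricts (mul_mem hc hJi)
  have := hγ.mul (h.restricts_aeval g)
  rw [hg, mul_zero, ← div_eq_mul_inv] at this
  exact hβ0 (h.restricts_unique hβ this)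

theorem hasPole_cuspForm_line (hL : IsMonomialCurve L ![0, 1, 0] 2 1 2 1) :
    HasPole 2 (projSpace 2) L (cuspForm planeX planeY) :=
  (isPlaneDivisor_line hL).hasPole_of_restricts (by rw [inv_one]; exact one_mem _)
    (restricts_cuspCoeff_line hL)
    (neg_ne_zero.2 (div_ne_zero two_ne_zero hL.isChart.sq_sub_one_ne_zero))
    (by rw [coords_line hL, aeval_lineEq, sub_self])

theorem hasPole_cuspForm_cubic (hD : IsMonomialCurve D ![2, 3, 0] 2 1 0 1) :
    HasPole 2 (projSpace 2) D (cuspForm planeX planeY) :=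
  (isPlaneDivisor_cubic hD).hasPole_of_restricts (neg_two_mul_planeY_inv_mem hD)
    (restricts_cuspCoeff_cubic hD)
    (mul_ne_zero (pow_ne_zero _ hD.coord_ne_zero) (inv_ne_zero
      (mul_ne_zero hD.isChart.sq_sub_one_ne_zero (pow_ne_zero _ hD.coord_ne_zero))))
    (by rw [coords_cubic hD, aeval_cubicEq]; ring)

theorem exists_sign_line (hL : IsMonomialCurve L ![0, 1, 0] 2 1 2 1)
    {θ : Forms (FunctionField L)}
    (h : IsResidue 1 (projSpace 2) L (c • (dForm planeX * dForm planeY)) θ)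
    (hθ : θ = (2 / (affCoord L 2 1 ^ 2 - 1)) • dForm (affCoord L 2 1) ∨
      θ = -((2 / (affCoord L 2 1 ^ 2 - 1)) • dForm (affCoord L 2 1))) :
    ∃ s : ℂ, (s = 1 ∨ s = -1) ∧ Restricts L (c / 1 * aeval ![planeX, planeY] lineEq)
      (algebraMap ℂ _ s * -(2 / (affCoord L 2 1 ^ 2 - 1))) := by
  obtain ⟨β, hβ, rfl⟩ := (isResidue_line_iff hL).1 h
  obtain ⟨s, hs, rfl⟩ := exists_sign_of_neg_smul_dForm_eq hL.isChart hθ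
  exact ⟨s, hs, hβ⟩

theorem exists_sign_cubic (hD : IsMonomialCurve D ![2, 3, 0] 2 1 0 1)
    {θ : Forms (FunctionField D)}
    (h : IsResidue 1 (projSpace 2) D (c • (dForm planeX * dForm planeY)) θ)
    (hθ : θ = (2 / (affCoord D 0 1 ^ 2 - 1)) • dForm (affCoord D 0 1) ∨
      θ = -((2 / (affCoord D 0 1 ^ 2 - 1)) • dForm (affCoord D 0 1))) :
    ∃ s : ℂ, Restricts D (c / (-2 * planeY) * aeval ![planeX, planeY] cubicEq)
      (algebraMap ℂ _ s *
        (affCoord D 0 1 ^ 2 * ((affCoord D 0 1 ^ 2 - 1) * affCoord D 0 1 ^ 3)⁻¹)) := by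
  obtain ⟨β, hβ, rfl⟩ := (isResidue_cubic_iff hD).1 h
  obtain ⟨s, -, hs⟩ := exists_sign_of_smul_dForm_eq hD.isChart hθ
  rw [eq_of_mul_two_mul_eq hD.coord_ne_zero hD.isChart.sq_sub_one_ne_zero hs] at hβ
  exact ⟨s, hβ⟩

variable {S : Set (RealProj 2)}

theorem isBoundaryComponent_plane_iff (hL : IsMonomialCurve L ![0, 1, 0] 2 1 2 1)
    (hD : IsMonomialCurve D ![2, 3, 0] 2 1 0 1)
    (hS : boundaryIdeal (projSpace 2) S = Ideal.span {cuspBoundary}) {Q : Variety 2} :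
    IsBoundaryComponent (projSpace 2) S Q ↔ Q = L ∨ Q = D := by
  have hPL := isPlaneDivisor_line hL
  have hPD := isPlaneDivisor_cubic hD
  have := L.isPrime
  have := D.isPrime
  rw [IsBoundaryComponent, hS, ← inf_ideal_eq hPL hPD,
    mem_minimalPrimes_inf_iff (not_line_le_cubic hPL hPD) (not_cubic_le_line hPL hPD)]
  exact or_congr ⟨Variety.eq_of_ideal_eq, congrArg _⟩ ⟨Variety.eq_of_ideal_eq, congrArg _⟩

theorem isCanonicalForm_cuspForm (hL : IsMonomialCurve L ![0, 1, 0] 2 1 2 1)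
    (hD : IsMonomialCurve D ![2, 3, 0] 2 1 0 1)
    (hS : boundaryIdeal (projSpace 2) S = Ideal.span {cuspBoundary})
    (hL₁ : ∀ ω, IsCanonicalForm 1 L (realPoints L ∩ S) ω ↔
      ω = (2 / (affCoord L 2 1 ^ 2 - 1)) • dForm (affCoord L 2 1) ∨
      ω = -((2 / (affCoord L 2 1 ^ 2 - 1)) • dForm (affCoord L 2 1)))
    (hD₁ : ∀ ω, IsCanonicalForm 1 D (realPoints D ∩ S) ω ↔
      ω = (2 / (affCoord D 0 1 ^ 2 - 1)) • dForm (affCoord D 0 1) ∨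
      ω = -((2 / (affCoord D 0 1 ^ 2 - 1)) • dForm (affCoord D 0 1))) :
    IsCanonicalForm 2 (projSpace 2) S (cuspForm planeX planeY) := by
  refine ⟨by rw [hS]; exact isLogarithmic_cusp, fun Q hQ => ?_⟩
  rcases (isBoundaryComponent_plane_iff hL hD hS).1 hQ with rfl | rfl
  · exact ⟨hasPole_cuspForm_line hL, _, (isResidue_cuspForm_line hL).2 rfl,
      (hL₁ _).2 (Or.inr rfl)⟩
  · exact ⟨hasPole_cuspForm_cubic hD, _, (isResidue_cuspForm_cubic hD).2 rfl,
      (hD₁ _).2 (Or.inl rfl)⟩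

theorem eq_cuspForm_or_eq_neg_of_isResidue (hL : IsMonomialCurve L ![0, 1, 0] 2 1 2 1)
    (hD : IsMonomialCurve D ![2, 3, 0] 2 1 0 1)
    (hlog : IsLogarithmic 2 (projSpace 2) (Ideal.span {cuspBoundary})
      (c • (dForm planeX * dForm planeY)))
    {θ : Forms (FunctionField L)}
    (h₁ : IsResidue 1 (projSpace 2) L (c • (dForm planeX * dForm planeY)) θ)
    (hθ : θ = (2 / (affCoord L 2 1 ^ 2 - 1)) • dForm (affCoord L 2 1) ∨
      θ = -((2 / (affCoord L 2 1 ^ 2 - 1)) • dForm (affCoord L 2 1)))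
    {θ' : Forms (FunctionField D)}
    (h₂ : IsResidue 1 (projSpace 2) D (c • (dForm planeX * dForm planeY)) θ')
    (hθ' : θ' = (2 / (affCoord D 0 1 ^ 2 - 1)) • dForm (affCoord D 0 1) ∨
      θ' = -((2 / (affCoord D 0 1 ^ 2 - 1)) • dForm (affCoord D 0 1))) :
    c • (dForm planeX * dForm planeY) = cuspForm planeX planeY ∨
      c • (dForm planeX * dForm planeY) = -cuspForm planeX planeY := by
  obtain ⟨s, hs, hβ⟩ := exists_sign_line hL h₁ hθ
  obtain ⟨s', hβ'⟩ := exists_sign_cubic hD h₂ hθ'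
  exact smul_eq_or_eq_neg hs (eq_smul_of_restricts hL hD hlog hβ hβ').2 _

theorem eq_cuspForm_or_eq_neg (hL : IsMonomialCurve L ![0, 1, 0] 2 1 2 1)
    (hD : IsMonomialCurve D ![2, 3, 0] 2 1 0 1)
    (hS : boundaryIdeal (projSpace 2) S = Ideal.span {cuspBoundary})
    (hL₁ : ∀ ω, IsCanonicalForm 1 L (realPoints L ∩ S) ω ↔
      ω = (2 / (affCoord L 2 1 ^ 2 - 1)) • dForm (affCoord L 2 1) ∨
      ω = -((2 / (affCoord L 2 1 ^ 2 - 1)) • dForm (affCoord L 2 1)))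
    (hD₁ : ∀ ω, IsCanonicalForm 1 D (realPoints D ∩ S) ω ↔
      ω = (2 / (affCoord D 0 1 ^ 2 - 1)) • dForm (affCoord D 0 1) ∨
      ω = -((2 / (affCoord D 0 1 ^ 2 - 1)) • dForm (affCoord D 0 1)))
    {ω : Forms (FunctionField (projSpace 2))} (hω : IsCanonicalForm 2 (projSpace 2) S ω) :
    ω = cuspForm planeX planeY ∨ ω = -cuspForm planeX planeY := by
  have hω' : IsLogarithmic 2 (projSpace 2) (boundaryIdeal (projSpace 2) S) ω ∧ _ := hω
  rw [hS] at hω'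
  refine (isChart_plane.exists_eq_smul hω'.1.1).elim fun c hc => ?_
  have h₁ := (hω'.2 L ((isBoundaryComponent_plane_iff hL hD hS).2 (Or.inl rfl))).2
  have h₂ := (hω'.2 D ((isBoundaryComponent_plane_iff hL hD hS).2 (Or.inr rfl))).2
  refine h₁.elim fun θ hθ => h₂.elim fun θ' hθ' => ?_
  rw [hc] at hω' hθ hθ' ⊢
  exact eq_cuspForm_or_eq_neg_of_isResidue hL hD hω'.1 hθ.1 ((hL₁ _).1 hθ.2) hθ'.1
    ((hD₁ _).1 hθ'.2)

end PlaneCanonical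

/-! ### Topological boundaries -/

section Boundary

variable {n : ℕ} {X : Variety n} {S : Set (RealProj n)} {p : RealProj n}

/-- For a closed set the frontier is the complement of the interior. Neighborhoods in the real
points of X are traces of open sets of the ambient projective space. -/
theorem mem_boundary_iff (hS : IsClosed S) : p ∈ boundary X S ↔
    p ∈ realPoints X ∧ p ∈ S ∧ ∀ U : Set (RealProj n), IsOpen U → p ∈ U →
      ∃ q ∈ realPoints X, q ∈ U ∧ q ∉ S := by
  have hcl : IsClosed (Subtype.val ⁻¹' S : Set (realPoints X)) := hS.preimage continuous_subtype_val
  rw [boundary, hcl.frontier_eq]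
  constructor
  · rintro ⟨⟨p, hp⟩, ⟨hpS, hint⟩, rfl⟩
    refine ⟨hp, hpS, fun U hU hpU => ?_⟩
    by_contra! hcon
    exact hint (mem_interior.2 ⟨Subtype.val ⁻¹' U, fun q hq => hcon q q.2 hq,
      hU.preimage continuous_subtype_val, hpU⟩)
  · rintro ⟨hp, hpS, h⟩
    refine ⟨⟨p, hp⟩, ⟨hpS, fun hint => ?_⟩, rfl⟩
    obtain ⟨V, hVS, hV, hpV⟩ := mem_interior.1 hint
    obtain ⟨U, hU, rfl⟩ := isOpen_induced_iff.1 hV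
    obtain ⟨q, hq, hqU, hqS⟩ := h U hU hpV
    exact hqS (hVS (a := ⟨q, hq⟩) hqU)

theorem continuous_mk {Y : Type} [TopologicalSpace Y] {γ : Y → Fin (n + 1) → ℝ}
    (hγ : Continuous γ) (hγ0 : ∀ y, γ y ≠ 0) :
    Continuous fun y => (Projectivization.mk ℝ (γ y) (hγ0 y) : RealProj n) :=
  (continuous_coinduced_rng (f := fun v : {v : Fin (n + 1) → ℝ // v ≠ 0} =>
    Projectivization.mk ℝ v.1 v.2)).comp (hγ.subtype_mk hγ0)

theorem mem_boundary_of_path (hS : IsClosed S) {γ : ℝ → RealProj n} (hγ : Continuous γ)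
    (hX : ∀ τ, γ τ ∈ realPoints X) {a : ℝ} (ha : γ a ∈ S)
    (hout : ∀ ε > 0, ∃ τ, |τ - a| < ε ∧ γ τ ∉ S) : γ a ∈ boundary X S := by
  refine (mem_boundary_iff hS).2 ⟨hX a, ha, fun U hU haU => ?_⟩
  obtain ⟨ε, hε, h⟩ := Metric.isOpen_iff.1 (hU.preimage hγ) a haU
  obtain ⟨τ, hτ, hτS⟩ := hout ε hε
  exact ⟨γ τ, hX τ, h hτ, hτS⟩

variable {ι : Type} {F : ι → MvPolynomial (Fin (n + 1)) ℝ} {e : ι → ℕ}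

theorem isOpen_setOf_pos [Finite ι] (hF : ∀ i, (F i).IsHomogeneous (2 * e i)) :
    ∃ U : Set (RealProj n), IsOpen U ∧ ∀ v (hv : v ≠ 0),
      Projectivization.mk ℝ v hv ∈ U ↔ ∀ i, 0 < eval v (F i) := by
  have hF' : ∀ i, ∀ _ : Unit, (-F i).IsHomogeneous (2 * e i) := fun i _ => (hF i).neg
  refine ⟨⋂ i, (basicSet fun _ : Unit => -F i)ᶜ, isOpen_iInter_of_finite fun i =>
    (isClosed_basicSet (hF' i)).isOpen_compl, fun v hv => ?_⟩
  rw [Set.mem_iInter]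
  refine forall_congr' fun i => ?_
  rw [Set.mem_compl_iff, mk_mem_basicSet (hF' i)]
  simp

/-- A point where all defining inequalities are strict is interior. -/
theorem exists_eval_eq_zero_of_mem_boundary [Finite ι] (hF : ∀ i, (F i).IsHomogeneous (2 * e i))
    {v : Fin (n + 1) → ℝ} {hv : v ≠ 0}
    (h : Projectivization.mk ℝ v hv ∈ boundary X (basicSet F)) : ∃ i, eval v (F i) = 0 := by
  obtain ⟨-, hS, hU⟩ := (mem_boundary_iff (isClosed_basicSet hF)).1 h
  by_contra! hne
  obtain ⟨U, hUo, hUv⟩ := isOpen_setOf_pos hF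
  obtain ⟨q, -, hqU, hqS⟩ := hU U hUo ((hUv v hv).2 fun i =>
    lt_of_le_of_ne ((mk_mem_basicSet hF).1 hS i) (hne i).symm)
  induction q using Projectivization.ind with
  | h w hw => exact hqS ((mk_mem_basicSet hF).2 fun i => ((hUv w hw).1 hqU i).le)

theorem mk_mem_image_chart_iff {T : Set (Fin n → ℝ)} {v : Fin (n + 1) → ℝ} {hv : v ≠ 0} :
    Projectivization.mk ℝ v hv ∈ chart n '' T ↔
      v (Fin.last n) ≠ 0 ∧ (fun i => v i.castSucc / v (Fin.last n)) ∈ T := by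
  constructor
  · rintro ⟨w, hw, hwv⟩
    obtain ⟨c, hc, h⟩ := mk_eq_mk_iff_exists.1 hwv.symm
    have hl : v (Fin.last n) = c := by rw [h]; simp
    refine ⟨hl ▸ hc, ?_⟩
    rw [hl]
    convert hw using 1
    ext i
    rw [h]
    simp [hc]
  · rintro ⟨hl, hT⟩
    refine ⟨_, hT, mk_eq_mk_iff_exists.2 ⟨(v (Fin.last n))⁻¹, inv_ne_zero hl, ?_⟩⟩
    ext i
    refine Fin.lastCases ?_ (fun i => ?_) i
    · simp [hl]
    · simp [div_eq_inv_mul]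

end Boundary

/-! ### Arcs of monomial curves -/

namespace IsMonomialCurve

section Arc

variable {n : ℕ} {D : Variety n} {d : Fin (n + 1) → ℕ} {j k l m : Fin (n + 1)}
  (h : IsMonomialCurve D d j k l m) {F G : MvPolynomial (Fin (n + 1)) ℝ} {a b : ℕ}
  (hF : F.IsHomogeneous (2 * a)) (hG : G.IsHomogeneous (2 * b))
  (hrep : ∀ v : Fin (n + 1) → ℝ, v ≠ 0 → 0 ≤ eval v F → 0 ≤ eval v G →
    ∃ τ c : ℝ, c ≠ 0 ∧ v = c • realPoint d τ)
  (hGD : ∀ (v : Fin (n + 1) → ℝ) (hv : v ≠ 0), Projectivization.mk ℝ v hv ∈ realPoints D →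
    eval v G = 0)
  (hF0 : ∀ τ, 0 ≤ eval (realPoint d τ) F ↔ τ ^ 2 ≤ 1)
  (hF1 : ∀ τ, eval (realPoint d τ) F = 0 → τ ^ 2 = 1)

include hF hG in
-- An arc is cut out by two inequalities. On the curve, F ≥ 0 means τ² ≤ 1. The form G vanishes on
-- the real points of the curve, and G ≥ 0 together with F ≥ 0 confines a point to the parametrized
-- part.
theorem mk_mem_arc {v : Fin (n + 1) → ℝ} {hv : v ≠ 0} :
    Projectivization.mk ℝ v hv ∈ basicSet ![F, G] ↔ 0 ≤ eval v F ∧ 0 ≤ eval v G := by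
  rw [mk_mem_basicSet (d := ![a, b]) (by intro i; fin_cases i <;> assumption), Fin.forall_fin_two]
  rfl

include hF hG hF0 hGD in
theorem realPoint_mem_arc {τ : ℝ} :
    Projectivization.mk ℝ (realPoint d τ) (h.realPoint_ne_zero τ) ∈ basicSet ![F, G] ↔
      τ ^ 2 ≤ 1 := by
  rw [mk_mem_arc hF hG, hF0, hGD _ _ (h.realPoint_mem τ)]
  simp

include hF hG hrep in
theorem exists_eq_of_mem_arc {p : RealProj n} (hp : p ∈ basicSet ![F, G]) :
    ∃ τ, p = Projectivization.mk ℝ (realPoint d τ) (h.realPoint_ne_zero τ) := by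
  induction p using Projectivization.ind with
  | h v hv =>
    have := (mk_mem_arc hF hG).1 hp
    obtain ⟨τ, c, hc, hv'⟩ := hrep v hv this.1 this.2
    exact ⟨τ, mk_eq_mk_iff_exists.2 ⟨c, hc, hv'⟩⟩

include hF hG in
theorem isClosed_arc : IsClosed (basicSet ![F, G]) :=
  isClosed_basicSet (d := ![a, b]) (by intro i; fin_cases i <;> assumption)

theorem continuous_realPoint : Continuous fun τ =>
    (Projectivization.mk ℝ (realPoint d τ) (h.realPoint_ne_zero τ) : RealProj n) :=
  continuous_mk (by unfold realPoint; fun_prop) _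

include h hF hG hrep hF0 hF1 hGD in
-- Where F > 0, nearby real points of the curve still satisfy both inequalities, G being zero on
-- them. So a boundary point has F = 0, hence τ = ±1, and at these two values increasing |τ| leaves
-- the arc.
theorem boundary_arc : boundary D (basicSet ![F, G]) =
    {Projectivization.mk ℝ (realPoint d 1) (h.realPoint_ne_zero 1),
      Projectivization.mk ℝ (realPoint d (-1)) (h.realPoint_ne_zero (-1))} := by
  have hcl := isClosed_arc hF hG
  apply subset_antisymm
  · intro p hp
    obtain ⟨-, hpS, hU⟩ := (mem_boundary_iff hcl).1 hp
    obtain ⟨τ, rfl⟩ := h.exists_eq_of_mem_arc hF hG hrep hpS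
    have hτ : eval (realPoint d τ) F = 0 := by
      by_contra hne
      obtain ⟨U, hUo, hUv⟩ := isOpen_setOf_pos (F := fun _ : Unit => F) fun _ => hF
      obtain ⟨q, hqD, hqU, hqS⟩ := hU U hUo ((hUv _ _).2 fun _ =>
        lt_of_le_of_ne ((mk_mem_arc hF hG).1 hpS).1 (Ne.symm hne))
      induction q using Projectivization.ind with
      | h w hw => exact hqS ((mk_mem_arc hF hG).2 ⟨((hUv w hw).1 hqU ()).le, (hGD w hw hqD).ge⟩)
    rcases mul_self_eq_one_iff.1 ((pow_two τ).symm.trans (hF1 τ hτ)) with rfl | rfl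
    · exact Or.inl rfl
    · exact Or.inr rfl
  · rintro _ (rfl | rfl)
    · refine mem_boundary_of_path hcl h.continuous_realPoint h.realPoint_mem
        ((h.realPoint_mem_arc hF hG hGD hF0).2 (by norm_num)) fun ε hε => ⟨1 + ε / 2, ?_, ?_⟩
      · rw [add_sub_cancel_left, abs_of_pos (by linarith)]; linarith
      · rw [h.realPoint_mem_arc hF hG hGD hF0]; nlinarith
    · refine mem_boundary_of_path hcl h.continuous_realPoint h.realPoint_mem
        ((h.realPoint_mem_arc hF hG hGD hF0).2 (by norm_num)) fun ε hε => ⟨-1 - ε / 2, ?_, ?_⟩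
      · rw [sub_sub_cancel_left, abs_of_neg (by linarith)]; linarith
      · rw [h.realPoint_mem_arc hF hG hGD hF0]; nlinarith

include h hF hG hrep hF0 hGD in
theorem isAdmissible_arc : IsAdmissible 1 D (basicSet ![F, G]) := by
  have hone := (h.realPoint_mem_arc hF hG hGD hF0 (τ := 1)).2 (by norm_num)
  refine isAdmissible_basicSet (d := ![a, b]) (by intro i; fin_cases i <;> assumption)
    h.trdeg_eq_one ⟨_, hone⟩ (h.vanishingIdeal_eq (fun p hp => ?_) ?_)
  · obtain ⟨τ, rfl⟩ := h.exists_eq_of_mem_arc hF hG hrep hp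
    exact h.realPoint_mem τ
  · refine (Set.Icc_infinite (zero_lt_one (α := ℝ))).mono fun τ hτ => ?_
    rw [Set.mem_ofPred_eq, h.realPoint_mem_arc hF hG hGD hF0]
    nlinarith [hτ.1, hτ.2]

include h hF hG hrep hF0 hGD in
theorem realPoints_inter_eq_arc {S : Set (RealProj n)}
    (hS : ∀ τ, τ ^ 2 ≤ 1 → Projectivization.mk ℝ (realPoint d τ) (h.realPoint_ne_zero τ) ∈ S)
    (hSF : ∀ (v : Fin (n + 1) → ℝ) (hv : v ≠ 0), Projectivization.mk ℝ v hv ∈ realPoints D →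
      Projectivization.mk ℝ v hv ∈ S → 0 ≤ eval v F) :
    realPoints D ∩ S = basicSet ![F, G] := by
  apply subset_antisymm
  · rintro p ⟨hpD, hpS⟩
    induction p using Projectivization.ind with
    | h v hv => exact (mk_mem_arc hF hG).2 ⟨hSF v hv hpD hpS, (hGD v hv hpD).ge⟩
  · intro p hp
    obtain ⟨τ, rfl⟩ := h.exists_eq_of_mem_arc hF hG hrep hp
    exact ⟨h.realPoint_mem τ, hS τ ((h.realPoint_mem_arc hF hG hGD hF0).1 hp)⟩

variable {r : CoordRing n} {e : ℕ} (hr : r.IsHomogeneous e)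
  (hrd : aeval (fun i => (Polynomial.X ^ d i : Polynomial ℂ)) r = Polynomial.X ^ 2 - 1)

include h hF hG hrep hF0 hF1 hGD hr hrd in
theorem isPositiveGeometry_arc : IsPositiveGeometry 1 D (basicSet ![F, G]) ∧
    ∀ ω, IsCanonicalForm 1 D (basicSet ![F, G]) ω ↔
      ω = (2 / (affCoord D l m ^ 2 - 1)) • dForm (affCoord D l m) ∨
      ω = -((2 / (affCoord D l m ^ 2 - 1)) • dForm (affCoord D l m)) := by
  have hb := h.boundary_arc hF hG hrep hGD hF0 hF1
  exact ⟨h.isPositiveGeometry hb hr hrd (h.isAdmissible_arc hF hG hrep hGD hF0)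
    ((h.realPoint_mem_arc hF hG hGD hF0).2 (by norm_num))
    ((h.realPoint_mem_arc hF hG hGD hF0).2 (by norm_num)),
    fun ω => h.isCanonicalForm_iff hb hr hrd⟩

end Arc

end IsMonomialCurve

/-! ### The region bounded by the line and the cuspidal cubic -/

section Region

theorem mk_mem_regionA {v : Fin 3 → ℝ} {hv : v ≠ 0} : Projectivization.mk ℝ v hv ∈ regionA ↔
    v 2 ≠ 0 ∧ v 0 / v 2 ≤ 1 ∧ (v 1 / v 2) ^ 2 ≤ (v 0 / v 2) ^ 3 :=
  mk_mem_image_chart_iff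

theorem mk_mem_interval {v : Fin 2 → ℝ} {hv : v ≠ 0} : Projectivization.mk ℝ v hv ∈ interval ↔
    v 1 ≠ 0 ∧ -1 ≤ v 0 / v 1 ∧ v 0 / v 1 ≤ 1 :=
  mk_mem_image_chart_iff

variable {n : ℕ}

theorem isHomogeneous_sq_sub_sq {R : Type} [CommRing R] (i j : Fin (n + 1)) :
    (X i ^ 2 - X j ^ 2 : MvPolynomial (Fin (n + 1)) R).IsHomogeneous (2 * 1) :=
  ((isHomogeneous_X R i).pow 2).sub ((isHomogeneous_X R j).pow 2)

theorem realPoint_line (τ : ℝ) : IsMonomialCurve.realPoint (n := 2) ![0, 1, 0] τ = ![1, τ, 1] := by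
  ext i
  fin_cases i <;> simp [IsMonomialCurve.realPoint]

theorem realPoint_cubic (τ : ℝ) :
    IsMonomialCurve.realPoint (n := 2) ![2, 3, 0] τ = ![τ ^ 2, τ ^ 3, 1] := by
  ext i
  fin_cases i <;> simp [IsMonomialCurve.realPoint]

theorem realPoint_projSpace_one (τ : ℝ) :
    IsMonomialCurve.realPoint (n := 1) ![1, 0] τ = ![τ, 1] := by
  ext i
  fin_cases i <;> simp [IsMonomialCurve.realPoint]

theorem eq_zero_of_fin_three {v : Fin 3 → ℝ} (h0 : v 0 = 0) (h1 : v 1 = 0) (h2 : v 2 = 0) :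
    v = 0 := by
  ext i
  fin_cases i <;> assumption

section Line

variable {L : Variety 2} (hL : IsMonomialCurve L ![0, 1, 0] 2 1 2 1)

include hL

theorem line_eq_of_mem_realPoints {v : Fin 3 → ℝ} {hv : v ≠ 0}
    (h : Projectivization.mk ℝ v hv ∈ realPoints L) : v 0 = v 2 := by
  have hm : (X 0 - X 2 : CoordRing 2) ∈ L.ideal := by
    rw [hL.mem_ideal_iff 1 _ isHomogeneous_line]
    simp
  have := mk_mem_realPoints_iff.1 h 1 _ isHomogeneous_line hm
  simp only [map_sub, eval_X] at this
  exact_mod_cast sub_eq_zero.1 this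

/-- On x = z the condition y² ≤ x³ reads y² ≤ z², which is the arc for F = z² - y² and G = -(x -
z)². -/
theorem isPositiveGeometry_line : IsPositiveGeometry 1 L (realPoints L ∩ regionA) ∧
    ∀ ω, IsCanonicalForm 1 L (realPoints L ∩ regionA) ω ↔
      ω = (2 / (affCoord L 2 1 ^ 2 - 1)) • dForm (affCoord L 2 1) ∨
      ω = -((2 / (affCoord L 2 1 ^ 2 - 1)) • dForm (affCoord L 2 1)) := by
  have hF := isHomogeneous_sq_sub_sq (n := 2) (R := ℝ) 2 1
  have hG : (-(X 0 - X 2) ^ 2 : MvPolynomial (Fin 3) ℝ).IsHomogeneous (2 * 1) :=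
    (((isHomogeneous_X ℝ 0).sub (isHomogeneous_X ℝ 2)).pow 2).neg
  have hrep : ∀ v : Fin 3 → ℝ, v ≠ 0 → 0 ≤ eval v (X 2 ^ 2 - X 1 ^ 2) →
      0 ≤ eval v (-(X 0 - X 2) ^ 2) →
      ∃ τ c : ℝ, c ≠ 0 ∧ v = c • IsMonomialCurve.realPoint (n := 2) ![0, 1, 0] τ := by
    intro v hv h1 h2
    simp only [map_sub, map_pow, eval_X, map_neg] at h1 h2
    have h02 : v 0 = v 2 := by
      have : (v 0 - v 2) ^ 2 = 0 := by nlinarith [sq_nonneg (v 0 - v 2)]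
      exact sub_eq_zero.1 (pow_eq_zero_iff two_ne_zero |>.1 this)
    have hv2 : v 2 ≠ 0 := fun hz => hv (by
      rw [hz] at h02 h1
      exact eq_zero_of_fin_three h02 (by nlinarith) hz)
    refine ⟨v 1 / v 2, v 2, hv2, ?_⟩
    rw [realPoint_line]
    ext i
    fin_cases i
    · simp [h02]
    · simp; field_simp
    · simp
  have hGD : ∀ (v : Fin 3 → ℝ) (hv : v ≠ 0), Projectivization.mk ℝ v hv ∈ realPoints L →
      eval v (-(X 0 - X 2) ^ 2) = 0 := fun v hv h => by
    simp [line_eq_of_mem_realPoints hL h]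
  have hF0 : ∀ τ, 0 ≤ eval (IsMonomialCurve.realPoint (n := 2) ![0, 1, 0] τ) (X 2 ^ 2 - X 1 ^ 2) ↔
      τ ^ 2 ≤ 1 := fun τ => by
    rw [realPoint_line]; simp
  have hF1 : ∀ τ, eval (IsMonomialCurve.realPoint (n := 2) ![0, 1, 0] τ) (X 2 ^ 2 - X 1 ^ 2) = 0 →
      τ ^ 2 = 1 := fun τ h => by
    rw [realPoint_line] at h
    simp at h
    linarith
  rw [hL.realPoints_inter_eq_arc hF hG hrep hGD hF0 (S := regionA)]
  · exact hL.isPositiveGeometry_arc hF hG hrep hGD hF0 hF1 (isHomogeneous_sq_sub_sq 1 2)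
      (by simp)
  · intro τ hτ
    refine mk_mem_regionA.2 ?_
    rw [realPoint_line]
    simpa using hτ
  · intro v hv hvL hvA
    obtain ⟨h2, -, h⟩ := mk_mem_regionA.1 hvA
    rw [line_eq_of_mem_realPoints hL hvL, div_self h2, one_pow, div_pow,
      div_le_one (by positivity)] at h
    simpa using h

end Line

section Cubic

variable {D : Variety 2} (hD : IsMonomialCurve D ![2, 3, 0] 2 1 0 1)

include hD

theorem cubic_eq_of_mem_realPoints {v : Fin 3 → ℝ} {hv : v ≠ 0}
    (h : Projectivization.mk ℝ v hv ∈ realPoints D) : v 1 ^ 2 * v 2 = v 0 ^ 3 := by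
  have hm : (X 1 ^ 2 * X 2 - X 0 ^ 3 : CoordRing 2) ∈ D.ideal := by
    rw [hD.mem_ideal_iff 3 _ isHomogeneous_cubic]
    simp
    ring
  have := mk_mem_realPoints_iff.1 h 3 _ isHomogeneous_cubic hm
  simp only [map_sub, map_mul, map_pow, eval_X] at this
  exact_mod_cast sub_eq_zero.1 this

/-- The same quadric z² - y² works on the cubic: there it is 1 - τ⁶ = (1 - τ²)(1 + τ² + τ⁴), with
positive second factor. The line x - z restricts to τ² - 1 and serves as the equation of the two
endpoints. -/
theorem isPositiveGeometry_cubic : IsPositiveGeometry 1 D (realPoints D ∩ regionA) ∧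
    ∀ ω, IsCanonicalForm 1 D (realPoints D ∩ regionA) ω ↔
      ω = (2 / (affCoord D 0 1 ^ 2 - 1)) • dForm (affCoord D 0 1) ∨
      ω = -((2 / (affCoord D 0 1 ^ 2 - 1)) • dForm (affCoord D 0 1)) := by
  have hF := isHomogeneous_sq_sub_sq (n := 2) (R := ℝ) 2 1
  have hG : (-(X 1 ^ 2 * X 2 - X 0 ^ 3) ^ 2 : MvPolynomial (Fin 3) ℝ).IsHomogeneous (2 * 3) :=
    (((((isHomogeneous_X ℝ 1).pow 2).mul (isHomogeneous_X ℝ 2)).sub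
      ((isHomogeneous_X ℝ 0).pow 3)).pow 2).neg
  have hrep : ∀ v : Fin 3 → ℝ, v ≠ 0 → 0 ≤ eval v (X 2 ^ 2 - X 1 ^ 2) →
      0 ≤ eval v (-(X 1 ^ 2 * X 2 - X 0 ^ 3) ^ 2) →
      ∃ τ c : ℝ, c ≠ 0 ∧ v = c • IsMonomialCurve.realPoint (n := 2) ![2, 3, 0] τ := by
    intro v hv h1 h2
    simp only [map_sub, map_pow, map_mul, eval_X, map_neg] at h1 h2
    have h3 : v 1 ^ 2 * v 2 = v 0 ^ 3 := by
      have : (v 1 ^ 2 * v 2 - v 0 ^ 3) ^ 2 = 0 := by nlinarith [sq_nonneg (v 1 ^ 2 * v 2 - v 0 ^ 3)]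
      exact sub_eq_zero.1 (pow_eq_zero_iff two_ne_zero |>.1 this)
    -- The only point of the cubic with z = 0 is (0 : 1 : 0), and F ≥ 0 excludes it.
    have hv2 : v 2 ≠ 0 := fun hz => hv (by
      rw [hz] at h3 h1
      refine eq_zero_of_fin_three (pow_eq_zero_iff three_ne_zero |>.1 ?_) (by nlinarith) hz
      rw [← h3, mul_zero])
    simp only [realPoint_cubic]
    -- The parameter is τ = y/x except at the cusp, where it is 0.
    by_cases h0 : v 0 = 0
    · have h1 : v 1 = 0 := by
        rw [h0] at h3
        simpa [hv2] using h3
      refine ⟨0, v 2, hv2, ?_⟩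
      ext i
      fin_cases i <;> simp [h0, h1]
    · refine ⟨v 1 / v 0, v 2, hv2, ?_⟩
      ext i
      fin_cases i
      · simp
        field_simp
        linarith
      · simp
        field_simp
        linear_combination (-v 1) * h3
      · simp
  have hGD : ∀ (v : Fin 3 → ℝ) (hv : v ≠ 0), Projectivization.mk ℝ v hv ∈ realPoints D →
      eval v (-(X 1 ^ 2 * X 2 - X 0 ^ 3) ^ 2) = 0 := fun v hv h => by
    simp [cubic_eq_of_mem_realPoints hD h]
  have e : ∀ τ : ℝ, eval (IsMonomialCurve.realPoint (n := 2) ![2, 3, 0] τ) (X 2 ^ 2 - X 1 ^ 2) =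
      (1 - τ ^ 2) * (1 + τ ^ 2 + τ ^ 4) := fun τ => by
    rw [realPoint_cubic]
    simp
    ring
  have hF0 : ∀ τ, 0 ≤ eval (IsMonomialCurve.realPoint (n := 2) ![2, 3, 0] τ) (X 2 ^ 2 - X 1 ^ 2) ↔
      τ ^ 2 ≤ 1 := fun τ => by
    rw [e, mul_nonneg_iff_of_pos_right (by positivity), sub_nonneg]
  have hF1 : ∀ τ, eval (IsMonomialCurve.realPoint (n := 2) ![2, 3, 0] τ) (X 2 ^ 2 - X 1 ^ 2) = 0 →
      τ ^ 2 = 1 := fun τ h => by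
    rw [e] at h
    have h' : 1 + τ ^ 2 + τ ^ 4 ≠ 0 := by positivity
    linarith [(mul_eq_zero.1 h).resolve_right h']
  rw [hD.realPoints_inter_eq_arc hF hG hrep hGD hF0 (S := regionA)]
  · refine hD.isPositiveGeometry_arc hF hG hrep hGD hF0 hF1 (r := X 0 - X 2) (e := 1)
      isHomogeneous_line (by simp)
  · intro τ hτ
    refine mk_mem_regionA.2 ?_
    rw [realPoint_cubic]
    refine ⟨by simp, by simpa using hτ, le_of_eq ?_⟩
    simp
    ring
  · intro v hv hvL hvA
    obtain ⟨h2, h1, h⟩ := mk_mem_regionA.1 hvA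
    have h3 := cubic_eq_of_mem_realPoints hD hvL
    have h4 : (v 1 / v 2) ^ 2 = (v 0 / v 2) ^ 3 := by
      field_simp
      exact h3
    have h5 : (v 1 / v 2) ^ 2 ≤ 1 := by
      have : 0 ≤ v 0 / v 2 := by
        by_contra! hneg
        have : (v 0 / v 2) ^ 3 < 0 := Odd.pow_neg (by decide) hneg
        nlinarith [sq_nonneg (v 1 / v 2)]
      rw [h4]
      exact pow_le_one₀ this h1
    rw [div_pow, div_le_one (by positivity)] at h5
    simpa using h5

end Cubic

end Region

/-! ### The interval on the projective line -/

section Interval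

/-- A binary form is determined by its values at the points (τ : 1), so the projective line itself
is a monomial curve with exponents 1 and 0. -/
theorem isMonomialCurve_projSpace_one : IsMonomialCurve (projSpace 1) ![1, 0] 1 0 1 0 := by
  refine ⟨fun e a ha => ?_, rfl, fun i => by fin_cases i <;> simp, rfl⟩
  rw [projSpace_ideal, Ideal.mem_bot]
  refine ⟨fun h => by rw [h, map_zero], fun h => ?_⟩
  have h1 : a * X 1 = 0 := by
    refine MvPolynomial.funext fun v => ?_
    rw [map_mul, eval_X, map_zero, mul_eq_zero, or_iff_not_imp_right]
    intro hv
    have hv' : v = fun i => (v 0 / v 1) ^ (![1, 0] : Fin 2 → ℕ) i * v 1 := by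
      ext i
      fin_cases i
      · simp [hv]
      · simp
    have := congrArg (Polynomial.eval (v 0 / v 1)) h
    rw [IsMonomialCurve.eval_aeval_eq, Polynomial.eval_zero] at this
    rw [hv', ← aeval_self_eq_eval, aeval_mul_of_isHomogeneous ha, aeval_self_eq_eval, this,
      zero_mul]
  exact (mul_eq_zero.1 h1).resolve_right (X_ne_zero 1)

theorem omegaInterval_eq : omegaInterval = (2 / (affCoord (projSpace 1) 1 0 ^ 2 - 1)) •
    dForm (affCoord (projSpace 1) 1 0) := by
  have : (affCoord (projSpace 1) 1 0 - 1) * (affCoord (projSpace 1) 1 0 + 1) =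
      affCoord (projSpace 1) 1 0 ^ 2 - 1 := by ring
  rw [← this]
  rfl

theorem isPositiveGeometry_interval : IsPositiveGeometry 1 (projSpace 1) interval ∧
    IsCanonicalForm 1 (projSpace 1) interval omegaInterval := by
  have hP := isMonomialCurve_projSpace_one
  have hF := isHomogeneous_sq_sub_sq (n := 1) (R := ℝ) 1 0
  -- The curve is the whole projective line, so no equation is needed and the second form is zero.
  have hG : (0 : MvPolynomial (Fin 2) ℝ).IsHomogeneous (2 * 0) := isHomogeneous_zero _ _ _
  have hrep : ∀ v : Fin 2 → ℝ, v ≠ 0 → 0 ≤ eval v (X 1 ^ 2 - X 0 ^ 2) →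
      0 ≤ eval v (0 : MvPolynomial (Fin 2) ℝ) →
      ∃ τ c : ℝ, c ≠ 0 ∧ v = c • IsMonomialCurve.realPoint (n := 1) ![1, 0] τ := by
    intro v hv h1 _
    simp only [map_sub, map_pow, eval_X] at h1
    have hv1 : v 1 ≠ 0 := fun hz => hv (by
      rw [hz] at h1
      ext i
      fin_cases i
      · change v 0 = 0
        nlinarith
      · exact hz)
    refine ⟨v 0 / v 1, v 1, hv1, ?_⟩
    rw [realPoint_projSpace_one]
    ext i
    fin_cases i
    · simp; field_simp
    · simp
  have e : ∀ τ : ℝ, eval (IsMonomialCurve.realPoint (n := 1) ![1, 0] τ) (X 1 ^ 2 - X 0 ^ 2) =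
      1 - τ ^ 2 := fun τ => by
    rw [realPoint_projSpace_one]
    simp
  have hF0 : ∀ τ, 0 ≤ eval (IsMonomialCurve.realPoint (n := 1) ![1, 0] τ) (X 1 ^ 2 - X 0 ^ 2) ↔
      τ ^ 2 ≤ 1 := fun τ => by rw [e, sub_nonneg]
  have hF1 : ∀ τ, eval (IsMonomialCurve.realPoint (n := 1) ![1, 0] τ) (X 1 ^ 2 - X 0 ^ 2) = 0 →
      τ ^ 2 = 1 := fun τ h => by
    rw [e] at h
    linarith
  have hS : interval = basicSet ![X 1 ^ 2 - X 0 ^ 2, 0] := by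
    rw [← hP.realPoints_inter_eq_arc hF hG hrep (fun v hv _ => map_zero _) hF0 (S := interval),
      realPoints_projSpace, Set.univ_inter]
    · intro τ hτ
      refine mk_mem_interval.2 ?_
      rw [realPoint_projSpace_one]
      simpa [abs_le] using hτ
    · intro v hv _ hvA
      obtain ⟨h1, h2⟩ := mk_mem_interval.1 hvA
      have h : (v 0 / v 1) ^ 2 ≤ 1 := by rw [sq_le_one_iff_abs_le_one, abs_le]; exact h2
      rw [div_pow, div_le_one (by positivity)] at h
      simpa using h
  have h := hP.isPositiveGeometry_arc hF hG hrep (fun v hv _ => map_zero _) hF0 hF1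
    (isHomogeneous_sq_sub_sq 0 1) (by simp)
  rw [← hS] at h
  exact ⟨h.1, (h.2 _).2 (Or.inl omegaInterval_eq)⟩

end Interval

/-! ### The parametrization of the cuspidal cubic -/

section Parametrization

theorem isPushforward_two_div_smul_iff {K L : Type} [Field K] [Field L] [Algebra ℂ K]
    [Algebra ℂ L] {φ : K →ₐ[ℂ] L} (hφ : Function.Bijective φ) (t : K) {θ : Forms K} :
    IsPushforward φ ((2 / (φ t ^ 2 - 1)) • dForm (φ t)) θ ↔
      θ = (2 / (t ^ 2 - 1)) • dForm t := by
  have h : formMap φ ((2 / (t ^ 2 - 1)) • dForm t) = (2 / (φ t ^ 2 - 1)) • dForm (φ t) := by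
    rw [formMap_smul, formMap_dForm, map_div₀, map_sub, map_pow, map_one, map_ofNat]
  rw [isPushforward_iff φ hφ.2, ← h]
  exact (formMap_bijective φ hφ).1.eq_iff

variable {D : Variety 2} (hD : IsMonomialCurve D ![2, 3, 0] 2 1 0 1)

theorem isHomogeneous_gammaPoly (i : Fin 3) : (gammaPoly i).IsHomogeneous 3 := by
  fin_cases i
  · exact ((isHomogeneous_X ℂ 0).pow 2).mul (isHomogeneous_X ℂ 1)
  · exact (isHomogeneous_X ℂ 0).pow 3
  · exact (isHomogeneous_X ℂ 1).pow 3

theorem dehom_aeval_gammaPoly (a : CoordRing 2) : dehom (projSpace 1) 1 (aeval gammaPoly a) =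
    Polynomial.aeval (affCoord (projSpace 1) 1 0)
      (aeval (fun i => (Polynomial.X ^ (![2, 3, 0] : Fin 3 → ℕ) i : Polynomial ℂ)) a) := by
  rw [← AlgHom.comp_apply, ← AlgHom.comp_apply]
  congr 1
  ext i
  have h1 := affCoord_self (X := projSpace 1) (X_notMem_projSpace 1 1)
  fin_cases i <;> simp [gammaPoly, dehom, h1]

include hD

/-- Dehomogenizing after the substitution t²s, t³, s³ amounts to substituting t², t³, 1, which
detects membership in the ideal of the cubic. The coordinate y/x goes to t³/t² = t, and this makes
the map surjective. -/
theorem exists_isPullbackAlong_gammaPoly :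
    ∃ φ : FunctionField D →ₐ[ℂ] FunctionField (projSpace 1),
      IsPullbackAlong (projSpace 1) D gammaPoly φ ∧
      φ (affCoord D 0 1) = affCoord (projSpace 1) 1 0 := by
  have hj := hD.X_notMem 2
  have hinj : ∀ p : Polynomial ℂ, Polynomial.aeval (affCoord (projSpace 1) 1 0) p = 0 ↔ p = 0 :=
    fun p => ⟨fun h => Polynomial.funext fun a => by
      rw [Polynomial.eval_zero]
      exact (isMonomialCurve_projSpace_one.isChart.polynomial_inv_mem_linePlace_iff p a).1
        (Or.inl h), fun h => by rw [h, map_zero]⟩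
  obtain ⟨φ, hφ⟩ := exists_algHom_of_homogeneous (dehom D 2)
    ((dehom (projSpace 1) 1).comp (aeval gammaPoly))
    (fun e a ha => by
      rw [dehom_eq_zero_iff D hj ha, hD.mem_ideal_iff e a ha, AlgHom.comp_apply,
        dehom_aeval_gammaPoly, hinj])
    (fun y => by
      obtain ⟨e, a, b, ha, hb, hbD, hy⟩ := exists_eq_dehom_div D hj y
      exact ⟨e, a, b, ha, hb, mt (dehom_eq_zero_iff D hj hb).1 hbD, hy⟩)
  refine ⟨φ, fun e a b ha hb hbD x hx => ?_, ?_⟩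
  · rw [coe_eq_ratio_iff D hj ha hb] at hx
    rw [coe_eq_ratio_iff _ (X_notMem_projSpace 1 1) (ha.aeval _ isHomogeneous_gammaPoly)
      (hb.aeval _ isHomogeneous_gammaPoly), hx]
    exact hφ e a b ha hb (mt (dehom_eq_zero_iff D hj hb).1 hbD)
  · have ht : affCoord (projSpace 1) 1 0 ≠ 0 := isMonomialCurve_projSpace_one.coord_ne_zero
    rw [affCoord_eq_div D hj, ← dehom_X, ← dehom_X, hφ 1 _ _ (isHomogeneous_X ℂ 1)
      (isHomogeneous_X ℂ 0) (mt (dehom_eq_zero_iff D hj (isHomogeneous_X ℂ 0)).1 (hD.X_notMem 0)),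
      AlgHom.comp_apply, AlgHom.comp_apply, dehom_aeval_gammaPoly, dehom_aeval_gammaPoly,
      aeval_X, aeval_X, map_pow, map_pow, Polynomial.aeval_X]
    change affCoord (projSpace 1) 1 0 ^ 3 / affCoord (projSpace 1) 1 0 ^ 2 = _
    rw [pow_succ _ 2, mul_div_cancel_left₀ _ (pow_ne_zero 2 ht)]

omit hD in
theorem bijective_of_map_coord {φ : FunctionField D →ₐ[ℂ] FunctionField (projSpace 1)}
    (hφ : φ (affCoord D 0 1) = affCoord (projSpace 1) 1 0) : Function.Bijective φ := by
  refine ⟨φ.injective, AlgHom.fieldRange_eq_top.1 ?_⟩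
  rw [eq_top_iff, ← isMonomialCurve_projSpace_one.isChart.gen, IntermediateField.adjoin_le_iff]
  rintro _ ⟨i, rfl⟩
  fin_cases i
  exact ⟨_, hφ⟩

omit hD in
theorem isPushforward_omegaInterval_iff
    {φ : FunctionField D →ₐ[ℂ] FunctionField (projSpace 1)}
    (hφ : φ (affCoord D 0 1) = affCoord (projSpace 1) 1 0) {θ : Forms (FunctionField D)} :
    IsPushforward φ omegaInterval θ ↔
      θ = (2 / (affCoord D 0 1 ^ 2 - 1)) • dForm (affCoord D 0 1) := by
  refine Iff.trans ?_ (isPushforward_two_div_smul_iff (bijective_of_map_coord hφ) _)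
  rw [hφ, omegaInterval_eq]

end Parametrization

/-! ### The positive geometry of the cuspidal region -/

section CuspidalRegion

/-- Quadratic and quartic polynomials whose nonnegativity defines the region. -/
def regionPoly : Fin 3 → MvPolynomial (Fin 3) ℝ :=
  -- The factor z makes the first two degrees even. The third inequality follows from the others
  -- where z ≠ 0; its purpose is to exclude the points at infinity.
  ![X 2 ^ 2 - X 0 * X 2, X 0 ^ 3 * X 2 - X 1 ^ 2 * X 2 ^ 2, 2 * X 2 ^ 2 - X 0 ^ 2 - X 1 ^ 2]

theorem isHomogeneous_regionPoly (i : Fin 3) :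
    (regionPoly i).IsHomogeneous (2 * (![1, 2, 1] : Fin 3 → ℕ) i) := by
  have h := isHomogeneous_X ℝ (σ := Fin 3)
  fin_cases i
  · exact ((h 2).pow 2).sub ((h 0).mul (h 2))
  · exact (((h 0).pow 3).mul (h 2)).sub (((h 1).pow 2).mul ((h 2).pow 2))
  · exact (((isHomogeneous_C (Fin 3) (2 : ℝ)).mul ((h 2).pow 2)).sub ((h 0).pow 2)).sub
      ((h 1).pow 2)

/-- From x³ ≥ y² ≥ 0 one gets x ≥ 0, and then y² ≤ x³ ≤ x² because x ≤ 1. -/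
theorem regionA_ineq {x y : ℝ} (hx : x ≤ 1) (hy : y ^ 2 ≤ x ^ 3) : 0 ≤ x ∧ y ^ 2 ≤ x ^ 2 := by
  have h0 : 0 ≤ x := by
    by_contra! hneg
    have : x ^ 3 < 0 := Odd.pow_neg (by decide) hneg
    nlinarith [sq_nonneg y]
  exact ⟨h0, hy.trans (pow_le_pow_of_le_one h0 hx (by norm_num))⟩

theorem regionA_eq : regionA = basicSet regionPoly := by
  ext p
  induction p using Projectivization.ind with
  | h v hv =>
    rw [mk_mem_regionA, mk_mem_basicSet isHomogeneous_regionPoly, Fin.forall_fin_succ,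
      Fin.forall_fin_two]
    simp only [regionPoly, Matrix.cons_val_zero, Matrix.cons_val_succ, Matrix.cons_val_one,
      Matrix.cons_val_fin_one, map_sub, map_mul, map_pow, eval_X, map_ofNat]
    have key : v 2 ≠ 0 →
        v 2 ^ 2 - v 0 * v 2 = v 2 ^ 2 * (1 - v 0 / v 2) ∧
        v 0 ^ 3 * v 2 - v 1 ^ 2 * v 2 ^ 2 = v 2 ^ 4 * ((v 0 / v 2) ^ 3 - (v 1 / v 2) ^ 2) ∧
        2 * v 2 ^ 2 - v 0 ^ 2 - v 1 ^ 2 = v 2 ^ 2 * (2 - (v 0 / v 2) ^ 2 - (v 1 / v 2) ^ 2) :=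
      fun h => ⟨by field_simp, by field_simp, by field_simp⟩
    constructor
    · rintro ⟨h2, hx, hy⟩
      obtain ⟨e1, e2, e3⟩ := key h2
      rw [e1, e2, e3]
      obtain ⟨h0, h1⟩ := regionA_ineq hx hy
      exact ⟨mul_nonneg (by positivity) (by linarith), mul_nonneg (by positivity) (by linarith),
        mul_nonneg (by positivity) (by nlinarith)⟩
    · rintro ⟨h1, h2, h3⟩
      have hv2 : v 2 ≠ 0 := fun hz => hv (by
        rw [hz] at h3
        exact eq_zero_of_fin_three (by nlinarith) (by nlinarith) hz)
      obtain ⟨e1, e2, -⟩ := key hv2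
      rw [e1, mul_nonneg_iff_of_pos_left (by positivity)] at h1
      rw [e2, mul_nonneg_iff_of_pos_left (by positivity)] at h2
      exact ⟨hv2, by linarith, by linarith⟩

theorem cuspBoundary_mem_boundaryIdeal : cuspBoundary ∈ boundaryIdeal (projSpace 2) regionA := by
  intro v hv hvS
  have hvA : Projectivization.mk ℝ v hv ∈ regionA := by
    rw [regionA_eq] at hvS ⊢
    exact ((mem_boundary_iff (isClosed_basicSet isHomogeneous_regionPoly)).1 hvS).2.1
  have h : (v 0 - v 2) * (v 1 ^ 2 * v 2 - v 0 ^ 3) = 0 := by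
    rw [regionA_eq] at hvS
    obtain ⟨h2, hx, hy⟩ := mk_mem_regionA.1 hvA
    obtain ⟨i, hi⟩ := exists_eval_eq_zero_of_mem_boundary isHomogeneous_regionPoly hvS
    fin_cases i
    · simp [regionPoly] at hi
      have : v 2 * (v 0 - v 2) = 0 := by linarith
      rw [(mul_eq_zero.1 this).resolve_left h2, zero_mul]
    · simp [regionPoly] at hi
      have : v 2 * (v 1 ^ 2 * v 2 - v 0 ^ 3) = 0 := by linarith
      rw [(mul_eq_zero.1 this).resolve_left h2, mul_zero]
    · simp [regionPoly] at hi
      obtain ⟨h0, h1⟩ := regionA_ineq hx hy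
      have e : (v 0 / v 2) ^ 2 + (v 1 / v 2) ^ 2 = 2 := by
        field_simp
        linarith
      -- In affine coordinates the equation is x² + y² = 2 with y² ≤ x² and 0 ≤ x ≤ 1, so x = 1:
      -- such a point lies on the line.
      have : v 0 / v 2 = 1 := by nlinarith
      rw [(div_eq_one_iff_eq h2).1 this, sub_self, zero_mul]
  have h' := congrArg (Complex.ofRealHom) h
  simpa [cuspBoundary] using h'

/-- Moving in the direction of increasing x violates x ≤ 1. Infinitely many values of τ suffice for
density, so 0 ≤ τ ≤ 1 is enough. -/
theorem line_mem_boundary {τ : ℝ} (hτ : τ ∈ Set.Icc (0 : ℝ) 1) (hv : ![1, τ, 1] ≠ 0) :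
    (Projectivization.mk ℝ ![1, τ, 1] hv : RealProj 2) ∈ boundary (projSpace 2) regionA := by
  have hcl : IsClosed regionA := regionA_eq ▸ isClosed_basicSet isHomogeneous_regionPoly
  have hne : ∀ x : ℝ, ![x, τ, 1] ≠ 0 := fun x h => by simpa using congrFun h 2
  refine mem_boundary_of_path hcl (γ := fun x => Projectivization.mk ℝ ![x, τ, 1] (hne x))
    (continuous_mk (continuous_pi fun i => by fin_cases i <;> simp <;> fun_prop) _)
    (fun x => by rw [realPoints_projSpace]; trivial) (mk_mem_regionA.2 ?_)
    fun ε hε => ⟨1 + ε / 2, ?_, fun h => ?_⟩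
  · have : τ ^ 2 ≤ 1 := by nlinarith [hτ.1, hτ.2]
    simpa using this
  · rw [add_sub_cancel_left, abs_of_pos (by linarith)]
    linarith
  · have := (mk_mem_regionA.1 h).2.1
    simp at this
    linarith

/-- With x = τ² fixed and τ ≥ 0, any y above τ³ violates y² ≤ x³. -/
theorem cubic_mem_boundary {τ : ℝ} (hτ : τ ∈ Set.Icc (0 : ℝ) 1) (hv : ![τ ^ 2, τ ^ 3, 1] ≠ 0) :
    (Projectivization.mk ℝ ![τ ^ 2, τ ^ 3, 1] hv : RealProj 2) ∈
      boundary (projSpace 2) regionA := by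
  have hcl : IsClosed regionA := regionA_eq ▸ isClosed_basicSet isHomogeneous_regionPoly
  have hne : ∀ y : ℝ, ![τ ^ 2, y, 1] ≠ 0 := fun x h => by simpa using congrFun h 2
  have h3 : 0 ≤ τ ^ 3 := pow_nonneg hτ.1 3
  refine mem_boundary_of_path hcl (γ := fun y => Projectivization.mk ℝ ![τ ^ 2, y, 1] (hne y))
    (continuous_mk (continuous_pi fun i => by fin_cases i <;> simp <;> fun_prop) _)
    (fun x => by rw [realPoints_projSpace]; trivial) (mk_mem_regionA.2 ?_)
    fun ε hε => ⟨τ ^ 3 + ε / 2, ?_, fun h => ?_⟩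
  · refine ⟨by simp, ?_, le_of_eq ?_⟩
    · have : τ ^ 2 ≤ 1 := by nlinarith [hτ.1, hτ.2]
      simpa using this
    · simp
      ring
  · rw [add_sub_cancel_left, abs_of_pos (by linarith)]
    linarith
  · have := (mk_mem_regionA.1 h).2.2
    simp at this
    nlinarith

variable {L D : Variety 2}

/-- A polynomial vanishing on the boundary vanishes on infinitely many points of each curve, hence
on both curves; conversely, the product of the equations vanishes at every boundary point. -/
theorem boundaryIdeal_regionA (hL : IsMonomialCurve L ![0, 1, 0] 2 1 2 1)
    (hD : IsMonomialCurve D ![2, 3, 0] 2 1 0 1) :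
    boundaryIdeal (projSpace 2) regionA = Ideal.span {cuspBoundary} := by
  apply le_antisymm
  · rw [← inf_ideal_eq (isPlaneDivisor_line hL) (isPlaneDivisor_cubic hD),
      ← hL.vanishingIdeal_eq (S := realPoints L ∩ boundary (projSpace 2) regionA)
        Set.inter_subset_left ((Set.Icc_infinite (zero_lt_one (α := ℝ))).mono fun τ hτ =>
          ⟨hL.realPoint_mem τ, ?_⟩),
      ← hD.vanishingIdeal_eq (S := realPoints D ∩ boundary (projSpace 2) regionA)
        Set.inter_subset_left ((Set.Icc_infinite (zero_lt_one (α := ℝ))).mono fun τ hτ =>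
          ⟨hD.realPoint_mem τ, ?_⟩)]
    · exact fun f hf => ⟨fun v hv h => hf v hv h.2, fun v hv h => hf v hv h.2⟩
    · simp only [realPoint_cubic]
      exact cubic_mem_boundary hτ _
    · simp only [realPoint_line]
      exact line_mem_boundary hτ _
  · rw [Ideal.span_singleton_le_iff_mem]
    exact cuspBoundary_mem_boundaryIdeal

theorem vanishingIdeal_regionA : vanishingIdeal regionA = (projSpace 2).ideal := by
  rw [projSpace_ideal, eq_bot_iff]
  intro f hf
  rw [Ideal.mem_bot]
  -- A box in homogeneous coordinates inside the cone over the region: x ≤ 1 ≤ z and y²z ≤ 2/64 ≤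
  -- 1/8 ≤ x³. A polynomial vanishing on a product of infinite sets is zero.
  let s : Fin 3 → Set ℝ := ![Set.Icc (1 / 2) 1, Set.Icc 0 (1 / 8), Set.Icc 1 2]
  refine MvPolynomial.funext_set (fun i => Complex.ofReal '' s i) (fun i => ?_) fun w hw => ?_
  · refine Set.Infinite.image Complex.ofReal_injective.injOn ?_
    fin_cases i
    · exact Set.Icc_infinite (by norm_num)
    · exact Set.Icc_infinite (by norm_num)
    · exact Set.Icc_infinite (by norm_num)
  · choose v hv using fun i => hw i trivial
    have h0 : 1 / 2 ≤ v 0 ∧ v 0 ≤ 1 := (hv 0).1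
    have h1 : 0 ≤ v 1 ∧ v 1 ≤ 1 / 8 := (hv 1).1
    have h2 : 1 ≤ v 2 ∧ v 2 ≤ 2 := (hv 2).1
    have hne : v ≠ 0 := fun h => by
      have := congrFun h 2
      simp only [Pi.zero_apply] at this
      linarith
    rw [map_zero, ← hf v hne (mk_mem_regionA.2 ?_)]
    · exact congrArg (fun u => eval u f) (funext fun i => (hv i).2.symm)
    · have hpos : 0 < v 2 := by linarith
      refine ⟨hpos.ne', (div_le_one hpos).2 (by linarith), ?_⟩
      rw [div_pow, div_pow, div_le_div_iff₀ (by positivity) (by positivity)]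
      have e1 : v 1 ^ 2 ≤ (1 / 8) ^ 2 := pow_le_pow_left₀ h1.1 h1.2 2
      have e2 : (1 / 2) ^ 3 ≤ v 0 ^ 3 := pow_le_pow_left₀ (by norm_num) h0.1 3
      calc v 1 ^ 2 * v 2 ^ 3 = v 1 ^ 2 * v 2 * v 2 ^ 2 := by ring
        _ ≤ v 0 ^ 3 * v 2 ^ 2 := by
          refine mul_le_mul_of_nonneg_right ?_ (by positivity)
          nlinarith

theorem isAdmissible_regionA : IsAdmissible 2 (projSpace 2) regionA := by
  have hfull := vanishingIdeal_regionA
  have hne : regionA.Nonempty := ⟨_, mk_mem_regionA (hv := fun h : ![(0 : ℝ), 0, 1] = 0 => by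
    simpa using congrFun h 2).2 (by simp)⟩
  rw [regionA_eq] at hfull hne ⊢
  exact isAdmissible_basicSet isHomogeneous_regionPoly isChart_plane.trdeg hne hfull

theorem isPositiveGeometry_regionA (hL : IsMonomialCurve L ![0, 1, 0] 2 1 2 1)
    (hD : IsMonomialCurve D ![2, 3, 0] 2 1 0 1) :
    IsPositiveGeometry 2 (projSpace 2) regionA ∧
      IsCanonicalForm 2 (projSpace 2) regionA (cuspForm planeX planeY) := by
  have hb := boundaryIdeal_regionA hL hD
  obtain ⟨hL₁, hL₂⟩ := isPositiveGeometry_line hL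
  obtain ⟨hD₁, hD₂⟩ := isPositiveGeometry_cubic hD
  have hcan := isCanonicalForm_cuspForm hL hD hb hL₂ hD₂
  refine ⟨⟨isAdmissible_regionA, fun Q hQ => ?_, _, hcan, fun ω' hω' =>
    eq_cuspForm_or_eq_neg hL hD hb hL₂ hD₂ hω'⟩, hcan⟩
  rcases (isBoundaryComponent_plane_iff hL hD hb).1 hQ with rfl | rfl
  · exact hL₁
  · exact hD₁

end CuspidalRegion

end PosGeom

end

theorem mainTheorem10 :
    PosGeom.IsPositiveGeometry 2 (PosGeom.projSpace 2) PosGeom.regionA ∧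
    PosGeom.IsCanonicalForm 2 (PosGeom.projSpace 2) PosGeom.regionA PosGeom.omegaA ∧
    PosGeom.boundaryIdeal (PosGeom.projSpace 2) PosGeom.regionA =
      Ideal.span {(MvPolynomial.X 0 - MvPolynomial.X 2) *
        (MvPolynomial.X 1 ^ 2 * MvPolynomial.X 2 - MvPolynomial.X 0 ^ 3)} ∧
    PosGeom.IsLogarithmic 2 (PosGeom.projSpace 2)
      (Ideal.span {(MvPolynomial.X 0 - MvPolynomial.X 2) *
        (MvPolynomial.X 1 ^ 2 * MvPolynomial.X 2 - MvPolynomial.X 0 ^ 3)}) PosGeom.omegaA ∧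
    PosGeom.IsPositiveGeometry 1 (PosGeom.projSpace 1) PosGeom.interval ∧
    PosGeom.IsCanonicalForm 1 (PosGeom.projSpace 1) PosGeom.interval PosGeom.omegaInterval ∧
    ∃ (C : PosGeom.Variety 2)
      (φ : PosGeom.FunctionField C →ₐ[ℂ] PosGeom.FunctionField (PosGeom.projSpace 1))
      (θ : PosGeom.Forms (PosGeom.FunctionField C)),
      C.ideal = Ideal.span {MvPolynomial.X 1 ^ 2 * MvPolynomial.X 2 - MvPolynomial.X 0 ^ 3} ∧
      PosGeom.IsPullbackAlong (PosGeom.projSpace 1) C PosGeom.gammaPoly φ ∧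
      Function.Bijective φ ∧
      (∀ θ', PosGeom.IsResidue 1 (PosGeom.projSpace 2) C PosGeom.omegaA θ' ↔ θ' = θ) ∧
      (∀ θ', PosGeom.IsPushforward φ PosGeom.omegaInterval θ' ↔ θ' = θ) := by
  -- The line x = z, parametrized by τ ↦ (1 : τ : 1) with coordinate t = X₁/X₂.
  obtain ⟨L, hL⟩ := PosGeom.exists_isMonomialCurve (n := 2) (d := ![0, 1, 0]) (j := 2) (k := 1)
    (l := 2) (m := 1) rfl (fun i => by fin_cases i <;> simp) rfl
  -- The cuspidal cubic, parametrized by τ ↦ (τ² : τ³ : 1) with coordinate t = X₁/X₀.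
  obtain ⟨C, hC⟩ := PosGeom.exists_isMonomialCurve (n := 2) (d := ![2, 3, 0]) (j := 2) (k := 1)
    (l := 0) (m := 1) rfl (fun i => by fin_cases i <;> simp) rfl
  obtain ⟨hpos, hcan⟩ := PosGeom.isPositiveGeometry_regionA hL hC
  obtain ⟨φ, hφ, hφt⟩ := PosGeom.exists_isPullbackAlong_gammaPoly hC
  exact ⟨hpos, hcan, PosGeom.boundaryIdeal_regionA hL hC, PosGeom.isLogarithmic_cusp,
    PosGeom.isPositiveGeometry_interval.1, PosGeom.isPositiveGeometry_interval.2, C, φ, _,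
    PosGeom.ideal_cubic (PosGeom.isPlaneDivisor_cubic hC), hφ,
    PosGeom.bijective_of_map_coord hφt, fun _ => PosGeom.isResidue_cuspForm_cubic hC,
    fun _ => PosGeom.isPushforward_omegaInterval_iff hφt⟩
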